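/- Let $m>0$, $\beta\neq0$, $\sigma\neq 0$ be real, $\gamma=\beta^2/16$, and let $\sigma_1,\sigma_2,\sigma_3$ be the Pauli matrices. For real $\lambda\ne0$ put $k_0(\lambda)=\frac m4(\lambda+\frac1\lambda)$, $k_1(\lambda)=\frac m4(\lambda-\frac1\lambda)$, so that $\operatorname{sgn}k_0'(\lambda)=\operatorname{sgn}(\lambda^2-1)$. *Phase space and bracket.* For integers $Q_\pm$ the phase space consists of pairs $(\phi,\Pi)$ of smooth real functions of $t\in\mathbb R$ with $\phi(t)\to 2\pi Q_\pm/\beta$ and $\Pi(t)\to0$ as $t\to\pm\infty$, in the Schwartz sense. For functionals $F,G$, $$\{F,G\}_T=\int_{\mathbb R}\Big(\frac{\delta F}{\delta\phi(t)}\frac{\delta G}{\delta\Pi(t)}-\frac{\delta F}{\delta\Pi(t)}\frac{\delta G}{\delta\phi(t)}\Big)dt ,$$ where variations are Schwartz functions, i.e. $\{\phi(t),\Pi(\tau)\}_T=\delta(t-\tau)$. *Time monodromy matrix.* Let $V(t,\lambda)=i\frac\beta4\Pi\sigma_3-ik_1(\lambda)\sin(\frac{\beta\phi}2)\sigma_1-ik_0(\lambda)\cos(\frac{\beta\phi}2)\sigma_2$,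 let $\mathcal T(t,\tau,\lambda)$ be the solution of $\partial_t\mathcal T=V\mathcal T$, $\mathcal T(\tau,\tau,\lambda)=1$, and let $\Omega(t)=e^{i\beta\phi(t)\sigma_3/4}$, $\mathcal E_0(t,\lambda)=\frac1{\sqrt2}(1+i\sigma_1)e^{-ik_0(\lambda)t\sigma_3}$. Put $$\mathcal T(\lambda)=\lim_{t\to\infty,\ \tau\to-\infty}\mathcal E_0(t,\lambda)^{-1}\,\Omega(t)^{-1}\mathcal T(t,\tau,\lambda)\Omega(\tau)\,\mathcal E_0(\tau,\lambda).$$ *Defect model.* Let $\widetilde\phi$ on $x\le0$ and $\phi$ on $x\ge0$ be solutions of $\phi_{tt}-\phi_{xx}+\frac{m^2}\beta\sin\beta\phi=0$ such that, with $\widetilde\Pi=-\widetilde\phi_x$ and $\Pi=-\phi_x$, the data at every position $x$ lie in the phase space with charges $\widetilde Q_\pm$, respectively $Q_\pm$ (not depending on $x$), and such that at $x=0$ $$\widetilde\phi_x-\phi_t=\tfrac m\beta\big(\sigma\sin\tfrac{\beta(\widetilde\phi+\phi)}2+\sigma^{-1}\sin\tfrac{\beta(\widetilde\phi-\phi)}2\big),\qquad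 \widetilde\phi_t-\phi_x=\tfrac m\beta\big(\sigma\sin\tfrac{\beta(\widetilde\phi+\phi)}2-\sigma^{-1}\sin\tfrac{\beta(\widetilde\phi-\phi)}2\big).$$ Let $\widetilde{\mathcal T}(x,\lambda)$ and $\mathcal T(x,\lambda)$ be the time monodromy matrices of the data at $x\le 0$, respectively $x\ge0$; let $\widetilde{\mathfrak a}$, $\mathfrak a$ be their $(1,1)$ entries, and let $$B_\pm(\lambda)=\frac{\lambda}{\lambda+i\sigma}\Big(1-\frac{i\sigma}{\lambda}(-1)^{\widetilde Q_\pm+Q_\pm}\sigma_3\Big),\qquad \mathcal M_T(x,\lambda)=\begin{cases}B_+(\lambda)\widetilde{\mathcal T}(x,\lambda)B_-(\lambda)^{-1},&x<0,\\ \mathcal T(x,\lambda),&x\ge0,\end{cases}$$ seen as a functional of the canonical data at $x$. *Claim.* The limits that define $\widetilde{\mathcal T}$ and $\mathcal T$ exist for all real $\lambda\ne0$, and $\mathcal T(0,\lambda)=B_+(\lambda)\widetilde{\mathcal T}(0,\lambda)B_-(\lambda)^{-1}$. For every $x\in\mathbb R$ (and at $x=0$ for either of the two expressions of $\mathcal M_T(0,\lambda)$),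 $$\{\mathcal M_{T1}(x,\lambda),\mathcal M_{T2}(x,\mu)\}_T=-r_+(x,\lambda,\mu)\mathcal M_{T1}(x,\lambda)\mathcal M_{T2}(x,\mu)+\mathcal M_{T1}(x,\lambda)\mathcal M_{T2}(x,\mu)\,r_-(x,\lambda,\mu)$$ as distributions in the real parameters $\lambda\ne 0$, $\mu\neq0$, $\lambda+\mu\ne0$ (that is, after integration against smooth compactly supported $\chi(\lambda)\psi(\mu)$), where $M_1=M\otimes1$, $M_2=1\otimes M$, $$r_\pm(x,\lambda,\mu)=\big(e^{ik_1(\lambda)x\sigma_3}\otimes e^{ik_1(\mu)x\sigma_3}\big)\,r_\pm(\lambda,\mu)\,\big(e^{-ik_1(\lambda)x\sigma_3}\otimes e^{-ik_1(\mu)x\sigma_3}\big),$$ $$r_\pm(\lambda,\mu)=-\gamma\begin{pmatrix}\frac{\lambda-\mu}{\lambda+\mu}&0&0&0\\0&\mathrm{p.v.}\frac{\lambda+\mu}{\lambda-\mu}&\mp i\pi\epsilon(\lambda)(\lambda+\mu)\delta(\lambda-\mu)&0\\0&\pm i\pi\epsilon(\lambda)(\lambda+\mu)\delta(\lambda-\mu)&\mathrm{p.v.}\frac{\lambda+\mu}{\lambda-\mu}&0\\0&0&0&\frac{\lambda-\mu}{\lambda+\mu}\end{pmatrix},\qquad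 \epsilon(\lambda)=\operatorname{sgn}(\lambda^2-1).$$ Moreover $\{\mathfrak a(\lambda),\mathfrak a(\mu)\}_T=0$ and $\{\widetilde{\mathfrak a}(\lambda),\widetilde{\mathfrak a}(\mu)\}_T=0$, as distributions in the real parameters $\lambda,\mu\ne0$, at every $x\ge0$, respectively $x\le0$; in this sense the defect model is Liouville integrable. -/

import Mathlib

open scoped Kronecker ContDiff Topology

noncomputable section

namespace SineGordonDefect

/-! ### Lax matrix in the time direction and time monodromy matrix -/

/-- `2 × 2` complex matrices. -/
abbrev Mat := Matrix (Fin 2) (Fin 2) ℂ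

/-- `4 × 4` complex matrices, seen as operators on `ℂ² ⊗ ℂ²`. -/
abbrev Mat4 := Matrix (Fin 2 × Fin 2) (Fin 2 × Fin 2) ℂ

/-- The Pauli matrices. -/
def pauli1 : Mat := !![0, 1; 1, 0]
def pauli2 : Mat := !![0, -Complex.I; Complex.I, 0]
def pauli3 : Mat := !![1, 0; 0, -1]

/-- `exp (z σ₃)`. -/
def expPauli3 (z : ℂ) : Mat := !![Complex.exp z, 0; 0, Complex.exp (-z)]

def k0 (m l : ℝ) : ℝ := m / 4 * (l + 1 / l)
def k1 (m l : ℝ) : ℝ := m / 4 * (l - 1 / l)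

/-- Canonical data `(φ, Π)` at a fixed position, as functions of time. -/
abbrev Phase := (ℝ → ℝ) × (ℝ → ℝ)

/-- The time Lax matrix `V(t, l)` built on the data `p = (φ, Π)`. -/
def laxV (m β : ℝ) (p : Phase) (l t : ℝ) : Mat :=
  (Complex.I * ((β / 4 * p.2 t : ℝ) : ℂ)) • pauli3
    - (Complex.I * ((k1 m l * Real.sin (β * p.1 t / 2) : ℝ) : ℂ)) • pauli1
    - (Complex.I * ((k0 m l * Real.cos (β * p.1 t / 2) : ℝ) : ℂ)) • pauli2

/-- The gauge matrix `Ω(t) = exp (i β φ(t) σ₃ / 4)`. -/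
def gaugeOmega (β : ℝ) (p : Phase) (t : ℝ) : Mat :=
  expPauli3 (Complex.I * ((β * p.1 t / 4 : ℝ) : ℂ))

/-- `N = (1 + i σ₁) / √2`. -/
def matN : Mat := ((1 / Real.sqrt 2 : ℝ) : ℂ) • (1 + Complex.I • pauli1)

/-- The vacuum solution `N exp (- i k₀(l) t σ₃)`. -/
def vacuumE (m l t : ℝ) : Mat := matN * expPauli3 (-Complex.I * ((k0 m l * t : ℝ) : ℂ))

/-- `T t τ` is the time transition matrix of `∂ₜ Ψ = V Ψ`, normalised by `T τ τ = 1`. -/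
def IsTransition (m β : ℝ) (p : Phase) (l : ℝ) (T : ℝ → ℝ → Mat) : Prop :=
  (∀ t τ i j, HasDerivAt (fun s => T s τ i j) ((laxV m β p l t * T t τ) i j) t) ∧
    ∀ τ, T τ τ = 1

/-- `M` is the time monodromy matrix: the limit, as `t → ∞` and `τ → -∞`, of
`E(t)⁻¹ (Ω(t)⁻¹ T(t, τ) Ω(τ)) E(τ)`, where `E` is the vacuum solution. -/
def IsMonodromy (m β : ℝ) (p : Phase) (l : ℝ) (M : Mat) : Prop :=
  ∃ T : ℝ → ℝ → Mat, IsTransition m β p l T ∧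
    Filter.Tendsto
      (fun q : ℝ × ℝ => (vacuumE m l q.1)⁻¹ *
        ((gaugeOmega β p q.1)⁻¹ * T q.1 q.2 * gaugeOmega β p q.2) * vacuumE m l q.2)
      (Filter.atTop ×ˢ Filter.atBot) (𝓝 M)

/-- The time monodromy matrix as a functional of the data (its existence on the phase space is
part of the theorem). -/
def timeMonodromy (m β : ℝ) (p : Phase) (l : ℝ) : Mat :=
  Classical.epsilon (IsMonodromy m β p l)

/-! ### Phase space -/

/-- `f` approaches the constant `c` along `F` in the Schwartz sense. -/
def RapidLimit (f : ℝ → ℝ) (F : Filter ℝ) (c : ℝ) : Prop :=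
  ∀ k n : ℕ, Filter.Tendsto (fun t => t ^ k * iteratedDeriv n (fun s => f s - c) t) F (𝓝 0)

/-- The phase space with charges `Qm` (as `t → -∞`) and `Qp` (as `t → ∞`). -/
structure IsPhasePoint (β : ℝ) (Qm Qp : ℤ) (p : Phase) : Prop where
  smooth_fst : ContDiff ℝ ∞ p.1
  smooth_snd : ContDiff ℝ ∞ p.2
  fst_atBot : RapidLimit p.1 Filter.atBot (2 * Real.pi * Qm / β)
  fst_atTop : RapidLimit p.1 Filter.atTop (2 * Real.pi * Qp / β)
  snd_atBot : RapidLimit p.2 Filter.atBot 0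
  snd_atTop : RapidLimit p.2 Filter.atTop 0

/-! ### The sine-Gordon model with a Bäcklund defect at the origin -/

/-- `(φ, Π)` solves the sine-Gordon equation `φ_tt - φ_xx + (m² / β) sin (β φ) = 0` for `x ∈ S`,
`Π = -φ_x`, with data in the phase space at every `x ∈ S`
(derivatives in `x` are one-sided at an end point of `S`). -/
structure IsSineGordonOn (m β : ℝ) (S : Set ℝ) (Qm Qp : ℤ) (φ P : ℝ → ℝ → ℝ) : Prop where
  phase : ∀ x ∈ S, IsPhasePoint β Qm Qp (φ x, P x)
  momentum : ∀ x ∈ S, ∀ t, HasDerivWithinAt (fun y => φ y t) (-P x t) S x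
  motion : ∀ x ∈ S, ∀ t, HasDerivWithinAt (fun y => P y t)
    (-iteratedDeriv 2 (φ x) t - m ^ 2 / β * Real.sin (β * φ x t)) S x

/-- Solutions of the defect model: `(φ', P')` for `x ≤ 0`, `(φ, P)` for `x ≥ 0`, and the frozen
Bäcklund conditions with parameter `σ` at `x = 0` (where `φ_x = -P` and `φ'_x = -P'`). -/
structure IsDefectSolution (m β σ : ℝ) (Qm' Qp' Qm Qp : ℤ) (φ' P' φ P : ℝ → ℝ → ℝ) : Prop where
  left : IsSineGordonOn m β (Set.Iic 0) Qm' Qp' φ' P'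
  right : IsSineGordonOn m β (Set.Ici 0) Qm Qp φ P
  defect1 : ∀ t, -P' 0 t - deriv (φ 0) t =
    m / β * (σ * Real.sin (β * ((φ' 0 t + φ 0 t) / 2))
      + σ⁻¹ * Real.sin (β * ((φ' 0 t - φ 0 t) / 2)))
  defect2 : ∀ t, deriv (φ' 0) t - -P 0 t =
    m / β * (σ * Real.sin (β * ((φ' 0 t + φ 0 t) / 2))
      - σ⁻¹ * Real.sin (β * ((φ' 0 t - φ 0 t) / 2)))

/-- The matrices `B_±(l)`, for the charges `Q'` and `Q` at the corresponding end. -/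
def matB (σ : ℝ) (Q' Q : ℤ) (l : ℝ) : Mat :=
  ((l : ℂ) / (l + Complex.I * σ)) •
    (1 - (Complex.I * σ / l * (-1 : ℂ) ^ (Q' + Q)) • pauli3)

/-- The branch `B₊ T' B₋⁻¹`, as a functional of the data `p = (φ', Π')`. -/
def leftMonodromy (m β σ : ℝ) (Qm' Qp' Qm Qp : ℤ) (p : Phase) (l : ℝ) : Mat :=
  matB σ Qp' Qp l * timeMonodromy m β p l * (matB σ Qm' Qm l)⁻¹

/-- The monodromy matrix of the defect model at position `x`, as a functional of the canonical
data `p` at `x`. -/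
def defectMonodromy (m β σ : ℝ) (Qm' Qp' Qm Qp : ℤ) (x : ℝ) (p : Phase) (l : ℝ) : Mat :=
  if x < 0 then leftMonodromy m β σ Qm' Qp' Qm Qp p l else timeMonodromy m β p l

/-- The canonical data at `x` of the configuration `(φ', P')`, `(φ, P)`. -/
def dataAt (φ' P' φ P : ℝ → ℝ → ℝ) (x : ℝ) : Phase :=
  if x < 0 then (φ' x, P' x) else (φ x, P x)

/-! ### The equal-space Poisson bracket -/

/-- `A = δF/δφ` and `B = δF/δΠ` at `p`: continuous kernels which represent the derivative of `F`
in the directions of Schwartz variations (these do not change the boundary values). -/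
structure HasFunctionalDeriv (F : Phase → ℂ) (p : Phase) (A B : ℝ → ℂ) : Prop where
  continuous_fst : Continuous A
  continuous_snd : Continuous B
  integrable_fst : ∀ h : SchwartzMap ℝ ℝ, MeasureTheory.Integrable (fun t => A t * (h t : ℂ))
  integrable_snd : ∀ h : SchwartzMap ℝ ℝ, MeasureTheory.Integrable (fun t => B t * (h t : ℂ))
  hasDeriv : ∀ h k : SchwartzMap ℝ ℝ,
    HasDerivAt (fun ε : ℝ => F (fun t => p.1 t + ε * h t, fun t => p.2 t + ε * k t))
      (∫ t, (A t * (h t : ℂ) + B t * (k t : ℂ))) 0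

/-- `{F, G}_T` exists at `p` and equals `v`, where
`{F, G}_T = ∫ (δF/δφ δG/δΠ - δF/δΠ δG/δφ) dt`, i.e. `{φ(t), Π(τ)}_T = δ(t - τ)`. -/
def HasBracketT (F G : Phase → ℂ) (p : Phase) (v : ℂ) : Prop :=
  ∃ A B C D : ℝ → ℂ, HasFunctionalDeriv F p A B ∧ HasFunctionalDeriv G p C D ∧
    MeasureTheory.Integrable (fun t => A t * D t - B t * C t) ∧
    v = ∫ t, (A t * D t - B t * C t)

/-! ### Spectral parameters: test functions and the `r`-matrices -/

/-- Test functions of a real non-zero spectral parameter. -/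
structure IsTest (χ : ℝ → ℂ) : Prop where
  smooth : ContDiff ℝ ∞ χ
  compact : HasCompactSupport χ
  zero_notMem : (0 : ℝ) ∉ tsupport χ

/-- The functional `∫ χ(l) F(l) dl`. -/
def smear (F : Phase → ℝ → ℂ) (χ : ℝ → ℂ) (p : Phase) : ℂ := ∫ l, χ l * F p l

def gam (β : ℝ) : ℝ := β ^ 2 / 16

/-- The diagonal part of `r_±(l, u)`, the same for both signs, with the principal value
truncated to `|l - u| > ε`. -/
def rDiag (β ε l u : ℝ) : Mat4 :=
  (-(gam β) : ℂ) • Matrix.diagonal fun a =>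
    if a.1 = a.2 then ((((l - u) / (l + u) : ℝ)) : ℂ)
    else if ε < |l - u| then (((l + u) / (l - u) : ℝ) : ℂ) else 0

/-- The coefficient of `δ(l - u)` in `r_±(l, u)`; `s = 1` for `r₊` and `s = -1` for `r₋`.
The factor `Real.sign (l ^ 2 - 1)` is the sign of `k₀'(l)` (for `m > 0`). -/
def rDelta (β s l u : ℝ) : Mat4 :=
  (-(gam β) : ℂ) • Matrix.of fun a b =>
    if a = (0, 1) ∧ b = (1, 0) then
      -(s : ℂ) * Complex.I * ((Real.pi * Real.sign (l ^ 2 - 1) * (l + u) : ℝ) : ℂ)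
    else if a = (1, 0) ∧ b = (0, 1) then
      (s : ℂ) * Complex.I * ((Real.pi * Real.sign (l ^ 2 - 1) * (l + u) : ℝ) : ℂ)
    else 0

/-- Conjugation by `exp (i k₁(l) x σ₃) ⊗ exp (i k₁(u) x σ₃)`. -/
def conjX (m x l u : ℝ) (R : Mat4) : Mat4 :=
  (expPauli3 (Complex.I * ((k1 m l * x : ℝ) : ℂ)) ⊗ₖ
      expPauli3 (Complex.I * ((k1 m u * x : ℝ) : ℂ))) * R *
    (expPauli3 (-Complex.I * ((k1 m l * x : ℝ) : ℂ)) ⊗ₖ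
      expPauli3 (-Complex.I * ((k1 m u * x : ℝ) : ℂ)))

/-- `-R₊ M(l)₁ M(u)₂ + M(l)₁ M(u)₂ R₋`, where `M₁ = M ⊗ 1` and `M₂ = 1 ⊗ M`. -/
def quadratic (M : ℝ → Mat) (l u : ℝ) (Rp Rm : Mat4) : Mat4 :=
  -(Rp * ((M l ⊗ₖ (1 : Mat)) * ((1 : Mat) ⊗ₖ M u)))
    + (M l ⊗ₖ (1 : Mat)) * ((1 : Mat) ⊗ₖ M u) * Rm

/-- The pairing of the distribution `-r₊(x, l, u) M₁(l) M₂(u) + M₁(l) M₂(u) r₋(x, l, u)` with the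
test function `χ(l) ψ(u)`, the principal value being truncated at `ε`. -/
def quadraticPairing (m β x : ℝ) (M : ℝ → Mat) (χ ψ : ℝ → ℂ) (a b : Fin 2 × Fin 2) (ε : ℝ) : ℂ :=
  (∫ l, ∫ u, χ l * ψ u *
      quadratic M l u (conjX m x l u (rDiag β ε l u)) (conjX m x l u (rDiag β ε l u)) a b)
    + ∫ l, χ l * ψ l *
      quadratic M l l (conjX m x l l (rDelta β 1 l l)) (conjX m x l l (rDelta β (-1) l l)) a b

/-- The matrix functional `M` satisfies, at the point `p`, the quadratic Poisson algebra
`{M₁(l), M₂(u)}_T = -r₊(x, l, u) M₁(l) M₂(u) + M₁(l) M₂(u) r₋(x, l, u)`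
as an identity of distributions in the real parameters `l ≠ 0`, `u ≠ 0`, `l + u ≠ 0`.
The entry of the left side in row `(i, k)` and column `(j, n)` is `{M i j, M k n}`. -/
def SatisfiesQuadraticAlgebra (m β x : ℝ) (M : Phase → ℝ → Mat) (p : Phase) : Prop :=
  ∀ χ ψ : ℝ → ℂ, IsTest χ → IsTest ψ → (∀ l ∈ tsupport χ, -l ∉ tsupport ψ) →
    ∀ i j k n : Fin 2, ∃ v : ℂ,
      HasBracketT (smear (fun q l => M q l i j) χ) (smear (fun q l => M q l k n) ψ) p v ∧
      Filter.Tendsto (quadraticPairing m β x (M p) χ ψ (i, k) (j, n)) (𝓝[>] 0) (𝓝 v)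

/-- `{a(l), a(u)}_T = 0` at the point `p`, as a distribution in the real parameters
`l ≠ 0`, `u ≠ 0`. -/
def InInvolution (a : Phase → ℝ → ℂ) (p : Phase) : Prop :=
  ∀ χ ψ : ℝ → ℂ, IsTest χ → IsTest ψ → HasBracketT (smear a χ) (smear a ψ) p 0

end SineGordonDefect

end

noncomputable section

namespace SineGordonDefect

open MeasureTheory Filter Set
open scoped Matrix.Norms.L2Operator

open scoped Matrix.Norms.L2Operator BoundedContinuousFunction

/-! ### Norms of `2 × 2` matrices -/

/-! Jost solutions. Let Ψ₋ and Ψ₊ (`psiMinus`, `psiPlus`) solve Ψ' = VΨ and be asymptotic to the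
vacuum frame Ω E₀ at t = -∞ and t = +∞, so that Ψ₋ = Ψ₊ T. Seen from that frame the potential is
bounded by a multiple of (1 + t²)⁻² and is skew-Hermitian for a real parameter. A Volterra equation
therefore gives the solutions (`exists_isJost`), they are unitary, and T is the limit at +∞ of the
solution normalised at -∞ (`isMonodromy_iff`).

Defect. The Bäcklund conditions make an explicit matrix S intertwine the two potentials, S' = ŴS -
SŴ' (`IsDefectSolution.hasDerivAt_defectMatrix`). Hence J* S J' is constant in t for the Jost
solutions J, J' of the two sides, and comparing its two limits gives B₊T' = TB₋.

Functional derivatives. Variation of constants gives δT = ∫ Ψ₊* δV Ψ₋ dt, so the functional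
derivatives of a smeared entry of T are smeared entries of Ψ₊*(∂V/∂φ)Ψ₋ and Ψ₊*(∂V/∂Π)Ψ₋
(`hasFunctionalDeriv_smear`). Smearing supplies the decay in t through the phases exp(±2i k₀ t). The
Π-kernel is O(|t|^(-1/3)), the phase being stationary at ±1; the φ-kernel carries, up to a rapidly
decaying part, the factor k₁(l) = l k₀'(l), which vanishes there, and is O(1/|t|). The products are
thus integrable (`exists_kernel_decay`).

Bracket. For fixed parameters l, u the density of the bracket is a total t-derivative
(`kerPhi_mul_kerPi_sub`, `hasDerivAt_exchProd`): an exchange term at (l, u) plus its reflection at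
(-l, u), each being the derivative of -γ(l + u)/(l - u) times a product of two transition
coefficients. Only boundary terms at t = ±R remain. As R grows, each such product approaches a
product of entries of T times either 1 or exp(±2iR(k₀(l) - k₀(u))) (`exists_exchProd_asymptotics`).
The factor 1 yields principal values; the oscillating factor yields ±iπ δ(l - u) with the sign of
k₀' (`tendsto_pv_oscProd_atTop`), which is the origin of ε(l). The symmetry T(-l) = σ₂T(l)σ₂ turns
the reflected principal values into the coefficient (l - u)/(l + u), and the reflected δ-terms live
on l + u = 0, away from the supports (`exchLimit_add_reflected`).

Consequences. Conjugation by exp(i k₁ x σ₃) does not change the r-matrices: it commutes with the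
diagonal part and its phases cancel on l = u. On the left branch B± are diagonal, so each entry of
T' is multiplied by a row factor over a column factor, which both sides of the algebra respect
(`satisfiesQuadraticAlgebra_of_scaling`). For two (1,1) entries the direct boundary terms cancel,
and so do the reflected ones, even where l + u = 0 (`inInvolution_timeMonodromy`). -/

lemma norm_entry_le (A : Mat) (i j : Fin 2) : ‖A i j‖ ≤ ‖A‖ := by
  have h := Matrix.l2_opNorm_mulVec A (EuclideanSpace.single j (1 : ℂ))
  have h2 : ‖A i j‖ ≤ ‖(EuclideanSpace.equiv (Fin 2) ℂ).symm
      (A.mulVec (EuclideanSpace.single j (1 : ℂ)).ofLp)‖ := by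
    have := PiLp.norm_apply_le ((EuclideanSpace.equiv (Fin 2) ℂ).symm
      (A.mulVec (EuclideanSpace.single j (1 : ℂ)).ofLp)) i
    simpa using this
  simpa using h2.trans h

/-- A `2 × 2` matrix is a diagonal matrix plus a diagonal matrix times the unitary swap, and the
operator norm of a diagonal matrix is its largest entry. -/
lemma norm_le_of_entries (A : Mat) {b : ℝ} (h : ∀ i j, ‖A i j‖ ≤ b) : ‖A‖ ≤ 2 * b := by
  have hb : 0 ≤ b := (norm_nonneg _).trans (h 0 0)
  have key : ∀ (D : Fin 2 → ℂ), (∀ i, ‖D i‖ ≤ b) → ‖(Matrix.diagonal D : Mat)‖ ≤ b := by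
    intro D hD
    rw [Matrix.l2_opNorm_diagonal]
    exact (pi_norm_le_iff_of_nonneg hb).2 hD
  have hs : ‖(!![0, 1; 1, 0] : Mat)‖ = 1 := by
    refine CStarRing.norm_of_mem_unitary ?_
    rw [Unitary.mem_iff]
    constructor <;> · ext i j; fin_cases i <;> fin_cases j <;>
      simp [Matrix.star_eq_conjTranspose, Matrix.mul_apply]
  have hA : A = Matrix.diagonal ![A 0 0, A 1 1] +
      Matrix.diagonal ![A 0 1, A 1 0] * !![0, 1; 1, 0] := by
    ext i j; fin_cases i <;> fin_cases j <;> simp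
  rw [hA]
  refine (norm_add_le _ _).trans ?_
  have h1 := key ![A 0 0, A 1 1] (by intro i; fin_cases i <;> simp [h])
  have h2 := key ![A 0 1, A 1 0] (by intro i; fin_cases i <;> simp [h])
  have h3 := norm_mul_le (Matrix.diagonal ![A 0 1, A 1 0] : Mat) !![0, 1; 1, 0]
  rw [hs, mul_one] at h3
  linarith

lemma norm_unitary {U : Mat} (hU : U ∈ unitary Mat) : ‖U‖ = 1 :=
  CStarRing.norm_of_mem_unitary hU

lemma norm_star_unitary {U : Mat} (hU : U ∈ unitary Mat) : ‖star U‖ = 1 := by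
  rw [norm_star, norm_unitary hU]

/-! ### Jost solutions of `G' = w G` -/

/-- `G` solves `G' = w G` and tends to `1` as `t → -∞`. -/
structure IsJost (w G : ℝ → Mat) : Prop where
  deriv : ∀ t, HasDerivAt G (w t * G t) t
  lim : Tendsto G atBot (𝓝 1)

lemma hasDerivAt_integral_Iic {E : Type*} [NormedAddCommGroup E] [NormedSpace ℝ E]
    [CompleteSpace E] {f : ℝ → E} (hf : Continuous f) (hi : Integrable f) (t : ℝ) :
    HasDerivAt (fun t => ∫ s in Iic t, f s) (f t) t := by
  have h : (fun t => ∫ s in Iic t, f s) = fun t => (∫ s in Iic 0, f s) + ∫ s in (0:ℝ)..t, f s := by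
    funext t
    rw [← intervalIntegral.integral_Iic_sub_Iic hi.integrableOn hi.integrableOn]
    abel
  rw [h]
  exact (intervalIntegral.integral_hasDerivAt_right (hf.intervalIntegrable _ _)
    hf.stronglyMeasurable.stronglyMeasurableAtFilter hf.continuousAt).const_add _

lemma integrable_const_div_one_add_sq (C : ℝ) : Integrable fun t : ℝ => C / (1 + t ^ 2) := by
  simpa [div_eq_mul_inv] using integrable_inv_one_add_sq.const_mul C

/-- The weight `2C (arctan t + π / 2)`, a primitive of `2C / (1 + t²)` which vanishes at `-∞`. -/
def jostWeight (C t : ℝ) : ℝ := 2 * C * (Real.arctan t + Real.pi / 2)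

lemma hasDerivAt_jostWeight (C t : ℝ) : HasDerivAt (jostWeight C) (2 * (C / (1 + t ^ 2))) t := by
  have := ((Real.hasDerivAt_arctan t).add_const (Real.pi / 2)).const_mul (2 * C)
  exact this.congr_deriv (by ring)

lemma continuous_jostWeight (C : ℝ) : Continuous (jostWeight C) :=
  continuous_iff_continuousAt.2 fun t => (hasDerivAt_jostWeight C t).continuousAt

lemma jostWeight_nonneg {C : ℝ} (hC : 0 ≤ C) (t : ℝ) : 0 ≤ jostWeight C t := by
  have := Real.neg_pi_div_two_lt_arctan t
  unfold jostWeight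
  exact mul_nonneg (by linarith) (by linarith)

lemma jostWeight_le {C : ℝ} (hC : 0 ≤ C) (t : ℝ) : jostWeight C t ≤ 2 * C * Real.pi := by
  have := Real.arctan_lt_pi_div_two t
  unfold jostWeight
  exact mul_le_mul_of_nonneg_left (by linarith) (by linarith)

lemma tendsto_jostWeight (C : ℝ) : Tendsto (jostWeight C) atBot (𝓝 0) := by
  have := (tendsto_nhds_of_tendsto_nhdsWithin Real.tendsto_arctan_atBot)
  have h := (this.add_const (Real.pi / 2)).const_mul (2 * C)
  rw [neg_add_cancel, mul_zero] at h
  exact h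

/-- The weight has derivative twice `C / (1 + s²)`, so the integrand is half the derivative of `exp
(jostWeight C s)`. This half becomes the contraction constant. -/
lemma integral_Iic_exp_jostWeight {C : ℝ} (hC : 0 ≤ C) (t : ℝ) :
    IntegrableOn (fun s => Real.exp (jostWeight C s) * (C / (1 + s ^ 2))) (Iic t) ∧
    ∫ s in Iic t, Real.exp (jostWeight C s) * (C / (1 + s ^ 2)) =
      (Real.exp (jostWeight C t) - 1) / 2 := by
  have hinteg : Integrable (fun s => Real.exp (jostWeight C s) * (C / (1 + s ^ 2))) := by
    refine (integrable_const_div_one_add_sq C).bdd_mul (c := Real.exp (2 * C * Real.pi))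
      (Real.continuous_exp.comp (continuous_jostWeight C)).aestronglyMeasurable ?_
    refine Eventually.of_forall fun s => ?_
    rw [Real.norm_eq_abs, abs_of_pos (Real.exp_pos _)]
    exact Real.exp_le_exp.2 (jostWeight_le hC s)
  refine ⟨hinteg.integrableOn, ?_⟩
  have h := integral_Iic_of_hasDerivAt_of_tendsto' (a := t) (m := (1 / 2 : ℝ))
    (f := fun s => Real.exp (jostWeight C s) / 2)
    (f' := fun s => Real.exp (jostWeight C s) * (C / (1 + s ^ 2)))
    (fun s _ => by
      have := ((hasDerivAt_jostWeight C s).exp).div_const 2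
      exact this.congr_deriv (by ring)) hinteg.integrableOn (by
      have := ((Real.continuous_exp.tendsto 0).comp (tendsto_jostWeight C)).div_const 2
      simpa using this)
  rw [h]; ring

/-! ### Existence of Jost solutions by contraction of a weighted Volterra operator -/

section existence

variable {w : ℝ → Mat} {C : ℝ}

lemma integrable_jost_integrand (hw : Continuous w) (hC : 0 ≤ C)
    (hb : ∀ t, ‖w t‖ ≤ C / (1 + t ^ 2)) (H : ℝ →ᵇ Mat) :
    Integrable fun s => Real.exp (jostWeight C s) • (w s * H s) := by
  refine ((integrable_const_div_one_add_sq C).const_mul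
    (Real.exp (2 * C * Real.pi) * ‖H‖)).mono' ?_ (Eventually.of_forall fun s => ?_)
  · exact (Continuous.smul (Real.continuous_exp.comp (continuous_jostWeight C))
      (hw.mul H.continuous)).aestronglyMeasurable
  · rw [norm_smul, Real.norm_eq_abs, abs_of_pos (Real.exp_pos _)]
    have h1 := Real.exp_le_exp.2 (jostWeight_le hC s)
    have h2 := (norm_mul_le (w s) (H s)).trans
      (mul_le_mul (hb s) (H.norm_coe_le_norm s) (norm_nonneg _) (by positivity))
    calc _ ≤ Real.exp (2 * C * Real.pi) * (C / (1 + s ^ 2) * ‖H‖) :=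
          mul_le_mul h1 h2 (norm_nonneg _) (Real.exp_pos _).le
      _ = _ := by ring

lemma norm_integral_jost_integrand_le (hC : 0 ≤ C)
    (hb : ∀ t, ‖w t‖ ≤ C / (1 + t ^ 2)) (H : ℝ →ᵇ Mat) (t : ℝ) :
    ‖∫ s in Iic t, Real.exp (jostWeight C s) • (w s * H s)‖ ≤
      (Real.exp (jostWeight C t) - 1) / 2 * ‖H‖ := by
  obtain ⟨hi, he⟩ := integral_Iic_exp_jostWeight hC t
  rw [← he, ← integral_mul_const]
  refine norm_integral_le_of_norm_le (hi.mul_const _) (Eventually.of_forall fun s => ?_)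
  rw [norm_smul, Real.norm_eq_abs, abs_of_pos (Real.exp_pos _), mul_assoc]
  exact mul_le_mul_of_nonneg_left ((norm_mul_le (w s) (H s)).trans
      (mul_le_mul (hb s) (H.norm_coe_le_norm s) (norm_nonneg _) (by positivity))) (Real.exp_pos _).le

/-- The Volterra operator, conjugated by the weight `exp (-jostWeight C t)`. -/
def jostMap (hw : Continuous w) (hC : 0 ≤ C) (hb : ∀ t, ‖w t‖ ≤ C / (1 + t ^ 2))
    (H : ℝ →ᵇ Mat) : ℝ →ᵇ Mat :=
  BoundedContinuousFunction.ofNormedAddCommGroup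
    (fun t => Real.exp (-jostWeight C t) •
      (1 + ∫ s in Iic t, Real.exp (jostWeight C s) • (w s * H s)))
    (by
      refine Continuous.smul (Real.continuous_exp.comp (continuous_jostWeight C).neg)
        (continuous_const.add (continuous_iff_continuousAt.2 fun t =>
          (hasDerivAt_integral_Iic ?_ (integrable_jost_integrand hw hC hb H) t).continuousAt))
      exact Continuous.smul (Real.continuous_exp.comp (continuous_jostWeight C))
        (hw.mul H.continuous))
    (1 + ‖H‖)
    (fun t => by
      rw [norm_smul, Real.norm_eq_abs, abs_of_pos (Real.exp_pos _)]
      have h1 := norm_integral_jost_integrand_le hC hb H t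
      have h2 : ‖(1 : Mat)‖ = 1 := norm_unitary (one_mem _)
      have h3 := norm_add_le (1 : Mat) (∫ s in Iic t, Real.exp (jostWeight C s) • (w s * H s))
      have h0 := Real.add_one_le_exp (jostWeight C t)
      have h00 := jostWeight_nonneg hC t
      have h4 : Real.exp (-jostWeight C t) * Real.exp (jostWeight C t) = 1 := by
        rw [← Real.exp_add]; simp
      have h5 : Real.exp (-jostWeight C t) ≤ 1 := Real.exp_le_one_iff.2 (by linarith)
      have h6 := Real.exp_pos (-jostWeight C t)
      have h7 := norm_nonneg H
      calc _ ≤ Real.exp (-jostWeight C t) * (1 + (Real.exp (jostWeight C t) - 1) / 2 * ‖H‖) :=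
            mul_le_mul_of_nonneg_left (by linarith) h6.le
        _ = Real.exp (-jostWeight C t) + (Real.exp (-jostWeight C t) * Real.exp (jostWeight C t)
            - Real.exp (-jostWeight C t)) / 2 * ‖H‖ := by ring
        _ ≤ 1 + ‖H‖ := by rw [h4]; nlinarith)

lemma jostMap_apply (hw : Continuous w) (hC : 0 ≤ C) (hb : ∀ t, ‖w t‖ ≤ C / (1 + t ^ 2))
    (H : ℝ →ᵇ Mat) (t : ℝ) : jostMap hw hC hb H t = Real.exp (-jostWeight C t) •
      (1 + ∫ s in Iic t, Real.exp (jostWeight C s) • (w s * H s)) := rfl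

/-- After conjugation by the weight W the operator has norm at most `e^(-W) (e^W - 1) / 2 ≤ 1 / 2`.
One contraction thus covers the whole line, however large `C` is. -/
lemma jostMap_contracting (hw : Continuous w) (hC : 0 ≤ C)
    (hb : ∀ t, ‖w t‖ ≤ C / (1 + t ^ 2)) :
    ContractingWith (1 / 2) (jostMap hw hC hb) := by
  refine ⟨by norm_num, LipschitzWith.of_dist_le_mul fun H H' => ?_⟩
  rw [dist_eq_norm, dist_eq_norm, BoundedContinuousFunction.norm_le (by positivity)]
  intro t
  have he : (jostMap hw hC hb H - jostMap hw hC hb H') t = Real.exp (-jostWeight C t) •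
      ∫ s in Iic t, Real.exp (jostWeight C s) • (w s * (H - H') s) := by
    simp only [BoundedContinuousFunction.coe_sub, Pi.sub_apply, jostMap_apply, ← smul_sub]
    congr 1
    simp only [mul_sub, smul_sub]
    rw [integral_sub (integrable_jost_integrand hw hC hb H).integrableOn
      (integrable_jost_integrand hw hC hb H').integrableOn]
    abel
  rw [he, norm_smul, Real.norm_eq_abs, abs_of_pos (Real.exp_pos _)]
  have h1 := norm_integral_jost_integrand_le hC hb (H - H') t
  have h4 : Real.exp (-jostWeight C t) * Real.exp (jostWeight C t) = 1 := by
    rw [← Real.exp_add]; simp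
  have h6 := Real.exp_pos (-jostWeight C t)
  have h7 := norm_nonneg (H - H')
  calc _ ≤ Real.exp (-jostWeight C t) * ((Real.exp (jostWeight C t) - 1) / 2 * ‖H - H'‖) :=
        mul_le_mul_of_nonneg_left h1 h6.le
    _ = (Real.exp (-jostWeight C t) * Real.exp (jostWeight C t)
            - Real.exp (-jostWeight C t)) / 2 * ‖H - H'‖ := by ring
    _ ≤ _ := by
      rw [h4]
      push_cast
      nlinarith

theorem exists_isJost (hw : Continuous w) (hC : 0 ≤ C)
    (hb : ∀ t, ‖w t‖ ≤ C / (1 + t ^ 2)) : ∃ G, IsJost w G := by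
  set H := ContractingWith.fixedPoint _ (jostMap_contracting hw hC hb) with hH
  have hfix : jostMap hw hC hb H = H :=
    ContractingWith.fixedPoint_isFixedPt (jostMap_contracting hw hC hb)
  have hi := integrable_jost_integrand hw hC hb H
  -- Removing the weight turns the fixed-point equation into the Volterra equation G(t) = 1 + ∫ w G
  -- over (-∞, t].
  refine ⟨fun t => Real.exp (jostWeight C t) • H t, ?_⟩
  have he : (fun t => Real.exp (jostWeight C t) • H t) =
      fun t => 1 + ∫ s in Iic t, Real.exp (jostWeight C s) • (w s * H s) := by
    funext t
    conv_lhs => rw [← hfix]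
    rw [jostMap_apply, smul_smul, ← Real.exp_add]
    simp
  constructor
  · intro t
    have hc : Continuous fun s => Real.exp (jostWeight C s) • (w s * H s) :=
      Continuous.smul (Real.continuous_exp.comp (continuous_jostWeight C)) (hw.mul H.continuous)
    have := (hasDerivAt_integral_Iic hc hi t).const_add 1
    rw [he]
    refine this.congr_deriv ?_
    rw [mul_smul_comm]
  · rw [he]
    have h0 : Tendsto (fun t => ∫ s in Iic t, Real.exp (jostWeight C s) • (w s * H s)) atBot
        (𝓝 0) := by
      refine squeeze_zero_norm (fun t => norm_integral_jost_integrand_le hC hb H t) ?_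
      have := (((Real.continuous_exp.tendsto 0).comp (tendsto_jostWeight C)).sub_const 1).div_const 2
      have := this.mul_const ‖H‖
      simpa using this
    simpa using h0.const_add 1

end existence

/-! ### Unitarity and limits of solutions with skew-Hermitian potential -/

section comparison

variable {w w₁ w₂ G G₁ G₂ : ℝ → Mat}

lemma IsJost.continuous (h : IsJost w G) : Continuous G :=
  continuous_iff_continuousAt.2 fun t => (h.deriv t).continuousAt

/-- The Wronskian identity behind everything below: uniqueness and unitarity when the potentials
agree, comparison estimates when they are close, the variation of T, and the derivative of the
transition coefficients when they are Lax matrices at two parameters. -/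
lemma hasDerivAt_star_mul (hs : ∀ t, star (w₁ t) = -w₁ t) {t : ℝ}
    (h₁ : HasDerivAt G₁ (w₁ t * G₁ t) t) (h₂ : HasDerivAt G₂ (w₂ t * G₂ t) t) :
    HasDerivAt (fun t => star (G₁ t) * G₂ t) (star (G₁ t) * (w₂ t - w₁ t) * G₂ t) t := by
  refine (h₁.star.mul h₂).congr_deriv ?_
  rw [star_mul, hs]
  noncomm_ring

lemma IsJost.mem_unitary (h : IsJost w G) (hs : ∀ t, star (w t) = -w t) (t : ℝ) :
    G t ∈ unitary Mat := by
  have hd : ∀ t, HasDerivAt (fun t => star (G t) * G t) 0 t := fun t => by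
    simpa using hasDerivAt_star_mul hs (h.deriv t) (h.deriv t)
  have hconst : ∀ x y, star (G x) * G x = star (G y) * G y :=
    is_const_of_deriv_eq_zero (fun t => (hd t).differentiableAt) (fun t => (hd t).deriv)
  have hl : Tendsto (fun t => star (G t) * G t) atBot (𝓝 1) := by
    simpa using (h.lim.star).mul h.lim
  have h1 : star (G t) * G t = 1 := by
    refine tendsto_nhds_unique ?_ hl
    exact tendsto_const_nhds.congr fun s => hconst t s
  exact Unitary.mem_iff.2 ⟨h1, mul_eq_one_comm.1 h1⟩

/-- A solution of `G' = w G` with integrable `w` has a limit at `+∞`. -/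
lemma IsJost.exists_tendsto_atTop (h : IsJost w G) (hs : ∀ t, star (w t) = -w t)
    (hw : Continuous w) {C : ℝ} (hb : ∀ t, ‖w t‖ ≤ C / (1 + t ^ 2)) :
    ∃ M, Tendsto G atTop (𝓝 M) := by
  have hi : Integrable fun t => w t * G t := by
    refine (integrable_const_div_one_add_sq C).mono' (hw.mul h.continuous).aestronglyMeasurable
      (Eventually.of_forall fun t => ?_)
    refine (norm_mul_le _ _).trans ?_
    rw [norm_unitary (h.mem_unitary hs t), mul_one]
    exact hb t
  exact ⟨_, tendsto_limUnder_of_hasDerivAt_of_integrableOn_Ioi (a := 0)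
    (fun t _ => h.deriv t) hi.integrableOn⟩

lemma mem_unitary_of_tendsto {l : Filter ℝ} [l.NeBot] {M : Mat} (hG : ∀ t, G t ∈ unitary Mat)
    (hl : Tendsto G l (𝓝 M)) : M ∈ unitary Mat := by
  rw [Unitary.mem_iff]
  refine ⟨tendsto_nhds_unique ((hl.star).mul hl) ?_, tendsto_nhds_unique (hl.mul hl.star) ?_⟩
  · simp only [fun t => (Unitary.mem_iff.1 (hG t)).1, tendsto_const_nhds]
  · simp only [fun t => (Unitary.mem_iff.1 (hG t)).2, tendsto_const_nhds]

end comparison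

/-! ### The vacuum frame and the potential in the interaction picture -/

/-- `Ω(t) E₀(t)`: the solution of the vacuum problem, in the gauge of `laxV`. -/
def frame (m β : ℝ) (p : Phase) (l t : ℝ) : Mat := gaugeOmega β p t * vacuumE m l t

/-- The potential `Ŵ` for which `(Ω E₀)' = V Ω E₀ - Ω E₀ Ŵ`. -/
def potential (m β : ℝ) (p : Phase) (l t : ℝ) : Mat :=
  !![Complex.I * ((m / (2 * l) * Real.sin (β * p.1 t / 2) ^ 2 : ℝ) : ℂ),
    (-((β / 4 * (p.2 t - deriv p.1 t) : ℝ) : ℂ) + Complex.I *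
      ((m / (2 * l) * (Real.sin (β * p.1 t / 2) * Real.cos (β * p.1 t / 2)) : ℝ) : ℂ)) *
      Complex.exp (2 * Complex.I * ((k0 m l * t : ℝ) : ℂ));
    (((β / 4 * (p.2 t - deriv p.1 t) : ℝ) : ℂ) + Complex.I *
      ((m / (2 * l) * (Real.sin (β * p.1 t / 2) * Real.cos (β * p.1 t / 2)) : ℝ) : ℂ)) *
      Complex.exp (-(2 * Complex.I * ((k0 m l * t : ℝ) : ℂ))),
    -(Complex.I * ((m / (2 * l) * Real.sin (β * p.1 t / 2) ^ 2 : ℝ) : ℂ))]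

lemma expPauli3_mul (a b : ℂ) : expPauli3 a * expPauli3 b = expPauli3 (a + b) := by
  ext i j; fin_cases i <;> fin_cases j <;>
    simp [expPauli3, ← Complex.exp_add, add_comm]

lemma expPauli3_zero : expPauli3 0 = 1 := by
  ext i j; fin_cases i <;> fin_cases j <;> simp [expPauli3]

lemma star_expPauli3 (x : ℝ) : star (expPauli3 (Complex.I * x)) = expPauli3 (-Complex.I * x) := by
  ext i j; fin_cases i <;> fin_cases j <;>
    simp [expPauli3, ← Complex.exp_conj]

lemma star_expPauli3_neg (x : ℝ) :
    star (expPauli3 (-Complex.I * x)) = expPauli3 (Complex.I * x) := by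
  rw [← star_expPauli3, star_star]

lemma expPauli3_mem_unitary (x : ℝ) : expPauli3 (Complex.I * x) ∈ unitary Mat := by
  rw [Unitary.mem_iff, star_expPauli3, expPauli3_mul, expPauli3_mul]
  simp [expPauli3_zero]

lemma expPauli3_neg_mem_unitary (x : ℝ) : expPauli3 (-Complex.I * x) ∈ unitary Mat := by
  have := expPauli3_mem_unitary (-x)
  simpa using this

/-- The matrix is `exp (i π σ₁ / 4)`; only `(√2)⁻¹ (√2)⁻¹ = 1 / 2` and `I ^ 2 = -1` enter the check.
-/
lemma matN_mem_unitary : matN ∈ unitary Mat := by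
  have h : ((Real.sqrt 2 : ℝ) : ℂ) * ((Real.sqrt 2 : ℝ) : ℂ) = 2 := by
    rw [← Complex.ofReal_mul, Real.mul_self_sqrt (by norm_num)]; norm_num
  have h0 : ((Real.sqrt 2 : ℝ) : ℂ) ≠ 0 := fun h0 => by rw [h0] at h; norm_num at h
  have h1 : (((Real.sqrt 2 : ℝ) : ℂ))⁻¹ * (((Real.sqrt 2 : ℝ) : ℂ))⁻¹ = 1 / 2 := by
    rw [← mul_inv, h]; norm_num
  rw [Unitary.mem_iff]
  constructor <;> · ext i j; fin_cases i <;> fin_cases j <;>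
    simp [matN, pauli1, Matrix.star_eq_conjTranspose, Matrix.mul_apply] <;>
    first
    | ring1
    | linear_combination 2 * h1 - (((Real.sqrt 2 : ℝ) : ℂ))⁻¹ ^ 2 * Complex.I_sq

lemma gaugeOmega_mem_unitary (β : ℝ) (p : Phase) (t : ℝ) : gaugeOmega β p t ∈ unitary Mat :=
  expPauli3_mem_unitary _

lemma vacuumE_mem_unitary (m l t : ℝ) : vacuumE m l t ∈ unitary Mat :=
  mul_mem matN_mem_unitary (expPauli3_neg_mem_unitary _)

lemma frame_mem_unitary (m β : ℝ) (p : Phase) (l t : ℝ) : frame m β p l t ∈ unitary Mat :=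
  mul_mem (gaugeOmega_mem_unitary _ _ _) (vacuumE_mem_unitary _ _ _)

lemma inv_eq_star_of_mem_unitary {U : Mat} (hU : U ∈ unitary Mat) : U⁻¹ = star U :=
  Matrix.inv_eq_left_inv (Unitary.mem_iff.1 hU).1

lemma star_laxV (m β : ℝ) (p : Phase) (l t : ℝ) : star (laxV m β p l t) = -laxV m β p l t := by
  ext i j; fin_cases i <;> fin_cases j <;>
    simp [laxV, pauli1, pauli2, pauli3, -Complex.ofReal_mul,
      -Complex.ofReal_div] <;> ring

lemma star_potential (m β : ℝ) (p : Phase) (l t : ℝ) :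
    star (potential m β p l t) = -potential m β p l t := by
  ext i j; fin_cases i <;> fin_cases j <;>
    simp [potential, -Complex.ofReal_mul, ← Complex.exp_conj,
      -Complex.ofReal_div, map_ofNat] <;> ring

lemma frame_eq (m β : ℝ) (p : Phase) (l t : ℝ) :
    frame m β p l t = ((1 / Real.sqrt 2 : ℝ) : ℂ) •
      !![Complex.exp (Complex.I * ((β * p.1 t / 4 - k0 m l * t : ℝ) : ℂ)),
        Complex.I * Complex.exp (Complex.I * ((β * p.1 t / 4 + k0 m l * t : ℝ) : ℂ));
        Complex.I * Complex.exp (-(Complex.I * ((β * p.1 t / 4 + k0 m l * t : ℝ) : ℂ))),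
        Complex.exp (-(Complex.I * ((β * p.1 t / 4 - k0 m l * t : ℝ) : ℂ)))] := by
  have e1 : Complex.I * ((β * p.1 t / 4 - k0 m l * t : ℝ) : ℂ) =
      Complex.I * ((β * p.1 t / 4 : ℝ) : ℂ) + -(Complex.I * ((k0 m l * t : ℝ) : ℂ)) := by
    push_cast; ring
  have e2 : Complex.I * ((β * p.1 t / 4 + k0 m l * t : ℝ) : ℂ) =
      Complex.I * ((β * p.1 t / 4 : ℝ) : ℂ) + (Complex.I * ((k0 m l * t : ℝ) : ℂ)) := by
    push_cast; ring
  rw [e1, e2]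
  ext i j; fin_cases i <;> fin_cases j <;>
    simp [frame, gaugeOmega, vacuumE, matN, expPauli3, pauli1, Matrix.mul_apply,
      -Complex.ofReal_mul, -Complex.ofReal_div, Complex.exp_add] <;> ring

lemma hasDerivAt_expI {f : ℝ → ℝ} {f' t : ℝ} (h : HasDerivAt f f' t) :
    HasDerivAt (fun t => Complex.exp (Complex.I * ((f t : ℝ) : ℂ)))
      (Complex.I * f' * Complex.exp (Complex.I * ((f t : ℝ) : ℂ))) t := by
  have := (h.ofReal_comp.const_mul Complex.I).cexp
  exact this.congr_deriv (by ring)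

/-- Conjugating V by Ω rotates σ₁ and σ₂ by the angle βφ/2. Since `k0 - k1 = m / (2 l)`, what then
differs from the vacuum matrix is proportional to sin(βφ/2) or to Π - φ', and both decay at the two
ends. -/
lemma hasDerivAt_frame (m β : ℝ) (p : Phase) (l t : ℝ) (hp : DifferentiableAt ℝ p.1 t) :
    HasDerivAt (frame m β p l)
      (laxV m β p l t * frame m β p l t - frame m β p l t * potential m β p l t) t := by
  have hd := hp.hasDerivAt
  have hm : HasDerivAt (fun t => β * p.1 t / 4 - k0 m l * t) (β * deriv p.1 t / 4 - k0 m l) t :=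
    (((hd.const_mul β).div_const 4).sub ((hasDerivAt_id t).const_mul (k0 m l))).congr_deriv
      (by simp)
  have hp : HasDerivAt (fun t => β * p.1 t / 4 + k0 m l * t) (β * deriv p.1 t / 4 + k0 m l) t :=
    (((hd.const_mul β).div_const 4).add ((hasDerivAt_id t).const_mul (k0 m l))).congr_deriv
      (by simp)
  have hm' := (hasDerivAt_expI hm).const_mul (((1 / Real.sqrt 2 : ℝ) : ℂ))
  have hp' := ((hasDerivAt_expI hp).const_mul Complex.I).const_mul (((1 / Real.sqrt 2 : ℝ) : ℂ))
  have hmn := (hasDerivAt_expI hm.fun_neg).const_mul (((1 / Real.sqrt 2 : ℝ) : ℂ))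
  have hpn := ((hasDerivAt_expI hp.fun_neg).const_mul Complex.I).const_mul
    (((1 / Real.sqrt 2 : ℝ) : ℂ))
  have hfr : frame m β p l = fun t => !![
      ((1 / Real.sqrt 2 : ℝ) : ℂ) * Complex.exp (Complex.I * ((β * p.1 t / 4 - k0 m l * t : ℝ) : ℂ)),
      ((1 / Real.sqrt 2 : ℝ) : ℂ) *
        (Complex.I * Complex.exp (Complex.I * ((β * p.1 t / 4 + k0 m l * t : ℝ) : ℂ)));
      ((1 / Real.sqrt 2 : ℝ) : ℂ) *
        (Complex.I * Complex.exp (Complex.I * ((-(β * p.1 t / 4 + k0 m l * t) : ℝ) : ℂ))),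
      ((1 / Real.sqrt 2 : ℝ) : ℂ) *
        Complex.exp (Complex.I * ((-(β * p.1 t / 4 - k0 m l * t) : ℝ) : ℂ))] := by
    funext t
    rw [frame_eq]
    simp only [Complex.ofReal_neg, mul_neg]
    ext i j; fin_cases i <;> fin_cases j <;> simp
  -- With ω = exp(iβφ/4) and e = exp(i k₀ t) every entry, the sine and the cosine included, is a
  -- Laurent polynomial, and the identity becomes algebraic.
  set om := Complex.exp (Complex.I * ((β * p.1 t / 4 : ℝ) : ℂ)) with hom
  set e := Complex.exp (Complex.I * ((k0 m l * t : ℝ) : ℂ)) with he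
  have hom0 : om ≠ 0 := Complex.exp_ne_zero _
  have he0 : e ≠ 0 := Complex.exp_ne_zero _
  have E1 : Complex.exp (Complex.I * ((β * p.1 t / 4 - k0 m l * t : ℝ) : ℂ)) = om * e⁻¹ := by
    rw [hom, he, ← Complex.exp_neg, ← Complex.exp_add]; congr 1; push_cast; ring
  have E2 : Complex.exp (Complex.I * ((β * p.1 t / 4 + k0 m l * t : ℝ) : ℂ)) = om * e := by
    rw [hom, he, ← Complex.exp_add]; congr 1; push_cast; ring
  have E3 : Complex.exp (2 * Complex.I * ((k0 m l * t : ℝ) : ℂ)) = e * e := by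
    rw [he, ← Complex.exp_add]; congr 1; push_cast; ring
  have E4 : ((Real.sin (β * p.1 t / 2) : ℝ) : ℂ) =
      (om⁻¹ * om⁻¹ - om * om) * Complex.I / 2 := by
    rw [Complex.ofReal_sin, Complex.sin, hom, ← Complex.exp_neg, ← Complex.exp_add,
      ← Complex.exp_add]
    congr 4 <;> · push_cast; ring
  have E5 : ((Real.cos (β * p.1 t / 2) : ℝ) : ℂ) = (om * om + om⁻¹ * om⁻¹) / 2 := by
    rw [Complex.ofReal_cos, Complex.cos, hom, ← Complex.exp_neg, ← Complex.exp_add,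
      ← Complex.exp_add]
    congr 3 <;> · push_cast; ring
  have F1 : Complex.exp (Complex.I * ((-(β * p.1 t / 4 - k0 m l * t) : ℝ) : ℂ)) = om⁻¹ * e := by
    rw [← inv_inv e, ← mul_inv, ← E1, ← Complex.exp_neg]; congr 1; push_cast; ring
  have F2 : Complex.exp (Complex.I * ((-(β * p.1 t / 4 + k0 m l * t) : ℝ) : ℂ)) =
      om⁻¹ * e⁻¹ := by
    rw [← mul_inv, ← E2, ← Complex.exp_neg]; congr 1; push_cast; ring
  have I4 : Complex.I ^ 4 = 1 := Complex.I_pow_four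
  have hfrt := congrFun hfr t
  simp only [E1, E2, F1, F2] at hfrt
  rw [hfrt]
  have hval : laxV m β p l t * !![
        ((1 / Real.sqrt 2 : ℝ) : ℂ) * (om * e⁻¹),
        ((1 / Real.sqrt 2 : ℝ) : ℂ) * (Complex.I * (om * e));
        ((1 / Real.sqrt 2 : ℝ) : ℂ) * (Complex.I * (om⁻¹ * e⁻¹)),
        ((1 / Real.sqrt 2 : ℝ) : ℂ) * (om⁻¹ * e)] - !![
        ((1 / Real.sqrt 2 : ℝ) : ℂ) * (om * e⁻¹),
        ((1 / Real.sqrt 2 : ℝ) : ℂ) * (Complex.I * (om * e));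
        ((1 / Real.sqrt 2 : ℝ) : ℂ) * (Complex.I * (om⁻¹ * e⁻¹)),
        ((1 / Real.sqrt 2 : ℝ) : ℂ) * (om⁻¹ * e)] * potential m β p l t =
      !![((1 / Real.sqrt 2 : ℝ) : ℂ) *
        (Complex.I * ((β * deriv p.1 t / 4 - k0 m l : ℝ) : ℂ) * (om * e⁻¹)),
      ((1 / Real.sqrt 2 : ℝ) : ℂ) *
        (Complex.I * (Complex.I * ((β * deriv p.1 t / 4 + k0 m l : ℝ) : ℂ) * (om * e)));
      ((1 / Real.sqrt 2 : ℝ) : ℂ) *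
        (Complex.I * (Complex.I * ((-(β * deriv p.1 t / 4 + k0 m l) : ℝ) : ℂ) * (om⁻¹ * e⁻¹))),
      ((1 / Real.sqrt 2 : ℝ) : ℂ) *
        (Complex.I * ((-(β * deriv p.1 t / 4 - k0 m l) : ℝ) : ℂ) * (om⁻¹ * e))] := by
    have hl : ((m / (2 * l) : ℝ) : ℂ) = m / 2 * (l : ℂ)⁻¹ := by
      push_cast; rw [div_eq_mul_inv, mul_inv]; ring
    have hk0 : ((k0 m l : ℝ) : ℂ) = m / 4 * (l + (l : ℂ)⁻¹) := by simp [k0]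
    have hk1 : ((k1 m l : ℝ) : ℂ) = m / 4 * (l - (l : ℂ)⁻¹) := by simp [k1]
    generalize ((1 / Real.sqrt 2 : ℝ) : ℂ) = r
    unfold laxV potential
    rw [Complex.exp_neg, E3]
    simp only [Complex.ofReal_mul (m / (2 * l)), Complex.ofReal_mul (k0 m l),
      Complex.ofReal_mul (k1 m l), Complex.ofReal_mul (Real.sin _), Complex.ofReal_pow, hl, hk0,
      hk1, Complex.ofReal_sub, Complex.ofReal_add, Complex.ofReal_neg, E4, E5]
    -- The identity is polynomial in l and 1/l taken as independent symbols, so `l = 0` need not be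
    -- excluded.
    generalize (l : ℂ)⁻¹ = l1
    ext i j; fin_cases i <;> fin_cases j <;>
    · simp [pauli1, pauli2, pauli3]
      field_simp
      ring_nf
      simp only [Complex.I_sq, I4]
      ring_nf
  rw [hval, hfr]
  refine hasDerivAt_pi.2 fun i => hasDerivAt_pi.2 fun j => ?_
  simp only [E1, E2, F1, F2] at hm' hp' hmn hpn
  fin_cases i <;> fin_cases j
  exacts [hm', hp', hpn, hmn]

/-! ### Comparison of solutions -/

section comparison

variable {w₁ w₂ G₁ G₂ : ℝ → Mat} {g : ℝ → ℝ}

lemma norm_sub_eq_norm_star_mul_sub_one {U U' : Mat} (hU : U ∈ unitary Mat) :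
    ‖U - U'‖ = ‖star U * U' - 1‖ := by
  have h : U - U' = -(U * (star U * U' - 1)) := by
    rw [mul_sub, ← mul_assoc, (Unitary.mem_iff.1 hU).2]; simp
  rw [h, norm_neg, CStarRing.norm_mem_unitary_mul _ hU]

lemma norm_star_mul_mul_le {U U' A : Mat} (hU : U ∈ unitary Mat) (hU' : U' ∈ unitary Mat) :
    ‖star U * A * U'‖ ≤ ‖A‖ := by
  refine (norm_mul_le _ _).trans ?_
  rw [norm_unitary hU', mul_one]
  refine (norm_mul_le _ _).trans ?_
  rw [norm_star_unitary hU, one_mul]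

/-- Since `G₁` is unitary, `‖G₁ - G₂‖ = ‖G₁* G₂ - 1‖`. The product tends to `1` at -∞ and its
derivative is bounded by `‖w₂ - w₁‖`, so no Grönwall factor appears. -/
lemma norm_sub_le_integral_Iic (hs : ∀ t, star (w₁ t) = -w₁ t)
    (h₁ : ∀ t, HasDerivAt G₁ (w₁ t * G₁ t) t) (h₂ : ∀ t, HasDerivAt G₂ (w₂ t * G₂ t) t)
    (u₁ : ∀ t, G₁ t ∈ unitary Mat) (u₂ : ∀ t, G₂ t ∈ unitary Mat)
    (hw₁ : Continuous w₁) (hw₂ : Continuous w₂)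
    (hl : Tendsto (fun t => star (G₁ t) * G₂ t) atBot (𝓝 1)) {t : ℝ}
    (hg : IntegrableOn g (Iic t)) (hb : ∀ s ≤ t, ‖w₂ s - w₁ s‖ ≤ g s) :
    ‖G₁ t - G₂ t‖ ≤ ∫ s in Iic t, g s := by
  have c₁ : Continuous G₁ := continuous_iff_continuousAt.2 fun t => (h₁ t).continuousAt
  have c₂ : Continuous G₂ := continuous_iff_continuousAt.2 fun t => (h₂ t).continuousAt
  have hle : ∀ s ∈ Iic t, ‖star (G₁ s) * (w₂ s - w₁ s) * G₂ s‖ ≤ g s := fun s hs' =>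
    (norm_star_mul_mul_le (u₁ s) (u₂ s)).trans (hb s hs')
  have hi : IntegrableOn (fun s => star (G₁ s) * (w₂ s - w₁ s) * G₂ s) (Iic t) := by
    refine Integrable.mono' hg ?_ ((ae_restrict_iff' measurableSet_Iic).2 (Eventually.of_forall hle))
    exact ((c₁.star.mul (hw₂.sub hw₁)).mul c₂).aestronglyMeasurable
  have he := integral_Iic_of_hasDerivAt_of_tendsto' (a := t) (m := (1 : Mat))
    (fun s _ => hasDerivAt_star_mul hs (h₁ s) (h₂ s)) hi hl
  rw [norm_sub_eq_norm_star_mul_sub_one (u₁ t), ← he]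
  exact norm_integral_le_of_norm_le hg
    ((ae_restrict_iff' measurableSet_Iic).2 (Eventually.of_forall hle))

lemma norm_sub_le_integral_Ioi (hs : ∀ t, star (w₁ t) = -w₁ t)
    (h₁ : ∀ t, HasDerivAt G₁ (w₁ t * G₁ t) t) (h₂ : ∀ t, HasDerivAt G₂ (w₂ t * G₂ t) t)
    (u₁ : ∀ t, G₁ t ∈ unitary Mat) (u₂ : ∀ t, G₂ t ∈ unitary Mat)
    (hw₁ : Continuous w₁) (hw₂ : Continuous w₂)
    (hl : Tendsto (fun t => star (G₁ t) * G₂ t) atTop (𝓝 1)) {t : ℝ}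
    (hg : IntegrableOn g (Ioi t)) (hb : ∀ s > t, ‖w₂ s - w₁ s‖ ≤ g s) :
    ‖G₁ t - G₂ t‖ ≤ ∫ s in Ioi t, g s := by
  have c₁ : Continuous G₁ := continuous_iff_continuousAt.2 fun t => (h₁ t).continuousAt
  have c₂ : Continuous G₂ := continuous_iff_continuousAt.2 fun t => (h₂ t).continuousAt
  have hle : ∀ s ∈ Ioi t, ‖star (G₁ s) * (w₂ s - w₁ s) * G₂ s‖ ≤ g s := fun s hs' =>
    (norm_star_mul_mul_le (u₁ s) (u₂ s)).trans (hb s hs')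
  have hi : IntegrableOn (fun s => star (G₁ s) * (w₂ s - w₁ s) * G₂ s) (Ioi t) := by
    refine Integrable.mono' hg ?_ ((ae_restrict_iff' measurableSet_Ioi).2 (Eventually.of_forall hle))
    exact ((c₁.star.mul (hw₂.sub hw₁)).mul c₂).aestronglyMeasurable
  have he := integral_Ioi_of_hasDerivAt_of_tendsto' (a := t) (m := (1 : Mat))
    (fun s _ => hasDerivAt_star_mul hs (h₁ s) (h₂ s)) hi hl
  rw [norm_sub_eq_norm_star_mul_sub_one (u₁ t), ← norm_neg, neg_sub, ← he]
  exact norm_integral_le_of_norm_le hg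
    ((ae_restrict_iff' measurableSet_Ioi).2 (Eventually.of_forall hle))

lemma integral_Iic_const_div (C t : ℝ) :
    ∫ s in Iic t, C / (1 + s ^ 2) = C * (Real.arctan t + Real.pi / 2) := by
  simp only [div_eq_mul_inv C, integral_const_mul, integral_Iic_inv_one_add_sq]

lemma integral_Ioi_const_div (C t : ℝ) :
    ∫ s in Ioi t, C / (1 + s ^ 2) = C * (Real.pi / 2 - Real.arctan t) := by
  simp only [div_eq_mul_inv C, integral_const_mul, integral_Ioi_inv_one_add_sq]

end comparison

/-! ### Decay of the data -/

/-- Since `(1 + t²)² ≤ 2 (1 + t⁴)`, the two limits control the weighted function near ±∞;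
compactness covers the interval in between. -/
lemma exists_le_div_of_tendsto {u : ℝ → ℝ} (hu : Continuous u)
    (h₁ : Tendsto (fun t => t ^ 4 * u t) atTop (𝓝 0))
    (h₁' : Tendsto u atTop (𝓝 0))
    (h₂ : Tendsto (fun t => t ^ 4 * u t) atBot (𝓝 0))
    (h₂' : Tendsto u atBot (𝓝 0)) :
    ∃ C, ∀ t, |u t| ≤ C / (1 + t ^ 2) ^ 2 := by
  have hc : Continuous fun t => (1 + t ^ 2) ^ 2 * u t := by fun_prop
  have key : ∀ t : ℝ, (1 + t ^ 2) ^ 2 ≤ 2 * (1 + t ^ 4) := fun t => by nlinarith [sq_nonneg (t^2-1)]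
  have hlim : ∀ F : Filter ℝ, Tendsto (fun t => t ^ 4 * u t) F (𝓝 0) → Tendsto u F (𝓝 0) →
      Tendsto (fun t => (1 + t ^ 2) ^ 2 * u t) F (𝓝 0) := by
    intro F h h'
    have h3 := ((h'.add h).abs).const_mul 2
    simp only [add_zero, abs_zero, mul_zero] at h3
    refine squeeze_zero_norm (fun t => ?_) h3
    rw [Real.norm_eq_abs, abs_mul, abs_of_nonneg (by positivity),
      show u t + t ^ 4 * u t = (1 + t ^ 4) * u t by ring, abs_mul,
      abs_of_nonneg (by positivity : (0:ℝ) ≤ 1 + t ^ 4), ← mul_assoc]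
    exact mul_le_mul_of_nonneg_right (key t) (abs_nonneg _)
  obtain ⟨a, ha⟩ := ((hlim _ h₁ h₁').abs.eventually (gt_mem_nhds (by simp : |(0:ℝ)| < 1))).exists_forall_of_atTop
  obtain ⟨b, hb⟩ := ((hlim _ h₂ h₂').abs.eventually (gt_mem_nhds (by simp : |(0:ℝ)| < 1))).exists_forall_of_atBot
  obtain ⟨K, hK⟩ := (isCompact_Icc (a := b) (b := a)).exists_bound_of_continuousOn hc.continuousOn
  refine ⟨max K 1, fun t => ?_⟩
  have hpos : (0:ℝ) < (1 + t ^ 2) ^ 2 := by positivity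
  rw [le_div_iff₀ hpos, mul_comm, ← abs_of_pos hpos, ← abs_mul]
  rcases le_or_gt a t with h | h
  · exact (ha t h).le.trans (le_max_right _ _)
  rcases le_or_gt t b with h' | h'
  · exact (hb t h').le.trans (le_max_right _ _)
  · exact (hK t ⟨h'.le, h.le⟩).trans (le_max_left _ _)

lemma RapidLimit.tendsto {f : ℝ → ℝ} {F : Filter ℝ} {c : ℝ} (h : RapidLimit f F c) (k : ℕ) :
    Tendsto (fun t => t ^ k * (f t - c)) F (𝓝 0) := by
  simpa using h k 0

lemma RapidLimit.tendsto_deriv {f : ℝ → ℝ} {F : Filter ℝ} {c : ℝ} (h : RapidLimit f F c) (k : ℕ) :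
    Tendsto (fun t => t ^ k * deriv f t) F (𝓝 0) := by
  simpa [iteratedDeriv_one] using h k 1

/-- The boundary values 2πQ/β are exactly where βφ/2 is a multiple of π, so the sine inherits the
decay of φ to its limit. -/
lemma abs_sin_le_of_int (β x : ℝ) (hβ : β ≠ 0) (Q : ℤ) :
    |Real.sin (β * x / 2)| ≤ |β / 2| * |x - 2 * Real.pi * Q / β| := by
  have h : β * x / 2 = β / 2 * (x - 2 * Real.pi * Q / β) + Q * Real.pi := by field_simp; ring
  rw [h, Real.sin_add_int_mul_pi, ← abs_mul]
  refine le_trans (le_of_eq ?_) Real.abs_sin_le_abs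
  rcases Int.even_or_odd Q with hQ | hQ <;> simp [hQ.neg_one_zpow]

/-- Decay like `(1 + t²)⁻²` leaves a spare power: one factor `1 + t²` absorbs the `|t|` produced by
varying l in exp(2i k₀(l) t), the other keeps the bounds integrable. -/
lemma IsPhasePoint.exists_bound {β : ℝ} {Qm Qp : ℤ} {p : Phase} (hβ : β ≠ 0)
    (hp : IsPhasePoint β Qm Qp p) :
    ∃ C, 0 ≤ C ∧ ∀ t, |Real.sin (β * p.1 t / 2)| ≤ C / (1 + t ^ 2) ^ 2 ∧
      |β / 4 * (p.2 t - deriv p.1 t)| ≤ C / (1 + t ^ 2) ^ 2 := by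
  have c1 := hp.smooth_fst.continuous
  have c2 := hp.smooth_snd.continuous
  have c3 : Continuous (deriv p.1) := hp.smooth_fst.continuous_deriv (by simp)
  have hs : ∀ (F : Filter ℝ) (Q : ℤ), RapidLimit p.1 F (2 * Real.pi * Q / β) → ∀ k : ℕ,
      Tendsto (fun t => t ^ k * Real.sin (β * p.1 t / 2)) F (𝓝 0) := by
    intro F Q h k
    have := ((h.tendsto k).abs).const_mul |β / 2|
    simp only [abs_zero, mul_zero] at this
    refine squeeze_zero_norm (fun t => ?_) this
    rw [Real.norm_eq_abs, abs_mul, abs_mul, mul_left_comm]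
    exact mul_le_mul_of_nonneg_left (abs_sin_le_of_int β _ hβ Q) (abs_nonneg _)
  have hq : ∀ (F : Filter ℝ) (Q : ℤ), RapidLimit p.1 F (2 * Real.pi * Q / β) → RapidLimit p.2 F 0 →
      ∀ k : ℕ, Tendsto (fun t => t ^ k * (β / 4 * (p.2 t - deriv p.1 t))) F (𝓝 0) := by
    intro F Q h h' k
    have := ((h'.tendsto k).sub (h.tendsto_deriv k)).const_mul (β / 4)
    simp only [sub_zero, mul_zero] at this
    refine this.congr fun t => by ring
  obtain ⟨C₁, h₁⟩ := exists_le_div_of_tendsto (u := fun t => Real.sin (β * p.1 t / 2))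
    (by fun_prop) (hs _ _ hp.fst_atTop 4) (by simpa using hs _ _ hp.fst_atTop 0)
    (hs _ _ hp.fst_atBot 4) (by simpa using hs _ _ hp.fst_atBot 0)
  obtain ⟨C₂, h₂⟩ := exists_le_div_of_tendsto (u := fun t => β / 4 * (p.2 t - deriv p.1 t))
    (by fun_prop) (hq _ _ hp.fst_atTop hp.snd_atTop 4)
    (by simpa using hq _ _ hp.fst_atTop hp.snd_atTop 0)
    (hq _ _ hp.fst_atBot hp.snd_atBot 4) (by simpa using hq _ _ hp.fst_atBot hp.snd_atBot 0)
  refine ⟨max 0 (max C₁ C₂), le_max_left _ _, fun t => ⟨(h₁ t).trans ?_, (h₂ t).trans ?_⟩⟩ <;> gcongr <;> simp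

lemma IsPhasePoint.continuous_potential {β : ℝ} {Qm Qp : ℤ} {p : Phase} (m : ℝ)
    (hp : IsPhasePoint β Qm Qp p) (l : ℝ) : Continuous (potential m β p l) := by
  have c1 := hp.smooth_fst.continuous
  have c2 := hp.smooth_snd.continuous
  have c3 : Continuous (deriv p.1) := hp.smooth_fst.continuous_deriv (by simp)
  refine continuous_matrix fun i j => ?_
  fin_cases i <;> fin_cases j <;> simp only [potential] <;> simp <;> fun_prop

/-! ### Dependence of the potential on the spectral parameter -/

/-- The annulus `c ≤ |l| ≤ 1 / c`. -/
def ann (c : ℝ) : Set ℝ := {l | c ≤ |l| ∧ |l| ≤ c⁻¹}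

lemma ne_zero_of_mem_ann {c l : ℝ} (hc : 0 < c) (h : l ∈ ann c) : l ≠ 0 := by
  rintro rfl
  have := h.1
  rw [abs_zero] at this
  linarith

lemma exists_mem_ann {l : ℝ} (hl : l ≠ 0) : ∃ c, 0 < c ∧ ∀ᶠ l' in 𝓝 l, l' ∈ ann c := by
  have h0 := abs_pos.2 hl
  refine ⟨min (|l| / 2) (2 * |l|)⁻¹, lt_min (by linarith) (by positivity), ?_⟩
  have h1 := (continuous_abs.tendsto l).eventually (lt_mem_nhds (show |l| / 2 < |l| by linarith))
  have h2 := (continuous_abs.tendsto l).eventually (gt_mem_nhds (show |l| < 2 * |l| by linarith))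
  filter_upwards [h1, h2] with l' h1 h2
  refine ⟨(min_le_left _ _).trans h1.le, h2.le.trans ?_⟩
  rw [le_inv_comm₀ (by positivity) (lt_min (by linarith) (by positivity))]
  exact min_le_right _ _

lemma abs_inv_le_of_mem_ann {c l : ℝ} (hc : 0 < c) (h : l ∈ ann c) : |l⁻¹| ≤ c⁻¹ := by
  rw [abs_inv]; exact inv_anti₀ hc h.1

lemma abs_inv_sub_inv_le {c l l' : ℝ} (hc : 0 < c) (h : l ∈ ann c) (h' : l' ∈ ann c) :
    |l⁻¹ - l'⁻¹| ≤ c⁻¹ * c⁻¹ * |l - l'| := by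
  have hl := ne_zero_of_mem_ann hc h
  have hl' := ne_zero_of_mem_ann hc h'
  have : l⁻¹ - l'⁻¹ = -(l⁻¹ * l'⁻¹ * (l - l')) := by field_simp; ring
  rw [this, abs_neg, abs_mul, abs_mul]
  gcongr
  · exact abs_inv_le_of_mem_ann hc h
  · exact abs_inv_le_of_mem_ann hc h'

lemma abs_k0_sub_le {c l l' : ℝ} (m : ℝ) (hc : 0 < c) (h : l ∈ ann c) (h' : l' ∈ ann c) :
    |k0 m l - k0 m l'| ≤ |m| / 4 * (1 + c⁻¹ * c⁻¹) * |l - l'| := by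
  have : k0 m l - k0 m l' = m / 4 * ((l - l') + (l⁻¹ - l'⁻¹)) := by simp [k0]; ring
  rw [this, abs_mul, abs_div, mul_assoc]
  have h1 := (abs_add_le (l - l') (l⁻¹ - l'⁻¹)).trans (add_le_add_right (abs_inv_sub_inv_le hc h h') _)
  rw [abs_of_pos (by norm_num : (0:ℝ) < 4)]
  exact mul_le_mul_of_nonneg_left (by linarith) (by positivity)

lemma norm_expI_sub_le (x y : ℝ) :
    ‖Complex.exp (Complex.I * x) - Complex.exp (Complex.I * y)‖ ≤ |x - y| := by
  have h : Complex.exp (Complex.I * x) - Complex.exp (Complex.I * y) =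
      Complex.exp (Complex.I * y) * (Complex.exp (Complex.I * ((x - y : ℝ) : ℂ)) - 1) := by
    rw [mul_sub, ← Complex.exp_add, mul_one]; congr 2; push_cast; ring
  rw [h, norm_mul, mul_comm Complex.I (y : ℂ), Complex.norm_exp_ofReal_mul_I, one_mul]
  exact Real.norm_exp_I_mul_ofReal_sub_one_le

/-! ### Bounds for the potential -/

lemma norm_exp_two_I (x : ℝ) : ‖Complex.exp (2 * Complex.I * (x : ℂ))‖ = 1 := by
  rw [show 2 * Complex.I * (x : ℂ) = ((2 * x : ℝ) : ℂ) * Complex.I by push_cast; ring,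
    Complex.norm_exp_ofReal_mul_I]

lemma norm_exp_neg_two_I (x : ℝ) : ‖Complex.exp (-(2 * Complex.I * (x : ℂ)))‖ = 1 := by
  rw [Complex.exp_neg, norm_inv, norm_exp_two_I, inv_one]

lemma abs_sin_mul_cos_le (x : ℝ) : |Real.sin x * Real.cos x| ≤ |Real.sin x| := by
  rw [abs_mul]
  exact mul_le_of_le_one_right (abs_nonneg _) (Real.abs_cos_le_one x)

lemma abs_sin_sq_le (x : ℝ) : |Real.sin x ^ 2| ≤ |Real.sin x| := by
  rw [abs_pow, sq]
  exact mul_le_of_le_one_right (abs_nonneg _) (Real.abs_sin_le_one x)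

lemma abs_coupling_le {c l m x y : ℝ} (hc : 0 < c) (h : l ∈ ann c) (hxy : |x| ≤ y) :
    |m / (2 * l) * x| ≤ |m| / 2 * c⁻¹ * y := by
  have : m / (2 * l) * x = m / 2 * l⁻¹ * x := by rw [div_eq_mul_inv, mul_inv]; ring
  rw [this, abs_mul, abs_mul, abs_div, abs_of_pos (by norm_num : (0:ℝ) < 2)]
  gcongr
  exact abs_inv_le_of_mem_ann hc h

lemma abs_coupling_sub_le {c l l' m x y : ℝ} (hc : 0 < c) (h : l ∈ ann c) (h' : l' ∈ ann c)
    (hxy : |x| ≤ y) :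
    |m / (2 * l) * x - m / (2 * l') * x| ≤ |m| / 2 * (c⁻¹ * c⁻¹) * |l - l'| * y := by
  have : m / (2 * l) * x - m / (2 * l') * x = m / 2 * (l⁻¹ - l'⁻¹) * x := by
    simp only [div_eq_mul_inv, mul_inv]; ring
  rw [this, abs_mul, abs_mul, abs_div, abs_of_pos (by norm_num : (0:ℝ) < 2), mul_assoc (|m| / 2) (c⁻¹ * c⁻¹)]
  gcongr
  exact abs_inv_sub_inv_le hc h h'

lemma norm_two_exp_sub_le (x y : ℝ) :
    ‖Complex.exp (2 * Complex.I * (x : ℂ)) - Complex.exp (2 * Complex.I * (y : ℂ))‖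
      ≤ 2 * |x - y| := by
  have := norm_expI_sub_le (2 * x) (2 * y)
  rw [← mul_sub, abs_mul, abs_of_pos (by norm_num : (0:ℝ) < 2)] at this
  convert this using 4 <;> · push_cast; ring

lemma norm_two_exp_neg_sub_le (x y : ℝ) :
    ‖Complex.exp (-(2 * Complex.I * (x : ℂ))) - Complex.exp (-(2 * Complex.I * (y : ℂ)))‖
      ≤ 2 * |x - y| := by
  have := norm_two_exp_sub_le (-x) (-y)
  rw [show -x - -y = -(x - y) by ring, abs_neg] at this
  convert this using 4 <;> · push_cast; ring

lemma norm_mul_sub_mul_le {a a' e e' : ℂ} {A B E : ℝ} (he : ‖e‖ ≤ 1) (ha' : ‖a'‖ ≤ B)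
    (haa : ‖a - a'‖ ≤ A) (hee : ‖e - e'‖ ≤ E) : ‖a * e - a' * e'‖ ≤ A + B * E := by
  have : a * e - a' * e' = (a - a') * e + a' * (e - e') := by ring
  rw [this]
  refine (norm_add_le _ _).trans (add_le_add ?_ ?_)
  · rw [norm_mul]
    exact (mul_le_of_le_one_right (norm_nonneg _) he).trans haa
  · rw [norm_mul]
    exact mul_le_mul ha' hee (norm_nonneg _) ((norm_nonneg _).trans ha')

section bounds

variable {m β c C : ℝ} {p : Phase}

/-- The data decay like `C / (1 + t²)²`. -/
def DataBound (β C : ℝ) (p : Phase) : Prop :=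
  ∀ t, |Real.sin (β * p.1 t / 2)| ≤ C / (1 + t ^ 2) ^ 2 ∧
      |β / 4 * (p.2 t - deriv p.1 t)| ≤ C / (1 + t ^ 2) ^ 2

lemma DataBound.norm_potential_le (hb : DataBound β C p) (hc : 0 < c) {l : ℝ} (hl : l ∈ ann c)
    (t : ℝ) : ‖potential m β p l t‖ ≤ 2 * (1 + |m| / 2 * c⁻¹) * (C / (1 + t ^ 2) ^ 2) := by
  obtain ⟨h1, h2⟩ := hb t
  have hC : 0 ≤ C / (1 + t ^ 2) ^ 2 := (abs_nonneg _).trans h1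
  rw [mul_assoc]
  have d := abs_coupling_le (m := m) hc hl ((abs_sin_sq_le (β * p.1 t / 2)).trans h1)
  have o := abs_coupling_le (m := m) hc hl ((abs_sin_mul_cos_le (β * p.1 t / 2)).trans h1)
  have hd : ‖Complex.I * ((m / (2 * l) * Real.sin (β * p.1 t / 2) ^ 2 : ℝ) : ℂ)‖ ≤
      (1 + |m| / 2 * c⁻¹) * (C / (1 + t ^ 2) ^ 2) := by
    rw [norm_mul, Complex.norm_I, one_mul, Complex.norm_real, Real.norm_eq_abs]
    linarith
  have ho : ‖Complex.I *
      ((m / (2 * l) * (Real.sin (β * p.1 t / 2) * Real.cos (β * p.1 t / 2)) : ℝ) : ℂ)‖ ≤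
      |m| / 2 * c⁻¹ * (C / (1 + t ^ 2) ^ 2) := by
    rw [norm_mul, Complex.norm_I, one_mul, Complex.norm_real, Real.norm_eq_abs]
    exact o
  have hq : ‖((β / 4 * (p.2 t - deriv p.1 t) : ℝ) : ℂ)‖ ≤ C / (1 + t ^ 2) ^ 2 := by
    rw [Complex.norm_real, Real.norm_eq_abs]; exact h2
  refine norm_le_of_entries _ fun i j => ?_
  fin_cases i <;> fin_cases j
  · exact hd
  · simp only [potential]
    refine (norm_mul_le _ _).trans ?_
    rw [norm_exp_two_I, mul_one]
    refine (norm_add_le _ _).trans ?_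
    rw [norm_neg]; linarith
  · simp only [potential]
    refine (norm_mul_le _ _).trans ?_
    rw [norm_exp_neg_two_I, mul_one]
    refine (norm_add_le _ _).trans ?_
    linarith
  · simp only [potential]
    refine (norm_neg _).le.trans hd

/-- In the constant, the first summand comes from the coupling `m / (2 l)`. The second is the size
of the off-diagonal entries times the Lipschitz constant of the phase; the latter brings a factor
`|t|`, paid for by one power of `1 + t²`. -/
lemma DataBound.norm_potential_sub_le (hb : DataBound β C p) (hc : 0 < c) {l l' : ℝ}
    (hl : l ∈ ann c) (hl' : l' ∈ ann c) (t : ℝ) :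
    ‖potential m β p l t - potential m β p l' t‖ ≤
      2 * (|m| / 2 * (c⁻¹ * c⁻¹) + (1 + |m| / 2 * c⁻¹) * (2 * (|m| / 4 * (1 + c⁻¹ * c⁻¹))))
        * C * |l - l'| / (1 + t ^ 2) := by
  obtain ⟨h1, h2⟩ := hb t
  set b := C / (1 + t ^ 2) ^ 2 with hbd
  have hb0 : 0 ≤ b := (abs_nonneg _).trans h1
  have hpos : (0:ℝ) < 1 + t ^ 2 := by positivity
  have hb1 : b * (1 + t ^ 2) = C / (1 + t ^ 2) := by rw [hbd]; field_simp
  have hbt : b * |t| ≤ C / (1 + t ^ 2) := by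
    rw [← hb1]
    exact mul_le_mul_of_nonneg_left (by nlinarith [sq_abs t, sq_nonneg (|t| - 1)]) hb0
  have hbb : b ≤ C / (1 + t ^ 2) := by
    rw [← hb1]; exact le_mul_of_one_le_right hb0 (by nlinarith [sq_nonneg t])
  have hk := abs_k0_sub_le m hc hl hl'
  set X := |m| / 2 * (c⁻¹ * c⁻¹) with hX
  set Y := 1 + |m| / 2 * c⁻¹ with hY
  set Z := |m| / 4 * (1 + c⁻¹ * c⁻¹) with hZ
  have hX0 : 0 ≤ X := by positivity
  have hY0 : 0 ≤ Y := by positivity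
  have hZ0 : 0 ≤ Z := by positivity
  have hT : 2 * (X + Y * (2 * Z)) * C * |l - l'| / (1 + t ^ 2) =
      2 * (X * |l - l'| * (C / (1 + t ^ 2)) + Y * (2 * Z) * |l - l'| * (C / (1 + t ^ 2))) := by
    ring
  rw [hT]
  have hw : 0 ≤ Y * (2 * Z) * |l - l'| * (C / (1 + t ^ 2)) := by
    have := hb0.trans hbb
    positivity
  have d := abs_coupling_sub_le (m := m) hc hl hl' ((abs_sin_sq_le (β * p.1 t / 2)).trans h1)
  have o := abs_coupling_sub_le (m := m) hc hl hl' ((abs_sin_mul_cos_le (β * p.1 t / 2)).trans h1)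
  have o' := abs_coupling_le (m := m) hc hl' ((abs_sin_mul_cos_le (β * p.1 t / 2)).trans h1)
  rw [← hX] at d o
  have hXb : X * |l - l'| * b ≤ X * |l - l'| * (C / (1 + t ^ 2)) := by gcongr
  have hd : ‖Complex.I * ((m / (2 * l) * Real.sin (β * p.1 t / 2) ^ 2 : ℝ) : ℂ) -
      Complex.I * ((m / (2 * l') * Real.sin (β * p.1 t / 2) ^ 2 : ℝ) : ℂ)‖ ≤
      X * |l - l'| * (C / (1 + t ^ 2)) + Y * (2 * Z) * |l - l'| * (C / (1 + t ^ 2)) := by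
    rw [← mul_sub, norm_mul, Complex.norm_I, one_mul, ← Complex.ofReal_sub, Complex.norm_real,
      Real.norm_eq_abs]
    linarith
  have ho : ∀ q : ℂ, ‖(q + Complex.I *
      ((m / (2 * l) * (Real.sin (β * p.1 t / 2) * Real.cos (β * p.1 t / 2)) : ℝ) : ℂ)) -
      (q + Complex.I *
      ((m / (2 * l') * (Real.sin (β * p.1 t / 2) * Real.cos (β * p.1 t / 2)) : ℝ) : ℂ))‖ ≤
      X * |l - l'| * (C / (1 + t ^ 2)) := by
    intro q
    rw [add_sub_add_left_eq_sub, ← mul_sub, norm_mul, Complex.norm_I, one_mul,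
      ← Complex.ofReal_sub, Complex.norm_real, Real.norm_eq_abs]
    linarith
  have ho' : ∀ q : ℂ, ‖q‖ ≤ b → ‖q + Complex.I *
      ((m / (2 * l') * (Real.sin (β * p.1 t / 2) * Real.cos (β * p.1 t / 2)) : ℝ) : ℂ)‖ ≤
      Y * b := by
    intro q hq
    refine (norm_add_le _ _).trans ?_
    rw [norm_mul, Complex.norm_I, one_mul, Complex.norm_real, Real.norm_eq_abs]
    have : Y * b = b + |m| / 2 * c⁻¹ * b := by rw [hY]; ring
    linarith
  have hq : ‖((β / 4 * (p.2 t - deriv p.1 t) : ℝ) : ℂ)‖ ≤ b := by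
    rw [Complex.norm_real, Real.norm_eq_abs]; exact h2
  have he : 2 * |k0 m l * t - k0 m l' * t| ≤ 2 * Z * |l - l'| * |t| := by
    rw [← sub_mul, abs_mul]
    nlinarith [abs_nonneg t]
  have hfin : Y * b * (2 * Z * |l - l'| * |t|) ≤ Y * (2 * Z) * |l - l'| * (C / (1 + t ^ 2)) := by
    have := mul_le_mul_of_nonneg_left hbt (show 0 ≤ Y * (2 * Z) * |l - l'| by positivity)
    linarith
  refine norm_le_of_entries _ fun i j => ?_
  fin_cases i <;> fin_cases j
  · exact hd
  · refine (norm_mul_sub_mul_le (norm_exp_two_I _).le (ho' _ (by rwa [norm_neg])) (ho _)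
      ((norm_two_exp_sub_le _ _).trans he)).trans ?_
    linarith
  · refine (norm_mul_sub_mul_le (norm_exp_neg_two_I _).le (ho' _ hq) (ho _)
      ((norm_two_exp_neg_sub_le _ _).trans he)).trans ?_
    linarith
  · refine le_trans (le_of_eq ?_) hd
    rw [← norm_neg]
    simp only [potential]
    congr 1
    simp [-Complex.ofReal_mul]
    ring

end bounds

/-! ### Jost solutions and the time monodromy matrix of a phase point -/

/-- The solution of `G' = Ŵ G` with limit `1` at `-∞`. -/
def jostMinus (m β : ℝ) (p : Phase) (l : ℝ) : ℝ → Mat :=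
  Classical.epsilon (IsJost (potential m β p l))

/-- The solution of `G' = Ŵ G` with limit `1` at `+∞`. -/
def jostPlus (m β : ℝ) (p : Phase) (l t : ℝ) : Mat :=
  jostMinus m β p l t * star (timeMonodromy m β p l)

/-- The frame intertwines the decaying potential with `laxV`, so this and `psiPlus` solve the
original linear problem. -/
def psiMinus (m β : ℝ) (p : Phase) (l t : ℝ) : Mat := frame m β p l t * jostMinus m β p l t

def psiPlus (m β : ℝ) (p : Phase) (l t : ℝ) : Mat := frame m β p l t * jostPlus m β p l t

section package

variable {m β : ℝ} {Qm Qp : ℤ} {p : Phase} {l : ℝ}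

lemma DataBound.nonneg {C : ℝ} (h : DataBound β C p) : 0 ≤ C := by
  simpa using (abs_nonneg _).trans (h 0).1

lemma DataBound.norm_potential_le_div {C c : ℝ} (hb : DataBound β C p) (hc : 0 < c)
    (hl : l ∈ ann c) (t : ℝ) :
    ‖potential m β p l t‖ ≤ 2 * (1 + |m| / 2 * c⁻¹) * C / (1 + t ^ 2) := by
  refine (hb.norm_potential_le hc hl t).trans ?_
  have := hb.nonneg
  rw [mul_div_assoc]
  gcongr
  exact le_self_pow₀ (by nlinarith [sq_nonneg t]) (by norm_num)

lemma isJost_jostMinus (hβ : β ≠ 0) (hp : IsPhasePoint β Qm Qp p) (hl : l ≠ 0) :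
    IsJost (potential m β p l) (jostMinus m β p l) := by
  obtain ⟨C, hC, hb⟩ := hp.exists_bound hβ
  obtain ⟨c, hc, hlc⟩ := exists_mem_ann hl
  exact Classical.epsilon_spec (exists_isJost (hp.continuous_potential m l) (by positivity)
    (DataBound.norm_potential_le_div hb hc hlc.self_of_nhds))

lemma jostMinus_mem_unitary (hβ : β ≠ 0) (hp : IsPhasePoint β Qm Qp p) (hl : l ≠ 0) (t : ℝ) :
    jostMinus m β p l t ∈ unitary Mat :=
  (isJost_jostMinus hβ hp hl).mem_unitary (star_potential m β p l) t

lemma IsPhasePoint.differentiable (hp : IsPhasePoint β Qm Qp p) : Differentiable ℝ p.1 :=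
  hp.smooth_fst.differentiable (by simp)

lemma hasDerivAt_frame_mul (hp : IsPhasePoint β Qm Qp p) {G : ℝ → Mat} {t : ℝ}
    (hG : HasDerivAt G (potential m β p l t * G t) t) :
    HasDerivAt (fun t => frame m β p l t * G t)
      (laxV m β p l t * (frame m β p l t * G t)) t := by
  refine ((hasDerivAt_frame m β p l t (hp.differentiable t)).mul hG).congr_deriv ?_
  noncomm_ring

lemma hasDerivAt_psiMinus (hβ : β ≠ 0) (hp : IsPhasePoint β Qm Qp p) (hl : l ≠ 0) (t : ℝ) :
    HasDerivAt (psiMinus m β p l) (laxV m β p l t * psiMinus m β p l t) t :=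
  hasDerivAt_frame_mul hp ((isJost_jostMinus hβ hp hl).deriv t)

lemma psiMinus_mem_unitary (hβ : β ≠ 0) (hp : IsPhasePoint β Qm Qp p) (hl : l ≠ 0) (t : ℝ) :
    psiMinus m β p l t ∈ unitary Mat :=
  mul_mem (frame_mem_unitary _ _ _ _ _) (jostMinus_mem_unitary hβ hp hl t)

/-- Two solutions of the same skew-Hermitian system have a constant product Ψ₋(t)* T(t, τ);
evaluating it at t = τ identifies T. -/
lemma IsTransition.eq {T : ℝ → ℝ → Mat} (hβ : β ≠ 0) (hp : IsPhasePoint β Qm Qp p) (hl : l ≠ 0)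
    (hT : IsTransition m β p l T) (t τ : ℝ) :
    T t τ = psiMinus m β p l t * star (psiMinus m β p l τ) := by
  have hd : ∀ t, HasDerivAt (fun t => star (psiMinus m β p l t) * T t τ) 0 t := fun t => by
    have h1 : HasDerivAt (fun s => T s τ) (laxV m β p l t * T t τ) t :=
      hasDerivAt_pi.2 fun i => hasDerivAt_pi.2 fun j => hT.1 t τ i j
    have := hasDerivAt_star_mul (star_laxV m β p l) (hasDerivAt_psiMinus hβ hp hl t) h1
    simpa using this
  have hc := is_const_of_deriv_eq_zero (fun t => (hd t).differentiableAt) (fun t => (hd t).deriv) t τ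
  simp only [hT.2, mul_one] at hc
  rw [← hc, ← mul_assoc, (Unitary.mem_iff.1 (psiMinus_mem_unitary hβ hp hl t)).2, one_mul]

/-- The factors Ω and E₀ in the definition of the monodromy matrix are the frames contained in Ψ₋,
and they cancel by unitarity. -/
lemma conj_transition_eq (t τ : ℝ) :
    (vacuumE m l t)⁻¹ * ((gaugeOmega β p t)⁻¹ *
      (psiMinus m β p l t * star (psiMinus m β p l τ)) * gaugeOmega β p τ) * vacuumE m l τ =
      jostMinus m β p l t * star (jostMinus m β p l τ) := by
  rw [inv_eq_star_of_mem_unitary (vacuumE_mem_unitary _ _ _),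
    inv_eq_star_of_mem_unitary (gaugeOmega_mem_unitary _ _ _)]
  have h1 : star (vacuumE m l t) * star (gaugeOmega β p t) = star (frame m β p l t) := by
    rw [frame, star_mul]
  calc _ = (star (vacuumE m l t) * star (gaugeOmega β p t)) * (psiMinus m β p l t *
        star (psiMinus m β p l τ)) * (gaugeOmega β p τ * vacuumE m l τ) := by noncomm_ring
    _ = (star (frame m β p l t) * frame m β p l t) * (jostMinus m β p l t *
        star (jostMinus m β p l τ)) * (star (frame m β p l τ) * frame m β p l τ) := by
      rw [h1, psiMinus, psiMinus, star_mul, ← frame]; noncomm_ring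
    _ = _ := by
      rw [(Unitary.mem_iff.1 (frame_mem_unitary m β p l t)).1,
        (Unitary.mem_iff.1 (frame_mem_unitary m β p l τ)).1, one_mul, mul_one]

lemma isTransition_psiMinus (hβ : β ≠ 0) (hp : IsPhasePoint β Qm Qp p) (hl : l ≠ 0) :
    IsTransition m β p l fun t τ => psiMinus m β p l t * star (psiMinus m β p l τ) := by
  refine ⟨fun t τ i j => ?_, fun τ => (Unitary.mem_iff.1 (psiMinus_mem_unitary hβ hp hl τ)).2⟩
  have := (hasDerivAt_psiMinus (m := m) hβ hp hl t).mul_const (star (psiMinus m β p l τ))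
  rw [mul_assoc] at this
  exact hasDerivAt_pi.1 (hasDerivAt_pi.1 this i) j

lemma tendsto_jostMinus_mul_star (hβ : β ≠ 0) (hp : IsPhasePoint β Qm Qp p) (hl : l ≠ 0) {M : Mat}
    (hM : Tendsto (jostMinus m β p l) atTop (𝓝 M)) :
    Tendsto (fun q : ℝ × ℝ => jostMinus m β p l q.1 * star (jostMinus m β p l q.2))
      (atTop ×ˢ atBot) (𝓝 M) := by
  have h1 := hM.comp (tendsto_fst (f := atTop) (g := (atBot : Filter ℝ)))
  have h2 := ((isJost_jostMinus (m := m) hβ hp hl).lim.star).comp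
    (tendsto_snd (f := (atTop : Filter ℝ)) (g := atBot))
  simpa using h1.mul h2

/-- The factor at τ tends to `1`, so the double limit is a single limit of `jostMinus` at +∞. In
particular it is unique, hence the choice in `timeMonodromy` is harmless. -/
lemma isMonodromy_iff (hβ : β ≠ 0) (hp : IsPhasePoint β Qm Qp p) (hl : l ≠ 0) (M : Mat) :
    IsMonodromy m β p l M ↔ Tendsto (jostMinus m β p l) atTop (𝓝 M) := by
  obtain ⟨C, hC, hb⟩ := hp.exists_bound hβ
  obtain ⟨c, hc, hlc⟩ := exists_mem_ann hl
  obtain ⟨M', hM'⟩ := (isJost_jostMinus (m := m) hβ hp hl).exists_tendsto_atTop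
    (star_potential m β p l) (hp.continuous_potential m l)
    (DataBound.norm_potential_le_div hb hc hlc.self_of_nhds)
  constructor
  · rintro ⟨T, hT, hlim⟩
    have : M = M' := by
      refine tendsto_nhds_unique (hlim.congr fun q => ?_) (tendsto_jostMinus_mul_star hβ hp hl hM')
      rw [hT.eq hβ hp hl, conj_transition_eq]
    rwa [this]
  · intro h
    refine ⟨_, isTransition_psiMinus hβ hp hl, ?_⟩
    simp only [conj_transition_eq]
    exact tendsto_jostMinus_mul_star hβ hp hl h

lemma tendsto_jostMinus_atTop (hβ : β ≠ 0) (hp : IsPhasePoint β Qm Qp p) (hl : l ≠ 0) :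
    Tendsto (jostMinus m β p l) atTop (𝓝 (timeMonodromy m β p l)) := by
  obtain ⟨C, hC, hb⟩ := hp.exists_bound hβ
  obtain ⟨c, hc, hlc⟩ := exists_mem_ann hl
  obtain ⟨M', hM'⟩ := (isJost_jostMinus (m := m) hβ hp hl).exists_tendsto_atTop
    (star_potential m β p l) (hp.continuous_potential m l)
    (DataBound.norm_potential_le_div hb hc hlc.self_of_nhds)
  exact (isMonodromy_iff hβ hp hl _).1
    (Classical.epsilon_spec ⟨M', (isMonodromy_iff hβ hp hl _).2 hM'⟩)

lemma isMonodromy_timeMonodromy (hβ : β ≠ 0) (hp : IsPhasePoint β Qm Qp p) (hl : l ≠ 0) :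
    IsMonodromy m β p l (timeMonodromy m β p l) :=
  (isMonodromy_iff hβ hp hl _).2 (tendsto_jostMinus_atTop hβ hp hl)

lemma timeMonodromy_mem_unitary (hβ : β ≠ 0) (hp : IsPhasePoint β Qm Qp p) (hl : l ≠ 0) :
    timeMonodromy m β p l ∈ unitary Mat :=
  mem_unitary_of_tendsto (jostMinus_mem_unitary hβ hp hl) (tendsto_jostMinus_atTop hβ hp hl)

lemma jostPlus_mem_unitary (hβ : β ≠ 0) (hp : IsPhasePoint β Qm Qp p) (hl : l ≠ 0) (t : ℝ) :
    jostPlus m β p l t ∈ unitary Mat :=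
  mul_mem (jostMinus_mem_unitary hβ hp hl t) (Unitary.star_mem (timeMonodromy_mem_unitary hβ hp hl))

lemma jostPlus_mul_timeMonodromy (hβ : β ≠ 0) (hp : IsPhasePoint β Qm Qp p) (hl : l ≠ 0) (t : ℝ) :
    jostPlus m β p l t * timeMonodromy m β p l = jostMinus m β p l t := by
  rw [jostPlus, mul_assoc, (Unitary.mem_iff.1 (timeMonodromy_mem_unitary hβ hp hl)).1, mul_one]

lemma hasDerivAt_jostPlus (hβ : β ≠ 0) (hp : IsPhasePoint β Qm Qp p) (hl : l ≠ 0) (t : ℝ) :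
    HasDerivAt (jostPlus m β p l) (potential m β p l t * jostPlus m β p l t) t := by
  have := ((isJost_jostMinus (m := m) hβ hp hl).deriv t).mul_const (star (timeMonodromy m β p l))
  rwa [mul_assoc] at this

lemma tendsto_jostPlus (hβ : β ≠ 0) (hp : IsPhasePoint β Qm Qp p) (hl : l ≠ 0) :
    Tendsto (jostPlus m β p l) atTop (𝓝 1) := by
  have := (tendsto_jostMinus_atTop (m := m) hβ hp hl).mul_const (star (timeMonodromy m β p l))
  rwa [(Unitary.mem_iff.1 (timeMonodromy_mem_unitary hβ hp hl)).2] at this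

lemma hasDerivAt_psiPlus (hβ : β ≠ 0) (hp : IsPhasePoint β Qm Qp p) (hl : l ≠ 0) (t : ℝ) :
    HasDerivAt (psiPlus m β p l) (laxV m β p l t * psiPlus m β p l t) t :=
  hasDerivAt_frame_mul hp (hasDerivAt_jostPlus hβ hp hl t)

lemma psiPlus_mem_unitary (hβ : β ≠ 0) (hp : IsPhasePoint β Qm Qp p) (hl : l ≠ 0) (t : ℝ) :
    psiPlus m β p l t ∈ unitary Mat :=
  mul_mem (frame_mem_unitary _ _ _ _ _) (jostPlus_mem_unitary hβ hp hl t)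

/-! ### Lipschitz dependence on the spectral parameter -/

/-- Beyond Lipschitz dependence on l, two refinements matter for the boundary terms of the bracket:
the constants vanish at the end where the solution is normalised, and the approach to `1` still
tends to zero after multiplication by `|t|`, the growth rate of the phases. -/
lemma exists_lipschitz_jost (m : ℝ) (hβ : β ≠ 0) (hp : IsPhasePoint β Qm Qp p) {c : ℝ}
    (hc : 0 < c) : ∃ C, 0 ≤ C ∧ ∀ l ∈ ann c,
      (∀ l' ∈ ann c, ∀ t,
        ‖jostMinus m β p l t - jostMinus m β p l' t‖ ≤
          C * (Real.arctan t + Real.pi / 2) * |l - l'| ∧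
        ‖jostPlus m β p l t - jostPlus m β p l' t‖ ≤
          C * (Real.pi / 2 - Real.arctan t) * |l - l'|) ∧
      (∀ t ≤ 0, |t| * ‖jostMinus m β p l t - 1‖ ≤ C * (Real.arctan t + Real.pi / 2)) ∧
      (∀ t ≥ 0, |t| * ‖jostPlus m β p l t - 1‖ ≤ C * (Real.pi / 2 - Real.arctan t)) := by
  obtain ⟨D, hD, hb⟩ := hp.exists_bound hβ
  have hb : DataBound β D p := hb
  set C₁ := 2 * (|m| / 2 * (c⁻¹ * c⁻¹) + (1 + |m| / 2 * c⁻¹) *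
    (2 * (|m| / 4 * (1 + c⁻¹ * c⁻¹)))) * D with hC₁
  set C₂ := 2 * (1 + |m| / 2 * c⁻¹) * D with hC₂
  have h1 : 0 ≤ C₁ := by positivity
  have h2 : 0 ≤ C₂ := by positivity
  have hcp := hp.continuous_potential m
  refine ⟨C₁ + C₂, by positivity, fun l hl => ⟨fun l' hl' t => ?_, fun t ht => ?_, fun t ht => ?_⟩⟩
  · have hl0 := ne_zero_of_mem_ann hc hl
    have hl0' := ne_zero_of_mem_ann hc hl'
    have hbd : ∀ s, ‖potential m β p l' s - potential m β p l s‖ ≤ C₁ * |l - l'| / (1 + s ^ 2) := by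
      intro s
      rw [norm_sub_rev]
      exact hb.norm_potential_sub_le hc hl hl' s
    have ha := Real.neg_pi_div_two_lt_arctan t
    have ha' := Real.arctan_lt_pi_div_two t
    constructor
    · have hlim := (isJost_jostMinus (m := m) hβ hp hl0).lim.star.mul
        (isJost_jostMinus (m := m) hβ hp hl0').lim
      rw [star_one, one_mul] at hlim
      have := norm_sub_le_integral_Iic (star_potential m β p l)
        (isJost_jostMinus hβ hp hl0).deriv (isJost_jostMinus hβ hp hl0').deriv
        (jostMinus_mem_unitary hβ hp hl0) (jostMinus_mem_unitary hβ hp hl0') (hcp l) (hcp l')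
        hlim
        (integrable_const_div_one_add_sq (C₁ * |l - l'|)).integrableOn (t := t) (fun s _ => hbd s)
      rw [integral_Iic_const_div] at this
      refine this.trans ?_
      have h3 : 0 ≤ C₂ * (Real.arctan t + Real.pi / 2) * |l - l'| :=
        mul_nonneg (mul_nonneg h2 (by linarith)) (abs_nonneg _)
      nlinarith
    · have hlim := (tendsto_jostPlus (m := m) hβ hp hl0).star.mul
        (tendsto_jostPlus (m := m) hβ hp hl0')
      rw [star_one, one_mul] at hlim
      have := norm_sub_le_integral_Ioi (star_potential m β p l)
        (hasDerivAt_jostPlus hβ hp hl0) (hasDerivAt_jostPlus hβ hp hl0')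
        (jostPlus_mem_unitary hβ hp hl0) (jostPlus_mem_unitary hβ hp hl0') (hcp l) (hcp l')
        hlim
        (integrable_const_div_one_add_sq (C₁ * |l - l'|)).integrableOn (t := t) (fun s _ => hbd s)
      rw [integral_Ioi_const_div] at this
      refine this.trans ?_
      have h3 : 0 ≤ C₂ * (Real.pi / 2 - Real.arctan t) * |l - l'| :=
        mul_nonneg (mul_nonneg h2 (by linarith)) (abs_nonneg _)
      nlinarith
  all_goals
    have hl0 := ne_zero_of_mem_ann hc hl
    have ha := Real.neg_pi_div_two_lt_arctan t
    have ha' := Real.arctan_lt_pi_div_two t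
    -- On the ray beyond t one has `|t| ≤ |s| ≤ 1 + s²`, which spends one of the two powers in the
    -- decay of the potential.
    have hkey : ∀ s : ℝ, |t| ≤ |s| → |t| * ‖potential m β p l s‖ ≤ C₂ / (1 + s ^ 2) := by
      intro s hs
      have h3 := hb.norm_potential_le (m := m) hc hl s
      have h4 : |s| ≤ 1 + s ^ 2 := by nlinarith [sq_abs s, sq_nonneg (|s| - 1)]
      calc |t| * ‖potential m β p l s‖ ≤ (1 + s ^ 2) * (2 * (1 + |m| / 2 * c⁻¹) * (D / (1 + s ^ 2) ^ 2)) :=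
            mul_le_mul (hs.trans h4) h3 (norm_nonneg _) (by positivity)
        _ = C₂ / (1 + s ^ 2) := by
          rw [hC₂]
          have : (0:ℝ) < 1 + s ^ 2 := by positivity
          field_simp
    rcases eq_or_ne t 0 with rfl | ht0
    · simp only [abs_zero, zero_mul]
      exact mul_nonneg (by positivity) (by linarith)
    have htp := abs_pos.2 ht0
    -- The comparison is with the constant solution `1` of the system with zero potential.
    have hone : ∀ s : ℝ, HasDerivAt (fun _ : ℝ => (1 : Mat)) ((0 : ℝ → Mat) s * 1) s := fun s => by
      simpa using hasDerivAt_const s (1 : Mat)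
    have hkey' : ∀ s : ℝ, |t| ≤ |s| → ‖potential m β p l s - (0 : ℝ → Mat) s‖ ≤
        C₂ / |t| / (1 + s ^ 2) := by
      intro s hs
      rw [div_right_comm, le_div_iff₀ htp, mul_comm]
      simpa using hkey s hs
  · have := norm_sub_le_integral_Iic (w₁ := 0) (G₁ := fun _ => 1) (by simp) hone
      (isJost_jostMinus hβ hp hl0).deriv (fun _ => one_mem _) (jostMinus_mem_unitary hβ hp hl0)
      continuous_zero (hcp l) (by simpa using (isJost_jostMinus (m := m) hβ hp hl0).lim)
      (integrable_const_div_one_add_sq (C₂ / |t|)).integrableOn (t := t)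
      (fun s hs => hkey' s (by rw [abs_of_nonpos ht, abs_of_nonpos (hs.trans ht)]; linarith))
    rw [integral_Iic_const_div, norm_sub_rev] at this
    have h3 := mul_le_mul_of_nonneg_left this htp.le
    have h4 : |t| * (C₂ / |t| * (Real.arctan t + Real.pi / 2)) =
      C₂ * (Real.arctan t + Real.pi / 2) := by field_simp
    have h5 : 0 ≤ C₁ * (Real.arctan t + Real.pi / 2) := mul_nonneg h1 (by linarith)
    linarith
  · have := norm_sub_le_integral_Ioi (w₁ := 0) (G₁ := fun _ => 1) (by simp) hone
      (hasDerivAt_jostPlus hβ hp hl0) (fun _ => one_mem _) (jostPlus_mem_unitary hβ hp hl0)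
      continuous_zero (hcp l) (by simpa using (tendsto_jostPlus (m := m) hβ hp hl0))
      (integrable_const_div_one_add_sq (C₂ / |t|)).integrableOn (t := t)
      (fun s hs => hkey' s (by rw [abs_of_nonneg ht, abs_of_nonneg (le_trans ht hs.le)]; exact hs.le))
    rw [integral_Ioi_const_div, norm_sub_rev] at this
    have h3 := mul_le_mul_of_nonneg_left this htp.le
    have h4 : |t| * (C₂ / |t| * (Real.pi / 2 - Real.arctan t)) =
      C₂ * (Real.pi / 2 - Real.arctan t) := by field_simp
    have h5 : 0 ≤ C₁ * (Real.pi / 2 - Real.arctan t) := mul_nonneg h1 (by linarith)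
    linarith

lemma exists_lipschitz_timeMonodromy (m : ℝ) (hβ : β ≠ 0) (hp : IsPhasePoint β Qm Qp p) {c : ℝ}
    (hc : 0 < c) : ∃ C, 0 ≤ C ∧ ∀ l ∈ ann c, ∀ l' ∈ ann c,
      ‖timeMonodromy m β p l - timeMonodromy m β p l'‖ ≤ C * |l - l'| := by
  obtain ⟨C, hC, h⟩ := exists_lipschitz_jost m hβ hp hc
  refine ⟨C * Real.pi, by positivity, fun l hl l' hl' => ?_⟩
  have hlim := ((tendsto_jostMinus_atTop (m := m) hβ hp (ne_zero_of_mem_ann hc hl)).sub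
    (tendsto_jostMinus_atTop (m := m) hβ hp (ne_zero_of_mem_ann hc hl'))).norm
  refine le_of_tendsto hlim (Eventually.of_forall fun t => ?_)
  refine (((h l hl).1 l' hl' t).1).trans ?_
  have ha' := Real.arctan_lt_pi_div_two t
  gcongr
  linarith

end package

/-! ### Matching at the defect -/

/-- The Bäcklund matrix in the interaction picture; `f` is `β (φ + φ') / 2`. -/
def defectMatrix (m σ : ℝ) (f : ℝ → ℝ) (l t : ℝ) : Mat :=
  !![1 - Complex.I * σ / l * ((Real.cos (f t) : ℝ) : ℂ),
    Complex.I * σ / l * ((Real.sin (f t) : ℝ) : ℂ) *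
      Complex.exp (2 * Complex.I * ((k0 m l * t : ℝ) : ℂ));
    Complex.I * σ / l * ((Real.sin (f t) : ℝ) : ℂ) *
      Complex.exp (-(2 * Complex.I * ((k0 m l * t : ℝ) : ℂ))),
    1 + Complex.I * σ / l * ((Real.cos (f t) : ℝ) : ℂ)]

lemma hasDerivAt_defectMatrix_aux (m σ l t f' : ℝ) (f : ℝ → ℝ) (hf : HasDerivAt f f' t) :
    HasDerivAt (defectMatrix m σ f l)
      !![Complex.I * σ / l * (Real.sin (f t) * f'),
        (Complex.I * σ / l * (Real.cos (f t) * f' + Real.sin (f t) * (2 * Complex.I * k0 m l))) *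
          Complex.exp (2 * Complex.I * ((k0 m l * t : ℝ) : ℂ));
        (Complex.I * σ / l * (Real.cos (f t) * f' - Real.sin (f t) * (2 * Complex.I * k0 m l))) *
          Complex.exp (-(2 * Complex.I * ((k0 m l * t : ℝ) : ℂ))),
        -(Complex.I * σ / l * (Real.sin (f t) * f'))] t := by
  have hs := hf.sin.ofReal_comp
  have hc := hf.cos.ofReal_comp
  have hk : HasDerivAt (fun t : ℝ => 2 * Complex.I * ((k0 m l * t : ℝ) : ℂ))
      (2 * Complex.I * k0 m l) t := by
    have := (((hasDerivAt_id t).const_mul (k0 m l)).ofReal_comp).const_mul (2 * Complex.I)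
    exact this.congr_deriv (by simp)
  have he := hk.cexp
  have hen := hk.fun_neg.cexp
  refine hasDerivAt_pi.2 fun i => hasDerivAt_pi.2 fun j => ?_
  fin_cases i <;> fin_cases j
  · refine ((hc.const_mul (Complex.I * σ / l)).const_sub 1).congr_deriv ?_
    push_cast
    simp
  · refine ((hs.const_mul (Complex.I * σ / l)).mul he).congr_deriv ?_
    push_cast
    simp
    ring
  · refine ((hs.const_mul (Complex.I * σ / l)).mul hen).congr_deriv ?_
    push_cast
    simp
    ring
  · refine ((hc.const_mul (Complex.I * σ / l)).const_add 1).congr_deriv ?_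
    push_cast
    simp

section matching

variable {m β σ : ℝ} {Qm' Qp' Qm Qp : ℤ} {φ' P' φ P : ℝ → ℝ → ℝ}

/-- The Bäcklund transformation as a gauge transformation: S' = ŴS - SŴ'. With x, y the halved
angles of φ, φ' and q, q' the combinations β(Π - φ_t)/4, the defect conditions enter only through
their sum and their difference. -/
lemma IsDefectSolution.hasDerivAt_defectMatrix (hβ : β ≠ 0) (hσ : σ ≠ 0)
    (h : IsDefectSolution m β σ Qm' Qp' Qm Qp φ' P' φ P) {l : ℝ} (hl : l ≠ 0) (t : ℝ) :
    HasDerivAt (defectMatrix m σ (fun t => β * φ 0 t / 2 + β * φ' 0 t / 2) l)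
      (potential m β (φ 0, P 0) l t *
          defectMatrix m σ (fun t => β * φ 0 t / 2 + β * φ' 0 t / 2) l t -
        defectMatrix m σ (fun t => β * φ 0 t / 2 + β * φ' 0 t / 2) l t *
          potential m β (φ' 0, P' 0) l t) t := by
  have d := ((h.right.phase 0 (by simp)).differentiable t).hasDerivAt
  have d' := ((h.left.phase 0 (by simp)).differentiable t).hasDerivAt
  simp only at d d'
  have hf : HasDerivAt (fun t => β * φ 0 t / 2 + β * φ' 0 t / 2)
      (β * deriv (φ 0) t / 2 + β * deriv (φ' 0) t / 2) t :=
    ((d.const_mul β).div_const 2).add ((d'.const_mul β).div_const 2)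
  refine (hasDerivAt_defectMatrix_aux m σ l t _ _ hf).congr_deriv ?_
  have D1 := h.defect1 t
  have D2 := h.defect2 t
  rw [show β * ((φ' 0 t + φ 0 t) / 2) = β * φ 0 t / 2 + β * φ' 0 t / 2 by ring,
    show β * ((φ' 0 t - φ 0 t) / 2) = -(β * φ 0 t / 2 - β * φ' 0 t / 2) by ring,
    Real.sin_neg] at D1 D2
  set x := β * φ 0 t / 2
  set y := β * φ' 0 t / 2
  set q := β / 4 * (P 0 t - deriv (φ 0) t) with hq
  set q' := β / 4 * (P' 0 t - deriv (φ' 0) t) with hq'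
  set a := β * deriv (φ 0) t / 2 + β * deriv (φ' 0) t / 2 with ha
  -- The sum of the defect conditions fixes q - q'; their difference, in `h2`, fixes q + q' and the
  -- rate of change of the angle x + y.
  have h1 : q - q' = m / 2 * σ * Real.sin (x + y) := by
    have e : q - q' = β / 4 * ((-P' 0 t - deriv (φ 0) t) + (deriv (φ' 0) t - -P 0 t)) := by
      rw [hq, hq']; ring
    rw [e, D1, D2]; field_simp; ring
  have h2 : σ * (a + q + q') = m / 2 * Real.sin (x - y) := by
    have e : a + q + q' = β / 4 * ((deriv (φ' 0) t - -P 0 t) - (-P' 0 t - deriv (φ 0) t)) := by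
      rw [ha, hq, hq']; ring
    rw [e, D1, D2]; field_simp; ring
  have s1 := Real.sin_sq_add_cos_sq x
  have s2 := Real.sin_sq_add_cos_sq y
  have T1 : Real.sin x ^ 2 - Real.sin y ^ 2 = Real.sin (x + y) * Real.sin (x - y) := by
    rw [Real.sin_add, Real.sin_sub]
    linear_combination Real.sin y ^ 2 * s1 - Real.sin x ^ 2 * s2
  have T2 : Real.sin x * Real.cos x - Real.sin y * Real.cos y =
      Real.cos (x + y) * Real.sin (x - y) := by
    rw [Real.cos_add, Real.sin_sub]
    linear_combination -Real.sin x * Real.cos x * s2 + Real.sin y * Real.cos y * s1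
  have T3 : Real.sin x * Real.cos x + Real.sin y * Real.cos y =
      Real.sin (x + y) * Real.cos (x - y) := by
    rw [Real.sin_add, Real.cos_sub]
    linear_combination -Real.sin x * Real.cos x * s2 - Real.sin y * Real.cos y * s1
  have T4 : Real.sin x ^ 2 + Real.sin y ^ 2 = 1 - Real.cos (x + y) * Real.cos (x - y) := by
    rw [Real.cos_add, Real.cos_sub]
    linear_combination (1 - Real.sin y ^ 2) * s1 + Real.cos x ^ 2 * s2
  have hk : ((k0 m l : ℝ) : ℂ) = m / 4 * (l + 1 / l) := by simp [k0]
  have hl' : (l : ℂ) ≠ 0 := by exact_mod_cast hl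
  have h1c : (q : ℂ) - q' = m / 2 * σ * Real.sin (x + y) := by exact_mod_cast h1
  have h2c : (σ : ℂ) * (a + q + q') = m / 2 * Real.sin (x - y) := by exact_mod_cast h2
  have T1c : ((Real.sin x : ℝ) : ℂ) ^ 2 - (Real.sin y : ℝ) ^ 2 =
    (Real.sin (x + y) : ℝ) * (Real.sin (x - y) : ℝ) := by exact_mod_cast T1
  have T2c : ((Real.sin x : ℝ) : ℂ) * (Real.cos x : ℝ) - (Real.sin y : ℝ) * (Real.cos y : ℝ) =
    (Real.cos (x + y) : ℝ) * (Real.sin (x - y) : ℝ) := by exact_mod_cast T2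
  have T3c : ((Real.sin x : ℝ) : ℂ) * (Real.cos x : ℝ) + (Real.sin y : ℝ) * (Real.cos y : ℝ) =
    (Real.sin (x + y) : ℝ) * (Real.cos (x - y) : ℝ) := by exact_mod_cast T3
  have T4c : ((Real.sin x : ℝ) : ℂ) ^ 2 + (Real.sin y : ℝ) ^ 2 =
    1 - (Real.cos (x + y) : ℝ) * (Real.cos (x - y) : ℝ) := by exact_mod_cast T4
  have hee : Complex.exp (2 * Complex.I * ((k0 m l * t : ℝ) : ℂ)) *
      Complex.exp (-(2 * Complex.I * ((k0 m l * t : ℝ) : ℂ))) = 1 := by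
    rw [← Complex.exp_add]; simp
  simp only [defectMatrix, potential]
  change _ = !![Complex.I * ((m / (2 * l) * Real.sin x ^ 2 : ℝ) : ℂ), (-(q : ℂ) + Complex.I *
      ((m / (2 * l) * (Real.sin x * Real.cos x) : ℝ) : ℂ)) * _;
    ((q : ℂ) + Complex.I * ((m / (2 * l) * (Real.sin x * Real.cos x) : ℝ) : ℂ)) * _,
    -(Complex.I * ((m / (2 * l) * Real.sin x ^ 2 : ℝ) : ℂ))] * _ -
    _ * !![Complex.I * ((m / (2 * l) * Real.sin y ^ 2 : ℝ) : ℂ), (-(q' : ℂ) + Complex.I *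
      ((m / (2 * l) * (Real.sin y * Real.cos y) : ℝ) : ℂ)) * _;
    ((q' : ℂ) + Complex.I * ((m / (2 * l) * (Real.sin y * Real.cos y) : ℝ) : ℂ)) * _,
    -(Complex.I * ((m / (2 * l) * Real.sin y ^ 2 : ℝ) : ℂ))]
  rw [hk]
  -- All transcendental quantities become symbols, tied together only by the relations just
  -- collected; each matrix entry is then a linear combination of these.
  generalize Complex.exp (2 * Complex.I * ((k0 m l * t : ℝ) : ℂ)) = e at *
  generalize Complex.exp (-(2 * Complex.I * ((k0 m l * t : ℝ) : ℂ))) = e' at *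
  simp only [Complex.ofReal_mul, Complex.ofReal_div, Complex.ofReal_pow, Complex.ofReal_ofNat] at *
  generalize ((Real.sin x : ℝ) : ℂ) = sx at *
  generalize ((Real.sin y : ℝ) : ℂ) = sy at *
  generalize ((Real.cos x : ℝ) : ℂ) = cx at *
  generalize ((Real.cos y : ℝ) : ℂ) = cy at *
  generalize ((Real.sin (x + y) : ℝ) : ℂ) = A at *
  generalize ((Real.cos (x + y) : ℝ) : ℂ) = K at *
  generalize ((Real.sin (x - y) : ℝ) : ℂ) = D at *
  generalize ((Real.cos (x - y) : ℝ) : ℂ) = E at *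
  generalize (q : ℂ) = q at *
  generalize (q' : ℂ) = q' at *
  generalize (a : ℂ) = a at *
  generalize (m : ℂ) = m at *
  generalize (σ : ℂ) = σ at *
  generalize (l : ℂ) = l at *
  have hI := Complex.I_sq
  generalize Complex.I = I at *
  ext i j; fin_cases i <;> fin_cases j <;> simp
  · linear_combination (norm := (field_simp; ring)) (I / l * A) * h2c
      + I * σ / l * A * (q + q' - I * (m / (2 * l)) * (sx * cx - sy * cy)) * hee
      - I * (m / (2 * l)) * (1 - I * σ / l * K) * T1c - I * σ / l * A * I * (m / (2 * l)) * T2c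
  · linear_combination (norm := (field_simp; ring)) e * (I / l * K * h2c + h1c
      - I * (m / (2 * l)) * T2c - I ^ 2 * (m / (2 * l)) * σ / l * A * T4c
      - I ^ 2 * (m / (2 * l)) * σ / l * K * T3c + m / 2 * σ * A * hI)
  · linear_combination (norm := (field_simp; ring)) e' * (I / l * K * h2c - h1c
      - I * (m / (2 * l)) * T2c + I ^ 2 * (m / (2 * l)) * σ / l * A * T4c
      + I ^ 2 * (m / (2 * l)) * σ / l * K * T3c - m / 2 * σ * A * hI)
  · linear_combination (norm := (field_simp; ring)) -(I / l * A) * h2c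
      - I * σ / l * A * (q + q' + I * (m / (2 * l)) * (sx * cx - sy * cy)) * hee
      + I * (m / (2 * l)) * (1 + I * σ / l * K) * T1c - I * σ / l * A * I * (m / (2 * l)) * T2c

/-- The limit of the Bäcklund matrix, up to a scalar the matrix `matB`. -/
def defectLimit (σ : ℝ) (Q' Q : ℤ) (l : ℝ) : Mat :=
  1 - (Complex.I * σ / l * (-1 : ℂ) ^ (Q' + Q)) • pauli3

/-- At an integer multiple of π the sine kills the off-diagonal entries, however fast their phases
rotate, and the cosine becomes a sign. -/
lemma tendsto_defectMatrix {F : Filter ℝ} {f : ℝ → ℝ} {Q' Q : ℤ}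
    (hf : Tendsto f F (𝓝 (((Q' + Q : ℤ) : ℝ) * Real.pi))) (l : ℝ) :
    Tendsto (defectMatrix m σ f l) F (𝓝 (defectLimit σ Q' Q l)) := by
  have hs : Tendsto (fun t => ((Real.sin (f t) : ℝ) : ℂ)) F (𝓝 0) := by
    have := (Real.continuous_sin.tendsto _).comp hf
    rw [Real.sin_int_mul_pi] at this
    exact_mod_cast (Complex.continuous_ofReal.tendsto 0).comp this
  have hc : Tendsto (fun t => ((Real.cos (f t) : ℝ) : ℂ)) F (𝓝 ((-1 : ℂ) ^ (Q' + Q))) := by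
    have := (Real.continuous_cos.tendsto _).comp hf
    rw [Real.cos_int_mul_pi] at this
    have h2 := (Complex.continuous_ofReal.tendsto _).comp this
    simpa [Function.comp_def] using h2
  have hz : ∀ g : ℝ → ℂ, (∀ t, ‖g t‖ = 1) →
      Tendsto (fun t => Complex.I * σ / l * ((Real.sin (f t) : ℝ) : ℂ) * g t) F (𝓝 0) := by
    intro g hg
    have := (hs.const_mul (Complex.I * σ / l)).norm
    simp only [mul_zero, norm_zero] at this
    refine squeeze_zero_norm (fun t => ?_) this
    rw [norm_mul _ (g t), hg, mul_one]
  refine tendsto_pi_nhds.2 fun i => tendsto_pi_nhds.2 fun j => ?_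
  fin_cases i <;> fin_cases j
  · simpa [defectMatrix, defectLimit, pauli3] using (hc.const_mul (Complex.I * σ / l)).const_sub 1
  · simpa [defectMatrix, defectLimit, pauli3] using hz _ (fun t => norm_exp_two_I (k0 m l * t))
  · simpa [defectMatrix, defectLimit, pauli3] using hz _ (fun t => norm_exp_neg_two_I (k0 m l * t))
  · simpa [defectMatrix, defectLimit, pauli3] using (hc.const_mul (Complex.I * σ / l)).const_add 1

/-- The determinant is `1 + (σ / l) ^ 2`, positive for real parameters; at `l = 0` the convention
for division makes it `1`. -/
lemma det_defectLimit_ne_zero (l : ℝ) (Q' Q : ℤ) :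
    (defectLimit σ Q' Q l).det ≠ 0 := by
  have h1 : ((-1 : ℂ) ^ (Q' + Q)) * (-1 : ℂ) ^ (Q' + Q) = 1 := by
    rw [← mul_zpow]; simp
  have h2 : (defectLimit σ Q' Q l).det = ((1 + (σ / l) ^ 2 : ℝ) : ℂ) := by
    simp [defectLimit, pauli3, Matrix.det_fin_two]
    linear_combination (-(Complex.I * σ / l) ^ 2) * h1 - (σ / l) ^ 2 * Complex.I_sq
  rw [h2]
  have : (0:ℝ) < 1 + (σ / l) ^ 2 := by positivity
  exact_mod_cast this.ne'

/-- The scalar prefactor of B₊ cancels against that of the inverse of B₋. -/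
lemma leftMonodromy_eq (Qm' Qp' Qm Qp : ℤ) (p : Phase) {l : ℝ} (hl : l ≠ 0) :
    leftMonodromy m β σ Qm' Qp' Qm Qp p l =
      defectLimit σ Qp' Qp l * timeMonodromy m β p l * (defectLimit σ Qm' Qm l)⁻¹ := by
  have hl' : (l : ℂ) ≠ 0 := by exact_mod_cast hl
  have h0 : (l : ℂ) + Complex.I * σ ≠ 0 := fun h => by
    have := congrArg Complex.re h
    simp at this
    exact hl this
  have hk : ((l : ℂ) / (l + Complex.I * σ)) ≠ 0 := div_ne_zero hl' h0
  change (_ • defectLimit σ Qp' Qp l) * _ * (_ • defectLimit σ Qm' Qm l)⁻¹ = _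
  have hinv : (((l : ℂ) / (l + Complex.I * σ)) • defectLimit σ Qm' Qm l)⁻¹ =
      ((l : ℂ) / (l + Complex.I * σ))⁻¹ • (defectLimit σ Qm' Qm l)⁻¹ := by
    refine Matrix.inv_eq_left_inv ?_
    rw [smul_mul_smul_comm, inv_mul_cancel₀ hk, one_smul,
      Matrix.nonsing_inv_mul _ (isUnit_iff_ne_zero.2 (det_defectLimit_ne_zero l _ _))]
  rw [hinv, smul_mul_assoc, smul_mul_smul_comm, mul_inv_cancel₀ hk, one_smul]

lemma RapidLimit.tendsto_self {f : ℝ → ℝ} {F : Filter ℝ} {c : ℝ} (h : RapidLimit f F c) :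
    Tendsto f F (𝓝 c) := by
  have := (h.tendsto 0).add_const c
  simpa using this

/-- The product J* S J' of the Jost solutions of the two sides with the Bäcklund matrix is constant
in t. Its limit is B₋ at -∞ and T* B₊ T' at +∞, up to the common scalar, and T is unitary. -/
theorem IsDefectSolution.leftMonodromy_eq_timeMonodromy (hβ : β ≠ 0) (hσ : σ ≠ 0)
    (h : IsDefectSolution m β σ Qm' Qp' Qm Qp φ' P' φ P) {l : ℝ} (hl : l ≠ 0) :
    leftMonodromy m β σ Qm' Qp' Qm Qp (φ' 0, P' 0) l = timeMonodromy m β (φ 0, P 0) l := by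
  have hp := h.right.phase 0 (by simp)
  have hp' := h.left.phase 0 (by simp)
  set S := defectMatrix m σ (fun t => β * φ 0 t / 2 + β * φ' 0 t / 2) l with hS
  have hlim : ∀ (F : Filter ℝ) (Q' Q : ℤ), RapidLimit (φ' 0) F (2 * Real.pi * Q' / β) →
      RapidLimit (φ 0) F (2 * Real.pi * Q / β) → Tendsto S F (𝓝 (defectLimit σ Q' Q l)) := by
    intro F Q' Q h1 h2
    refine tendsto_defectMatrix ?_ l
    have := ((h2.tendsto_self.const_mul β).div_const 2).add
      ((h1.tendsto_self.const_mul β).div_const 2)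
    convert this using 2
    push_cast
    field_simp
    ring
  have hJ := isJost_jostMinus (m := m) hβ hp hl
  have hJ' := isJost_jostMinus (m := m) hβ hp' hl
  have hd : ∀ t, HasDerivAt (fun t => star (jostMinus m β (φ 0, P 0) l t) * S t *
      jostMinus m β (φ' 0, P' 0) l t) 0 t := by
    intro t
    refine (((hJ.deriv t).star.mul (h.hasDerivAt_defectMatrix hβ hσ hl t)).mul
      (hJ'.deriv t)).congr_deriv ?_
    rw [star_mul, star_potential, Pi.mul_apply]
    noncomm_ring
  have hc := is_const_of_deriv_eq_zero (fun t => (hd t).differentiableAt) (fun t => (hd t).deriv)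
  have hbot := (hJ.lim.star.mul (hlim atBot Qm' Qm hp'.fst_atBot hp.fst_atBot)).mul hJ'.lim
  have htop := ((tendsto_jostMinus_atTop (m := m) hβ hp hl).star.mul
    (hlim atTop Qp' Qp hp'.fst_atTop hp.fst_atTop)).mul (tendsto_jostMinus_atTop (m := m) hβ hp' hl)
  rw [star_one, one_mul, mul_one] at hbot
  have e1 := tendsto_nhds_unique hbot (tendsto_const_nhds.congr fun s => hc 0 s)
  have e2 := tendsto_nhds_unique htop (tendsto_const_nhds.congr fun s => hc 0 s)
  have e := e2.trans e1.symm
  have hM := Unitary.mem_iff.1 (timeMonodromy_mem_unitary (m := m) hβ hp hl)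
  have e3 : defectLimit σ Qp' Qp l * timeMonodromy m β (φ' 0, P' 0) l =
      timeMonodromy m β (φ 0, P 0) l * defectLimit σ Qm' Qm l := by
    rw [← e, ← mul_assoc, ← mul_assoc, hM.2, one_mul]
  rw [leftMonodromy_eq _ _ _ _ _ hl, e3, mul_assoc,
    Matrix.mul_nonsing_inv _ (isUnit_iff_ne_zero.2 (det_defectLimit_ne_zero l _ _)), mul_one]

end matching

/-! ### Oscillatory integrals -/

lemma norm_expI (x : ℝ) : ‖Complex.exp (Complex.I * x)‖ = 1 := by
  rw [mul_comm, Complex.norm_exp_ofReal_mul_I]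

/-- The Riemann–Lebesgue lemma with linear phase. -/
lemma tendsto_integral_mul_expI (h : ℝ → ℂ) :
    Tendsto (fun R : ℝ => ∫ y, h y * Complex.exp (Complex.I * ((R * y : ℝ) : ℂ)))
      (cocompact ℝ) (𝓝 0) := by
  have h1 := Real.tendsto_integral_exp_smul_cocompact h
  have h2 : Tendsto (fun R : ℝ => -(2 * Real.pi)⁻¹ * R) (cocompact ℝ) (cocompact ℝ) :=
    tendsto_cocompact_mul_left₀ (by simp [Real.pi_ne_zero])
  refine (h1.comp h2).congr fun R => ?_
  refine integral_congr_ae (Eventually.of_forall fun y => ?_)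
  simp only [Circle.smul_def, smul_eq_mul, Real.fourierChar_apply]
  rw [mul_comm]
  congr 2
  push_cast
  have : (Real.pi : ℂ) ≠ 0 := by exact_mod_cast Real.pi_ne_zero
  field_simp

/-- The Riemann–Lebesgue lemma for a phase which is injective with non-zero derivative on `s`. -/
lemma tendsto_setIntegral_mul_expI {s : Set ℝ} (hs : MeasurableSet s) {f f' : ℝ → ℝ}
    (hf : ∀ x ∈ s, HasDerivAt f (f' x) x) (hf0 : ∀ x ∈ s, f' x ≠ 0) (hinj : InjOn f s)
    (h : ℝ → ℂ) :
    Tendsto (fun R : ℝ => ∫ x in s, h x * Complex.exp (Complex.I * ((R * f x : ℝ) : ℂ)))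
      (cocompact ℝ) (𝓝 0) := by
  -- Taking f(x) as the new variable makes the phase linear; the Jacobian is absorbed in the
  -- amplitude.
  set g := Function.invFunOn f s
  have hg : ∀ x ∈ s, g (f x) = x := fun x hx => hinj.leftInvOn_invFunOn hx
  set H : ℝ → ℂ := (f '' s).indicator fun y => |f' (g y)|⁻¹ • h (g y) with hH
  have hcont : ContinuousOn f s := fun x hx => (hf x hx).continuousAt.continuousWithinAt
  have hms : MeasurableSet (f '' s) := hs.image_of_continuousOn_injOn hcont hinj
  refine (tendsto_integral_mul_expI H).congr fun R => ?_
  have e1 : (fun y => H y * Complex.exp (Complex.I * ((R * y : ℝ) : ℂ))) = (f '' s).indicator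
      fun y => (|f' (g y)|⁻¹ • h (g y)) * Complex.exp (Complex.I * ((R * y : ℝ) : ℂ)) := by
    funext y
    rw [hH, indicator_mul_left]
  rw [e1, integral_indicator hms, integral_image_eq_integral_abs_deriv_smul hs
    (fun x hx => (hf x hx).hasDerivWithinAt) hinj]
  refine setIntegral_congr_fun hs fun x hx => ?_
  rw [hg x hx, smul_mul_assoc, smul_smul, mul_inv_cancel₀ (abs_ne_zero.2 (hf0 x hx)), one_smul]

lemma hasDerivAt_k0 (m : ℝ) {l : ℝ} (hl : l ≠ 0) :
    HasDerivAt (k0 m) (m / 4 * (1 - (l ^ 2)⁻¹)) l := by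
  have := ((hasDerivAt_id l).add (hasDerivAt_inv hl)).const_mul (m / 4)
  have h2 : k0 m = fun l => m / 4 * (id l + l⁻¹) := by funext l; simp [k0]
  rw [h2]
  exact this.congr_deriv (by ring)

/-- The factorisation shows that k₀(l) = k₀(u) only for l = u or lu = 1. It gives injectivity on
sets containing no reciprocal pair. -/
lemma k0_sub_k0 (m : ℝ) {l u : ℝ} (hl : l ≠ 0) (hu : u ≠ 0) :
    k0 m l - k0 m u = m / 4 * (l - u) * (1 - (l * u)⁻¹) := by
  simp only [k0]; field_simp; ring

lemma k0_injOn {m : ℝ} (hm : 0 < m) {s : Set ℝ} (h0 : ∀ l ∈ s, l ≠ 0)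
    (h1 : ∀ l ∈ s, ∀ u ∈ s, l * u ≠ 1) : InjOn (k0 m) s := by
  intro l hl u hu h
  have h2 := k0_sub_k0 m (h0 l hl) (h0 u hu)
  rw [h, sub_self] at h2
  have h3 : (1 - (l * u)⁻¹) ≠ 0 := fun h3 => h1 l hl u hu (by
    rw [← inv_inv (l * u), ← sub_eq_zero.1 h3, inv_one])
  have h4 : l - u = 0 := by
    by_contra h4
    exact mul_ne_zero (mul_ne_zero (by positivity) h4) h3 h2.symm
  linarith

/-- The Riemann–Lebesgue lemma with phase `k₀`. -/
lemma tendsto_integral_mul_exp_k0 {m : ℝ} (hm : 0 < m) {h : ℝ → ℂ} (hh : Integrable h) :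
    Tendsto (fun R : ℝ => ∫ l, h l * Complex.exp (Complex.I * ((R * k0 m l : ℝ) : ℂ)))
      (cocompact ℝ) (𝓝 0) := by
  -- The critical points ±1 separate the line, up to a null set, into two regions on each of which
  -- no product of two parameters is 1; k₀ is injective and non-critical on each.
  set s₁ : Set ℝ := {l | 1 < |l|}
  set s₂ : Set ℝ := {l | 0 < |l| ∧ |l| < 1}
  have m₁ : MeasurableSet s₁ := measurableSet_lt measurable_const measurable_norm
  have m₂ : MeasurableSet s₂ := (measurableSet_lt measurable_const measurable_norm).inter
    (measurableSet_lt measurable_norm measurable_const)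
  have d₁ : ∀ l ∈ s₁, l ≠ 0 := fun l hl h0 => by
    have : 1 < |l| := hl
    rw [h0, abs_zero] at this; linarith
  have d₂ : ∀ l ∈ s₂, l ≠ 0 := fun l hl => abs_pos.1 hl.1
  have e₁ : ∀ l ∈ s₁, ∀ u ∈ s₁, l * u ≠ 1 := fun l hl u hu h => by
    have h1 : 1 < |l| := hl
    have h2 : 1 < |u| := hu
    have : |l| * |u| = 1 := by rw [← abs_mul, h, abs_one]
    nlinarith
  have e₂ : ∀ l ∈ s₂, ∀ u ∈ s₂, l * u ≠ 1 := fun l hl u hu h => by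
    have : |l| * |u| = 1 := by rw [← abs_mul, h, abs_one]
    nlinarith [hl.1, hl.2, hu.1, hu.2]
  have key : ∀ s : Set ℝ, MeasurableSet s → (∀ l ∈ s, l ≠ 0) → (∀ l ∈ s, ∀ u ∈ s, l * u ≠ 1) →
      Tendsto (fun R : ℝ => ∫ l in s, h l * Complex.exp (Complex.I * ((R * k0 m l : ℝ) : ℂ)))
        (cocompact ℝ) (𝓝 0) := by
    intro s ms d e
    refine tendsto_setIntegral_mul_expI ms (fun l hl => hasDerivAt_k0 m (d l hl)) (fun l hl h0 => ?_)
      (k0_injOn hm d e) h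
    rcases mul_eq_zero.1 h0 with h1 | h1
    · linarith
    · refine e l hl l hl ?_
      rw [← sq, ← inv_inv (l ^ 2), ← sub_eq_zero.1 h1, inv_one]
  have hnull : ∀ᵐ l : ℝ, l ∈ s₁ ∪ s₂ := by
    have : ({0, 1, -1} : Set ℝ).Finite := by simp
    have h0 := this.countable.ae_notMem volume
    filter_upwards [h0] with l hl
    simp only [mem_insert_iff, mem_singleton_iff, not_or] at hl
    rcases lt_trichotomy |l| 1 with h1 | h1 | h1
    · exact Or.inr ⟨abs_pos.2 hl.1, h1⟩
    · rcases eq_or_eq_neg_of_abs_eq h1 with h2 | h2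
      · exact absurd h2 hl.2.1
      · exact absurd h2 hl.2.2
    · exact Or.inl h1
  have hsum := (key s₁ m₁ d₁ e₁).add (key s₂ m₂ d₂ e₂)
  rw [add_zero] at hsum
  refine hsum.congr fun R => ?_
  have hdisj : Disjoint s₁ s₂ := Set.disjoint_left.2 fun l h1 h2 => by
    have : 1 < |l| := h1
    linarith [h2.2]
  have hmeas : Measurable (k0 m) := by unfold k0; fun_prop
  have hi : Integrable fun l => h l * Complex.exp (Complex.I * ((R * k0 m l : ℝ) : ℂ)) := by
    refine hh.mul_bdd (c := 1) ?_ (Eventually.of_forall fun l => (norm_expI _).le)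
    have : Measurable fun l => Complex.exp (Complex.I * ((R * k0 m l : ℝ) : ℂ)) := by fun_prop
    exact this.aestronglyMeasurable
  rw [← setIntegral_union hdisj m₂ hi.integrableOn hi.integrableOn]
  exact setIntegral_eq_integral_of_ae_compl_eq_zero (by
    filter_upwards [hnull] with l hl hl'
    exact absurd hl hl')

lemma measurable_k0 (m : ℝ) : Measurable (k0 m) := by unfold k0; fun_prop

lemma measurable_k1 (m : ℝ) : Measurable (k1 m) := by unfold k1; fun_prop

/-- The Riemann–Lebesgue lemma in two variables, with phase `k₀(l) - k₀(u)`. -/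
lemma tendsto_integral_prod_mul_exp_k0 {m : ℝ} (hm : 0 < m) {h : ℝ × ℝ → ℂ} (hh : Integrable h)
    {κ : ℝ} (hκ : κ ≠ 0) :
    Tendsto (fun R : ℝ => ∫ z, h z *
      Complex.exp (Complex.I * ((κ * R * (k0 m z.1 - k0 m z.2) : ℝ) : ℂ))) atTop (𝓝 0) := by
  have hm0 := measurable_k0 m
  have hi : ∀ R : ℝ, Integrable fun z : ℝ × ℝ => h z *
      Complex.exp (Complex.I * ((κ * R * (k0 m z.1 - k0 m z.2) : ℝ) : ℂ)) := fun R => by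
    refine hh.mul_bdd (c := 1) ?_ (Eventually.of_forall fun l => (norm_expI _).le)
    have : Measurable fun z : ℝ × ℝ =>
      Complex.exp (Complex.I * ((κ * R * (k0 m z.1 - k0 m z.2) : ℝ) : ℂ)) := by fun_prop
    exact this.aestronglyMeasurable
  have e : ∀ R : ℝ, (∫ z, h z *
      Complex.exp (Complex.I * ((κ * R * (k0 m z.1 - k0 m z.2) : ℝ) : ℂ))) =
      ∫ u, ∫ l, h (l, u) * Complex.exp (Complex.I * ((κ * R * (k0 m l - k0 m u) : ℝ) : ℂ)) :=
    fun R => integral_prod_symm _ (hi R)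
  simp only [e]
  rw [show (0 : ℂ) = ∫ _ : ℝ, (0 : ℂ) by simp]
  refine tendsto_integral_filter_of_dominated_convergence (fun u => ∫ l, ‖h (l, u)‖)
    (Eventually.of_forall fun R => ((hi R).swap.integral_prod_left).aestronglyMeasurable)
    (Eventually.of_forall fun R => Eventually.of_forall fun u => ?_) ?_ ?_
  · refine (norm_integral_le_integral_norm _).trans (le_of_eq ?_)
    refine integral_congr_ae (Eventually.of_forall fun l => ?_)
    simp only [norm_mul, norm_expI, mul_one]
  · exact hh.swap.norm.integral_prod_left
  · filter_upwards [hh.swap.prod_right_ae] with u hu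
    have hu' : Integrable fun l => h (l, u) := hu
    have hT : Tendsto (fun R : ℝ => κ * R) atTop (cocompact ℝ) :=
      (tendsto_cocompact_mul_left₀ hκ).comp (tendsto_id.mono_right atTop_le_cocompact)
    have h1 := (tendsto_integral_mul_exp_k0 hm hu').comp hT
    -- For fixed u the phase in u is a unimodular constant, so the one-variable lemma applies to
    -- each slice.
    have h2 : Tendsto (fun R : ℝ =>
        ‖∫ l, h (l, u) * Complex.exp (Complex.I * ((κ * R * k0 m l : ℝ) : ℂ))‖) atTop (𝓝 0) := by
      rw [← norm_zero (E := ℂ)]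
      exact h1.norm
    refine squeeze_zero_norm (fun R => le_of_eq ?_) h2
    rw [← one_mul ‖∫ l, h (l, u) * Complex.exp (Complex.I * ((κ * R * k0 m l : ℝ) : ℂ))‖,
      ← norm_expI (-(κ * R * k0 m u)), ← norm_mul, ← integral_const_mul]
    congr 1
    refine integral_congr_ae (Eventually.of_forall fun l => ?_)
    beta_reduce
    rw [mul_left_comm, ← Complex.exp_add]
    congr 2
    push_cast
    ring

/-! ### The kernel `sin (κ y) / y` -/

lemma abs_sin_mul_div_le (κ y : ℝ) : |Real.sin (κ * y) / y| ≤ |κ| := by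
  rcases eq_or_ne y 0 with rfl | hy
  · simp
  · rw [abs_div, div_le_iff₀ (abs_pos.2 hy), ← abs_mul]
    exact Real.abs_sin_le_abs

lemma integrableOn_exp_neg : IntegrableOn (fun y : ℝ => Real.exp (-y)) (Ioi 0) := by
  simpa using integrableOn_exp_mul_Ioi (a := -1) (by norm_num) 0

lemma integrable_exp_neg_abs : Integrable fun y : ℝ => Real.exp (-|y|) := by
  rw [← integrableOn_univ, ← Iic_union_Ioi (a := (0 : ℝ))]
  refine IntegrableOn.union ?_ ?_
  · refine (integrableOn_exp_Iic 0).congr_fun (fun y hy => ?_) measurableSet_Iic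
    simp only [abs_of_nonpos (mem_Iic.1 hy), neg_neg]
  · refine integrableOn_exp_neg.congr_fun (fun y hy => ?_) measurableSet_Ioi
    simp only [abs_of_pos (mem_Ioi.1 hy)]

lemma integral_exp_neg_mul_cos (κ : ℝ) :
    ∫ y in Ioi (0:ℝ), Real.exp (-y) * Real.cos (κ * y) = 1 / (1 + κ ^ 2) := by
  have hre : ((-1 : ℂ) + κ * Complex.I).re < 0 := by simp
  have h1 := integral_exp_mul_complex_Ioi hre 0
  have h2 := congrArg Complex.re h1
  rw [← RCLike.re_to_complex, ← integral_re (integrableOn_exp_mul_complex_Ioi hre 0)] at h2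
  have e : ∀ y : ℝ, RCLike.re (Complex.exp (((-1 : ℂ) + κ * Complex.I) * y)) =
      Real.exp (-y) * Real.cos (κ * y) := by
    intro y
    rw [RCLike.re_to_complex, Complex.exp_re]
    simp
  simp only [e] at h2
  rw [h2, Complex.div_re]
  simp [Complex.normSq_apply, sq]

/-- Differentiation in κ removes the division by y and leaves a Laplace transform; both sides vanish
at κ = 0. The damping makes this an absolutely convergent substitute for the Dirichlet integral. -/
lemma integral_exp_neg_mul_sin_div (κ : ℝ) :
    ∫ y in Ioi (0:ℝ), Real.exp (-y) * (Real.sin (κ * y) / y) = Real.arctan κ := by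
  have hmeas : ∀ κ : ℝ, Measurable fun y : ℝ => Real.exp (-y) * (Real.sin (κ * y) / y) := by
    intro κ; fun_prop
  have hd : ∀ κ : ℝ, HasDerivAt
      (fun κ => ∫ y in Ioi (0:ℝ), Real.exp (-y) * (Real.sin (κ * y) / y)) (1 / (1 + κ ^ 2)) κ := by
    intro κ
    rw [← integral_exp_neg_mul_cos]
    refine (hasDerivAt_integral_of_dominated_loc_of_deriv_le (s := univ)
      (bound := fun y => Real.exp (-y))
      (F := fun κ y => Real.exp (-y) * (Real.sin (κ * y) / y))
      (F' := fun κ y => Real.exp (-y) * Real.cos (κ * y)) (x₀ := κ) univ_mem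
      (Eventually.of_forall fun κ => (hmeas κ).aestronglyMeasurable) ?_ ?_ ?_
      integrableOn_exp_neg ?_).2
    · refine (integrableOn_exp_neg.mul_const |κ|).mono' (hmeas κ).aestronglyMeasurable
        (Eventually.of_forall fun y => ?_)
      rw [norm_mul, Real.norm_eq_abs, Real.norm_eq_abs, abs_of_pos (Real.exp_pos _)]
      exact mul_le_mul_of_nonneg_left (abs_sin_mul_div_le κ y) (Real.exp_pos _).le
    · exact Continuous.aestronglyMeasurable (by fun_prop)
    · refine Eventually.of_forall fun y x _ => ?_
      rw [norm_mul, Real.norm_eq_abs, Real.norm_eq_abs, abs_of_pos (Real.exp_pos _)]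
      exact mul_le_of_le_one_right (Real.exp_pos _).le (Real.abs_cos_le_one _)
    · refine (ae_restrict_iff' measurableSet_Ioi).2 (Eventually.of_forall fun y hy x _ => ?_)
      have hy0 : y ≠ 0 := (ne_of_gt hy)
      have := ((((hasDerivAt_id x).mul_const y).sin).div_const y).const_mul (Real.exp (-y))
      refine this.congr_deriv ?_
      simp only [id]
      field_simp
  have hz : ∀ κ : ℝ, HasDerivAt (fun κ =>
      (∫ y in Ioi (0:ℝ), Real.exp (-y) * (Real.sin (κ * y) / y)) - Real.arctan κ) 0 κ := fun κ =>
    ((hd κ).sub (Real.hasDerivAt_arctan κ)).congr_deriv (by simp)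
  have hc := is_const_of_deriv_eq_zero (fun κ => (hz κ).differentiableAt)
    (fun κ => (hz κ).deriv) κ 0
  simp at hc
  linarith

lemma integral_exp_neg_abs_mul_sin_div (κ : ℝ) :
    ∫ y : ℝ, Real.exp (-|y|) * (Real.sin (κ * y) / y) = 2 * Real.arctan κ := by
  rw [← integral_exp_neg_mul_sin_div, ← integral_comp_abs
    (f := fun y => Real.exp (-y) * (Real.sin (κ * y) / y))]
  refine integral_congr_ae (Eventually.of_forall fun y => ?_)
  rcases abs_choice y with h | h
  · simp only [h]
  · simp only [h]
    rw [mul_neg, Real.sin_neg, neg_div_neg_eq]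

/-- The difference quotient which remains after subtracting `f(0) exp (-|y|)`. -/
def sincRemainder (f : ℝ → ℂ) (y : ℝ) : ℂ := (f y - f 0 * (Real.exp (-|y|) : ℝ)) * ((1 / y : ℝ) : ℂ)

section sinc

variable {f : ℝ → ℂ} {B Y : ℝ}

/-- Near zero both `f y - f 0` and `f 0 (1 - exp (-|y|))` are of order `|y|`, cancelling the pole;
outside the support of `f` only the exponential tail is left. -/
lemma norm_sincRemainder_le (hY : 0 < Y) (hB : ∀ y, ‖f y‖ ≤ B)
    (hL : ∀ y, ‖f y - f 0‖ ≤ B * |y|) (h0 : ∀ y, Y < |y| → f y = 0) (y : ℝ) :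
    ‖sincRemainder f y‖ ≤ 2 * B * (Icc (-Y) Y).indicator 1 y + B / Y * Real.exp (-|y|) := by
  have hB0 : 0 ≤ B := (norm_nonneg _).trans (hB 0)
  rw [sincRemainder, norm_mul, Complex.norm_real, Real.norm_eq_abs, abs_div, abs_one]
  by_cases hy : |y| ≤ Y
  · rw [indicator_of_mem (show y ∈ Icc (-Y) Y from abs_le.1 hy), Pi.one_apply, mul_one]
    have h3 : 0 ≤ B / Y * Real.exp (-|y|) := by positivity
    rcases eq_or_ne y 0 with rfl | hy0
    · simp; positivity
    have hy1 := abs_pos.2 hy0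
    have h1 : ‖f 0 - f 0 * (Real.exp (-|y|) : ℝ)‖ ≤ B * |y| := by
      rw [← mul_one_sub, norm_mul]
      refine mul_le_mul (hB 0) ?_ (norm_nonneg _) hB0
      rw [← Complex.ofReal_one, ← Complex.ofReal_sub, Complex.norm_real, Real.norm_eq_abs,
        abs_of_nonneg (by simp)]
      linarith [Real.add_one_le_exp (-|y|)]
    have h2 : ‖f y - f 0 * (Real.exp (-|y|) : ℝ)‖ ≤ 2 * B * |y| := by
      have := norm_add_le (f y - f 0) (f 0 - f 0 * (Real.exp (-|y|) : ℝ))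
      rw [sub_add_sub_cancel] at this
      linarith [hL y]
    have h4 : ‖f y - f 0 * (Real.exp (-|y|) : ℝ)‖ * (1 / |y|) ≤ 2 * B := by
      rw [mul_one_div, div_le_iff₀ hy1]; exact h2
    linarith
  · push Not at hy
    rw [indicator_of_notMem (show y ∉ Icc (-Y) Y from fun h => absurd (abs_le.2 h) (not_le.2 hy)), mul_zero, zero_add,
      h0 y hy, zero_sub, norm_neg, norm_mul, Complex.norm_real, Real.norm_eq_abs,
      abs_of_pos (Real.exp_pos _)]
    have : 1 / |y| ≤ 1 / Y := one_div_le_one_div_of_le hY hy.le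
    calc ‖f 0‖ * Real.exp (-|y|) * (1 / |y|) ≤ B * Real.exp (-|y|) * (1 / Y) := by
          gcongr; exact hB 0
      _ = _ := by ring

lemma integrable_sincBound (B Y : ℝ) : Integrable fun y : ℝ =>
    2 * B * (Icc (-Y) Y).indicator (1 : ℝ → ℝ) y + B / Y * Real.exp (-|y|) := by
  refine Integrable.add (Integrable.const_mul ?_ _) (integrable_exp_neg_abs.const_mul _)
  exact (integrable_indicator_iff measurableSet_Icc).2 (integrableOn_const (by simp))

lemma integrable_sincRemainder (hY : 0 < Y) (hf : Measurable f) (hB : ∀ y, ‖f y‖ ≤ B)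
    (hL : ∀ y, ‖f y - f 0‖ ≤ B * |y|) (h0 : ∀ y, Y < |y| → f y = 0) :
    Integrable (sincRemainder f) := by
  refine (integrable_sincBound B Y).mono' ?_
    (Eventually.of_forall (norm_sincRemainder_le hY hB hL h0))
  have : Measurable (sincRemainder f) := by unfold sincRemainder; fun_prop
  exact this.aestronglyMeasurable

lemma integral_mul_sin_div_eq (hY : 0 < Y) (hf : Measurable f) (hB : ∀ y, ‖f y‖ ≤ B)
    (hL : ∀ y, ‖f y - f 0‖ ≤ B * |y|) (h0 : ∀ y, Y < |y| → f y = 0) (κ : ℝ) :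
    ∫ y, f y * ((Real.sin (κ * y) / y : ℝ) : ℂ) =
      (∫ y, sincRemainder f y * ((Real.sin (κ * y) : ℝ) : ℂ)) +
        f 0 * ((2 * Real.arctan κ : ℝ) : ℂ) := by
  have hi := integrable_sincRemainder hY hf hB hL h0
  have hi1 : Integrable fun y => sincRemainder f y * ((Real.sin (κ * y) : ℝ) : ℂ) := by
    refine hi.mul_bdd (c := 1) (Continuous.aestronglyMeasurable (by fun_prop))
      (Eventually.of_forall fun y => ?_)
    rw [Complex.norm_real]; exact Real.abs_sin_le_one _
  have hi2 : Integrable fun y : ℝ => Real.exp (-|y|) * (Real.sin (κ * y) / y) := by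
    have hm : Measurable fun y : ℝ => Real.sin (κ * y) / y := by fun_prop
    exact integrable_exp_neg_abs.mul_bdd (c := |κ|) hm.aestronglyMeasurable
      (Eventually.of_forall fun y => abs_sin_mul_div_le κ y)
  have hi3 : Integrable fun y : ℝ =>
      f 0 * ((Real.exp (-|y|) * (Real.sin (κ * y) / y) : ℝ) : ℂ) :=
    Integrable.const_mul hi2.ofReal _
  rw [← integral_exp_neg_abs_mul_sin_div, ← integral_complex_ofReal, ← integral_const_mul,
    ← integral_add hi1 hi3]
  refine integral_congr_ae (Eventually.of_forall fun y => ?_)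
  simp only [sincRemainder]
  push_cast
  ring

/-- The bound does not depend on κ; it serves as the dominating function when the remaining variable
is integrated. -/
lemma norm_integral_mul_sin_div_le (hY : 0 < Y) (hf : Measurable f) (hB : ∀ y, ‖f y‖ ≤ B)
    (hL : ∀ y, ‖f y - f 0‖ ≤ B * |y|) (h0 : ∀ y, Y < |y| → f y = 0) (κ : ℝ) :
    ‖∫ y, f y * ((Real.sin (κ * y) / y : ℝ) : ℂ)‖ ≤
      (∫ y, (2 * B * (Icc (-Y) Y).indicator (1 : ℝ → ℝ) y + B / Y * Real.exp (-|y|))) +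
        B * Real.pi := by
  rw [integral_mul_sin_div_eq hY hf hB hL h0]
  refine (norm_add_le _ _).trans (add_le_add ?_ ?_)
  · refine norm_integral_le_of_norm_le (integrable_sincBound B Y) (Eventually.of_forall fun y => ?_)
    rw [norm_mul, Complex.norm_real]
    exact (mul_le_of_le_one_right (norm_nonneg _) (Real.abs_sin_le_one _)).trans
      (norm_sincRemainder_le hY hB hL h0 y)
  · rw [norm_mul, Complex.norm_real, Real.norm_eq_abs]
    refine mul_le_mul (hB 0) ?_ (abs_nonneg _) ((norm_nonneg _).trans (hB 0))
    rw [abs_le]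
    constructor <;> linarith [Real.arctan_lt_pi_div_two κ, Real.neg_pi_div_two_lt_arctan κ]

lemma tendsto_integral_mul_sin {h : ℝ → ℂ} (hh : Integrable h) :
    Tendsto (fun κ : ℝ => ∫ y, h y * ((Real.sin (κ * y) : ℝ) : ℂ)) (cocompact ℝ) (𝓝 0) := by
  have h1 := tendsto_integral_mul_expI h
  have h2 : Tendsto (fun κ : ℝ => -κ) (cocompact ℝ) (cocompact ℝ) := by
    simpa using tendsto_cocompact_mul_left₀ (a := (-1 : ℝ)) (by norm_num)
  have h3 := (h1.sub (h1.comp h2)).mul_const (1 / (2 * Complex.I))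
  simp only [sub_zero, zero_mul] at h3
  refine h3.congr fun κ => ?_
  have hi : ∀ κ : ℝ, Integrable fun y => h y * Complex.exp (Complex.I * ((κ * y : ℝ) : ℂ)) :=
    fun κ => hh.mul_bdd (c := 1) (Continuous.aestronglyMeasurable (by fun_prop))
      (Eventually.of_forall fun y => (norm_expI _).le)
  simp only [Function.comp]
  rw [← integral_sub (hi _) (hi _), ← integral_mul_const]
  refine integral_congr_ae (Eventually.of_forall fun y => ?_)
  simp only
  rw [Complex.ofReal_sin, Complex.sin]
  have hI := Complex.I_ne_zero
  have e1 : Complex.I * ((κ * y : ℝ) : ℂ) = ((κ * y : ℝ) : ℂ) * Complex.I := mul_comm _ _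
  have e2 : Complex.I * ((-κ * y : ℝ) : ℂ) = -((κ * y : ℝ) : ℂ) * Complex.I := by push_cast; ring
  rw [e1, e2]
  field_simp
  rw [Complex.I_sq]
  ring

/-- sin(κy)/y converges to π δ: the remainder dies by Riemann–Lebesgue, and the subtracted part is
exactly `f 0` times `2 arctan κ`. -/
lemma tendsto_integral_mul_sin_div (hY : 0 < Y) (hf : Measurable f) (hB : ∀ y, ‖f y‖ ≤ B)
    (hL : ∀ y, ‖f y - f 0‖ ≤ B * |y|) (h0 : ∀ y, Y < |y| → f y = 0) :
    Tendsto (fun κ : ℝ => ∫ y, f y * ((Real.sin (κ * y) / y : ℝ) : ℂ)) atTop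
      (𝓝 (Real.pi * f 0)) := by
  simp only [integral_mul_sin_div_eq hY hf hB hL h0]
  have h1 := (tendsto_integral_mul_sin (integrable_sincRemainder hY hf hB hL h0)).mono_left
    atTop_le_cocompact
  have h2 := (tendsto_nhds_of_tendsto_nhdsWithin Real.tendsto_arctan_atTop).const_mul 2
  have h3 := ((Complex.continuous_ofReal.tendsto _).comp h2).const_mul (f 0)
  have h4 := h1.add h3
  have e : (0 : ℂ) + f 0 * ((2 * (Real.pi / 2) : ℝ) : ℂ) = Real.pi * f 0 := by push_cast; ring
  rw [e] at h4
  exact h4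

lemma tendsto_integral_mul_sin_div_atBot (hY : 0 < Y) (hf : Measurable f) (hB : ∀ y, ‖f y‖ ≤ B)
    (hL : ∀ y, ‖f y - f 0‖ ≤ B * |y|) (h0 : ∀ y, Y < |y| → f y = 0) :
    Tendsto (fun κ : ℝ => ∫ y, f y * ((Real.sin (κ * y) / y : ℝ) : ℂ)) atBot
      (𝓝 (-(Real.pi * f 0))) := by
  have h := ((tendsto_integral_mul_sin_div hY hf hB hL h0).comp tendsto_neg_atBot_atTop).neg
  refine h.congr fun κ => ?_
  simp only [Function.comp]
  rw [← integral_neg]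
  refine integral_congr_ae (Eventually.of_forall fun y => ?_)
  simp only [neg_mul, Real.sin_neg, neg_div]
  push_cast
  ring

end sinc

/-! ### Lipschitz amplitudes supported away from zero and infinity -/

/-- `a` is bounded and Lipschitz with constant `L`, and vanishes off the set `ann c`. -/
structure IsAmp (c L : ℝ) (a : ℝ → ℂ) : Prop where
  pos : 0 < c
  zero : ∀ l ∉ ann c, a l = 0
  bdd : ∀ l, ‖a l‖ ≤ L
  lip : ∀ l l', ‖a l - a l'‖ ≤ L * |l - l'|

namespace IsAmp

variable {c L : ℝ} {a b : ℝ → ℂ}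

lemma nonneg (ha : IsAmp c L a) : 0 ≤ L := (norm_nonneg _).trans (ha.bdd 0)

lemma continuous (ha : IsAmp c L a) : Continuous a := by
  have : LipschitzWith L.toNNReal a := LipschitzWith.of_dist_le_mul fun x y => by
    rw [dist_eq_norm, Real.dist_eq, Real.coe_toNNReal _ ha.nonneg]; exact ha.lip x y
  exact this.continuous

lemma measurable (ha : IsAmp c L a) : Measurable a := ha.continuous.measurable

lemma mem (ha : IsAmp c L a) {l : ℝ} (h : a l ≠ 0) : l ∈ ann c := by
  by_contra hl; exact h (ha.zero l hl)

lemma map_zero (ha : IsAmp c L a) : a 0 = 0 :=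
  ha.zero 0 fun h => by simpa using (ha.pos.trans_le h.1)

lemma mono {c' L' : ℝ} (ha : IsAmp c L a) (hc' : 0 < c') (hc : c' ≤ c) (hL : L ≤ L') :
    IsAmp c' L' a where
  pos := hc'
  zero l hl := ha.zero l fun h => hl ⟨hc.trans h.1, h.2.trans (inv_anti₀ hc' hc)⟩
  bdd l := (ha.bdd l).trans hL
  lip l l' := (ha.lip l l').trans (mul_le_mul_of_nonneg_right hL (abs_nonneg _))

/-- The factor `g` need be controlled only on the annulus: if one of the two points lies outside,
the amplitude vanishes there, and its Lipschitz bound alone gives the estimate. -/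
lemma mul (ha : IsAmp c L a) {g : ℝ → ℂ} {B : ℝ} (hg : ∀ l ∈ ann c, ‖g l‖ ≤ B)
    (hL : ∀ l ∈ ann c, ∀ l' ∈ ann c, ‖g l - g l'‖ ≤ B * |l - l'|) (hB : 0 ≤ B) :
    IsAmp c (2 * L * B) (fun l => a l * g l) where
  pos := ha.pos
  zero l hl := by simp [ha.zero l hl]
  bdd l := by
    have hL0 := ha.nonneg
    by_cases hl : l ∈ ann c
    · rw [norm_mul]
      have := mul_le_mul (ha.bdd l) (hg l hl) (norm_nonneg _) hL0
      nlinarith [mul_nonneg hL0 hB]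
    · simp [ha.zero l hl]; positivity
  lip l l' := by
    have hL0 := ha.nonneg
    have key : ∀ x y : ℝ, x ∈ ann c → y ∉ ann c → ‖a x * g x - a y * g y‖ ≤
        2 * L * B * |x - y| := fun x y hx hy => by
      have h1 := ha.lip x y
      rw [ha.zero y hy, sub_zero] at h1
      rw [ha.zero y hy, zero_mul, sub_zero, norm_mul]
      have := mul_le_mul h1 (hg x hx) (norm_nonneg _) (by positivity)
      nlinarith [mul_nonneg (mul_nonneg hL0 hB) (abs_nonneg (x - y))]
    by_cases hl : l ∈ ann c <;> by_cases hl' : l' ∈ ann c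
    · have e : a l * g l - a l' * g l' = (a l - a l') * g l + a l' * (g l - g l') := by ring
      rw [e]
      refine (norm_add_le _ _).trans ?_
      rw [norm_mul, norm_mul]
      have h1 := mul_le_mul (ha.lip l l') (hg l hl) (norm_nonneg _) (by positivity)
      have h2 := mul_le_mul (ha.bdd l') (hL l hl l' hl') (norm_nonneg _) hL0
      linarith
    · exact key l l' hl hl'
    · rw [norm_sub_rev, abs_sub_comm]; exact key l' l hl' hl
    · simp [ha.zero l hl, ha.zero l' hl']; positivity

lemma neg_arg (ha : IsAmp c L a) : IsAmp c L (fun l => a (-l)) where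
  pos := ha.pos
  zero l hl := ha.zero _ fun h => hl (by simpa [ann] using h)
  bdd l := ha.bdd _
  lip l l' := by
    have := ha.lip (-l) (-l')
    rwa [neg_sub_neg, abs_sub_comm] at this

lemma abs_le (ha : IsAmp c L a) {l : ℝ} (h : a l ≠ 0) : |l| ≤ c⁻¹ := (ha.mem h).2

lemma integrable (ha : IsAmp c L a) : Integrable a := by
  refine ha.continuous.integrable_of_hasCompactSupport
    (HasCompactSupport.of_support_subset_isCompact (isCompact_Icc (a := -c⁻¹) (b := c⁻¹))
      fun l hl => _root_.abs_le.1 (ha.abs_le hl))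

/-- The part of an amplitude on the half line of positive parameters. -/
lemma posPart (ha : IsAmp c L a) : IsAmp c L ((Ioi (0:ℝ)).indicator a) where
  pos := ha.pos
  zero l hl := by
    rw [indicator_apply]; split_ifs
    · exact ha.zero l hl
    · rfl
  bdd l := (norm_indicator_le_norm_self _ _).trans (ha.bdd l)
  lip l l' := by
    -- An amplitude vanishes at zero, so cutting it off there preserves the Lipschitz constant.
    have h0 : ∀ l, ‖a l‖ ≤ L * |l| := fun l => by simpa [ha.map_zero] using ha.lip l 0
    have hL := ha.nonneg
    simp only [indicator_apply, mem_Ioi]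
    split_ifs with h1 h2 h2
    · exact ha.lip l l'
    · rw [sub_zero]
      refine (h0 l).trans (mul_le_mul_of_nonneg_left ?_ hL)
      rw [abs_of_pos h1, abs_of_pos (by linarith)]; linarith
    · rw [zero_sub, norm_neg]
      refine (h0 l').trans (mul_le_mul_of_nonneg_left ?_ hL)
      rw [abs_of_pos h2, abs_of_neg (by linarith)]; linarith
    · simp; positivity

end IsAmp

lemma integrable_of_bdd_of_supp {F : ℝ × ℝ → ℂ} {B T : ℝ} (hF : Measurable F)
    (hB : ∀ z, F z ≠ 0 → ‖F z‖ ≤ B) (hT : ∀ z, F z ≠ 0 → |z.1| ≤ T ∧ |z.2| ≤ T) :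
    Integrable F := by
  have hs : Function.support F ⊆ Icc (-T) T ×ˢ Icc (-T) T := fun z hz =>
    ⟨abs_le.1 (hT z hz).1, abs_le.1 (hT z hz).2⟩
  rw [← integrableOn_iff_integrable_of_support_subset hs]
  refine Measure.integrableOn_of_bounded (M := max B 0) ?_ hF.aestronglyMeasurable
    (Eventually.of_forall fun z => ?_)
  · exact ((isCompact_Icc.prod isCompact_Icc).measure_lt_top).ne
  · by_cases hz : F z = 0
    · simp [hz]
    · exact (hB z hz).trans (le_max_left _ _)

/-- Change of variables `(l, u) = (c + d, c - d)`. -/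
lemma integral_prod_eq_integral_add_sub {K : ℝ × ℝ → ℂ} {B T : ℝ} (hK : Measurable K)
    (hB : ∀ z, K z ≠ 0 → ‖K z‖ ≤ B) (hT : ∀ z, K z ≠ 0 → |z.1| ≤ T ∧ |z.2| ≤ T) :
    ∫ z, K z = ∫ c, ∫ d, 2 * K (c + d, c - d) := by
  have i1 : Integrable K := integrable_of_bdd_of_supp hK hB hT
  have i2 : Integrable fun z : ℝ × ℝ => 2 * K (2 * z.2 + z.1, z.1) := by
    refine integrable_of_bdd_of_supp (B := 2 * B) (T := 2 * T) (by fun_prop) (fun z hz => ?_)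
      fun z hz => ?_
    · rw [norm_mul]; simpa using hB _ (right_ne_zero_of_mul hz)
    · obtain ⟨h1, h2⟩ := hT _ (right_ne_zero_of_mul hz)
      simp only at h1 h2
      rw [abs_le] at *
      rw [abs_le] at *
      exact ⟨by constructor <;> linarith, by constructor <;> linarith⟩
  have i3 : Integrable fun z : ℝ × ℝ => 2 * K (z.2 + z.1, z.2 - z.1) := by
    refine integrable_of_bdd_of_supp (B := 2 * B) (T := 2 * T) (by fun_prop) (fun z hz => ?_)
      fun z hz => ?_
    · rw [norm_mul]; simpa using hB _ (right_ne_zero_of_mul hz)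
    · obtain ⟨h1, h2⟩ := hT _ (right_ne_zero_of_mul hz)
      simp only at h1 h2
      rw [abs_le] at *
      rw [abs_le] at *
      exact ⟨by constructor <;> linarith, by constructor <;> linarith⟩
  have e1 : ∫ z, K z = ∫ r, ∫ s, K (s, r) := integral_prod_symm K i1
  have e2 : ∀ r, ∫ s, K (s, r) = ∫ d, 2 * K (2 * d + r, r) := fun r => by
    rw [integral_const_mul, Measure.integral_comp_mul_left (fun x => K (x + r, r)) 2,
      integral_add_right_eq_self (fun x => K (x, r)) r, abs_of_pos (by norm_num),
      Complex.real_smul]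
    push_cast
    ring
  rw [e1]
  simp only [e2]
  rw [integral_integral_swap i2]
  have e3 : ∀ d, ∫ r, 2 * K (2 * d + r, r) = ∫ c, 2 * K (c + d, c - d) := fun d => by
    rw [← integral_sub_right_eq_self (fun r => 2 * K (2 * d + r, r)) d]
    congr 1; ext c
    congr 3; ring
  simp only [e3]
  exact integral_integral_swap i3

lemma setIntegral_Ioi_zero_eq_integral_exp (F : ℝ → ℂ) :
    ∫ l in Ioi (0:ℝ), F l = ∫ s, ((Real.exp s : ℝ) : ℂ) * F (Real.exp s) := by
  have := integral_image_eq_integral_abs_deriv_smul (s := univ) MeasurableSet.univ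
    (fun x _ => (Real.hasDerivAt_exp x).hasDerivWithinAt) Real.exp_injective.injOn F
  rw [image_univ, Real.range_exp, setIntegral_univ] at this
  rw [this]
  congr 1; ext s
  rw [abs_of_pos (Real.exp_pos s), Complex.real_smul]

lemma integral_eq_integral_sinh (F : ℝ → ℂ) :
    ∫ y, F y = ∫ d, ((Real.cosh d : ℝ) : ℂ) * F (Real.sinh d) := by
  have := integral_image_eq_integral_abs_deriv_smul (s := univ) MeasurableSet.univ
    (fun x _ => (Real.hasDerivAt_sinh x).hasDerivWithinAt) Real.sinh_injective.injOn F
  rw [image_univ, Real.sinh_surjective.range_eq, setIntegral_univ, setIntegral_univ] at this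
  rw [this]
  congr 1; ext s
  rw [abs_of_pos (Real.cosh_pos s), Complex.real_smul]

/-! ### The oscillating kernel `sin (2 R (k₀(l) - k₀(u))) (l + u) / (l - u)` -/

def sinKernel (m R : ℝ) (z : ℝ × ℝ) : ℝ :=
  (z.1 + z.2) * (Real.sin (2 * R * (k0 m z.1 - k0 m z.2)) / (z.1 - z.2))

lemma measurable_sinKernel (m R : ℝ) : Measurable (sinKernel m R) := by
  have := measurable_k0 m
  unfold sinKernel
  fun_prop

lemma abs_sinKernel_le {c : ℝ} (m R : ℝ) (hc : 0 < c) {z : ℝ × ℝ} (h1 : z.1 ∈ ann c)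
    (h2 : z.2 ∈ ann c) :
    |sinKernel m R z| ≤ 2 * c⁻¹ * (2 * |R| * (|m| / 4 * (1 + c⁻¹ * c⁻¹))) := by
  have hc' := inv_pos.2 hc
  rw [sinKernel, abs_mul]
  refine mul_le_mul ?_ ?_ (abs_nonneg _) (by positivity)
  · exact (abs_add_le _ _).trans (by linarith [h1.2, h2.2])
  · rcases eq_or_ne z.1 z.2 with h | h
    · simp [h]; positivity
    · have h0 := abs_pos.2 (sub_ne_zero.2 h)
      rw [abs_div, div_le_iff₀ h0]
      refine Real.abs_sin_le_abs.trans ?_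
      rw [abs_mul, abs_mul, abs_two]
      have := abs_k0_sub_le m hc h1 h2
      calc 2 * |R| * |k0 m z.1 - k0 m z.2|
          ≤ 2 * |R| * (|m| / 4 * (1 + c⁻¹ * c⁻¹) * |z.1 - z.2|) := by gcongr
        _ = _ := by ring

lemma integrable_mul_sinKernel {c L : ℝ} {a b : ℝ → ℂ} (m R : ℝ) (ha : IsAmp c L a)
    (hb : IsAmp c L b) :
    Integrable fun z : ℝ × ℝ => a z.1 * b z.2 * ((sinKernel m R z : ℝ) : ℂ) := by
  have h1 := ha.measurable
  have h2 := hb.measurable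
  have h3 := measurable_sinKernel m R
  have hL := ha.nonneg
  refine integrable_of_bdd_of_supp (T := c⁻¹)
    (B := L * L * (2 * c⁻¹ * (2 * |R| * (|m| / 4 * (1 + c⁻¹ * c⁻¹))))) (by fun_prop)
    (fun z hz => ?_) fun z hz => ?_
  all_goals
    have hza : a z.1 ≠ 0 := fun h => hz (by simp [h])
    have hzb : b z.2 ≠ 0 := fun h => hz (by simp [h])
  · rw [norm_mul, norm_mul, Complex.norm_real]
    exact mul_le_mul (mul_le_mul (ha.bdd _) (hb.bdd _) (norm_nonneg _) hL)
      (abs_sinKernel_le m R ha.pos (ha.mem hza) (hb.mem hzb)) (norm_nonneg _) (by positivity)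
  · exact ⟨ha.abs_le hza, hb.abs_le hzb⟩

lemma k0_exp (m s : ℝ) : k0 m (Real.exp s) = m / 2 * Real.cosh s := by
  rw [k0, Real.cosh_eq, Real.exp_neg]; ring

/-- In rapidity variables k₀ is a hyperbolic cosine, so the difference of phases factorises; with y
= sinh d the kernel is sin(κy)/y times the Jacobian cosh d, where κ = 2Rm sinh c. -/
lemma sinKernel_exp (m R c d : ℝ) :
    sinKernel m R (Real.exp (c + d), Real.exp (c - d)) =
      Real.cosh d * (Real.sin (2 * R * m * Real.sinh c * Real.sinh d) / Real.sinh d) := by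
  have h1 : Real.exp (c + d) + Real.exp (c - d) = Real.exp c * (2 * Real.cosh d) := by
    rw [sub_eq_add_neg, Real.exp_add, Real.exp_add, Real.cosh_eq]; ring
  have h2 : Real.exp (c + d) - Real.exp (c - d) = Real.exp c * (2 * Real.sinh d) := by
    rw [sub_eq_add_neg c d, Real.exp_add, Real.exp_add, Real.sinh_eq]; ring
  have h3 : 2 * R * (k0 m (Real.exp (c + d)) - k0 m (Real.exp (c - d))) =
      2 * R * m * Real.sinh c * Real.sinh d := by
    rw [k0_exp, k0_exp, Real.cosh_add, Real.cosh_sub]; ring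
  have hc := Real.exp_ne_zero c
  simp only [sinKernel]
  rw [h1, h2, h3]
  rcases eq_or_ne (Real.sinh d) 0 with h | h
  · simp [h]
  · field_simp

lemma abs_arsinh_le (y : ℝ) : |Real.arsinh y| ≤ |y| := by
  have key : ∀ y : ℝ, 0 ≤ y → Real.arsinh y ≤ y := fun y hy => by
    rw [← Real.sinh_le_sinh, Real.sinh_arsinh]; exact Real.self_le_sinh_iff.2 hy
  rcases le_total 0 y with h | h
  · rw [abs_of_nonneg h, abs_of_nonneg (Real.arsinh_nonneg_iff.2 h)]; exact key y h
  · rw [abs_of_nonpos h, abs_of_nonpos (Real.arsinh_nonpos_iff.2 h), ← Real.arsinh_neg]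
    exact key (-y) (by linarith)

lemma abs_exp_add_sub_le {T c d : ℝ} (hc : |c| ≤ T) (hd : |d| ≤ T) :
    |Real.exp (c + d) - Real.exp c| ≤ Real.exp (2 * T) * |d| := by
  have hmv := Convex.norm_image_sub_le_of_norm_hasDerivWithin_le (f := Real.exp) (f' := Real.exp)
    (s := Iic (2 * T)) (C := Real.exp (2 * T)) (x := c) (y := c + d)
    (fun x _ => (Real.hasDerivAt_exp x).hasDerivWithinAt)
    (fun x hx => by rw [Real.norm_eq_abs, abs_of_pos (Real.exp_pos x)]; exact Real.exp_le_exp.2 hx)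
    (convex_Iic _)
  have hT : 0 ≤ T := (abs_nonneg _).trans hc
  have h1 := (abs_le.1 hc).2
  have h2 := (abs_le.1 hd).2
  simpa [Real.norm_eq_abs] using hmv (by rw [mem_Iic]; linarith) (by rw [mem_Iic]; linarith)

/-! ### The oscillating kernel for positive parameters, in hyperbolic coordinates -/

section positive

variable {c L m : ℝ} {a b : ℝ → ℂ}

/-- The product of two amplitudes in the coordinates `l = exp (s + arsinh y)`,
`u = exp (s - arsinh y)`. -/
def hypProd (a b : ℝ → ℂ) (s y : ℝ) : ℂ :=
  a (Real.exp (s + Real.arsinh y)) * b (Real.exp (s - Real.arsinh y))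

lemma abs_log_le_of_mem_ann {l : ℝ} (hc : 0 < c) (hl : l ∈ ann c) :
    |Real.log l| ≤ |Real.log c| + 1 := by
  have hl0 : 0 < |l| := hc.trans_le hl.1
  have h1 := Real.log_le_log hc hl.1
  have h2 := Real.log_le_log hl0 hl.2
  rw [Real.log_abs] at h1 h2
  rw [Real.log_inv] at h2
  have := neg_abs_le (Real.log c)
  rw [abs_le]
  constructor <;> linarith

lemma hypProd_supp (ha : IsAmp c L a) (hb : IsAmp c L b) {s y : ℝ} (h : hypProd a b s y ≠ 0) :
    |s| ≤ |Real.log c| + 1 ∧ |Real.arsinh y| ≤ |Real.log c| + 1 := by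
  have h1 := abs_log_le_of_mem_ann ha.pos (ha.mem (left_ne_zero_of_mul h))
  have h2 := abs_log_le_of_mem_ann hb.pos (hb.mem (right_ne_zero_of_mul h))
  rw [Real.log_exp, abs_le] at h1 h2
  rw [abs_le, abs_le]
  refine ⟨⟨?_, ?_⟩, ?_, ?_⟩ <;> linarith

lemma measurable_hypProd (ha : Measurable a) (hb : Measurable b) :
    Measurable fun z : ℝ × ℝ => hypProd a b z.1 z.2 := by
  have := Real.continuous_arsinh.measurable
  unfold hypProd
  fun_prop

lemma norm_hypProd_le (ha : IsAmp c L a) (hb : IsAmp c L b) (s y : ℝ) :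
    ‖hypProd a b s y‖ ≤ L * L := by
  rw [hypProd, norm_mul]
  exact mul_le_mul (ha.bdd _) (hb.bdd _) (norm_nonneg _) ha.nonneg

/-- Constants uniform in s, as required to apply the Dirichlet-kernel lemmas in y slice by slice
with a common bound. -/
lemma exists_hypProd_bound (ha : IsAmp c L a) (hb : IsAmp c L b) :
    ∃ B Y : ℝ, 0 < Y ∧ ∀ s, (∀ y, ‖hypProd a b s y‖ ≤ B) ∧
      (∀ y, ‖hypProd a b s y - hypProd a b s 0‖ ≤ B * |y|) ∧
      ∀ y, Y < |y| → hypProd a b s y = 0 := by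
  set T := |Real.log c| + 1 with hT
  have hT0 : 0 < T := by positivity
  set Y := Real.sinh T with hY
  have hY0 : 0 < Y := Real.sinh_pos_iff.2 hT0
  have hL := ha.nonneg
  have hsupp : ∀ s y, Y < |y| → hypProd a b s y = 0 := fun s y hy => by
    by_contra h
    have h1 := (hypProd_supp ha hb h).2
    have h2 : |y| ≤ Y := by
      rw [abs_le] at h1 ⊢
      constructor
      · have := Real.sinh_le_sinh.2 h1.1
        rwa [Real.sinh_neg, Real.sinh_arsinh] at this
      · have := Real.sinh_le_sinh.2 h1.2
        rwa [Real.sinh_arsinh] at this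
    exact absurd h2 (not_le.2 hy)
  refine ⟨L * L + 2 * (L * L * Real.exp (2 * T)) + L * L / Y, Y, hY0, fun s => ⟨fun y => ?_,
    fun y => ?_, hsupp s⟩⟩
  · refine (norm_hypProd_le ha hb s y).trans ?_
    have h1 : 0 ≤ L * L * Real.exp (2 * T) := by positivity
    have h2 : 0 ≤ L * L / Y := by positivity
    linarith
  · have p1 : 0 ≤ L * L * Real.exp (2 * T) := by positivity
    have p2 : 0 ≤ L * L / Y := by positivity
    have p3 : 0 ≤ L * L := by positivity
    have p4 := abs_nonneg y
    rcases lt_or_ge Y |y| with hy | hy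
    · rw [hsupp s y hy, zero_sub, norm_neg]
      refine (norm_hypProd_le ha hb s 0).trans ?_
      have : L * L ≤ L * L / Y * |y| := by
        rw [div_mul_eq_mul_div, le_div_iff₀ hY0]; gcongr
      nlinarith [mul_nonneg p1 p4, mul_nonneg p3 p4]
    · have hd : |Real.arsinh y| ≤ T := by
        rw [abs_le] at hy ⊢
        constructor
        · rw [← Real.sinh_le_sinh, Real.sinh_neg, Real.sinh_arsinh]; exact hy.1
        · rw [← Real.sinh_le_sinh, Real.sinh_arsinh]; exact hy.2
      by_cases hs : |s| ≤ T
      · have h1 : ‖a (Real.exp (s + Real.arsinh y)) - a (Real.exp s)‖ ≤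
            L * (Real.exp (2 * T) * |y|) := by
          refine (ha.lip _ _).trans (mul_le_mul_of_nonneg_left ?_ hL)
          exact (abs_exp_add_sub_le hs hd).trans
            (mul_le_mul_of_nonneg_left (abs_arsinh_le y) (Real.exp_pos _).le)
        have h2 : ‖b (Real.exp (s - Real.arsinh y)) - b (Real.exp s)‖ ≤
            L * (Real.exp (2 * T) * |y|) := by
          refine (hb.lip _ _).trans (mul_le_mul_of_nonneg_left ?_ hL)
          have := abs_exp_add_sub_le (d := -Real.arsinh y) hs (by rwa [abs_neg])
          rw [abs_neg] at this
          exact this.trans (mul_le_mul_of_nonneg_left (abs_arsinh_le y) (Real.exp_pos _).le)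
        have e : hypProd a b s y - hypProd a b s 0 =
            (a (Real.exp (s + Real.arsinh y)) - a (Real.exp s)) * b (Real.exp (s - Real.arsinh y))
            + a (Real.exp s) * (b (Real.exp (s - Real.arsinh y)) - b (Real.exp s)) := by
          simp only [hypProd, Real.arsinh_zero, add_zero, sub_zero]; ring
        rw [e]
        refine (norm_add_le _ _).trans ?_
        rw [norm_mul, norm_mul]
        have h3 := mul_le_mul h1 (hb.bdd (Real.exp (s - Real.arsinh y))) (norm_nonneg _)
          (by positivity)
        have h4 := mul_le_mul (ha.bdd (Real.exp s)) h2 (norm_nonneg _) hL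
        nlinarith [mul_nonneg p3 p4, mul_nonneg p2 p4]
      · have z : ∀ y, hypProd a b s y = 0 := fun y => by
          by_contra h; exact hs (hypProd_supp ha hb h).1
        rw [z, z, sub_zero, norm_zero]
        positivity

/-- The weight `2 exp (2 s)` is the product of the Jacobian l u of the exponentials and the Jacobian
2 of sum and difference variables; the factor cosh in the kernel is the Jacobian of y = sinh d. -/
lemma integral_mul_sinKernel_eq (ha : IsAmp c L a) (hb : IsAmp c L b) (R : ℝ)
    (ha0 : ∀ l ≤ 0, a l = 0) (hb0 : ∀ l ≤ 0, b l = 0) :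
    ∫ z : ℝ × ℝ, a z.1 * b z.2 * ((sinKernel m R z : ℝ) : ℂ) =
      ∫ s, ((2 * Real.exp (2 * s) : ℝ) : ℂ) *
        ∫ y, hypProd a b s y *
          ((Real.sin (2 * R * m * Real.sinh s * y) / y : ℝ) : ℂ) := by
  set T := |Real.log c| + 1 with hT
  set K : ℝ × ℝ → ℂ := fun z => ((Real.exp z.1 : ℝ) : ℂ) * (((Real.exp z.2 : ℝ) : ℂ) *
    (a (Real.exp z.1) * b (Real.exp z.2) *
      ((sinKernel m R (Real.exp z.1, Real.exp z.2) : ℝ) : ℂ))) with hK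
  have hma := ha.measurable
  have hmb := hb.measurable
  have hms := measurable_sinKernel m R
  have hL := ha.nonneg
  have hKm : Measurable K := by rw [hK]; fun_prop
  have hKa : ∀ z, K z ≠ 0 → Real.exp z.1 ∈ ann c ∧ Real.exp z.2 ∈ ann c := fun z hz =>
    ⟨ha.mem fun h => hz (by simp [hK, h]), hb.mem fun h => hz (by simp [hK, h])⟩
  have hKT : ∀ z, K z ≠ 0 → |z.1| ≤ T ∧ |z.2| ≤ T := fun z hz => by
    have h1 := abs_log_le_of_mem_ann ha.pos (hKa z hz).1
    have h2 := abs_log_le_of_mem_ann ha.pos (hKa z hz).2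
    rw [Real.log_exp] at h1 h2
    exact ⟨h1, h2⟩
  have hKB : ∀ z, K z ≠ 0 → ‖K z‖ ≤ Real.exp T * (Real.exp T *
      (L * L * (2 * c⁻¹ * (2 * |R| * (|m| / 4 * (1 + c⁻¹ * c⁻¹)))))) := fun z hz => by
    have hc := inv_pos.2 ha.pos
    have h1 := hKT z hz
    have h2 := hKa z hz
    have e1 : Real.exp z.1 ≤ Real.exp T := Real.exp_le_exp.2 (abs_le.1 h1.1).2
    have e2 : Real.exp z.2 ≤ Real.exp T := Real.exp_le_exp.2 (abs_le.1 h1.2).2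
    have e3 := abs_sinKernel_le (z := (Real.exp z.1, Real.exp z.2)) m R ha.pos h2.1 h2.2
    simp only [hK, norm_mul, Complex.norm_real, Real.norm_eq_abs, Real.abs_exp]
    gcongr
    · exact ha.bdd _
    · exact hb.bdd _
  have e1 : ∫ z : ℝ × ℝ, a z.1 * b z.2 * ((sinKernel m R z : ℝ) : ℂ) = ∫ z, K z := by
    have iK : Integrable K := integrable_of_bdd_of_supp hKm hKB hKT
    rw [show (∫ z, K z) = ∫ s, ∫ r, K (s, r) from integral_prod K iK,
      show (∫ z : ℝ × ℝ, a z.1 * b z.2 * ((sinKernel m R z : ℝ) : ℂ)) =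
        ∫ l, ∫ u, a l * b u * ((sinKernel m R (l, u) : ℝ) : ℂ) from
        integral_prod _ (integrable_mul_sinKernel m R ha hb)]
    have h1 : ∀ l, ∫ u, a l * b u * ((sinKernel m R (l, u) : ℝ) : ℂ) =
        ∫ r, ((Real.exp r : ℝ) : ℂ) * (a l * b (Real.exp r) *
          ((sinKernel m R (l, Real.exp r) : ℝ) : ℂ)) := fun l => by
      rw [← setIntegral_Ioi_zero_eq_integral_exp
        (fun u => a l * b u * ((sinKernel m R (l, u) : ℝ) : ℂ))]
      refine (setIntegral_eq_integral_of_forall_compl_eq_zero fun u hu => ?_).symm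
      simp [hb0 u (not_lt.1 hu)]
    simp only [h1]
    rw [← setIntegral_eq_integral_of_forall_compl_eq_zero (s := Ioi 0),
      setIntegral_Ioi_zero_eq_integral_exp]
    · simp only [hK, integral_const_mul]
    · intro l hl
      simp [ha0 l (not_lt.1 hl)]
  rw [e1, integral_prod_eq_integral_add_sub hKm hKB hKT]
  refine integral_congr_ae (Eventually.of_forall fun s => ?_)
  simp only
  rw [← integral_const_mul, integral_eq_integral_sinh (fun y => _ * (hypProd a b s y * _))]
  refine integral_congr_ae (Eventually.of_forall fun d => ?_)
  simp only [hK, hypProd, Real.arsinh_sinh, sinKernel_exp]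
  have : Real.exp (s + d) * Real.exp (s - d) = Real.exp (2 * s) := by
    rw [← Real.exp_add]; congr 1; ring
  rw [← this]
  push_cast
  ring

/-- The inner integral tends to π sgn(κ) times its amplitude at y = 0, and κ has the sign of sinh s.
As l = e^s on the diagonal, this is the sign of l² - 1, that is, of k₀'(l). -/
lemma tendsto_integral_mul_sinKernel_pos (hm : 0 < m) (ha : IsAmp c L a) (hb : IsAmp c L b)
    (ha0 : ∀ l ≤ 0, a l = 0) (hb0 : ∀ l ≤ 0, b l = 0) :
    Tendsto (fun R => ∫ z : ℝ × ℝ, a z.1 * b z.2 * ((sinKernel m R z : ℝ) : ℂ)) atTop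
      (𝓝 (Real.pi * ∫ l, ((2 * l * Real.sign (l ^ 2 - 1) : ℝ) : ℂ) * (a l * b l))) := by
  obtain ⟨B, Y, hY, hH⟩ := exists_hypProd_bound ha hb
  have hmeas := measurable_hypProd ha.measurable hb.measurable
  set T := |Real.log c| + 1 with hT
  have hlim : (Real.pi * ∫ l, ((2 * l * Real.sign (l ^ 2 - 1) : ℝ) : ℂ) * (a l * b l)) =
      ∫ s, ((2 * Real.exp (2 * s) : ℝ) : ℂ) *
        ((Real.pi * Real.sign s : ℝ) * hypProd a b s 0) := by
    rw [← setIntegral_eq_integral_of_forall_compl_eq_zero (s := Ioi 0),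
      setIntegral_Ioi_zero_eq_integral_exp, ← integral_const_mul]
    · refine integral_congr_ae (Eventually.of_forall fun s => ?_)
      have hsgn : Real.sign (Real.exp s ^ 2 - 1) = Real.sign s := by
        rw [← Real.exp_nat_mul]
        rcases lt_trichotomy s 0 with h | h | h
        · rw [Real.sign_of_neg h, Real.sign_of_neg]
          rw [sub_neg, Real.exp_lt_one_iff]; push_cast; linarith
        · simp [h]
        · rw [Real.sign_of_pos h, Real.sign_of_pos]
          rw [sub_pos, Real.one_lt_exp_iff]; push_cast; linarith
      have h2 : Real.exp (2 * s) = Real.exp s * Real.exp s := by rw [← Real.exp_add]; ring_nf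
      simp only [hypProd, Real.arsinh_zero, add_zero, sub_zero, hsgn, h2]
      push_cast
      ring
    · intro l hl
      simp [ha0 l (not_lt.1 hl)]
  simp only [integral_mul_sinKernel_eq ha hb _ ha0 hb0]
  rw [hlim]
  set D := (∫ y, (2 * B * (Icc (-Y) Y).indicator (1 : ℝ → ℝ) y + B / Y * Real.exp (-|y|))) +
        B * Real.pi with hD
  have hbound : ∀ s κ : ℝ, ‖∫ y, hypProd a b s y * ((Real.sin (κ * y) / y : ℝ) : ℂ)‖ ≤ D :=
    fun s κ => norm_integral_mul_sin_div_le hY (hmeas.comp (measurable_prodMk_left))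
      (hH s).1 (hH s).2.1 (hH s).2.2 κ
  refine tendsto_integral_filter_of_dominated_convergence
    (fun s => (Icc (-T) T).indicator (fun _ => 2 * Real.exp (2 * T) * D) s)
    (Eventually.of_forall fun R => ?_) (Eventually.of_forall fun R => Eventually.of_forall
      fun s => ?_) ?_ ?_
  · have h1 : Measurable fun z : ℝ × ℝ => hypProd a b z.1 z.2 *
        ((Real.sin (2 * R * m * Real.sinh z.1 * z.2) / z.2 : ℝ) : ℂ) := by fun_prop
    have h2 := (show Measurable (Function.uncurry fun s y : ℝ => hypProd a b s y *
        ((Real.sin (2 * R * m * Real.sinh s * y) / y : ℝ) : ℂ)) from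
        h1).stronglyMeasurable.integral_prod_right (ν := volume)
    exact (Measurable.mul (by fun_prop) h2.measurable).aestronglyMeasurable
  · rw [indicator_apply]
    split_ifs with hs
    · rw [norm_mul, Complex.norm_real, Real.norm_eq_abs, abs_of_pos (by positivity)]
      refine mul_le_mul ?_ (hbound s _) (norm_nonneg _) (by positivity)
      have := hs.2
      gcongr
    · have z : ∀ y, hypProd a b s y = 0 := fun y => by
        by_contra h; exact hs (abs_le.1 (hypProd_supp ha hb h).1)
      simp [z]
  · exact (integrable_indicator_iff measurableSet_Icc).2 (integrableOn_const (by simp))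
  -- The excluded value s = 0 is the critical point l = 1 of k₀, where κ vanishes for every R.
  · have h0 : ∀ᵐ s : ℝ, s ≠ 0 := by simp [ae_iff]
    filter_upwards [h0] with s hs
    refine Tendsto.const_mul _ ?_
    have hms : Measurable (hypProd a b s) := hmeas.comp measurable_prodMk_left
    have hlin : ∀ R : ℝ, 2 * R * m * Real.sinh s = (2 * m * Real.sinh s) * R := fun R => by ring
    simp only [hlin]
    rcases lt_or_gt_of_ne hs with h | h
    · have hk : Tendsto (fun R : ℝ => (2 * m * Real.sinh s) * R) atTop atBot :=
        tendsto_id.const_mul_atTop_of_neg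
          (mul_neg_of_pos_of_neg (by positivity) (Real.sinh_neg_iff.2 h))
      have := (tendsto_integral_mul_sin_div_atBot hY hms (hH s).1 (hH s).2.1 (hH s).2.2).comp hk
      rw [Real.sign_of_neg h]
      refine (this.congr fun R => rfl).trans (le_of_eq ?_)
      push_cast; ring_nf
    · have hk : Tendsto (fun R : ℝ => (2 * m * Real.sinh s) * R) atTop atTop :=
        tendsto_id.const_mul_atTop (mul_pos (by positivity) (Real.sinh_pos_iff.2 h))
      have := (tendsto_integral_mul_sin_div hY hms (hH s).1 (hH s).2.1 (hH s).2.2).comp hk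
      rw [Real.sign_of_pos h]
      refine (this.congr fun R => rfl).trans (le_of_eq ?_)
      push_cast; ring_nf

end positive

/-! ### The oscillating kernel for parameters of arbitrary sign -/

section

variable {c L m : ℝ} {a b : ℝ → ℂ}

lemma integrable_comp_swap {F : ℝ × ℝ → ℂ} (hF : Integrable F) :
    Integrable fun z : ℝ × ℝ => F z.swap := hF.swap

lemma integral_comp_swap (F : ℝ × ℝ → ℂ) : ∫ z : ℝ × ℝ, F z.swap = ∫ z, F z :=
  integral_prod_swap (μ := volume) (ν := volume) F

lemma integral_eq_integral_add_swap {F : ℝ × ℝ → ℂ} (hF : Integrable F) (x : ℂ) :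
    Integrable (fun z => x / 2 * (F z + F z.swap)) ∧
      ∫ z, x / 2 * (F z + F z.swap) = x * ∫ z, F z := by
  have h2 := integrable_comp_swap hF
  refine ⟨(hF.add h2).const_mul _, ?_⟩
  rw [integral_const_mul, integral_add hF h2, integral_comp_swap]
  ring

lemma integrable_mul_expI_prod {h : ℝ × ℝ → ℂ} (hh : Integrable h) (m κ R : ℝ) :
    Integrable fun z : ℝ × ℝ =>
      h z * Complex.exp (Complex.I * ((κ * R * (k0 m z.1 - k0 m z.2) : ℝ) : ℂ)) := by
  have hm := measurable_k0 m
  refine hh.mul_bdd (c := 1) (Measurable.aestronglyMeasurable (by fun_prop))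
    (Eventually.of_forall fun z => (norm_expI _).le)

lemma tendsto_integral_prod_mul_cos (hm : 0 < m) {h : ℝ × ℝ → ℂ} (hh : Integrable h) :
    Tendsto (fun R : ℝ => ∫ z : ℝ × ℝ, h z * ((Real.cos (2 * R * (k0 m z.1 - k0 m z.2)) : ℝ) : ℂ))
      atTop (𝓝 0) := by
  have h1 := tendsto_integral_prod_mul_exp_k0 hm hh (κ := 2) (by norm_num)
  have h2 := tendsto_integral_prod_mul_exp_k0 hm hh (κ := -2) (by norm_num)
  have h3 := (h1.add h2).mul_const (1 / 2)
  simp only [add_zero, zero_mul] at h3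
  refine h3.congr fun R => ?_
  rw [← integral_add (integrable_mul_expI_prod hh m _ R) (integrable_mul_expI_prod hh m _ R),
    ← integral_mul_const]
  refine integral_congr_ae (Eventually.of_forall fun z => ?_)
  simp only
  rw [Complex.ofReal_cos, Complex.cos]
  have e1 : ∀ x : ℂ, Complex.I * x = x * Complex.I := fun x => mul_comm _ _
  have e2 : ((-2 * R * (k0 m z.1 - k0 m z.2) : ℝ) : ℂ) =
    -((2 * R * (k0 m z.1 - k0 m z.2) : ℝ) : ℂ) := by push_cast; ring
  rw [e1, e1, e2]
  ring

lemma tendsto_integral_prod_mul_sin (hm : 0 < m) {h : ℝ × ℝ → ℂ} (hh : Integrable h) :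
    Tendsto (fun R : ℝ => ∫ z : ℝ × ℝ, h z * ((Real.sin (2 * R * (k0 m z.1 - k0 m z.2)) : ℝ) : ℂ))
      atTop (𝓝 0) := by
  have h1 := tendsto_integral_prod_mul_exp_k0 hm hh (κ := 2) (by norm_num)
  have h2 := tendsto_integral_prod_mul_exp_k0 hm hh (κ := -2) (by norm_num)
  have h3 := (h2.sub h1).mul_const (Complex.I / 2)
  simp only [sub_zero, zero_mul] at h3
  refine h3.congr fun R => ?_
  rw [← integral_sub (integrable_mul_expI_prod hh m _ R) (integrable_mul_expI_prod hh m _ R),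
    ← integral_mul_const]
  refine integral_congr_ae (Eventually.of_forall fun z => ?_)
  simp only
  rw [Complex.ofReal_sin, Complex.sin]
  have e1 : ∀ x : ℂ, Complex.I * x = x * Complex.I := fun x => mul_comm _ _
  have e2 : ((-2 * R * (k0 m z.1 - k0 m z.2) : ℝ) : ℂ) =
    -((2 * R * (k0 m z.1 - k0 m z.2) : ℝ) : ℂ) := by push_cast; ring
  rw [e1, e1, e2]
  ring

lemma k0_neg (m l : ℝ) : k0 m (-l) = -k0 m l := by
  unfold k0; rw [div_neg]; ring

lemma sinKernel_neg (m R : ℝ) (z : ℝ × ℝ) : sinKernel m R (-z) = -sinKernel m R z := by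
  simp only [sinKernel, Prod.fst_neg, Prod.snd_neg, k0_neg]
  have e1 : 2 * R * (-k0 m z.1 - -k0 m z.2) = -(2 * R * (k0 m z.1 - k0 m z.2)) := by ring
  have e2 : -z.1 - -z.2 = -(z.1 - z.2) := by ring
  rw [e1, e2, Real.sin_neg, neg_div_neg_eq]
  ring

lemma sinKernel_neg_param (m R : ℝ) (z : ℝ × ℝ) : sinKernel m (-R) z = -sinKernel m R z := by
  simp only [sinKernel]
  rw [show 2 * -R * (k0 m z.1 - k0 m z.2) = -(2 * R * (k0 m z.1 - k0 m z.2)) by ring,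
    Real.sin_neg]
  ring

lemma sinKernel_swap (m R : ℝ) (z : ℝ × ℝ) : sinKernel m R z.swap = sinKernel m R z := by
  simp only [sinKernel, Prod.fst_swap, Prod.snd_swap]
  rw [show 2 * R * (k0 m z.2 - k0 m z.1) = -(2 * R * (k0 m z.1 - k0 m z.2)) by ring,
    show z.2 - z.1 = -(z.1 - z.2) by ring, Real.sin_neg, neg_div_neg_eq, add_comm]

/-- Reflecting both parameters changes the sign of the kernel and of the weight `2 l`, reducing the
claim to positive parameters. -/
lemma tendsto_integral_mul_sinKernel_neg (hm : 0 < m) (ha : IsAmp c L a) (hb : IsAmp c L b)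
    (ha0 : ∀ l, 0 ≤ l → a l = 0) (hb0 : ∀ l, 0 ≤ l → b l = 0) :
    Tendsto (fun R => ∫ z : ℝ × ℝ, a z.1 * b z.2 * ((sinKernel m R z : ℝ) : ℂ)) atTop
      (𝓝 (Real.pi * ∫ l, ((2 * l * Real.sign (l ^ 2 - 1) : ℝ) : ℂ) * (a l * b l))) := by
  have h := (tendsto_integral_mul_sinKernel_pos hm ha.neg_arg hb.neg_arg
    (fun l hl => ha0 _ (by linarith)) (fun l hl => hb0 _ (by linarith))).neg
  rw [← integral_neg_eq_self, ← mul_neg, ← integral_neg] at h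
  refine (h.congr fun R => ?_).trans (le_of_eq ?_)
  · rw [← integral_neg_eq_self, ← integral_neg]
    refine integral_congr_ae (Eventually.of_forall fun z => ?_)
    simp only [sinKernel_neg, Prod.fst_neg, Prod.snd_neg, neg_neg]
    push_cast; ring
  · congr 2
    refine integral_congr_ae (Eventually.of_forall fun l => ?_)
    simp only [neg_neg, neg_sq]
    push_cast; ring

/-- For opposite signs `|l + u| ≤ |l - u|`, so the quotient is bounded, there is no singularity, and
Riemann–Lebesgue suffices. -/
lemma tendsto_integral_mul_sinKernel_mixed (hm : 0 < m) (ha : IsAmp c L a) (hb : IsAmp c L b)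
    (hab : ∀ l u, a l ≠ 0 → b u ≠ 0 → l * u < 0) :
    Tendsto (fun R => ∫ z : ℝ × ℝ, a z.1 * b z.2 * ((sinKernel m R z : ℝ) : ℂ)) atTop
      (𝓝 0) := by
  have h1 := ha.measurable
  have h2 := hb.measurable
  have hL := ha.nonneg
  have hc := ha.pos
  have hi : Integrable fun z : ℝ × ℝ =>
      a z.1 * b z.2 * (((z.1 + z.2) / (z.1 - z.2) : ℝ) : ℂ) := by
    refine integrable_of_bdd_of_supp (T := c⁻¹) (B := L * L * 1) (by fun_prop)
      (fun z hz => ?_) fun z hz => ?_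
    all_goals
      have hza : a z.1 ≠ 0 := fun h => hz (by simp [h])
      have hzb : b z.2 ≠ 0 := fun h => hz (by simp [h])
    · rw [norm_mul, norm_mul, Complex.norm_real]
      refine mul_le_mul (mul_le_mul (ha.bdd _) (hb.bdd _) (norm_nonneg _) hL) ?_ (norm_nonneg _)
        (by positivity)
      have h3 := hab _ _ hza hzb
      rw [Real.norm_eq_abs, ← sq_le_one_iff_abs_le_one, div_pow, div_le_one]
      · nlinarith
      · nlinarith [sq_nonneg (z.1 + z.2)]
    · exact ⟨ha.abs_le hza, hb.abs_le hzb⟩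
  refine (tendsto_integral_prod_mul_sin hm hi).congr fun R => ?_
  refine integral_congr_ae (Eventually.of_forall fun z => ?_)
  simp only [sinKernel]
  push_cast; ring

lemma IsAmp.negPart (ha : IsAmp c L a) : IsAmp c L ((Iio (0:ℝ)).indicator a) := by
  have h := ha.neg_arg.posPart.neg_arg
  have e : (fun l => (Ioi (0:ℝ)).indicator (fun l => a (-l)) (-l)) = (Iio (0:ℝ)).indicator a := by
    ext l
    simp [indicator_apply]
  rwa [e] at h

lemma IsAmp.eq_negPart_add_posPart (ha : IsAmp c L a) (l : ℝ) :
    a l = (Iio (0:ℝ)).indicator a l + (Ioi (0:ℝ)).indicator a l := by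
  rcases lt_trichotomy l 0 with h | h | h
  · rw [indicator_of_mem (mem_Iio.2 h), indicator_of_notMem (by simp [h.le]), add_zero]
  · simp [h, ha.map_zero]
  · rw [indicator_of_mem (mem_Ioi.2 h), indicator_of_notMem (by simp [h.le]), zero_add]

lemma tendsto_integral_mul_sinKernel (hm : 0 < m) (ha : IsAmp c L a) (hb : IsAmp c L b) :
    Tendsto (fun R => ∫ z : ℝ × ℝ, a z.1 * b z.2 * ((sinKernel m R z : ℝ) : ℂ)) atTop
      (𝓝 (Real.pi * ∫ l, ((2 * l * Real.sign (l ^ 2 - 1) : ℝ) : ℂ) * (a l * b l))) := by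
  set ap := (Ioi (0:ℝ)).indicator a with hap
  set bp := (Ioi (0:ℝ)).indicator b with hbp
  set an := (Iio (0:ℝ)).indicator a with han
  set bn := (Iio (0:ℝ)).indicator b with hbn
  have hap' : IsAmp c L ap := ha.posPart
  have hbp' : IsAmp c L bp := hb.posPart
  have han' : IsAmp c L an := ha.negPart
  have hbn' : IsAmp c L bn := hb.negPart
  have pos0 : ∀ f : ℝ → ℂ, ∀ l ≤ 0, (Ioi (0:ℝ)).indicator f l = 0 := fun f l hl =>
    indicator_of_notMem (by simpa using hl) _
  have neg0 : ∀ f : ℝ → ℂ, ∀ l, 0 ≤ l → (Iio (0:ℝ)).indicator f l = 0 := fun f l hl =>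
    indicator_of_notMem (by simpa using hl) _
  have h1 := tendsto_integral_mul_sinKernel_pos hm hap' hbp' (pos0 a) (pos0 b)
  have h2 := tendsto_integral_mul_sinKernel_neg hm han' hbn' (neg0 a) (neg0 b)
  have h3 := tendsto_integral_mul_sinKernel_mixed hm hap' hbn' fun l u hl hu =>
    mul_neg_of_pos_of_neg (mem_Ioi.1 (mem_of_indicator_ne_zero (f := a) hl))
      (mem_Iio.1 (mem_of_indicator_ne_zero (f := b) hu))
  have h4 := tendsto_integral_mul_sinKernel_mixed hm han' hbp' fun l u hl hu =>
    mul_neg_of_neg_of_pos (mem_Iio.1 (mem_of_indicator_ne_zero (f := a) hl))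
      (mem_Ioi.1 (mem_of_indicator_ne_zero (f := b) hu))
  have i1 := fun R => integrable_mul_sinKernel m R hap' hbp'
  have i2 := fun R => integrable_mul_sinKernel m R han' hbn'
  have i3 := fun R => integrable_mul_sinKernel m R hap' hbn'
  have i4 := fun R => integrable_mul_sinKernel m R han' hbp'
  have hinteg : ∀ f g : ℝ → ℂ, IsAmp c L f → IsAmp c L g →
      Integrable fun l => ((2 * l * Real.sign (l ^ 2 - 1) : ℝ) : ℂ) * (f l * g l) := by
    intro f g hf hg
    have hsg : Measurable fun l : ℝ => Real.sign (l ^ 2 - 1) := by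
      have : Measurable Real.sign := by
        unfold Real.sign
        exact Measurable.ite measurableSet_Iio measurable_const
          (Measurable.ite measurableSet_Ioi measurable_const measurable_const)
      fun_prop
    have h5 : Integrable fun l => f l * (g l * (l : ℂ)) := by
      refine (hf.integrable).mul_bdd (c := L * c⁻¹)
        (hg.continuous.mul Complex.continuous_ofReal).aestronglyMeasurable
        (Eventually.of_forall fun l => ?_)
      have := hg.nonneg
      have := inv_pos.2 hg.pos
      by_cases hgl : g l = 0
      · simp [hgl]; positivity
      · rw [norm_mul, Complex.norm_real]
        exact mul_le_mul (hg.bdd l) (hg.abs_le hgl) (norm_nonneg _) (by positivity)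
    have h6 : Integrable fun l => (f l * (g l * (l : ℂ))) * ((2 * Real.sign (l ^ 2 - 1) : ℝ) : ℂ) :=
      h5.mul_bdd (c := 2) (Measurable.aestronglyMeasurable (by fun_prop))
        (Eventually.of_forall fun l => by
          rw [Complex.norm_real, Real.norm_eq_abs, abs_mul, abs_two]
          have : |Real.sign (l ^ 2 - 1)| ≤ 1 := by
            rcases Real.sign_apply_eq (l ^ 2 - 1) with h | h | h <;> simp [h]
          linarith)
    refine h6.congr (Eventually.of_forall fun l => ?_)
    simp only
    push_cast; ring
  have hcongr : ∀ l, a l * b l = an l * bn l + ap l * bp l := fun l => by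
    rw [ha.eq_negPart_add_posPart, hb.eq_negPart_add_posPart]
    rcases le_total l 0 with h | h
    · simp [pos0 _ _ h, hap, hbp, han, hbn]
    · simp [neg0 _ _ h, hap, hbp, han, hbn]
  have hR : (Real.pi * ∫ l, ((2 * l * Real.sign (l ^ 2 - 1) : ℝ) : ℂ) * (a l * b l)) =
      (Real.pi * ∫ l, ((2 * l * Real.sign (l ^ 2 - 1) : ℝ) : ℂ) * (ap l * bp l)) +
      (Real.pi * ∫ l, ((2 * l * Real.sign (l ^ 2 - 1) : ℝ) : ℂ) * (an l * bn l)) + 0 + 0 := by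
    rw [add_zero, add_zero, ← mul_add, ← integral_add (hinteg _ _ hap' hbp') (hinteg _ _ han' hbn')]
    congr 2
    ext l
    rw [hcongr]; ring
  rw [hR]
  refine (((h1.add h2).add h3).add h4).congr fun R => ?_
  rw [← integral_add (i1 R) (i2 R), ← integral_add ((i1 R).fun_add (i2 R)) (i3 R),
    ← integral_add (((i1 R).fun_add (i2 R)).fun_add (i3 R)) (i4 R)]
  refine integral_congr_ae (Eventually.of_forall fun z => ?_)
  beta_reduce
  rw [ha.eq_negPart_add_posPart z.1, hb.eq_negPart_add_posPart z.2]
  ring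

/-! ### Symmetrised principal values -/

/-- The integrand of the symmetrised principal value of `∫∫ H(l, u) / (l - u)`. -/
def pvIntegrand (H : ℝ × ℝ → ℂ) (z : ℝ × ℝ) : ℂ :=
  (H z - H z.swap) * ((1 / (2 * (z.1 - z.2)) : ℝ) : ℂ)

/-- The principal value of `∫∫ H(l, u) / (l - u)`, in symmetrised form. -/
def pv (H : ℝ × ℝ → ℂ) : ℂ := ∫ z, pvIntegrand H z

/-- The bridge between total boundary terms, for which the quotient is integrable, and their
separate pieces, which have only a principal value. -/
lemma pv_eq_integral {H : ℝ × ℝ → ℂ}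
    (hH : Integrable fun z : ℝ × ℝ => H z * ((1 / (z.1 - z.2) : ℝ) : ℂ)) :
    Integrable (pvIntegrand H) ∧ pv H = ∫ z : ℝ × ℝ, H z * ((1 / (z.1 - z.2) : ℝ) : ℂ) := by
  have e : pvIntegrand H = fun z => (1 / 2 : ℂ) * (H z * ((1 / (z.1 - z.2) : ℝ) : ℂ) +
      H z.swap * ((1 / (z.swap.1 - z.swap.2) : ℝ) : ℂ)) := by
    ext z
    simp only [pvIntegrand, Prod.fst_swap, Prod.snd_swap]
    rw [← neg_sub z.1 z.2, div_neg]
    have : (1 / (2 * (z.1 - z.2)) : ℝ) = 1 / 2 * (1 / (z.1 - z.2)) := by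
      rw [one_div_mul_one_div]
    rw [this]
    push_cast
    ring
  have h := integral_eq_integral_add_swap hH 1
  rw [pv, e]
  exact ⟨h.1, h.2.trans (one_mul _)⟩

lemma pv_sub {H H' : ℝ × ℝ → ℂ} (h : Integrable (pvIntegrand H))
    (h' : Integrable (pvIntegrand H')) : pv (fun z => H z - H' z) = pv H - pv H' := by
  rw [pv, pv, pv, ← integral_sub h h']
  congr 1
  ext z
  simp only [pvIntegrand]
  ring

/-- The function `(l + u) a(l) b(u) exp (2 i r (k₀(l) - k₀(u)))`. -/
def oscProd (m : ℝ) (a b : ℝ → ℂ) (r : ℝ) (z : ℝ × ℝ) : ℂ :=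
  ((z.1 + z.2 : ℝ) : ℂ) * (a z.1 * b z.2) *
    Complex.exp (Complex.I * ((2 * r * (k0 m z.1 - k0 m z.2) : ℝ) : ℂ))

/-- The smooth part of the symmetrised integrand. -/
def oscSym (a b : ℝ → ℂ) (z : ℝ × ℝ) : ℂ :=
  ((z.1 + z.2 : ℝ) : ℂ) * (a z.1 * b z.2 - a z.2 * b z.1) * ((1 / (2 * (z.1 - z.2)) : ℝ) : ℂ)

/-- Under exchange of the parameters the cosine is even and the sine odd. The cosine thus multiplies
an antisymmetrised amplitude, which cancels the pole, while the sine cancels it by itself and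
produces `sinKernel`. -/
lemma pvIntegrand_oscProd (m r : ℝ) (a b : ℝ → ℂ) (z : ℝ × ℝ) :
    pvIntegrand (oscProd m a b r) z =
      oscSym a b z * ((Real.cos (2 * r * (k0 m z.1 - k0 m z.2)) : ℝ) : ℂ) +
      Complex.I / 2 * (a z.1 * b z.2 * ((sinKernel m r z : ℝ) : ℂ) +
        a z.swap.1 * b z.swap.2 * ((sinKernel m r z.swap : ℝ) : ℂ)) := by
  rw [sinKernel_swap]
  simp only [pvIntegrand, oscProd, oscSym, sinKernel, Prod.fst_swap, Prod.snd_swap]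
  have e1 : Complex.exp (Complex.I * ((2 * r * (k0 m z.1 - k0 m z.2) : ℝ) : ℂ)) =
      ((Real.cos (2 * r * (k0 m z.1 - k0 m z.2)) : ℝ) : ℂ) +
        ((Real.sin (2 * r * (k0 m z.1 - k0 m z.2)) : ℝ) : ℂ) * Complex.I := by
    rw [mul_comm, Complex.exp_mul_I, Complex.ofReal_cos, Complex.ofReal_sin]
  have e2 : Complex.exp (Complex.I * ((2 * r * (k0 m z.2 - k0 m z.1) : ℝ) : ℂ)) =
      ((Real.cos (2 * r * (k0 m z.1 - k0 m z.2)) : ℝ) : ℂ) -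
        ((Real.sin (2 * r * (k0 m z.1 - k0 m z.2)) : ℝ) : ℂ) * Complex.I := by
    rw [show 2 * r * (k0 m z.2 - k0 m z.1) = -(2 * r * (k0 m z.1 - k0 m z.2)) by ring,
      mul_comm, Complex.exp_mul_I, ← Complex.ofReal_cos, ← Complex.ofReal_sin, Real.cos_neg,
      Real.sin_neg]
    push_cast; ring
  rw [e1, e2]
  have : (1 / (2 * (z.1 - z.2)) : ℝ) = 1 / 2 * (1 / (z.1 - z.2)) := by
    rw [one_div_mul_one_div]
  rw [this, div_eq_mul_one_div (Real.sin _)]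
  push_cast
  ring

lemma norm_oscSym_le (ha : IsAmp c L a) (hb : IsAmp c L b) {z : ℝ × ℝ} (hz : oscSym a b z ≠ 0) :
    ‖oscSym a b z‖ ≤ 2 * c⁻¹ * (2 * (L * L)) ∧ |z.1| ≤ c⁻¹ ∧ |z.2| ≤ c⁻¹ := by
  have hL := ha.nonneg
  have hc := inv_pos.2 ha.pos
  have hz' : a z.1 * b z.2 - a z.2 * b z.1 ≠ 0 := fun h => hz (by simp [oscSym, h])
  have hann : |z.1| ≤ c⁻¹ ∧ |z.2| ≤ c⁻¹ := by
    by_cases h : a z.1 * b z.2 = 0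
    · rw [h, zero_sub, neg_ne_zero] at hz'
      exact ⟨hb.abs_le (right_ne_zero_of_mul hz'), ha.abs_le (left_ne_zero_of_mul hz')⟩
    · exact ⟨ha.abs_le (left_ne_zero_of_mul h), hb.abs_le (right_ne_zero_of_mul h)⟩
  refine ⟨?_, hann⟩
  have hne : z.1 - z.2 ≠ 0 := fun h => hz (by simp [oscSym, h])
  have h0 := abs_pos.2 hne
  rw [oscSym, norm_mul, norm_mul, Complex.norm_real, Complex.norm_real, Real.norm_eq_abs,
    Real.norm_eq_abs, mul_assoc]
  refine mul_le_mul ((abs_add_le _ _).trans (by linarith)) ?_ (by positivity) (by positivity)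
  have e : a z.1 * b z.2 - a z.2 * b z.1 =
      (a z.1 - a z.2) * b z.2 + a z.2 * (b z.2 - b z.1) := by ring
  have h1 : ‖a z.1 * b z.2 - a z.2 * b z.1‖ ≤ 2 * (L * L) * |z.1 - z.2| := by
    rw [e]
    refine (norm_add_le _ _).trans ?_
    rw [norm_mul, norm_mul]
    have h1 := mul_le_mul (ha.lip z.1 z.2) (hb.bdd z.2) (norm_nonneg _) (by positivity)
    have h2 := mul_le_mul (ha.bdd z.2) (hb.lip z.2 z.1) (norm_nonneg _) hL
    rw [abs_sub_comm z.2] at h2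
    linarith
  rw [abs_div, abs_one, abs_mul, abs_two, mul_one_div, div_le_iff₀ (by positivity)]
  have : 0 ≤ L * L * |z.1 - z.2| := by positivity
  linarith

lemma measurable_oscSym (ha : Measurable a) (hb : Measurable b) : Measurable (oscSym a b) := by
  unfold oscSym; fun_prop

lemma integrable_oscSym (ha : IsAmp c L a) (hb : IsAmp c L b) : Integrable (oscSym a b) :=
  integrable_of_bdd_of_supp (measurable_oscSym ha.measurable hb.measurable)
    (fun _ hz => (norm_oscSym_le ha hb hz).1) fun _ hz => (norm_oscSym_le ha hb hz).2

lemma pv_oscProd (m r : ℝ) (ha : IsAmp c L a) (hb : IsAmp c L b) :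
    Integrable (pvIntegrand (oscProd m a b r)) ∧ pv (oscProd m a b r) =
      (∫ z : ℝ × ℝ, oscSym a b z * ((Real.cos (2 * r * (k0 m z.1 - k0 m z.2)) : ℝ) : ℂ)) +
      Complex.I * ∫ z : ℝ × ℝ, a z.1 * b z.2 * ((sinKernel m r z : ℝ) : ℂ) := by
  have i1 : Integrable fun z : ℝ × ℝ =>
      oscSym a b z * ((Real.cos (2 * r * (k0 m z.1 - k0 m z.2)) : ℝ) : ℂ) := by
    have hk := measurable_k0 m
    refine (integrable_oscSym ha hb).mul_bdd (c := 1)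
      (Measurable.aestronglyMeasurable (by fun_prop)) (Eventually.of_forall fun z => ?_)
    rw [Complex.norm_real]; exact Real.abs_cos_le_one _
  have i2 := integrable_mul_sinKernel m r ha hb
  have i3 := integral_eq_integral_add_swap i2 Complex.I
  have e : pvIntegrand (oscProd m a b r) = _ := funext (pvIntegrand_oscProd m r a b)
  rw [pv, e]
  refine ⟨i1.add i3.1, ?_⟩
  rw [← i3.2]
  exact integral_add i1 i3.1

/-- The distribution p.v. e^(iκx)/x tends to iπ δ(x) as κ → ∞. Riemann–Lebesgue removes the cosine
part; the sine part gives the local term, with `l + u` becoming `2 l` on the diagonal. -/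
lemma tendsto_pv_oscProd_atTop (hm : 0 < m) (ha : IsAmp c L a) (hb : IsAmp c L b) :
    Tendsto (fun r => pv (oscProd m a b r)) atTop
      (𝓝 (Complex.I *
        (Real.pi * ∫ l, ((2 * l * Real.sign (l ^ 2 - 1) : ℝ) : ℂ) * (a l * b l)))) := by
  simp only [fun r => (pv_oscProd m r ha hb).2]
  have h1 := tendsto_integral_prod_mul_cos hm (integrable_oscSym ha hb)
  have h2 := (tendsto_integral_mul_sinKernel hm ha hb).const_mul Complex.I
  simpa using h1.add h2

lemma tendsto_pv_oscProd_atBot (hm : 0 < m) (ha : IsAmp c L a) (hb : IsAmp c L b) :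
    Tendsto (fun r => pv (oscProd m a b r)) atBot
      (𝓝 (-(Complex.I *
        (Real.pi * ∫ l, ((2 * l * Real.sign (l ^ 2 - 1) : ℝ) : ℂ) * (a l * b l))))) := by
  have h1 := tendsto_integral_prod_mul_cos hm (integrable_oscSym ha hb)
  have h2 := ((tendsto_integral_mul_sinKernel hm ha hb).const_mul Complex.I).neg
  have h3 := (h1.add h2).comp tendsto_neg_atBot_atTop
  rw [zero_add] at h3
  refine h3.congr fun r => ?_
  rw [(pv_oscProd m r ha hb).2, Function.comp]
  congr 1
  · refine integral_congr_ae (Eventually.of_forall fun z => ?_)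
    simp only
    rw [show 2 * -r * (k0 m z.1 - k0 m z.2) = -(2 * r * (k0 m z.1 - k0 m z.2)) by ring,
      Real.cos_neg]
  · rw [← mul_neg, ← integral_neg]
    congr 2; ext z
    rw [sinKernel_neg_param]
    push_cast; ring

/-- Truncated principal values converge to the symmetrised one. -/
lemma tendsto_truncated_pv (m : ℝ) (ha : IsAmp c L a) (hb : IsAmp c L b) :
    (∀ ε > 0, Integrable fun z : ℝ × ℝ => a z.1 * b z.2 *
      (if ε < |z.1 - z.2| then (((z.1 + z.2) / (z.1 - z.2) : ℝ) : ℂ) else 0)) ∧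
    Tendsto (fun ε : ℝ => ∫ z : ℝ × ℝ, a z.1 * b z.2 *
      (if ε < |z.1 - z.2| then (((z.1 + z.2) / (z.1 - z.2) : ℝ) : ℂ) else 0))
      (𝓝[>] 0) (𝓝 (pv (oscProd m a b 0))) := by
  have hma := ha.measurable
  have hmb := hb.measurable
  have hL := ha.nonneg
  have hc := inv_pos.2 ha.pos
  have hset : ∀ ε : ℝ, MeasurableSet {z : ℝ × ℝ | ε < |z.1 - z.2|} := fun ε =>
    measurableSet_lt measurable_const (by fun_prop)
  have hmeas : ∀ ε : ℝ, Measurable fun z : ℝ × ℝ => a z.1 * b z.2 *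
      (if ε < |z.1 - z.2| then (((z.1 + z.2) / (z.1 - z.2) : ℝ) : ℂ) else 0) := fun ε =>
    Measurable.mul (by fun_prop) (Measurable.ite (hset ε) (by fun_prop) measurable_const)
  have hinteg : ∀ ε > 0, Integrable fun z : ℝ × ℝ => a z.1 * b z.2 *
      (if ε < |z.1 - z.2| then (((z.1 + z.2) / (z.1 - z.2) : ℝ) : ℂ) else 0) := fun ε hε => by
    refine integrable_of_bdd_of_supp (T := c⁻¹) (B := L * L * (2 * c⁻¹ / ε)) (hmeas ε)
      (fun z hz => ?_) fun z hz => ?_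
    all_goals
      have hza : a z.1 ≠ 0 := fun h => hz (by simp [h])
      have hzb : b z.2 ≠ 0 := fun h => hz (by simp [h])
    · rw [norm_mul, norm_mul]
      refine mul_le_mul (mul_le_mul (ha.bdd _) (hb.bdd _) (norm_nonneg _) hL) ?_ (norm_nonneg _)
        (by positivity)
      split_ifs with h
      · rw [Complex.norm_real, Real.norm_eq_abs, abs_div]
        refine div_le_div₀ (by positivity) ?_ hε h.le
        exact (abs_add_le _ _).trans (by linarith [ha.abs_le hza, hb.abs_le hzb])
      · simp; positivity
    · exact ⟨ha.abs_le hza, hb.abs_le hzb⟩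
  refine ⟨hinteg, ?_⟩
  have e0 : pvIntegrand (oscProd m a b 0) = oscSym a b := by
    ext z; rw [pvIntegrand_oscProd]; simp [sinKernel]
  -- The truncation region is symmetric under exchange, so the truncated integral may be
  -- symmetrised; its integrand is then dominated by the integrable `oscSym`, independently of ε.
  have hsym : ∀ ε > 0, ∫ z : ℝ × ℝ, a z.1 * b z.2 *
      (if ε < |z.1 - z.2| then (((z.1 + z.2) / (z.1 - z.2) : ℝ) : ℂ) else 0) =
      ∫ z, {z : ℝ × ℝ | ε < |z.1 - z.2|}.indicator (oscSym a b) z := fun ε hε => by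
    have h4 := (integral_eq_integral_add_swap (hinteg ε hε) 1).2
    rw [one_mul] at h4
    rw [← h4]
    refine integral_congr_ae (Eventually.of_forall fun z => ?_)
    simp only [indicator_apply, mem_ofPred_eq, Prod.fst_swap, Prod.snd_swap, oscSym,
      abs_sub_comm z.2 z.1]
    split_ifs with h
    · rw [← neg_sub z.1 z.2, div_neg, ← one_div_mul_one_div, div_eq_mul_one_div (z.1 + z.2),
        div_eq_mul_one_div (z.2 + z.1)]
      push_cast
      ring
    · simp
  have hlim : Tendsto (fun ε : ℝ => ∫ z, {z : ℝ × ℝ | ε < |z.1 - z.2|}.indicator (oscSym a b) z)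
      (𝓝[>] 0) (𝓝 (∫ z, oscSym a b z)) := by
    refine tendsto_integral_filter_of_dominated_convergence (fun z => ‖oscSym a b z‖)
      (Eventually.of_forall fun ε =>
        ((measurable_oscSym hma hmb).indicator (hset ε)).aestronglyMeasurable)
      (Eventually.of_forall fun ε => Eventually.of_forall fun z => norm_indicator_le_norm_self _ _)
      (integrable_oscSym ha hb).norm (Eventually.of_forall fun z => ?_)
    by_cases hz : z.1 - z.2 = 0
    · have : oscSym a b z = 0 := by simp [oscSym, hz]
      simp [indicator_apply, this]
    · refine tendsto_const_nhds.congr' ?_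
      have h0 := abs_pos.2 hz
      filter_upwards [nhdsWithin_le_nhds (Iio_mem_nhds h0)] with ε hε
      rw [indicator_of_mem (show z ∈ {z : ℝ × ℝ | ε < |z.1 - z.2|} from hε)]
  rw [pv, e0]
  refine hlim.congr' ?_
  filter_upwards [self_mem_nhdsWithin] with ε hε
  exact (hsym ε hε).symm

end

/-! ### Decay of oscillatory integrals with Lipschitz amplitudes -/

section

variable {c L m : ℝ} {a : ℝ → ℂ}

lemma mem_ann_half {l h : ℝ} (hl : l ∈ ann c) (hh : |h| ≤ c / 2) (hh' : |h| ≤ c⁻¹) :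
    l + h ∈ ann (c / 2) := by
  have h1 := abs_sub_abs_le_abs_sub l (-h)
  have h2 := abs_add_le l h
  rw [abs_neg, sub_neg_eq_add] at h1
  refine ⟨by linarith [hl.1], h2.trans ?_⟩
  rw [inv_div, div_eq_mul_inv]
  linarith [hl.2]

/-- Integration by parts for an amplitude that is merely Lipschitz: the derivative of the
exponential is replaced by a difference quotient, and a translation moves the difference onto the
amplitude. The right side does not depend on t. -/
lemma norm_integral_mul_deriv_exp_k0_le (m t : ℝ) (ha : IsAmp c L a) :
    ‖∫ l, a l * (Complex.I * ((2 * t * (m / 4 * (1 - (l ^ 2)⁻¹)) : ℝ) : ℂ) *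
      Complex.exp (Complex.I * ((2 * t * k0 m l : ℝ) : ℂ)))‖ ≤ L * (4 * c⁻¹) := by
  set F : ℝ → ℂ := fun l => Complex.exp (Complex.I * ((2 * t * k0 m l : ℝ) : ℂ)) with hF
  have hk := measurable_k0 m
  have hFm : Measurable F := by rw [hF]; fun_prop
  have hFn : ∀ l, ‖F l‖ = 1 := fun l => norm_expI _
  have hc := ha.pos
  have hc' := inv_pos.2 hc
  have hL := ha.nonneg
  have ham := ha.measurable
  have hinteg : ∀ (g : ℝ → ℂ) (h h' : ℝ), Integrable g → Integrable fun l => g (l + h) * F (l + h') :=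
    fun g h h' hg => (hg.comp_add_right h).mul_bdd (c := 1)
      (hFm.comp (measurable_add_const h')).aestronglyMeasurable
      (Eventually.of_forall fun l => (hFn _).le)
  set K := 2 * |t| * (|m| / 4 * (1 + (c / 2)⁻¹ * (c / 2)⁻¹)) with hK
  have hlim : Tendsto (fun h : ℝ => ∫ l, a l * ((F (l + h) - F l) * ((h⁻¹ : ℝ) : ℂ))) (𝓝[≠] 0)
      (𝓝 (∫ l, a l * (Complex.I * ((2 * t * (m / 4 * (1 - (l ^ 2)⁻¹)) : ℝ) : ℂ) * F l))) := by
    refine tendsto_integral_filter_of_dominated_convergence (fun l => ‖a l‖ * K)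
      (Eventually.of_forall fun h => Measurable.aestronglyMeasurable (by fun_prop)) ?_
      (ha.integrable.norm.mul_const _) (Eventually.of_forall fun l => ?_)
    -- So small a shift keeps `l + h` in the annulus with constant `c / 2`, away from the
    -- singularity of k₀ at zero.
    · have h1 : ∀ᶠ h : ℝ in 𝓝[≠] 0, |h| < min (c / 2) c⁻¹ := by
        refine nhdsWithin_le_nhds ?_
        have : Tendsto (fun h : ℝ => |h|) (𝓝 0) (𝓝 0) := by simpa using continuous_abs.tendsto (0:ℝ)
        exact this.eventually (Iio_mem_nhds (by positivity))
      filter_upwards [h1, self_mem_nhdsWithin] with h hh hh0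
      refine Eventually.of_forall fun l => ?_
      rw [norm_mul]
      by_cases hal : a l = 0
      · simp [hal]
      refine mul_le_mul_of_nonneg_left ?_ (norm_nonneg _)
      have hl := ha.mem hal
      have hlh := mem_ann_half hl (hh.le.trans (min_le_left _ _)) (hh.le.trans (min_le_right _ _))
      have hl2 : l ∈ ann (c / 2) := by
        simpa using mem_ann_half (h := 0) hl (by simp; positivity) (by simp; positivity)
      have h2 := norm_expI_sub_le (2 * t * k0 m (l + h)) (2 * t * k0 m l)
      have h3 := abs_k0_sub_le m (half_pos hc) hlh hl2
      rw [← mul_sub, abs_mul, abs_mul, abs_two, ] at h2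
      rw [add_sub_cancel_left] at h3
      have h4 : ‖F (l + h) - F l‖ ≤ K * |h| := by
        refine h2.trans ?_
        rw [hK, mul_assoc (2 * |t|)]
        gcongr
      rw [norm_mul, Complex.norm_real, Real.norm_eq_abs, abs_inv, ← div_eq_mul_inv,
        div_le_iff₀ (abs_pos.2 hh0)]
      exact h4
    · by_cases hal : l = 0
      · simp [hal, ha.map_zero]
      · refine Tendsto.const_mul _ ?_
        have hd : HasDerivAt F
            (Complex.I * ((2 * t * (m / 4 * (1 - (l ^ 2)⁻¹)) : ℝ) : ℂ) * F l) l := by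
          have h1 := ((hasDerivAt_k0 m hal).const_mul (2 * t)).ofReal_comp.const_mul Complex.I
          refine h1.cexp.congr_deriv ?_
          rw [mul_comm]
        have := hd.tendsto_slope_zero
        refine this.congr fun h => ?_
        rw [Complex.real_smul, mul_comm]
  refine le_of_tendsto hlim.norm ?_
  have h1 : ∀ᶠ h : ℝ in 𝓝[≠] 0, |h| < c⁻¹ := by
    refine nhdsWithin_le_nhds ?_
    have : Tendsto (fun h : ℝ => |h|) (𝓝 0) (𝓝 0) := by simpa using continuous_abs.tendsto (0:ℝ)
    exact this.eventually (Iio_mem_nhds hc')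
  filter_upwards [h1, self_mem_nhdsWithin] with h hh hh0
  have e : ∫ l, a l * ((F (l + h) - F l) * ((h⁻¹ : ℝ) : ℂ)) =
      ∫ l, (a (l - h) - a l) * F l * ((h⁻¹ : ℝ) : ℂ) := by
    have i1 : Integrable fun l => a l * F (l + h) := by simpa using hinteg a 0 h ha.integrable
    have i2 : Integrable fun l => a l * F l := by simpa using hinteg a 0 0 ha.integrable
    have i3 : Integrable fun l => a (l - h) * F l := by
      simpa [sub_eq_add_neg] using hinteg a (-h) 0 ha.integrable
    rw [integral_mul_const]
    simp only [← mul_assoc]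
    rw [integral_mul_const]
    congr 1
    simp only [mul_sub, sub_mul]
    rw [integral_sub i1 i2, integral_sub i3 i2]
    congr 1
    rw [← integral_sub_right_eq_self (fun l => a l * F (l + h)) h]
    simp
  rw [e]
  -- As `|h| < c⁻¹`, the amplitude and its translate both live on an interval of length `4 c⁻¹`,
  -- which explains the constant.
  have hs : ∀ l, l ∉ Icc (-(2 * c⁻¹)) (2 * c⁻¹) →
      (a (l - h) - a l) * F l * ((h⁻¹ : ℝ) : ℂ) = 0 := fun l hl => by
    have h2 : ¬ |l| ≤ 2 * c⁻¹ := fun h' => hl (abs_le.1 h')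
    have h3 : a l = 0 := by
      by_contra h'; exact h2 ((ha.abs_le h').trans (by linarith))
    have h4 : a (l - h) = 0 := by
      by_contra h'
      have := ha.abs_le h'
      have := abs_add_le (l - h) h
      rw [sub_add_cancel] at this
      exact h2 (by linarith)
    simp [h3, h4]
  rw [← setIntegral_eq_integral_of_forall_compl_eq_zero hs]
  refine (norm_setIntegral_le_of_norm_le_const (C := L) (by simp) fun l _ => ?_).trans
    (le_of_eq ?_)
  · rw [norm_mul, norm_mul, hFn, mul_one, Complex.norm_real, Real.norm_eq_abs, abs_inv,
      ← div_eq_mul_inv, div_le_iff₀ (abs_pos.2 hh0)]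
    simpa using ha.lip (l - h) l
  · rw [Real.volume_real_Icc_of_le (by linarith)]
    ring

lemma IsAmp.mul_self_arg (ha : IsAmp c L a) :
    IsAmp c (2 * L * (1 + c⁻¹)) (fun l => a l * (l : ℂ)) := by
  have hc' := inv_pos.2 ha.pos
  refine ha.mul (fun l hl => ?_) (fun l _ l' _ => ?_) (by positivity)
  · rw [Complex.norm_real, Real.norm_eq_abs]; linarith [hl.2]
  · rw [← Complex.ofReal_sub, Complex.norm_real, Real.norm_eq_abs]
    nlinarith [abs_nonneg (l - l')]

/-- Because `k1 m l` is `l` times the derivative of k₀, the extra factor k₁ makes the integrand a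
multiple, by `1 / t`, of one that can be integrated by parts despite the critical points. -/
lemma norm_integral_mul_k1_exp_le (m : ℝ) {t : ℝ} (ht : t ≠ 0) (ha : IsAmp c L a) :
    ‖∫ l, a l * ((k1 m l : ℝ) : ℂ) * Complex.exp (Complex.I * ((2 * t * k0 m l : ℝ) : ℂ))‖ ≤
      L * (4 * (1 + c⁻¹) * c⁻¹) / |t| := by
  have h := norm_integral_mul_deriv_exp_k0_le m t ha.mul_self_arg
  have e : ∫ l, a l * (l : ℂ) * (Complex.I * ((2 * t * (m / 4 * (1 - (l ^ 2)⁻¹)) : ℝ) : ℂ) *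
      Complex.exp (Complex.I * ((2 * t * k0 m l : ℝ) : ℂ))) =
      (2 * t : ℝ) * Complex.I * ∫ l, a l * ((k1 m l : ℝ) : ℂ) *
        Complex.exp (Complex.I * ((2 * t * k0 m l : ℝ) : ℂ)) := by
    rw [← integral_const_mul]
    refine integral_congr_ae (Eventually.of_forall fun l => ?_)
    simp only
    have : k1 m l = l * (m / 4 * (1 - (l ^ 2)⁻¹)) := by
      rcases eq_or_ne l 0 with rfl | hl
      · simp [k1]
      · rw [k1]; field_simp
    rw [this]
    push_cast
    ring
  rw [e, norm_mul, norm_mul, Complex.norm_I, Complex.norm_real, Real.norm_eq_abs, abs_mul,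
    abs_two, mul_one] at h
  rw [le_div_iff₀ (abs_pos.2 ht)]
  linarith

lemma abs_k1_sub_le {l l' : ℝ} (m : ℝ) (hc : 0 < c) (hl : l ∈ ann c) (hl' : l' ∈ ann c) :
    |k1 m l - k1 m l'| ≤ |m| / 4 * (1 + c⁻¹ * c⁻¹) * |l - l'| := by
  have h1 := abs_inv_sub_inv_le hc hl hl'
  have e : k1 m l - k1 m l' = m / 4 * ((l - l') - (l⁻¹ - l'⁻¹)) := by
    simp only [k1, one_div]; ring
  rw [e, abs_mul, abs_div, abs_of_pos (by norm_num : (0:ℝ) < 4), mul_assoc]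
  refine mul_le_mul_of_nonneg_left ((abs_sub _ _).trans ?_) (by positivity)
  linarith

lemma abs_k1_le {l : ℝ} (m : ℝ) (hc : 0 < c) (hl : l ∈ ann c) :
    |k1 m l| ≤ |m| / 4 * (2 * c⁻¹) := by
  rw [k1, abs_mul, abs_div, abs_of_pos (by norm_num : (0:ℝ) < 4), one_div]
  refine mul_le_mul_of_nonneg_left ((abs_sub _ _).trans ?_) (by positivity)
  linarith [hl.2, abs_inv_le_of_mem_ann hc hl]

lemma abs_div_sq_add_sq_le {η : ℝ} (hη : 0 < η) (hη1 : η ≤ 1) (x : ℝ) :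
    |x / (x ^ 2 + η ^ 2)| ≤ 1 / η ^ 2 := by
  rw [abs_div, abs_of_pos (by positivity : 0 < x ^ 2 + η ^ 2), div_le_div_iff₀ (by positivity)
    (by positivity), one_mul, ← sq_abs x]
  have := abs_nonneg x
  nlinarith [sq_nonneg (|x| - η), mul_nonneg this hη.le, mul_le_mul_of_nonneg_left hη1 hη.le,
    mul_nonneg this (mul_nonneg hη.le (sub_nonneg.2 hη1))]

lemma abs_div_sq_add_sq_sub_le {η : ℝ} (hη : 0 < η) (x y : ℝ) :
    |x / (x ^ 2 + η ^ 2) - y / (y ^ 2 + η ^ 2)| ≤ 1 / η ^ 2 * |x - y| := by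
  have hx : 0 < x ^ 2 + η ^ 2 := by positivity
  have hy : 0 < y ^ 2 + η ^ 2 := by positivity
  have e : x / (x ^ 2 + η ^ 2) - y / (y ^ 2 + η ^ 2) =
      (η ^ 2 - x * y) / ((x ^ 2 + η ^ 2) * (y ^ 2 + η ^ 2)) * (x - y) := by
    field_simp; ring
  rw [e, abs_mul]
  refine mul_le_mul_of_nonneg_right ?_ (abs_nonneg _)
  rw [abs_div, abs_of_pos (mul_pos hx hy), div_le_div_iff₀ (mul_pos hx hy) (by positivity), one_mul]
  have h1 : |η ^ 2 - x * y| ≤ η ^ 2 + |x * y| := by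
    refine (abs_sub _ _).trans ?_
    rw [abs_of_pos (by positivity : 0 < η ^ 2)]
  have h2 : |x * y| ^ 2 = x ^ 2 * y ^ 2 := by rw [sq_abs]; ring
  have h3 : 2 * |x * y| ≤ x ^ 2 + y ^ 2 := by
    rw [abs_mul, ← sq_abs x, ← sq_abs y]; nlinarith [sq_nonneg (|x| - |y|)]
  have h4 : 0 < η ^ 2 := by positivity
  nlinarith [abs_nonneg (x * y), mul_le_mul_of_nonneg_right h1 h4.le,
    mul_le_mul_of_nonneg_left h3 h4.le, sq_nonneg (x * y)]

lemma integrable_lorentz (κ x₀ : ℝ) (hκ : κ ≠ 0) :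
    Integrable (fun l : ℝ => (1 + (κ * (l - x₀)) ^ 2)⁻¹) ∧
      ∫ l : ℝ, (1 + (κ * (l - x₀)) ^ 2)⁻¹ = |κ⁻¹| * Real.pi := by
  constructor
  · exact ((integrable_inv_one_add_sq.comp_mul_left' hκ).comp_sub_right x₀)
  · rw [integral_sub_right_eq_self (fun l => (1 + (κ * l) ^ 2)⁻¹) x₀,
      Measure.integral_comp_mul_left (fun l => (1 + l ^ 2)⁻¹) κ, integral_univ_inv_one_add_sq,
      smul_eq_mul]

/-- On each half line `|k₁(l)|` is at least `m / 4` times the distance to the zero of k₁ there, by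
the factorisation of k₁² into squares; this gives a Lorentzian of width proportional to η. -/
lemma lorentz_k1_le (hm : 0 < m) {η : ℝ} (hη : 0 < η) {l : ℝ} (hl : l ≠ 0) :
    η ^ 2 / (k1 m l ^ 2 + η ^ 2) ≤ (1 + (m / (4 * η) * (l - 1)) ^ 2)⁻¹ +
      (1 + (m / (4 * η) * (l - -1)) ^ 2)⁻¹ := by
  have key : ∀ x₀ : ℝ, (m / 4 * (l - x₀)) ^ 2 ≤ k1 m l ^ 2 →
      η ^ 2 / (k1 m l ^ 2 + η ^ 2) ≤ (1 + (m / (4 * η) * (l - x₀)) ^ 2)⁻¹ := fun x₀ h => by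
    rw [← one_div, div_le_div_iff₀ (by positivity) (by positivity)]
    have e : η ^ 2 * (1 + (m / (4 * η) * (l - x₀)) ^ 2) = η ^ 2 + (m / 4 * (l - x₀)) ^ 2 := by
      field_simp
    rw [e]; linarith
  have hk : k1 m l ^ 2 = (m / 4) ^ 2 * ((l - 1) ^ 2 * (l + 1) ^ 2 / l ^ 2) := by
    rw [k1]; field_simp; ring
  have hl2 : 0 < l ^ 2 := by positivity
  rcases lt_or_gt_of_ne hl with h | h
  · refine (key (-1) ?_).trans (le_add_of_nonneg_left (by positivity))
    rw [hk, mul_pow, sub_neg_eq_add]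
    refine mul_le_mul_of_nonneg_left ?_ (by positivity)
    rw [le_div_iff₀ hl2, mul_comm]
    refine mul_le_mul_of_nonneg_right ?_ (sq_nonneg _)
    nlinarith
  · refine (key 1 ?_).trans (le_add_of_nonneg_right (by positivity))
    rw [hk, mul_pow]
    refine mul_le_mul_of_nonneg_left ?_ (by positivity)
    rw [le_div_iff₀ hl2]
    refine mul_le_mul_of_nonneg_left ?_ (sq_nonneg _)
    nlinarith

/-- The identity 1 = k₁²/(k₁² + η²) + η²/(k₁² + η²) separates a part containing the factor k₁, where
integration by parts costs `1 / η ^ 2`, from a part concentrated near ±1 with mass O(η). -/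
lemma exists_norm_integral_mul_exp_le_split (hm : 0 < m) (hc : 0 < c) :
    ∃ C, 0 ≤ C ∧ ∀ (L : ℝ) (a : ℝ → ℂ), IsAmp c L a → ∀ (t η : ℝ), t ≠ 0 → 0 < η → η ≤ 1 →
      ‖∫ l, a l * Complex.exp (Complex.I * ((2 * t * k0 m l : ℝ) : ℂ))‖ ≤
        C * L * (η + 1 / (η ^ 2 * |t|)) := by
  have hc' := inv_pos.2 hc
  set K := 1 + |m| / 4 * (1 + c⁻¹ * c⁻¹) with hK
  have hK0 : 0 < K := by positivity
  refine ⟨2 * K * (4 * (1 + c⁻¹) * c⁻¹) + 8 / m * Real.pi, by positivity,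
    fun L a ha t η ht hη hη1 => ?_⟩
  have hL := ha.nonneg
  have ham := ha.measurable
  have hk0 := measurable_k0 m
  have hk1 := measurable_k1 m
  have hexp : Measurable fun l => Complex.exp (Complex.I * ((2 * t * k0 m l : ℝ) : ℂ)) := by
    fun_prop
  have hB : 0 ≤ 1 / η ^ 2 * K := by positivity
  -- The function x/(x² + η²) is bounded by `1 / η ^ 2` (as η ≤ 1) and Lipschitz with the same
  -- constant; the summand `1` in `K` lets one number serve for both bounds.
  have h1 : IsAmp c (2 * L * (1 / η ^ 2 * K))
      (fun l => a l * ((k1 m l / (k1 m l ^ 2 + η ^ 2) : ℝ) : ℂ)) := by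
    refine ha.mul (fun l hl => ?_) (fun l hl l' hl' => ?_) hB
    · rw [Complex.norm_real, Real.norm_eq_abs]
      refine (abs_div_sq_add_sq_le hη hη1 _).trans ?_
      refine le_mul_of_one_le_right (by positivity) ?_
      rw [hK]; linarith [(by positivity : 0 ≤ |m| / 4 * (1 + c⁻¹ * c⁻¹))]
    · rw [← Complex.ofReal_sub, Complex.norm_real, Real.norm_eq_abs]
      refine (abs_div_sq_add_sq_sub_le hη _ _).trans ?_
      rw [mul_assoc]
      refine mul_le_mul_of_nonneg_left ((abs_k1_sub_le m hc hl hl').trans ?_) (by positivity)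
      rw [hK]; nlinarith [abs_nonneg (l - l')]
  have hle : ∀ l : ℝ, |k1 m l ^ 2 / (k1 m l ^ 2 + η ^ 2)| ≤ 1 ∧
      |η ^ 2 / (k1 m l ^ 2 + η ^ 2)| ≤ 1 := fun l => by
    constructor
    · rw [abs_of_nonneg (by positivity), div_le_one (by positivity)]; nlinarith
    · rw [abs_of_nonneg (by positivity), div_le_one (by positivity)]; nlinarith [sq_nonneg (k1 m l)]
  have i0 : Integrable fun l => a l * Complex.exp (Complex.I * ((2 * t * k0 m l : ℝ) : ℂ)) :=
    ha.integrable.mul_bdd (c := 1) hexp.aestronglyMeasurable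
      (Eventually.of_forall fun l => (norm_expI _).le)
  have i1 : Integrable fun l => a l * Complex.exp (Complex.I * ((2 * t * k0 m l : ℝ) : ℂ)) *
      ((k1 m l ^ 2 / (k1 m l ^ 2 + η ^ 2) : ℝ) : ℂ) :=
    i0.mul_bdd (c := 1) (Measurable.aestronglyMeasurable (by fun_prop))
      (Eventually.of_forall fun l => by rw [Complex.norm_real]; exact (hle l).1)
  have i2 : Integrable fun l => a l * Complex.exp (Complex.I * ((2 * t * k0 m l : ℝ) : ℂ)) *
      ((η ^ 2 / (k1 m l ^ 2 + η ^ 2) : ℝ) : ℂ) :=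
    i0.mul_bdd (c := 1) (Measurable.aestronglyMeasurable (by fun_prop))
      (Eventually.of_forall fun l => by rw [Complex.norm_real]; exact (hle l).2)
  have hsplit : ∫ l, a l * Complex.exp (Complex.I * ((2 * t * k0 m l : ℝ) : ℂ)) =
      (∫ l, a l * Complex.exp (Complex.I * ((2 * t * k0 m l : ℝ) : ℂ)) *
        ((k1 m l ^ 2 / (k1 m l ^ 2 + η ^ 2) : ℝ) : ℂ)) +
      ∫ l, a l * Complex.exp (Complex.I * ((2 * t * k0 m l : ℝ) : ℂ)) *
        ((η ^ 2 / (k1 m l ^ 2 + η ^ 2) : ℝ) : ℂ) := by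
    rw [← integral_add i1 i2]
    refine integral_congr_ae (Eventually.of_forall fun l => ?_)
    simp only
    rw [← mul_add, ← Complex.ofReal_add, ← add_div, div_self (by positivity), Complex.ofReal_one,
      mul_one]
  have b1 : ‖∫ l, a l * Complex.exp (Complex.I * ((2 * t * k0 m l : ℝ) : ℂ)) *
        ((k1 m l ^ 2 / (k1 m l ^ 2 + η ^ 2) : ℝ) : ℂ)‖ ≤
      2 * L * (1 / η ^ 2 * K) * (4 * (1 + c⁻¹) * c⁻¹) / |t| := by
    have h2 := norm_integral_mul_k1_exp_le m ht h1
    refine le_of_eq_of_le (congrArg norm ?_) h2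
    refine integral_congr_ae (Eventually.of_forall fun l => ?_)
    simp only
    rw [sq (k1 m l)]
    push_cast
    ring
  have b2 : ‖∫ l, a l * Complex.exp (Complex.I * ((2 * t * k0 m l : ℝ) : ℂ)) *
        ((η ^ 2 / (k1 m l ^ 2 + η ^ 2) : ℝ) : ℂ)‖ ≤ L * (8 / m * Real.pi) * η := by
    have hκ : m / (4 * η) ≠ 0 := by positivity
    obtain ⟨j1, j2⟩ := integrable_lorentz (m / (4 * η)) 1 hκ
    obtain ⟨j3, j4⟩ := integrable_lorentz (m / (4 * η)) (-1) hκ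
    have h3 := norm_integral_le_of_norm_le ((j1.fun_add j3).const_mul L)
      (f := fun l => a l * Complex.exp (Complex.I * ((2 * t * k0 m l : ℝ) : ℂ)) *
        ((η ^ 2 / (k1 m l ^ 2 + η ^ 2) : ℝ) : ℂ)) (Eventually.of_forall fun l => ?_)
    · refine h3.trans (le_of_eq ?_)
      rw [integral_const_mul, integral_add j1 j3, j2, j4, abs_of_pos (by positivity)]
      field_simp
      ring
    · by_cases hal : a l = 0
      · simp only [hal, zero_mul, norm_zero]; positivity
      · have hl0 : l ≠ 0 := fun h => hal (h ▸ ha.map_zero)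
        rw [norm_mul, norm_mul, norm_expI, mul_one, Complex.norm_real, Real.norm_eq_abs,
          abs_of_nonneg (by positivity)]
        exact mul_le_mul (ha.bdd l) (lorentz_k1_le hm hη hl0) (by positivity) hL
  rw [hsplit]
  refine (norm_add_le _ _).trans ((add_le_add b1 b2).trans ?_)
  have ht' := abs_pos.2 ht
  have e : 2 * L * (1 / η ^ 2 * K) * (4 * (1 + c⁻¹) * c⁻¹) / |t| =
      2 * K * (4 * (1 + c⁻¹) * c⁻¹) * L * (1 / (η ^ 2 * |t|)) := by
    field_simp
  rw [e]
  have p1 : 0 ≤ 2 * K * (4 * (1 + c⁻¹) * c⁻¹) * L * η := by positivity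
  have p2 : 0 ≤ 8 / m * Real.pi * L * (1 / (η ^ 2 * |t|)) := by positivity
  nlinarith

lemma norm_integral_le_of_supp {f : ℝ → ℂ} {B T : ℝ} (hB : ∀ l, ‖f l‖ ≤ B) (hT : 0 ≤ T)
    (hf : ∀ l, f l ≠ 0 → |l| ≤ T) : ‖∫ l, f l‖ ≤ B * (2 * T) := by
  have hs : ∀ l, l ∉ Icc (-T) T → f l = 0 := fun l hl => by
    by_contra h; exact hl (abs_le.1 (hf l h))
  rw [← setIntegral_eq_integral_of_forall_compl_eq_zero hs]
  refine (norm_setIntegral_le_of_norm_le_const (C := B) (by simp) fun l _ => hB l).trans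
    (le_of_eq ?_)
  rw [Real.volume_real_Icc_of_le (by linarith)]
  ring

/-- Uniform decay of the oscillatory integrals, without and with the factor `k₁`. -/
lemma exists_oscillatory_decay (hm : 0 < m) (hc : 0 < c) :
    ∃ C, 0 ≤ C ∧ ∀ (L : ℝ) (a : ℝ → ℂ), IsAmp c L a → ∀ t : ℝ,
      ‖∫ l, a l * Complex.exp (Complex.I * ((2 * t * k0 m l : ℝ) : ℂ))‖ ≤
        C * L * (1 + |t|) ^ (-(1 / 3 : ℝ)) ∧
      ‖∫ l, a l * ((k1 m l : ℝ) : ℂ) * Complex.exp (Complex.I * ((2 * t * k0 m l : ℝ) : ℂ))‖ ≤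
        C * L * (1 + |t|) ^ (-1 : ℝ) := by
  obtain ⟨C, hC, h⟩ := exists_norm_integral_mul_exp_le_split hm hc
  have hc' := inv_pos.2 hc
  set D1 := 4 * C + 2 * (2 * c⁻¹) with hD1
  set D2 := 2 * (4 * (1 + c⁻¹) * c⁻¹) + 2 * (|m| / 4 * (2 * c⁻¹) * (2 * c⁻¹)) with hD2
  have p1 : 0 ≤ D1 := by positivity
  have p2 : 0 ≤ D2 := by positivity
  refine ⟨D1 + D2, by positivity, fun L a ha t => ?_⟩
  have hL := ha.nonneg
  have ht1 : 0 < 1 + |t| := by positivity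
  have q1 : 0 ≤ (1 + |t|) ^ (-(1 / 3 : ℝ)) := by positivity
  have q2 : 0 ≤ (1 + |t|) ^ (-1 : ℝ) := by positivity
  have bd1 : ‖∫ l, a l * Complex.exp (Complex.I * ((2 * t * k0 m l : ℝ) : ℂ))‖ ≤
      L * (2 * c⁻¹) := by
    refine norm_integral_le_of_supp (fun l => ?_) hc'.le fun l hl =>
      ha.abs_le (left_ne_zero_of_mul hl)
    rw [norm_mul, norm_expI, mul_one]; exact ha.bdd l
  have bd2 : ‖∫ l, a l * ((k1 m l : ℝ) : ℂ) *
      Complex.exp (Complex.I * ((2 * t * k0 m l : ℝ) : ℂ))‖ ≤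
      L * (|m| / 4 * (2 * c⁻¹)) * (2 * c⁻¹) := by
    refine norm_integral_le_of_supp (fun l => ?_) hc'.le fun l hl =>
      ha.abs_le (left_ne_zero_of_mul (left_ne_zero_of_mul hl))
    rw [norm_mul, norm_mul, norm_expI, mul_one, Complex.norm_real]
    by_cases hal : a l = 0
    · simp [hal]; positivity
    · exact mul_le_mul (ha.bdd l) (abs_k1_le m hc (ha.mem hal)) (norm_nonneg _) hL
  constructor
  · suffices hs : ‖∫ l, a l * Complex.exp (Complex.I * ((2 * t * k0 m l : ℝ) : ℂ))‖ ≤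
        D1 * L * (1 + |t|) ^ (-(1 / 3 : ℝ)) by
      nlinarith [mul_nonneg (mul_nonneg p2 hL) q1]
    rcases le_or_gt |t| 1 with ht | ht
    · have h2 : (1 / 2 : ℝ) ≤ (1 + |t|) ^ (-(1 / 3 : ℝ)) := by
        have h3 : (2 : ℝ) ^ (-(1 / 3 : ℝ)) ≤ (1 + |t|) ^ (-(1 / 3 : ℝ)) :=
          Real.rpow_le_rpow_of_nonpos ht1 (by linarith) (by norm_num)
        have h4 : (2 : ℝ) ^ (-1 : ℝ) ≤ (2 : ℝ) ^ (-(1 / 3 : ℝ)) :=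
          Real.rpow_le_rpow_of_exponent_le (by norm_num) (by norm_num)
        rw [Real.rpow_neg_one] at h4
        linarith
      have h5 : D1 * L * (1 / 2) ≤ D1 * L * (1 + |t|) ^ (-(1 / 3 : ℝ)) :=
        mul_le_mul_of_nonneg_left h2 (by positivity)
      have h6 : 0 ≤ C * L := by positivity
      rw [hD1] at h5
      nlinarith
    · have ht0 : 0 < |t| := by linarith
      -- This η balances the two errors, η = 1/(η²|t|). The exponent 1/3 is enough, since together
      -- with the rate 1 of the other integral it exceeds 1.
      have h2 := h L a ha t (|t| ^ (-(1 / 3 : ℝ))) (abs_pos.1 ht0) (by positivity)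
        (Real.rpow_le_one_of_one_le_of_nonpos ht.le (by norm_num))
      have e1 : (|t| ^ (-(1 / 3 : ℝ))) ^ 2 * |t| = |t| ^ (1 / 3 : ℝ) := by
        rw [← Real.rpow_natCast, ← Real.rpow_mul ht0.le]
        nth_rw 2 [← Real.rpow_one |t|]
        rw [← Real.rpow_add ht0]
        norm_num
      rw [e1, one_div (|t| ^ (1 / 3 : ℝ)), ← Real.rpow_neg ht0.le] at h2
      have e2 : |t| ^ (-(1 / 3 : ℝ)) ≤ 2 * (1 + |t|) ^ (-(1 / 3 : ℝ)) := by
        have h3 : (2 * |t|) ^ (-(1 / 3 : ℝ)) ≤ (1 + |t|) ^ (-(1 / 3 : ℝ)) :=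
          Real.rpow_le_rpow_of_nonpos ht1 (by linarith) (by norm_num)
        rw [Real.mul_rpow (by norm_num) ht0.le] at h3
        have h4 : (2 : ℝ) ^ (-1 : ℝ) ≤ (2 : ℝ) ^ (-(1 / 3 : ℝ)) :=
          Real.rpow_le_rpow_of_exponent_le (by norm_num) (by norm_num)
        rw [Real.rpow_neg_one] at h4
        have h5 : 0 ≤ |t| ^ (-(1 / 3 : ℝ)) := by positivity
        nlinarith
      have h6 : C * L * (|t| ^ (-(1 / 3 : ℝ)) + |t| ^ (-(1 / 3 : ℝ))) ≤
          C * L * (4 * (1 + |t|) ^ (-(1 / 3 : ℝ))) :=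
        mul_le_mul_of_nonneg_left (by linarith) (by positivity)
      have h7 : 0 ≤ 2 * (2 * c⁻¹) * L * (1 + |t|) ^ (-(1 / 3 : ℝ)) := by positivity
      rw [hD1]
      nlinarith
  · suffices hs : ‖∫ l, a l * ((k1 m l : ℝ) : ℂ) *
        Complex.exp (Complex.I * ((2 * t * k0 m l : ℝ) : ℂ))‖ ≤
        D2 * L * (1 + |t|) ^ (-1 : ℝ) by
      nlinarith [mul_nonneg (mul_nonneg p1 hL) q2]
    rw [Real.rpow_neg_one]
    have p3 : 0 ≤ 4 * (1 + c⁻¹) * c⁻¹ := by positivity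
    have p4 : 0 ≤ |m| / 4 * (2 * c⁻¹) * (2 * c⁻¹) := by positivity
    rcases le_or_gt |t| 1 with ht | ht
    · refine bd2.trans ?_
      rw [← div_eq_mul_inv (D2 * L), le_div_iff₀ ht1, hD2]
      nlinarith [mul_nonneg p4 hL, mul_nonneg p3 hL, mul_le_mul_of_nonneg_left ht (mul_nonneg p4 hL)]
    · have ht0 : 0 < |t| := by linarith
      refine (norm_integral_mul_k1_exp_le m (abs_pos.1 ht0) ha).trans ?_
      rw [← div_eq_mul_inv (D2 * L), div_le_div_iff₀ ht0 ht1, hD2]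
      nlinarith [mul_nonneg p4 hL, mul_nonneg p3 hL, mul_nonneg (mul_nonneg p4 hL) ht0.le,
        mul_le_mul_of_nonneg_left ht.le (mul_nonneg p3 hL)]

end

/-! ### Variation of the Jost solutions with the data -/

/-- The data `p + ε (h, k)`. -/
def perturb (p : Phase) (h k : SchwartzMap ℝ ℝ) (ε : ℝ) : Phase :=
  (fun t => p.1 t + ε * h t, fun t => p.2 t + ε * k t)

lemma tendsto_pow_mul_iteratedDeriv_schwartz (h : SchwartzMap ℝ ℝ) (k n : ℕ) :
    Tendsto (fun t => t ^ k * iteratedDeriv n h t) (cocompact ℝ) (𝓝 0) := by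
  obtain ⟨C, -, hC⟩ := h.decay (k + 1) n
  have hinv : Tendsto (fun t : ℝ => C * ‖t‖⁻¹) (cocompact ℝ) (𝓝 0) := by
    simpa using (tendsto_inv_atTop_zero.comp (tendsto_norm_cocompact_atTop (E := ℝ))).const_mul C
  refine squeeze_zero_norm' ?_ hinv
  have h0 : ∀ᶠ t : ℝ in cocompact ℝ, 0 < ‖t‖ :=
    tendsto_norm_cocompact_atTop.eventually (eventually_gt_atTop 0)
  filter_upwards [h0] with t ht
  rw [norm_mul, norm_pow, ← norm_iteratedFDeriv_eq_norm_iteratedDeriv, ← div_eq_mul_inv,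
    le_div_iff₀ ht]
  have := hC t
  rw [pow_succ] at this
  linarith

/-- Schwartz variations preserve the phase space and its charges, so the Jost theory applies to
every perturbed configuration. -/
lemma RapidLimit.add_schwartz {f : ℝ → ℝ} {F : Filter ℝ} {c : ℝ} (hF : F ≤ cocompact ℝ)
    (hf : ContDiff ℝ ∞ f) (hr : RapidLimit f F c) (h : SchwartzMap ℝ ℝ) (ε : ℝ) :
    RapidLimit (fun t => f t + ε * h t) F c := by
  intro k n
  have h1 := (hr k n).add (((tendsto_pow_mul_iteratedDeriv_schwartz h k n).mono_left hF).const_mul ε)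
  simp only [mul_zero, add_zero] at h1
  refine h1.congr fun t => ?_
  have hn : ((n : ℕ∞) : WithTop ℕ∞) ≤ ((⊤ : ℕ∞) : WithTop ℕ∞) := by exact_mod_cast le_top
  have c1 : ContDiffAt ℝ n (fun s => f s - c) t := ((hf.sub contDiff_const).of_le hn).contDiffAt
  have c2 : ContDiffAt ℝ n (h : ℝ → ℝ) t := (h.smooth n).contDiffAt
  have c3 : ContDiffAt ℝ n (fun s => ε * h s) t := contDiffAt_const.mul c2
  have e : (fun s => f s + ε * h s - c) = (fun s => f s - c) + fun s => ε * h s := by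
    ext s; simp; ring
  rw [e, iteratedDeriv_add c1 c3, iteratedDeriv_const_mul_field]
  ring

lemma IsPhasePoint.perturb {β : ℝ} {Qm Qp : ℤ} {p : Phase} (hp : IsPhasePoint β Qm Qp p)
    (h k : SchwartzMap ℝ ℝ) (ε : ℝ) : IsPhasePoint β Qm Qp (perturb p h k ε) where
  smooth_fst := hp.smooth_fst.add (contDiff_const.mul (h.smooth _))
  smooth_snd := hp.smooth_snd.add (contDiff_const.mul (k.smooth _))
  fst_atBot := hp.fst_atBot.add_schwartz atBot_le_cocompact hp.smooth_fst h ε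
  fst_atTop := hp.fst_atTop.add_schwartz atTop_le_cocompact hp.smooth_fst h ε
  snd_atBot := hp.snd_atBot.add_schwartz atBot_le_cocompact hp.smooth_snd k ε
  snd_atTop := hp.snd_atTop.add_schwartz atTop_le_cocompact hp.smooth_snd k ε

/-- The derivative of the Lax matrix with respect to `φ(t)`. -/
def laxVPhi (m β : ℝ) (p : Phase) (l t : ℝ) : Mat :=
  (Complex.I * ((k0 m l * (β / 2 * Real.sin (β * p.1 t / 2)) : ℝ) : ℂ)) • pauli2
    - (Complex.I * ((k1 m l * (β / 2 * Real.cos (β * p.1 t / 2)) : ℝ) : ℂ)) • pauli1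

/-- The derivative of the Lax matrix with respect to `Π(t)`. -/
def laxVPi (β : ℝ) : Mat := (Complex.I * ((β / 4 : ℝ) : ℂ)) • pauli3

lemma abs_sin_add_sub_sub_le (x y : ℝ) :
    |Real.sin (x + y) - Real.sin x - y * Real.cos x| ≤ y ^ 2 := by
  have hd : ∀ s ∈ Icc (-|y|) |y|, HasDerivWithinAt
      (fun s => Real.sin (x + s) - s * Real.cos x) (Real.cos (x + s) - Real.cos x)
      (Icc (-|y|) |y|) s := fun s _ => by
    have h1 := ((hasDerivAt_id s).const_add x).sin
    have h2 := (hasDerivAt_id s).mul_const (Real.cos x)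
    refine ((h1.sub h2).congr_deriv ?_).hasDerivWithinAt
    simp
  have hb : ∀ s ∈ Icc (-|y|) |y|, ‖Real.cos (x + s) - Real.cos x‖ ≤ |y| := fun s hs => by
    have := Real.abs_cos_sub_cos_le (x + s) x
    rw [add_sub_cancel_left] at this
    exact this.trans (abs_le.2 hs)
  have hmv := (convex_Icc (-|y|) |y|).norm_image_sub_le_of_norm_hasDerivWithin_le hd hb
    (x := 0) (y := y) (by simp) (abs_le.1 le_rfl)
  simp only [add_zero, zero_mul, sub_zero, Real.norm_eq_abs] at hmv
  rw [← sq, sq_abs] at hmv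
  rwa [show Real.sin (x + y) - Real.sin x - y * Real.cos x =
    Real.sin (x + y) - y * Real.cos x - Real.sin x by ring]

/-- The estimate for the sine, shifted by a quarter period. -/
lemma abs_cos_add_sub_add_le (x y : ℝ) :
    |Real.cos (x + y) - Real.cos x + y * Real.sin x| ≤ y ^ 2 := by
  have h := abs_sin_add_sub_sub_le (x + Real.pi / 2) y
  rwa [show x + Real.pi / 2 + y = x + y + Real.pi / 2 by ring, Real.sin_add_pi_div_two,
    Real.sin_add_pi_div_two, Real.cos_add_pi_div_two, mul_neg, sub_neg_eq_add] at h

lemma abs_k0_le {c l : ℝ} (m : ℝ) (hc : 0 < c) (hl : l ∈ ann c) :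
    |k0 m l| ≤ |m| / 4 * (2 * c⁻¹) := by
  rw [k0, abs_mul, abs_div, abs_of_pos (by norm_num : (0:ℝ) < 4), one_div]
  refine mul_le_mul_of_nonneg_left ((abs_add_le _ _).trans ?_) (by positivity)
  linarith [hl.2, abs_inv_le_of_mem_ann hc hl]

/-- A matrix `i (x σ₃ - y σ₁ - z σ₂)` is small when `x`, `y`, `z` are. -/
lemma norm_pauli_combination_le (x y z : ℝ) :
    ‖(Complex.I * (x : ℂ)) • pauli3 - (Complex.I * (y : ℂ)) • pauli1
      - (Complex.I * (z : ℂ)) • pauli2‖ ≤ 2 * (|x| + |y| + |z|) := by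
  refine norm_le_of_entries _ fun i j => ?_
  have hx := abs_nonneg x
  have hy := abs_nonneg y
  have hz := abs_nonneg z
  have key : ‖-(Complex.I * (y : ℂ)) - (z : ℂ)‖ ≤ |y| + |z| ∧
      ‖-(Complex.I * (y : ℂ)) + (z : ℂ)‖ ≤ |y| + |z| := by
    constructor
    · refine (norm_sub_le _ _).trans (le_of_eq ?_)
      simp [Complex.norm_real]
    · refine (norm_add_le _ _).trans (le_of_eq ?_)
      simp [Complex.norm_real]
  have hI : ∀ w : ℂ, Complex.I * w * Complex.I = -w := fun w => by
    rw [mul_comm, ← mul_assoc, Complex.I_mul_I]; ring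
  fin_cases i <;> fin_cases j <;>
    simp [pauli1, pauli2, pauli3, hI]
  · linarith
  · have := key.1; linarith
  · have := key.2; linarith
  · linarith

section

variable {m β c : ℝ} {Qm Qp : ℤ} {p : Phase} {l : ℝ}

/-- The first variation of the Lax matrix in the direction `(h, k)`. -/
def laxVariation (m β : ℝ) (p : Phase) (h k : SchwartzMap ℝ ℝ) (l t : ℝ) : Mat :=
  ((h t : ℝ) : ℂ) • laxVPhi m β p l t + ((k t : ℝ) : ℂ) • laxVPi β

lemma laxVariation_eq (h k : SchwartzMap ℝ ℝ) (t : ℝ) :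
    laxVariation m β p h k l t =
      (Complex.I * ((β / 4 * k t : ℝ) : ℂ)) • pauli3
      - (Complex.I * ((k1 m l * (β / 2 * h t * Real.cos (β * p.1 t / 2)) : ℝ) : ℂ)) • pauli1
      - (Complex.I * ((-(k0 m l * (β / 2 * h t * Real.sin (β * p.1 t / 2))) : ℝ) : ℂ)) • pauli2 := by
  simp only [laxVariation, laxVPhi, laxVPi, smul_sub, smul_smul]
  push_cast
  module

lemma laxV_perturb_sub (h k : SchwartzMap ℝ ℝ) (ε t : ℝ) :
    laxV m β (perturb p h k ε) l t - laxV m β p l t =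
      (Complex.I * ((β / 4 * (ε * k t) : ℝ) : ℂ)) • pauli3
      - (Complex.I * ((k1 m l * (Real.sin (β * p.1 t / 2 + β / 2 * (ε * h t))
          - Real.sin (β * p.1 t / 2)) : ℝ) : ℂ)) • pauli1
      - (Complex.I * ((k0 m l * (Real.cos (β * p.1 t / 2 + β / 2 * (ε * h t))
          - Real.cos (β * p.1 t / 2)) : ℝ) : ℂ)) • pauli2 := by
  have e : β * (p.1 t + ε * h t) / 2 = β * p.1 t / 2 + β / 2 * (ε * h t) := by ring
  simp only [laxV, perturb, e]
  push_cast
  module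

/-- A bound for `|k₀|` and `|k₁|` on `ann c`. -/
def kBound (m c : ℝ) : ℝ := 1 + |m| / 4 * (2 * c⁻¹)

lemma one_le_kBound (hc : 0 < c) : 1 ≤ kBound m c := by
  have := inv_pos.2 hc
  unfold kBound
  linarith [(by positivity : 0 ≤ |m| / 4 * (2 * c⁻¹))]

lemma abs_le_kBound (hc : 0 < c) (hl : l ∈ ann c) : |k0 m l| ≤ kBound m c ∧ |k1 m l| ≤ kBound m c :=
  ⟨(abs_k0_le m hc hl).trans (by unfold kBound; linarith),
    (abs_k1_le m hc hl).trans (by unfold kBound; linarith)⟩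

lemma norm_laxVariation_le (hc : 0 < c) (hl : l ∈ ann c) (h k : SchwartzMap ℝ ℝ) (t : ℝ) :
    ‖laxVariation m β p h k l t‖ ≤ 2 * |β| * kBound m c * (|h t| + |k t|) := by
  obtain ⟨h0, h1⟩ := abs_le_kBound (m := m) hc hl
  have hK := one_le_kBound (m := m) hc
  have hK0 : 0 ≤ kBound m c := by linarith
  rw [laxVariation_eq]
  refine (norm_pauli_combination_le _ _ _).trans ?_
  rw [abs_neg, abs_mul, abs_mul, abs_mul (k0 m l), abs_mul (β / 2 * h t), abs_mul (β / 2 * h t),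
    abs_mul (β / 2), abs_div, abs_div, abs_two, abs_of_pos (by norm_num : (0:ℝ) < 4)]
  have e1 : |k1 m l| * (|β| / 2 * |h t| * |Real.cos (β * p.1 t / 2)|) ≤
      kBound m c * (|β| / 2 * |h t| * 1) := by
    gcongr; exact Real.abs_cos_le_one _
  have e2 : |k0 m l| * (|β| / 2 * |h t| * |Real.sin (β * p.1 t / 2)|) ≤
      kBound m c * (|β| / 2 * |h t| * 1) := by
    gcongr; exact Real.abs_sin_le_one _
  have e3 : |β| * |k t| ≤ kBound m c * (|β| * |k t|) :=
    le_mul_of_one_le_left (by positivity) hK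
  nlinarith [abs_nonneg β, abs_nonneg (k t)]

lemma norm_laxV_perturb_sub_le (hc : 0 < c) (hl : l ∈ ann c) (h k : SchwartzMap ℝ ℝ) (ε t : ℝ) :
    ‖laxV m β (perturb p h k ε) l t - laxV m β p l t‖ ≤
      2 * |β| * kBound m c * |ε| * (|h t| + |k t|) := by
  obtain ⟨h0, h1⟩ := abs_le_kBound (m := m) hc hl
  have hK := one_le_kBound (m := m) hc
  have hK0 : 0 ≤ kBound m c := by linarith
  rw [laxV_perturb_sub]
  refine (norm_pauli_combination_le _ _ _).trans ?_
  have s1 := Real.abs_sin_sub_sin_le (β * p.1 t / 2 + β / 2 * (ε * h t)) (β * p.1 t / 2)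
  have s2 := Real.abs_cos_sub_cos_le (β * p.1 t / 2 + β / 2 * (ε * h t)) (β * p.1 t / 2)
  rw [add_sub_cancel_left, abs_mul (β / 2), abs_mul ε, abs_div, abs_two] at s1 s2
  rw [abs_mul, abs_mul (k1 m l), abs_mul (k0 m l), abs_mul ε, abs_div,
    abs_of_pos (by norm_num : (0:ℝ) < 4)]
  have e1 := mul_le_mul h1 s1 (abs_nonneg _) hK0
  have e2 := mul_le_mul h0 s2 (abs_nonneg _) hK0
  have e3 : |β| * (|ε| * |k t|) ≤ kBound m c * (|β| * (|ε| * |k t|)) :=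
    le_mul_of_one_le_left (by positivity) hK
  nlinarith [(by positivity : 0 ≤ |β| * (|ε| * |k t|))]

lemma norm_laxV_perturb_sub_sub_le (hc : 0 < c) (hl : l ∈ ann c) (h k : SchwartzMap ℝ ℝ)
    (ε t : ℝ) :
    ‖laxV m β (perturb p h k ε) l t - laxV m β p l t - (ε : ℂ) • laxVariation m β p h k l t‖ ≤
      kBound m c * β ^ 2 * ε ^ 2 * h t ^ 2 := by
  obtain ⟨h0, h1⟩ := abs_le_kBound (m := m) hc hl
  have hK := one_le_kBound (m := m) hc
  have hK0 : 0 ≤ kBound m c := by linarith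
  have e : laxV m β (perturb p h k ε) l t - laxV m β p l t -
      (ε : ℂ) • laxVariation m β p h k l t =
      (Complex.I * ((0 : ℝ) : ℂ)) • pauli3
      - (Complex.I * ((k1 m l * (Real.sin (β * p.1 t / 2 + β / 2 * (ε * h t))
          - Real.sin (β * p.1 t / 2) - β / 2 * (ε * h t) * Real.cos (β * p.1 t / 2)) : ℝ) : ℂ)) •
          pauli1
      - (Complex.I * ((k0 m l * (Real.cos (β * p.1 t / 2 + β / 2 * (ε * h t))
          - Real.cos (β * p.1 t / 2) + β / 2 * (ε * h t) * Real.sin (β * p.1 t / 2)) : ℝ) : ℂ)) •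
          pauli2 := by
    rw [laxV_perturb_sub, laxVariation_eq]
    push_cast
    module
  rw [e]
  refine (norm_pauli_combination_le _ _ _).trans ?_
  have s1 := abs_sin_add_sub_sub_le (β * p.1 t / 2) (β / 2 * (ε * h t))
  have s2 := abs_cos_add_sub_add_le (β * p.1 t / 2) (β / 2 * (ε * h t))
  rw [abs_zero, abs_mul, abs_mul (k0 m l)]
  have e1 := mul_le_mul h1 s1 (abs_nonneg _) hK0
  have e2 := mul_le_mul h0 s2 (abs_nonneg _) hK0
  nlinarith

/-- The frame contains Ω and hence depends on φ. Two configurations with the same asymptotics have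
asymptotically equal frames, so their solutions Ψ may be compared at infinity. -/
lemma tendsto_star_frame_mul_frame (m l : ℝ) {p p' : Phase} {F : Filter ℝ}
    (hF : Tendsto (fun t => p'.1 t - p.1 t) F (𝓝 0)) :
    Tendsto (fun t => star (frame m β p l t) * frame m β p' l t) F (𝓝 1) := by
  have h1 : Tendsto (fun t => expPauli3 (Complex.I * ((β * (p'.1 t - p.1 t) / 4 : ℝ) : ℂ))) F
      (𝓝 1) := by
    have hc : Continuous fun x : ℝ => expPauli3 (Complex.I * ((β * x / 4 : ℝ) : ℂ)) := by
      refine continuous_matrix fun i j => ?_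
      fin_cases i <;> fin_cases j <;> simp [expPauli3] <;> fun_prop
    have h0 := (hc.tendsto 0).comp hF
    simp only [mul_zero, zero_div, Complex.ofReal_zero, expPauli3_zero] at h0
    exact h0
  rw [tendsto_iff_norm_sub_tendsto_zero] at h1 ⊢
  refine h1.congr fun t => ?_
  have hE := vacuumE_mem_unitary m l t
  have hO : star (gaugeOmega β p t) * gaugeOmega β p' t =
      expPauli3 (Complex.I * ((β * (p'.1 t - p.1 t) / 4 : ℝ) : ℂ)) := by
    unfold gaugeOmega
    rw [star_expPauli3, expPauli3_mul]
    congr 1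
    push_cast
    ring
  rw [frame, frame, star_mul, mul_assoc, ← mul_assoc (star (gaugeOmega β p t)), hO]
  set X := expPauli3 (Complex.I * ((β * (p'.1 t - p.1 t) / 4 : ℝ) : ℂ))
  have e : star (vacuumE m l t) * (X * vacuumE m l t) - 1 =
      star (vacuumE m l t) * (X - 1) * vacuumE m l t := by
    rw [mul_sub, mul_one, sub_mul, Unitary.star_mul_self_of_mem hE, mul_assoc]
  rw [e]
  refine le_antisymm ?_ ?_
  · have e2 : X - 1 = vacuumE m l t * (star (vacuumE m l t) * (X - 1) * vacuumE m l t) *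
        star (vacuumE m l t) := by
      have := Unitary.mul_star_self_of_mem hE
      calc X - 1 = (vacuumE m l t * star (vacuumE m l t)) * (X - 1) *
            (vacuumE m l t * star (vacuumE m l t)) := by rw [this, one_mul, mul_one]
        _ = _ := by noncomm_ring
    conv_lhs => rw [e2]
    refine (norm_mul_le _ _).trans ?_
    rw [norm_star_unitary hE, mul_one]
    refine (norm_mul_le _ _).trans ?_
    rw [norm_unitary hE, one_mul]
  · exact norm_star_mul_mul_le hE hE

lemma tendsto_perturb_sub (h k : SchwartzMap ℝ ℝ) (ε : ℝ) {F : Filter ℝ} (hF : F ≤ cocompact ℝ) :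
    Tendsto (fun t => (perturb p h k ε).1 t - p.1 t) F (𝓝 0) := by
  have h1 := ((tendsto_pow_mul_iteratedDeriv_schwartz h 0 0).mono_left hF).const_mul ε
  simp only [mul_zero] at h1
  refine h1.congr fun t => ?_
  simp [perturb]

lemma IsPhasePoint.continuous_laxV (hp : IsPhasePoint β Qm Qp p) (m l : ℝ) :
    Continuous (laxV m β p l) := by
  have h1 := hp.smooth_fst.continuous
  have h2 := hp.smooth_snd.continuous
  unfold laxV
  fun_prop

lemma integrable_variation_bound (h k : SchwartzMap ℝ ℝ) :
    Integrable fun t => |h t| + |k t| := h.integrable.abs.add k.integrable.abs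

lemma continuous_laxVariation (hp : IsPhasePoint β Qm Qp p) (m l : ℝ) (h k : SchwartzMap ℝ ℝ) :
    Continuous (laxVariation m β p h k l) := by
  have h1 := hp.smooth_fst.continuous
  have h2 := h.continuous
  have h3 := k.continuous
  unfold laxVariation laxVPhi laxVPi
  fun_prop

lemma continuous_psiMinus (hβ : β ≠ 0) (hp : IsPhasePoint β Qm Qp p) (hl : l ≠ 0) :
    Continuous (psiMinus m β p l) :=
  continuous_iff_continuousAt.2 fun t => (hasDerivAt_psiMinus hβ hp hl t).continuousAt

lemma continuous_psiPlus (hβ : β ≠ 0) (hp : IsPhasePoint β Qm Qp p) (hl : l ≠ 0) :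
    Continuous (psiPlus m β p l) :=
  continuous_iff_continuousAt.2 fun t => (hasDerivAt_psiPlus hβ hp hl t).continuousAt

/-- The comparison is made for the original Lax matrix: it does not decay, but its change under a
Schwartz variation is integrable in t. -/
lemma norm_psiMinus_sub_perturb_le (hβ : β ≠ 0) (hp : IsPhasePoint β Qm Qp p) (hc : 0 < c)
    (hl : l ∈ ann c) (h k : SchwartzMap ℝ ℝ) (ε t : ℝ) :
    ‖psiMinus m β p l t - psiMinus m β (perturb p h k ε) l t‖ ≤
      2 * |β| * kBound m c * |ε| * ∫ s, (|h s| + |k s|) := by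
  have hl0 := ne_zero_of_mem_ann hc hl
  have hp' := hp.perturb h k ε
  have hK := one_le_kBound (m := m) hc
  have hi := (integrable_variation_bound h k).const_mul (2 * |β| * kBound m c * |ε|)
  have hlim : Tendsto (fun t => star (psiMinus m β p l t) * psiMinus m β (perturb p h k ε) l t)
      atBot (𝓝 1) := by
    have h1 := (isJost_jostMinus (m := m) hβ hp hl0).lim.star.mul
      ((tendsto_star_frame_mul_frame (β := β) m l
        (tendsto_perturb_sub (p := p) h k ε atBot_le_cocompact)).mul
        (isJost_jostMinus (m := m) hβ hp' hl0).lim)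
    simp only [star_one, mul_one] at h1
    refine h1.congr fun t => ?_
    rw [psiMinus, psiMinus, star_mul]
    noncomm_ring
  have hc1 := norm_sub_le_integral_Iic (star_laxV m β p l)
    (hasDerivAt_psiMinus (m := m) hβ hp hl0) (hasDerivAt_psiMinus hβ hp' hl0)
    (psiMinus_mem_unitary hβ hp hl0) (psiMinus_mem_unitary hβ hp' hl0)
    (hp.continuous_laxV m l) (hp'.continuous_laxV m l) hlim (t := t) hi.integrableOn
    (fun s _ => norm_laxV_perturb_sub_le hc hl h k ε s)
  refine hc1.trans ?_
  rw [← integral_const_mul]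
  exact setIntegral_le_integral hi (Eventually.of_forall fun s => by
    have : 0 ≤ kBound m c := by linarith
    simp only [Pi.zero_apply]; positivity)

/-- The difference of the monodromy matrices of two configurations with the same asymptotics. -/
lemma timeMonodromy_perturb_sub (hβ : β ≠ 0) (hp : IsPhasePoint β Qm Qp p) (hc : 0 < c)
    (hl : l ∈ ann c) (h k : SchwartzMap ℝ ℝ) (ε : ℝ) :
    timeMonodromy m β (perturb p h k ε) l - timeMonodromy m β p l =
      ∫ t, star (psiPlus m β p l t) * (laxV m β (perturb p h k ε) l t - laxV m β p l t) *
        psiMinus m β (perturb p h k ε) l t := by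
  have hl0 := ne_zero_of_mem_ann hc hl
  have hp' := hp.perturb h k ε
  have hi : Integrable fun t => star (psiPlus m β p l t) *
      (laxV m β (perturb p h k ε) l t - laxV m β p l t) * psiMinus m β (perturb p h k ε) l t := by
    refine ((integrable_variation_bound h k).const_mul (2 * |β| * kBound m c * |ε|)).mono'
      (((continuous_psiPlus hβ hp hl0).star.mul ((hp'.continuous_laxV m l).sub
        (hp.continuous_laxV m l))).mul (continuous_psiMinus hβ hp' hl0)).aestronglyMeasurable
      (Eventually.of_forall fun t => ?_)
    exact (norm_star_mul_mul_le (psiPlus_mem_unitary hβ hp hl0 t)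
      (psiMinus_mem_unitary hβ hp' hl0 t)).trans (norm_laxV_perturb_sub_le hc hl h k ε t)
  have e : ∀ t, star (psiPlus m β p l t) * psiMinus m β (perturb p h k ε) l t =
      star (jostPlus m β p l t) * ((star (frame m β p l t) * frame m β (perturb p h k ε) l t) *
        jostMinus m β (perturb p h k ε) l t) := fun t => by
    rw [psiPlus, psiMinus, star_mul]; noncomm_ring
  have ltop : Tendsto (fun t => star (psiPlus m β p l t) * psiMinus m β (perturb p h k ε) l t)
      atTop (𝓝 (timeMonodromy m β (perturb p h k ε) l)) := by
    have h1 := (tendsto_jostPlus (m := m) hβ hp hl0).star.mul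
      ((tendsto_star_frame_mul_frame (β := β) m l
        (tendsto_perturb_sub (p := p) h k ε atTop_le_cocompact)).mul
        (tendsto_jostMinus_atTop (m := m) hβ hp' hl0))
    simp only [star_one, one_mul] at h1
    simpa only [e] using h1
  have lbot : Tendsto (fun t => star (psiPlus m β p l t) * psiMinus m β (perturb p h k ε) l t)
      atBot (𝓝 (timeMonodromy m β p l)) := by
    -- At -∞ the solution normalised at +∞ tends to T*, so the product runs from T to the perturbed
    -- T and the integral of its derivative is their difference.
    have hj : Tendsto (fun t => star (jostPlus m β p l t)) atBot (𝓝 (timeMonodromy m β p l)) := by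
      have h2 := (isJost_jostMinus (m := m) hβ hp hl0).lim.star.const_mul (timeMonodromy m β p l)
      simp only [star_one, mul_one] at h2
      refine h2.congr fun t => ?_
      rw [jostPlus, star_mul, star_star]
    have h1 := hj.mul ((tendsto_star_frame_mul_frame (β := β) m l
        (tendsto_perturb_sub (p := p) h k ε atBot_le_cocompact)).mul
        (isJost_jostMinus (m := m) hβ hp' hl0).lim)
    simp only [mul_one] at h1
    simpa only [e] using h1
  exact (integral_of_hasDerivAt_of_tendsto (fun t => hasDerivAt_star_mul (star_laxV m β p l)
    (hasDerivAt_psiPlus (m := m) hβ hp hl0 t) (hasDerivAt_psiMinus hβ hp' hl0 t)) hi lbot ltop).symm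

lemma integrable_star_psiPlus_mul_laxVariation (hβ : β ≠ 0) (hp : IsPhasePoint β Qm Qp p)
    (hc : 0 < c) (hl : l ∈ ann c) (h k : SchwartzMap ℝ ℝ) :
    Integrable fun t => star (psiPlus m β p l t) * laxVariation m β p h k l t *
      psiMinus m β p l t := by
  have hl0 := ne_zero_of_mem_ann hc hl
  refine ((integrable_variation_bound h k).const_mul (2 * |β| * kBound m c)).mono'
    (((continuous_psiPlus hβ hp hl0).star.mul (continuous_laxVariation hp m l h k)).mul
      (continuous_psiMinus hβ hp hl0)).aestronglyMeasurable (Eventually.of_forall fun t => ?_)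
  exact (norm_star_mul_mul_le (psiPlus_mem_unitary hβ hp hl0 t)
    (psiMinus_mem_unitary hβ hp hl0 t)).trans (norm_laxVariation_le hc hl h k t)

/-- First-order expansion with a quadratic error uniform in l on the annulus; the uniformity permits
differentiation under the smearing integral. -/
lemma norm_timeMonodromy_perturb_sub_le (hβ : β ≠ 0) (hp : IsPhasePoint β Qm Qp p) (hc : 0 < c)
    (hl : l ∈ ann c) (h k : SchwartzMap ℝ ℝ) (ε : ℝ) :
    ‖timeMonodromy m β (perturb p h k ε) l - timeMonodromy m β p l - (ε : ℂ) •
      ∫ t, star (psiPlus m β p l t) * laxVariation m β p h k l t * psiMinus m β p l t‖ ≤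
      (∫ t, (kBound m c * β ^ 2 * h t ^ 2 + (2 * |β| * kBound m c) ^ 2 *
        (∫ s, (|h s| + |k s|)) * (|h t| + |k t|))) * ε ^ 2 := by
  have hl0 := ne_zero_of_mem_ann hc hl
  have hp' := hp.perturb h k ε
  have hK := one_le_kBound (m := m) hc
  have hK0 : 0 ≤ kBound m c := by linarith
  have hi := integrable_star_psiPlus_mul_laxVariation (m := m) hβ hp hc hl h k
  have hi' : Integrable fun t => star (psiPlus m β p l t) *
      (laxV m β (perturb p h k ε) l t - laxV m β p l t) * psiMinus m β (perturb p h k ε) l t := by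
    refine ((integrable_variation_bound h k).const_mul (2 * |β| * kBound m c * |ε|)).mono'
      (((continuous_psiPlus hβ hp hl0).star.mul ((hp'.continuous_laxV m l).sub
        (hp.continuous_laxV m l))).mul (continuous_psiMinus hβ hp' hl0)).aestronglyMeasurable
      (Eventually.of_forall fun t => ?_)
    exact (norm_star_mul_mul_le (psiPlus_mem_unitary hβ hp hl0 t)
      (psiMinus_mem_unitary hβ hp' hl0 t)).trans (norm_laxV_perturb_sub_le hc hl h k ε t)
  have hh2 : Integrable fun t => h t ^ 2 := by
    obtain ⟨B, -, hB⟩ := h.decay 0 0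
    simp only [pow_zero, one_mul, norm_iteratedFDeriv_zero] at hB
    simp only [sq]
    exact h.integrable.mul_bdd (c := B) h.continuous.aestronglyMeasurable (Eventually.of_forall hB)
  rw [timeMonodromy_perturb_sub hβ hp hc hl, ← integral_smul,
    ← integral_sub hi' (hi.fun_smul (ε : ℂ)),
    ← integral_mul_const]
  refine norm_integral_le_of_norm_le (((hh2.const_mul _).fun_add
    ((integrable_variation_bound h k).const_mul _)).mul_const _) (Eventually.of_forall fun t => ?_)
  -- Two sources of error: the Taylor remainder of the Lax matrix, and the replacement of the
  -- perturbed Ψ₋ by the unperturbed one inside a term already of order ε.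
  have e : star (psiPlus m β p l t) * (laxV m β (perturb p h k ε) l t - laxV m β p l t) *
      psiMinus m β (perturb p h k ε) l t - (ε : ℂ) •
        (star (psiPlus m β p l t) * laxVariation m β p h k l t * psiMinus m β p l t) =
      star (psiPlus m β p l t) * (laxV m β (perturb p h k ε) l t - laxV m β p l t -
        (ε : ℂ) • laxVariation m β p h k l t) * psiMinus m β (perturb p h k ε) l t -
      (ε : ℂ) • (star (psiPlus m β p l t) * laxVariation m β p h k l t *
        (psiMinus m β p l t - psiMinus m β (perturb p h k ε) l t)) := by
    simp only [mul_sub, sub_mul, mul_smul_comm, smul_mul_assoc, smul_sub]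
    abel
  rw [e]
  refine (norm_sub_le _ _).trans ?_
  have b1 := (norm_star_mul_mul_le (psiPlus_mem_unitary (m := m) hβ hp hl0 t)
    (psiMinus_mem_unitary (m := m) hβ hp' hl0 t)).trans
      (norm_laxV_perturb_sub_sub_le (m := m) (β := β) (p := p) hc hl h k ε t)
  have b2 : ‖(ε : ℂ) • (star (psiPlus m β p l t) * laxVariation m β p h k l t *
        (psiMinus m β p l t - psiMinus m β (perturb p h k ε) l t))‖ ≤
      |ε| * ((2 * |β| * kBound m c * (|h t| + |k t|)) *
        (2 * |β| * kBound m c * |ε| * ∫ s, (|h s| + |k s|))) := by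
    rw [norm_smul, Complex.norm_real, Real.norm_eq_abs]
    refine mul_le_mul_of_nonneg_left ((norm_mul_le _ _).trans (mul_le_mul ?_
      (norm_psiMinus_sub_perturb_le hβ hp hc hl h k ε t) (norm_nonneg _) (by positivity)))
      (abs_nonneg _)
    refine (norm_mul_le _ _).trans ?_
    rw [norm_star_unitary (psiPlus_mem_unitary hβ hp hl0 t), one_mul]
    exact norm_laxVariation_le hc hl h k t
  refine (add_le_add b1 b2).trans (le_of_eq ?_)
  rw [← sq_abs ε]
  ring

end

/-! ### Functional derivatives of the smeared monodromy matrix -/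

/-- An amplitude vanishes in a whole neighbourhood of zero, so the other factor may be arbitrary
where the parameter is zero. -/
lemma IsAmp.continuousAt_mul {X : Type*} [TopologicalSpace X] {c L : ℝ} {a : ℝ → ℂ}
    (ha : IsAmp c L a) {g : X → ℝ} {x : X} (hg : ContinuousAt g x) {F : X → ℂ}
    (hF : g x ≠ 0 → ContinuousAt F x) : ContinuousAt (fun x => a (g x) * F x) x := by
  by_cases hx : g x = 0
  · have h1 : ∀ᶠ y in 𝓝 x, |g y| < c := by
      have : Tendsto (fun y => |g y|) (𝓝 x) (𝓝 |g x|) := hg.abs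
      rw [hx, abs_zero] at this
      exact this.eventually (Iio_mem_nhds ha.pos)
    refine (continuousAt_const (y := (0 : ℂ))).congr ?_
    filter_upwards [h1] with y hy
    rw [ha.zero _ fun h => absurd h.1 (not_le.2 hy), zero_mul]
  · exact (ha.continuous.continuousAt.comp hg).mul (hF hx)

lemma IsAmp.continuous_mul {X : Type*} [TopologicalSpace X] {c L : ℝ} {a : ℝ → ℂ}
    (ha : IsAmp c L a) {g : X → ℝ} (hg : Continuous g) {F : X → ℂ}
    (hF : ∀ x, g x ≠ 0 → ContinuousAt F x) : Continuous fun x => a (g x) * F x :=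
  continuous_iff_continuousAt.2 fun x => ha.continuousAt_mul hg.continuousAt (hF x)

section

variable {m β c L : ℝ} {Qm Qp : ℤ} {p : Phase} {a : ℝ → ℂ}

lemma continuousAt_k0 (m : ℝ) {l : ℝ} (hl : l ≠ 0) : ContinuousAt (k0 m) l :=
  (hasDerivAt_k0 m hl).continuousAt

lemma continuousAt_k1 (m : ℝ) {l : ℝ} (hl : l ≠ 0) : ContinuousAt (k1 m) l := by
  unfold k1
  exact continuousAt_const.mul (continuousAt_id.sub (continuousAt_const.div continuousAt_id hl))

lemma exists_lipschitz_jost_const (m : ℝ) (hβ : β ≠ 0) (hp : IsPhasePoint β Qm Qp p)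
    (hc : 0 < c) : ∃ C, 0 ≤ C ∧ ∀ l ∈ ann c, ∀ l' ∈ ann c, ∀ t,
      ‖jostMinus m β p l t - jostMinus m β p l' t‖ ≤ C * |l - l'| ∧
      ‖jostPlus m β p l t - jostPlus m β p l' t‖ ≤ C * |l - l'| := by
  obtain ⟨C, hC, h⟩ := exists_lipschitz_jost m hβ hp hc
  refine ⟨C * Real.pi, by positivity, fun l hl l' hl' t => ?_⟩
  have h1 := Real.neg_pi_div_two_lt_arctan t
  have h2 := Real.arctan_lt_pi_div_two t
  obtain ⟨h3, h4⟩ := (h l hl).1 l' hl' t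
  constructor
  · refine h3.trans ?_
    gcongr; linarith
  · refine h4.trans ?_
    gcongr; linarith

/-- A Lipschitz bound in l uniform in t upgrades separate continuity to joint continuity. -/
lemma continuousAt_of_lipschitz {G : ℝ → ℝ → Mat} {z : ℝ × ℝ} {C : ℝ}
    (hG : ContinuousAt (G z.1) z.2) (hL : ∀ᶠ l in 𝓝 z.1, ∀ t, ‖G l t - G z.1 t‖ ≤ C * |l - z.1|) :
    ContinuousAt (fun z : ℝ × ℝ => G z.1 z.2) z := by
  have h1 : Tendsto (fun y : ℝ × ℝ => C * |y.1 - z.1| + ‖G z.1 y.2 - G z.1 z.2‖) (𝓝 z) (𝓝 0) := by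
    have e1 : Tendsto (fun y : ℝ × ℝ => C * |y.1 - z.1|) (𝓝 z) (𝓝 (C * |z.1 - z.1|)) :=
      Continuous.tendsto (by fun_prop) z
    have e2 : Tendsto (fun y : ℝ × ℝ => G z.1 y.2) (𝓝 z) (𝓝 (G z.1 z.2)) :=
      hG.tendsto.comp (continuous_snd.tendsto z)
    have e3 := tendsto_iff_norm_sub_tendsto_zero.1 e2
    simpa using e1.add e3
  refine tendsto_iff_norm_sub_tendsto_zero.2 (squeeze_zero' (Eventually.of_forall fun y =>
    norm_nonneg _) ?_ h1)
  filter_upwards [(continuous_fst.tendsto z).eventually hL] with y hy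
  have := norm_add_le (G y.1 y.2 - G z.1 y.2) (G z.1 y.2 - G z.1 z.2)
  rw [sub_add_sub_cancel] at this
  linarith [hy y.2]

lemma continuousAt_jostMinus (hβ : β ≠ 0) (hp : IsPhasePoint β Qm Qp p) {z : ℝ × ℝ}
    (hz : z.1 ≠ 0) : ContinuousAt (fun z : ℝ × ℝ => jostMinus m β p z.1 z.2) z := by
  obtain ⟨c, hc, hz1⟩ := exists_mem_ann hz
  obtain ⟨C, hC, h⟩ := exists_lipschitz_jost_const m hβ hp hc
  refine continuousAt_of_lipschitz (C := C)
    ((isJost_jostMinus hβ hp hz).deriv z.2).continuousAt ?_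
  filter_upwards [hz1] with l hl t
  exact (h l hl z.1 hz1.self_of_nhds t).1

lemma continuousAt_jostPlus (hβ : β ≠ 0) (hp : IsPhasePoint β Qm Qp p) {z : ℝ × ℝ}
    (hz : z.1 ≠ 0) : ContinuousAt (fun z : ℝ × ℝ => jostPlus m β p z.1 z.2) z := by
  obtain ⟨c, hc, hz1⟩ := exists_mem_ann hz
  obtain ⟨C, hC, h⟩ := exists_lipschitz_jost_const m hβ hp hc
  refine continuousAt_of_lipschitz (C := C) (hasDerivAt_jostPlus hβ hp hz z.2).continuousAt ?_
  filter_upwards [hz1] with l hl t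
  exact (h l hl z.1 hz1.self_of_nhds t).2

lemma continuousAt_frame (hp : IsPhasePoint β Qm Qp p) {z : ℝ × ℝ} (hz : z.1 ≠ 0) :
    ContinuousAt (fun z : ℝ × ℝ => frame m β p z.1 z.2) z := by
  have h1 : ContinuousAt (fun z : ℝ × ℝ => p.1 z.2) z :=
    (hp.smooth_fst.continuous.comp continuous_snd).continuousAt
  have h2 : ContinuousAt (fun z : ℝ × ℝ => k0 m z.1) z :=
    ContinuousAt.comp (f := Prod.fst) (continuousAt_k0 m hz) continuousAt_fst
  simp only [frame_eq]
  refine continuousAt_pi.2 fun i => continuousAt_pi.2 fun j => ?_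
  fin_cases i <;> fin_cases j <;> simp <;> fun_prop

lemma continuousAt_psiMinus (hβ : β ≠ 0) (hp : IsPhasePoint β Qm Qp p) {z : ℝ × ℝ}
    (hz : z.1 ≠ 0) : ContinuousAt (fun z : ℝ × ℝ => psiMinus m β p z.1 z.2) z :=
  (continuousAt_frame hp hz).mul (continuousAt_jostMinus hβ hp hz)

lemma continuousAt_psiPlus (hβ : β ≠ 0) (hp : IsPhasePoint β Qm Qp p) {z : ℝ × ℝ}
    (hz : z.1 ≠ 0) : ContinuousAt (fun z : ℝ × ℝ => psiPlus m β p z.1 z.2) z :=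
  (continuousAt_frame hp hz).mul (continuousAt_jostPlus hβ hp hz)

lemma continuousAt_laxVPhi (hp : IsPhasePoint β Qm Qp p) {z : ℝ × ℝ} (hz : z.1 ≠ 0) :
    ContinuousAt (fun z : ℝ × ℝ => laxVPhi m β p z.1 z.2) z := by
  have h1 : ContinuousAt (fun z : ℝ × ℝ => p.1 z.2) z :=
    (hp.smooth_fst.continuous.comp continuous_snd).continuousAt
  have h2 : ContinuousAt (fun z : ℝ × ℝ => k0 m z.1) z :=
    ContinuousAt.comp (f := Prod.fst) (continuousAt_k0 m hz) continuousAt_fst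
  have h3 : ContinuousAt (fun z : ℝ × ℝ => k1 m z.1) z :=
    ContinuousAt.comp (f := Prod.fst) (continuousAt_k1 m hz) continuousAt_fst
  unfold laxVPhi
  fun_prop

/-- The density `Ψ₊ᴴ (∂V/∂φ) Ψ₋` of the functional derivative of the monodromy matrix. -/
def kerPhi (m β : ℝ) (p : Phase) (l t : ℝ) : Mat :=
  star (psiPlus m β p l t) * laxVPhi m β p l t * psiMinus m β p l t

/-- The density `Ψ₊ᴴ (∂V/∂Π) Ψ₋` of the functional derivative of the monodromy matrix. -/
def kerPi (m β : ℝ) (p : Phase) (l t : ℝ) : Mat :=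
  star (psiPlus m β p l t) * laxVPi β * psiMinus m β p l t

lemma continuousAt_kerPhi (hβ : β ≠ 0) (hp : IsPhasePoint β Qm Qp p) {z : ℝ × ℝ} (hz : z.1 ≠ 0) :
    ContinuousAt (fun z : ℝ × ℝ => kerPhi m β p z.1 z.2) z :=
  ((continuousAt_psiPlus hβ hp hz).star.mul (continuousAt_laxVPhi hp hz)).mul
    (continuousAt_psiMinus hβ hp hz)

lemma continuousAt_kerPi (hβ : β ≠ 0) (hp : IsPhasePoint β Qm Qp p) {z : ℝ × ℝ} (hz : z.1 ≠ 0) :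
    ContinuousAt (fun z : ℝ × ℝ => kerPi m β p z.1 z.2) z :=
  ((continuousAt_psiPlus hβ hp hz).star.mul continuousAt_const).mul
    (continuousAt_psiMinus hβ hp hz)

lemma continuousAt_entry {X : Type*} [TopologicalSpace X] {G : X → Mat} {x : X}
    (h : ContinuousAt G x) (i j : Fin 2) : ContinuousAt (fun x => G x i j) x :=
  (continuousAt_pi.1 ((continuousAt_pi.1 h) i)) j

lemma norm_kerPhi_le (hβ : β ≠ 0) (hp : IsPhasePoint β Qm Qp p) (hc : 0 < c) {l : ℝ}
    (hl : l ∈ ann c) (t : ℝ) : ‖kerPhi m β p l t‖ ≤ 2 * |β| * kBound m c := by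
  have hl0 := ne_zero_of_mem_ann hc hl
  obtain ⟨h0, h1⟩ := abs_le_kBound (m := m) hc hl
  have hK := one_le_kBound (m := m) hc
  have hK0 : 0 ≤ kBound m c := by linarith
  refine (norm_star_mul_mul_le (psiPlus_mem_unitary hβ hp hl0 t)
    (psiMinus_mem_unitary hβ hp hl0 t)).trans ?_
  have e : laxVPhi m β p l t = (Complex.I * ((0 : ℝ) : ℂ)) • pauli3
      - (Complex.I * ((k1 m l * (β / 2 * Real.cos (β * p.1 t / 2)) : ℝ) : ℂ)) • pauli1
      - (Complex.I * ((-(k0 m l * (β / 2 * Real.sin (β * p.1 t / 2))) : ℝ) : ℂ)) • pauli2 := by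
    unfold laxVPhi
    push_cast
    module
  rw [e]
  refine (norm_pauli_combination_le _ _ _).trans ?_
  rw [abs_zero, abs_neg, abs_mul, abs_mul (k0 m l), abs_mul (β / 2), abs_mul (β / 2), abs_div,
    abs_two]
  have e1 : |k1 m l| * (|β| / 2 * |Real.cos (β * p.1 t / 2)|) ≤ kBound m c * (|β| / 2 * 1) := by
    gcongr; exact Real.abs_cos_le_one _
  have e2 : |k0 m l| * (|β| / 2 * |Real.sin (β * p.1 t / 2)|) ≤ kBound m c * (|β| / 2 * 1) := by
    gcongr; exact Real.abs_sin_le_one _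
  linarith

lemma norm_kerPi_le (hβ : β ≠ 0) (hp : IsPhasePoint β Qm Qp p) (hc : 0 < c) {l : ℝ}
    (hl : l ∈ ann c) (t : ℝ) : ‖kerPi m β p l t‖ ≤ 2 * |β| * kBound m c := by
  have hl0 := ne_zero_of_mem_ann hc hl
  have hK := one_le_kBound (m := m) hc
  refine (norm_star_mul_mul_le (psiPlus_mem_unitary hβ hp hl0 t)
    (psiMinus_mem_unitary hβ hp hl0 t)).trans ?_
  have e : laxVPi β = (Complex.I * ((β / 4 : ℝ) : ℂ)) • pauli3
      - (Complex.I * ((0 : ℝ) : ℂ)) • pauli1 - (Complex.I * ((0 : ℝ) : ℂ)) • pauli2 := by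
    simp [laxVPi]
  rw [e]
  refine (norm_pauli_combination_le _ _ _).trans ?_
  rw [abs_zero, abs_div, abs_of_pos (by norm_num : (0:ℝ) < 4)]
  nlinarith [abs_nonneg β]

/-- The entry in row `i` and column `j`, as a continuous linear map. -/
def entryCLM (i j : Fin 2) : Mat →L[ℂ] ℂ :=
  (Matrix.entryLinearMap ℂ ℂ i j).mkContinuous 1 fun A => by
    rw [one_mul]; exact norm_entry_le A i j

/-- `∫ a(l) K(l, t)_{ij} dl`, for a matrix density `K`. -/
def smearKernel (K : ℝ → ℝ → Mat) (a : ℝ → ℂ) (i j : Fin 2) (t : ℝ) : ℂ := ∫ l, a l * K l t i j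

lemma continuous_amp_mul_kernel {K : ℝ → ℝ → Mat} (ha : IsAmp c L a)
    (hK : ∀ z : ℝ × ℝ, z.1 ≠ 0 → ContinuousAt (fun z : ℝ × ℝ => K z.1 z.2) z) (i j : Fin 2) :
    Continuous fun z : ℝ × ℝ => a z.1 * K z.1 z.2 i j :=
  ha.continuous_mul continuous_fst fun z hz => continuousAt_entry (hK z hz) i j

lemma norm_amp_mul_kernel_le {K : ℝ → ℝ → Mat} {B : ℝ} (ha : IsAmp c L a)
    (hB : ∀ l ∈ ann c, ∀ t, ‖K l t‖ ≤ B) (i j : Fin 2) (l t : ℝ) :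
    ‖a l * K l t i j‖ ≤ ‖a l‖ * B := by
  rw [norm_mul]
  by_cases hl : a l = 0
  · simp [hl]
  · exact mul_le_mul_of_nonneg_left ((norm_entry_le _ i j).trans (hB l (ha.mem hl) t))
      (norm_nonneg _)

lemma continuous_smearKernel {K : ℝ → ℝ → Mat} {B : ℝ} (ha : IsAmp c L a)
    (hK : ∀ z : ℝ × ℝ, z.1 ≠ 0 → ContinuousAt (fun z : ℝ × ℝ => K z.1 z.2) z)
    (hB : ∀ l ∈ ann c, ∀ t, ‖K l t‖ ≤ B) (i j : Fin 2) :
    Continuous (smearKernel K a i j) ∧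
      ∀ t, ‖smearKernel K a i j t‖ ≤ ∫ l, ‖a l‖ * B := by
  have hc := continuous_amp_mul_kernel ha hK i j
  have hb := norm_amp_mul_kernel_le ha hB i j
  refine ⟨continuous_of_dominated (fun t => (hc.comp
    (continuous_id.prodMk continuous_const)).aestronglyMeasurable)
    (fun t => Eventually.of_forall fun l => hb l t) (ha.integrable.norm.mul_const B)
    (Eventually.of_forall fun l => hc.comp (continuous_const.prodMk continuous_id)), fun t => ?_⟩
  exact norm_integral_le_of_norm_le (ha.integrable.norm.mul_const B)
    (Eventually.of_forall fun l => hb l t)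

/-- Fubini between the parameter and time, legitimate because the kernel is bounded on the support
of the amplitude and the variation is integrable. -/
lemma integrable_smearKernel_mul {K : ℝ → ℝ → Mat} {B : ℝ} (ha : IsAmp c L a)
    (hK : ∀ z : ℝ × ℝ, z.1 ≠ 0 → ContinuousAt (fun z : ℝ × ℝ => K z.1 z.2) z)
    (hB : ∀ l ∈ ann c, ∀ t, ‖K l t‖ ≤ B) (i j : Fin 2) (h : SchwartzMap ℝ ℝ) :
    Integrable (fun t => smearKernel K a i j t * (h t : ℂ)) ∧
      Integrable (fun z : ℝ × ℝ => a z.1 * K z.1 z.2 i j * (h z.2 : ℂ)) ∧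
      ∫ t, smearKernel K a i j t * (h t : ℂ) = ∫ l, ∫ t, a l * K l t i j * (h t : ℂ) := by
  obtain ⟨h1, h2⟩ := continuous_smearKernel ha hK hB i j
  have hc := continuous_amp_mul_kernel ha hK i j
  have hh : Integrable fun t => (h t : ℂ) := h.integrable.ofReal
  have hi : Integrable (fun z : ℝ × ℝ => a z.1 * K z.1 z.2 i j * (h z.2 : ℂ)) := by
    have hdom := (ha.integrable.norm.mul_const B).mul_prod (h.integrable (μ := volume)).norm
    refine hdom.mono' (hc.mul (Complex.continuous_ofReal.comp
      (h.continuous.comp continuous_snd))).aestronglyMeasurable (Eventually.of_forall fun z => ?_)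
    rw [norm_mul, Complex.norm_real]
    exact mul_le_mul_of_nonneg_right (norm_amp_mul_kernel_le ha hB i j z.1 z.2) (norm_nonneg _)
  refine ⟨hh.bdd_mul h1.aestronglyMeasurable (Eventually.of_forall h2), hi, ?_⟩
  rw [integral_integral_swap hi]
  simp only [smearKernel, integral_mul_const]

/-- `l ↦ χ(l) M(l)_{ij}` is an amplitude. -/
lemma exists_isAmp_mul_timeMonodromy (m : ℝ) (hβ : β ≠ 0) (hp : IsPhasePoint β Qm Qp p)
    (ha : IsAmp c L a) :
    ∃ L', ∀ i j, IsAmp c L' fun l => a l * timeMonodromy m β p l i j := by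
  obtain ⟨C, hC, h⟩ := exists_lipschitz_timeMonodromy m hβ hp ha.pos
  refine ⟨2 * L * (1 + C), fun i j => ha.mul (fun l hl => ?_) (fun l hl l' hl' => ?_)
    (by positivity)⟩
  · refine (norm_entry_le _ i j).trans ?_
    rw [norm_unitary (timeMonodromy_mem_unitary hβ hp (ne_zero_of_mem_ann ha.pos hl))]
    linarith
  · have := norm_entry_le (timeMonodromy m β p l - timeMonodromy m β p l') i j
    rw [Matrix.sub_apply] at this
    refine this.trans ((h l hl l' hl').trans ?_)
    gcongr; linarith

/-- The first variation of T is integrated against the amplitude, and Fubini moves the smearing onto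
the kernels. -/
lemma hasFunctionalDeriv_smear (m : ℝ) (hβ : β ≠ 0) (hp : IsPhasePoint β Qm Qp p)
    (ha : IsAmp c L a) (i j : Fin 2) :
    HasFunctionalDeriv (smear (fun q l => timeMonodromy m β q l i j) a) p
      (smearKernel (kerPhi m β p) a i j) (smearKernel (kerPi m β p) a i j) := by
  have hc := ha.pos
  have c1 : ∀ z : ℝ × ℝ, z.1 ≠ 0 → ContinuousAt (fun z : ℝ × ℝ => kerPhi m β p z.1 z.2) z :=
    fun z hz => continuousAt_kerPhi hβ hp hz
  have c2 : ∀ z : ℝ × ℝ, z.1 ≠ 0 → ContinuousAt (fun z : ℝ × ℝ => kerPi m β p z.1 z.2) z :=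
    fun z hz => continuousAt_kerPi hβ hp hz
  have b1 : ∀ l ∈ ann c, ∀ t, ‖kerPhi m β p l t‖ ≤ 2 * |β| * kBound m c :=
    fun l hl t => norm_kerPhi_le hβ hp hc hl t
  have b2 : ∀ l ∈ ann c, ∀ t, ‖kerPi m β p l t‖ ≤ 2 * |β| * kBound m c :=
    fun l hl t => norm_kerPi_le hβ hp hc hl t
  refine ⟨(continuous_smearKernel ha c1 b1 i j).1, (continuous_smearKernel ha c2 b2 i j).1,
    fun h => (integrable_smearKernel_mul ha c1 b1 i j h).1,
    fun h => (integrable_smearKernel_mul ha c2 b2 i j h).1, fun h k => ?_⟩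
  obtain ⟨p1, q1, r1⟩ := integrable_smearKernel_mul ha c1 b1 i j h
  obtain ⟨p2, q2, r2⟩ := integrable_smearKernel_mul ha c2 b2 i j k
  set D : ℝ → ℂ := fun l => a l * (∫ t, star (psiPlus m β p l t) * laxVariation m β p h k l t *
    psiMinus m β p l t) i j with hD
  have hDe : ∀ l, D l = (∫ t, a l * kerPhi m β p l t i j * (h t : ℂ)) +
      ∫ t, a l * kerPi m β p l t i j * (k t : ℂ) := fun l => by
    by_cases hal : a l = 0
    · simp [hD, hal]
    have hl := ha.mem hal
    have hl0 := ne_zero_of_mem_ann hc hl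
    have hi := integrable_star_psiPlus_mul_laxVariation (m := m) hβ hp hc hl h k
    have i1 : Integrable fun t => kerPhi m β p l t i j * (h t : ℂ) := by
      refine (h.integrable.ofReal (𝕜 := ℂ)).bdd_mul (c := 2 * |β| * kBound m c)
        (Continuous.aestronglyMeasurable ?_)
        (Eventually.of_forall fun t => (norm_entry_le _ i j).trans (b1 l hl t))
      exact continuous_iff_continuousAt.2 fun t => ContinuousAt.comp (f := fun t => (l, t))
        (continuousAt_entry (c1 (l, t) hl0) i j) (by fun_prop)
    have i2 : Integrable fun t => kerPi m β p l t i j * (k t : ℂ) := by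
      refine (k.integrable.ofReal (𝕜 := ℂ)).bdd_mul (c := 2 * |β| * kBound m c)
        (Continuous.aestronglyMeasurable ?_)
        (Eventually.of_forall fun t => (norm_entry_le _ i j).trans (b2 l hl t))
      exact continuous_iff_continuousAt.2 fun t => ContinuousAt.comp (f := fun t => (l, t))
        (continuousAt_entry (c2 (l, t) hl0) i j) (by fun_prop)
    have e : (∫ t, star (psiPlus m β p l t) * laxVariation m β p h k l t * psiMinus m β p l t) i j =
        ∫ t, (star (psiPlus m β p l t) * laxVariation m β p h k l t * psiMinus m β p l t) i j :=
      (ContinuousLinearMap.integral_comp_comm (entryCLM i j) hi).symm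
    rw [show D l = _ from congrArg (a l * ·) e]
    simp only [mul_assoc (a l), integral_const_mul]
    rw [← mul_add, ← integral_add i1 i2]
    congr 1
    refine integral_congr_ae (Eventually.of_forall fun t => ?_)
    simp only [laxVariation, kerPhi, kerPi, mul_add, add_mul, mul_smul_comm, smul_mul_assoc,
      Matrix.add_apply, Matrix.smul_apply, smul_eq_mul]
    ring
  have hDi : Integrable D := by
    rw [show D = _ from funext hDe]
    exact q1.integral_prod_left.add q2.integral_prod_left
  have hval : ∫ t, (smearKernel (kerPhi m β p) a i j t * (h t : ℂ) +
      smearKernel (kerPi m β p) a i j t * (k t : ℂ)) = ∫ l, D l := by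
    rw [integral_add p1 p2, r1, r2, show D = _ from funext hDe]
    exact (integral_add q1.integral_prod_left q2.integral_prod_left).symm
  rw [hval]
  set E := ∫ t, (kBound m c * β ^ 2 * h t ^ 2 + (2 * |β| * kBound m c) ^ 2 *
        (∫ s, (|h s| + |k s|)) * (|h t| + |k t|)) with hE
  have hMi : ∀ ε, Integrable fun l => a l * timeMonodromy m β (perturb p h k ε) l i j := fun ε =>
    let ⟨_, h⟩ := exists_isAmp_mul_timeMonodromy m hβ (hp.perturb h k ε) ha
    (h i j).integrable
  have hM0 : Integrable fun l => a l * timeMonodromy m β p l i j :=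
    let ⟨_, h⟩ := exists_isAmp_mul_timeMonodromy m hβ hp ha
    (h i j).integrable
  -- The quadratic remainder is uniform on the support of the amplitude and survives integration; an
  -- O(ε²) error gives the derivative at ε = 0.
  have key : ∀ ε : ℝ, ‖smear (fun q l => timeMonodromy m β q l i j) a (perturb p h k ε) -
      smear (fun q l => timeMonodromy m β q l i j) a p - (ε : ℂ) * ∫ l, D l‖ ≤
      (∫ l, ‖a l‖ * E) * ε ^ 2 := fun ε => by
    have hsub : Integrable fun l => a l * timeMonodromy m β (perturb p h k ε) l i j -
        a l * timeMonodromy m β p l i j := Integrable.sub (hMi ε) hM0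
    simp only [smear]
    rw [← integral_sub (hMi ε) hM0, ← integral_const_mul,
      ← integral_sub hsub (hDi.const_mul _), ← integral_mul_const]
    refine norm_integral_le_of_norm_le ((ha.integrable.norm.mul_const E).mul_const _)
      (Eventually.of_forall fun l => ?_)
    by_cases hal : a l = 0
    · simp [hD, hal]
    have hl := ha.mem hal
    have e : a l * timeMonodromy m β (perturb p h k ε) l i j - a l * timeMonodromy m β p l i j -
        (ε : ℂ) * D l = a l * (timeMonodromy m β (perturb p h k ε) l - timeMonodromy m β p l -
        (ε : ℂ) • ∫ t, star (psiPlus m β p l t) * laxVariation m β p h k l t *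
          psiMinus m β p l t) i j := by
      simp only [hD, Matrix.sub_apply, Matrix.smul_apply, smul_eq_mul]
      ring
    rw [e, norm_mul, mul_assoc]
    exact mul_le_mul_of_nonneg_left ((norm_entry_le _ i j).trans
      (norm_timeMonodromy_perturb_sub_le hβ hp hc hl h k ε)) (norm_nonneg _)
  have hp0 : perturb p h k 0 = p := by simp [perturb]
  change HasDerivAt (fun ε : ℝ => smear (fun q l => timeMonodromy m β q l i j) a (perturb p h k ε))
    (∫ l, D l) 0
  rw [hasDerivAt_iff_isLittleO_nhds_zero]
  refine Asymptotics.IsBigO.trans_isLittleO (g := fun ε : ℝ => ε ^ 2) ?_ ?_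
  · refine Asymptotics.IsBigO.of_bound (∫ l, ‖a l‖ * E) (Eventually.of_forall fun ε => ?_)
    have := key ε
    simp only [zero_add, hp0, Complex.real_smul, Real.norm_eq_abs, abs_of_nonneg (sq_nonneg ε)]
    exact this
  · exact Asymptotics.isLittleO_pow_id (by norm_num)

end

/-! ### Decay of the kernels and integrability of the bracket -/

lemma star_expI (x : ℝ) : star (Complex.exp (Complex.I * (x : ℂ))) =
    Complex.exp (-(Complex.I * (x : ℂ))) := by
  rw [Complex.star_def, ← Complex.exp_conj]; simp

/-- A and K stand for exp(iβφ/4) and exp(i k₀ t), A' and K' for their inverses; conjugation of Pauli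
matrices by the frame then becomes polynomial algebra in these symbols. -/
lemma exists_frame_factors (m β : ℝ) (p : Phase) (l t : ℝ) : ∃ s A A' K K' : ℂ,
    s * s = 1 / 2 ∧ A * A' = 1 ∧ K * K' = 1 ∧
    A * A + A' * A' = 2 * ((Real.cos (β * p.1 t / 2) : ℝ) : ℂ) ∧
    A * A - A' * A' = 2 * Complex.I * ((Real.sin (β * p.1 t / 2) : ℝ) : ℂ) ∧
    Complex.exp (Complex.I * ((2 * t * k0 m l : ℝ) : ℂ)) = K * K ∧
    Complex.exp (Complex.I * ((2 * -t * k0 m l : ℝ) : ℂ)) = K' * K' ∧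
    frame m β p l t = !![s * (A * K'), s * (Complex.I * (A * K));
      s * (Complex.I * (A' * K')), s * (A' * K)] ∧
    star (frame m β p l t) = !![s * (A' * K), -(s * (Complex.I * (A * K)));
      -(s * (Complex.I * (A' * K'))), s * (A * K')] := by
  set x := β * p.1 t / 4 with hx
  set y := k0 m l * t with hy
  have e1 : Complex.exp (Complex.I * ((x - y : ℝ) : ℂ)) =
      Complex.exp (Complex.I * x) * Complex.exp (-(Complex.I * y)) := by
    rw [← Complex.exp_add]; congr 1; push_cast; ring
  have e2 : Complex.exp (Complex.I * ((x + y : ℝ) : ℂ)) =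
      Complex.exp (Complex.I * x) * Complex.exp (Complex.I * y) := by
    rw [← Complex.exp_add]; congr 1; push_cast; ring
  have e3 : Complex.exp (-(Complex.I * ((x + y : ℝ) : ℂ))) =
      Complex.exp (-(Complex.I * x)) * Complex.exp (-(Complex.I * y)) := by
    rw [← Complex.exp_add]; congr 1; push_cast; ring
  have e4 : Complex.exp (-(Complex.I * ((x - y : ℝ) : ℂ))) =
      Complex.exp (-(Complex.I * x)) * Complex.exp (Complex.I * y) := by
    rw [← Complex.exp_add]; congr 1; push_cast; ring
  have hf : frame m β p l t = !![((1 / Real.sqrt 2 : ℝ) : ℂ) * (Complex.exp (Complex.I * x) *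
        Complex.exp (-(Complex.I * y))),
      ((1 / Real.sqrt 2 : ℝ) : ℂ) * (Complex.I * (Complex.exp (Complex.I * x) *
        Complex.exp (Complex.I * y)));
      ((1 / Real.sqrt 2 : ℝ) : ℂ) * (Complex.I * (Complex.exp (-(Complex.I * x)) *
        Complex.exp (-(Complex.I * y)))),
      ((1 / Real.sqrt 2 : ℝ) : ℂ) * (Complex.exp (-(Complex.I * x)) *
        Complex.exp (Complex.I * y))] := by
    rw [frame_eq, ← hx, ← hy, e1, e2, e3, e4]
    ext i j
    fin_cases i <;> fin_cases j <;> simp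
  have se : ∀ w : ℝ, star (Complex.exp (-(Complex.I * (w : ℂ)))) =
      Complex.exp (Complex.I * (w : ℂ)) := fun w => by rw [← star_expI, star_star]
  refine ⟨((1 / Real.sqrt 2 : ℝ) : ℂ), Complex.exp (Complex.I * x), Complex.exp (-(Complex.I * x)),
    Complex.exp (Complex.I * y), Complex.exp (-(Complex.I * y)), ?_, ?_, ?_, ?_, ?_, ?_, ?_, hf, ?_⟩
  · rw [← Complex.ofReal_mul, div_mul_div_comm, Real.mul_self_sqrt (by norm_num)]
    norm_num
  · rw [← Complex.exp_add, add_neg_cancel, Complex.exp_zero]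
  · rw [← Complex.exp_add, add_neg_cancel, Complex.exp_zero]
  · rw [Complex.ofReal_cos, Complex.two_cos, ← Complex.exp_add, ← Complex.exp_add]
    congr 2 <;> rw [hx] <;> push_cast <;> ring
  · rw [Complex.ofReal_sin, mul_assoc, mul_left_comm, Complex.two_sin, ← Complex.exp_add,
      ← Complex.exp_add, mul_left_comm, Complex.I_mul_I]
    rw [show Complex.I * x + Complex.I * x = ((β * p.1 t / 2 : ℝ) : ℂ) * Complex.I by
      rw [hx]; push_cast; ring, show -(Complex.I * (x : ℂ)) + -(Complex.I * x) =
      -((β * p.1 t / 2 : ℝ) : ℂ) * Complex.I by rw [hx]; push_cast; ring]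
    ring
  · rw [← Complex.exp_add]; congr 1; rw [hy]; push_cast; ring
  · rw [← Complex.exp_add]; congr 1; rw [hy]; push_cast; ring
  · rw [hf]
    ext i j
    rw [Matrix.star_apply]
    fin_cases i <;> fin_cases j
    all_goals
      simp only [Matrix.of_apply, Matrix.cons_val', Matrix.cons_val_zero, Matrix.cons_val_one,
        Fin.zero_eta, Fin.mk_one, Matrix.cons_val_fin_one, star_mul', se, star_expI,
        Complex.star_def, Complex.conj_I, Complex.conj_ofReal] <;>
      ring

lemma star_frame_mul_pauli3_mul_frame (m β : ℝ) (p : Phase) (l t : ℝ) :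
    star (frame m β p l t) * pauli3 * frame m β p l t =
      !![0, Complex.I * Complex.exp (Complex.I * ((2 * t * k0 m l : ℝ) : ℂ));
        -(Complex.I * Complex.exp (Complex.I * ((2 * -t * k0 m l : ℝ) : ℂ))), 0] := by
  obtain ⟨s, A, A', K, K', hs, hA, hK, hc, hsn, h1, h2, hf, hf'⟩ := exists_frame_factors m β p l t
  rw [h1, h2, hf', hf]
  have hI := Complex.I_mul_I
  ext i j
  fin_cases i <;> fin_cases j <;> simp [pauli3, Matrix.mul_apply, Fin.sum_univ_two]
  · linear_combination (s * s * A * A' * K * K') * hI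
  · linear_combination (2 * Complex.I * A * A' * K * K) * hs + Complex.I * K * K * hA
  · linear_combination (-2 * Complex.I * A * A' * K' * K') * hs - Complex.I * K' * K' * hA
  · linear_combination -(s * s * A * A' * K * K') * hI

lemma star_frame_mul_pauli1_mul_frame (m β : ℝ) (p : Phase) (l t : ℝ) :
    star (frame m β p l t) * pauli1 * frame m β p l t =
      !![((Real.sin (β * p.1 t / 2) : ℝ) : ℂ), ((Real.cos (β * p.1 t / 2) : ℝ) : ℂ) *
          Complex.exp (Complex.I * ((2 * t * k0 m l : ℝ) : ℂ));
        ((Real.cos (β * p.1 t / 2) : ℝ) : ℂ) *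
          Complex.exp (Complex.I * ((2 * -t * k0 m l : ℝ) : ℂ)),
        -((Real.sin (β * p.1 t / 2) : ℝ) : ℂ)] := by
  obtain ⟨s, A, A', K, K', hs, hA, hK, hc, hsn, h1, h2, hf, hf'⟩ := exists_frame_factors m β p l t
  rw [h1, h2, hf', hf]
  have hI := Complex.I_mul_I
  ext i j
  fin_cases i <;> fin_cases j <;>
    simp [pauli1, Matrix.mul_apply, Fin.sum_univ_two, -Complex.ofReal_cos, -Complex.ofReal_sin]
  · linear_combination (-(s * s * Complex.I * K * K')) * hsn + (-2 * s * s * K * K' * ((Real.sin (β * p.1 t / 2) : ℝ) : ℂ)) * hI +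
      (2 * K * K' * ((Real.sin (β * p.1 t / 2) : ℝ) : ℂ)) * hs + ((Real.sin (β * p.1 t / 2) : ℝ) : ℂ) * hK
  · linear_combination (-s * s * A * A * K * K) * hI + s * s * K * K * hc + 2 * ((Real.cos (β * p.1 t / 2) : ℝ) : ℂ) * K * K * hs
  · linear_combination (-s * s * A' * A' * K' * K') * hI + s * s * K' * K' * hc +
      2 * ((Real.cos (β * p.1 t / 2) : ℝ) : ℂ) * K' * K' * hs
  · linear_combination (s * s * Complex.I * K * K') * hsn + (2 * s * s * K * K' * ((Real.sin (β * p.1 t / 2) : ℝ) : ℂ)) * hI -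
      (2 * K * K' * ((Real.sin (β * p.1 t / 2) : ℝ) : ℂ)) * hs - ((Real.sin (β * p.1 t / 2) : ℝ) : ℂ) * hK

section

variable {m β c L : ℝ} {Qm Qp : ℤ} {p : Phase} {a : ℝ → ℂ}

/-- The part of the `φ`-kernel in the moving frame which decays with `sin (β φ / 2)`. -/
lemma exists_star_frame_mul_laxVPhi_mul_frame (m β : ℝ) (p : Phase) (l t : ℝ) : ∃ X : Mat,
    star (frame m β p l t) * laxVPhi m β p l t * frame m β p l t =
      (-(Complex.I * ((β / 2 * k1 m l : ℝ) : ℂ))) •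
        !![0, Complex.exp (Complex.I * ((2 * t * k0 m l : ℝ) : ℂ));
          Complex.exp (Complex.I * ((2 * -t * k0 m l : ℝ) : ℂ)), 0] + X ∧
    ‖X‖ ≤ |β| * (2 * |k0 m l| + |k1 m l|) * |Real.sin (β * p.1 t / 2)| := by
  set S := Real.sin (β * p.1 t / 2) with hS
  set C := Real.cos (β * p.1 t / 2) with hC
  set e := Complex.exp (Complex.I * ((2 * t * k0 m l : ℝ) : ℂ)) with he
  set e' := Complex.exp (Complex.I * ((2 * -t * k0 m l : ℝ) : ℂ)) with he'
  have hSC : (C : ℂ) * C = 1 - S * S := by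
    rw [← Complex.ofReal_mul, ← Complex.ofReal_mul, ← Complex.ofReal_one, ← Complex.ofReal_sub]
    congr 1
    rw [hS, hC]; nlinarith [Real.sin_sq_add_cos_sq (β * p.1 t / 2)]
  have hf := frame_mem_unitary m β p l t
  -- The witness gathers the σ₂ term, which already carries the sine, and what remains of the σ₁
  -- term once cos² is replaced by 1 - sin².
  refine ⟨(Complex.I * ((β / 2 * k0 m l * S : ℝ) : ℂ)) •
      (star (frame m β p l t) * pauli2 * frame m β p l t) +
    (-(Complex.I * ((β / 2 * k1 m l * S : ℝ) : ℂ))) •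
      !![(C : ℂ), -(S * e); -(S * e'), -(C : ℂ)], ?_, ?_⟩
  · have h1 := star_frame_mul_pauli1_mul_frame m β p l t
    have h2 : star (frame m β p l t) * laxVPhi m β p l t * frame m β p l t =
        (Complex.I * ((β / 2 * k0 m l * S : ℝ) : ℂ)) •
          (star (frame m β p l t) * pauli2 * frame m β p l t) -
        (Complex.I * ((β / 2 * k1 m l * C : ℝ) : ℂ)) •
          (star (frame m β p l t) * pauli1 * frame m β p l t) := by
      simp only [laxVPhi, mul_sub, sub_mul, mul_smul_comm, smul_mul_assoc]
      rw [← hS, ← hC]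
      push_cast
      congr 2 <;> ring
    rw [h2, h1, ← hS, ← hC, ← he, ← he', sub_eq_add_neg, add_comm, add_left_comm, add_comm]
    congr 1
    ext i j
    fin_cases i <;> fin_cases j <;> simp [-Complex.ofReal_cos, -Complex.ofReal_sin]
    · ring
    · linear_combination (-(Complex.I * (β / 2 * k1 m l) * e)) * hSC
    · linear_combination (-(Complex.I * (β / 2 * k1 m l) * e')) * hSC
    · ring
  · have hS1 : |S| ≤ 1 := Real.abs_sin_le_one _
    have hC1 : |C| ≤ 1 := Real.abs_cos_le_one _
    have n1 : ‖star (frame m β p l t) * pauli2 * frame m β p l t‖ ≤ 2 * 1 := by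
      refine (norm_star_mul_mul_le hf hf).trans (norm_le_of_entries _ fun i j => ?_)
      fin_cases i <;> fin_cases j <;> simp [pauli2]
    have n2 : ‖(!![(C : ℂ), -(S * e); -(S * e'), -(C : ℂ)] : Mat)‖ ≤ 2 * 1 := by
      have ee : ‖e‖ = 1 := norm_expI _
      have ee' : ‖e'‖ = 1 := norm_expI _
      refine norm_le_of_entries _ fun i j => ?_
      fin_cases i <;> fin_cases j <;> simp [ee, ee', hS1, hC1]
    refine (norm_add_le _ _).trans ?_
    have s1 : ∀ k : ℝ, ‖Complex.I * ((β / 2 * k * S : ℝ) : ℂ)‖ = |β| / 2 * |k| * |S| := fun k => by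
      rw [norm_mul, Complex.norm_I, one_mul, Complex.norm_real, Real.norm_eq_abs, abs_mul, abs_mul,
        abs_div, abs_two]
    rw [norm_smul, norm_smul, norm_neg, s1, s1]
    have m1 := mul_le_mul_of_nonneg_left n1 (by positivity : 0 ≤ |β| / 2 * |k0 m l| * |S|)
    have m2 := mul_le_mul_of_nonneg_left n2 (by positivity : 0 ≤ |β| / 2 * |k1 m l| * |S|)
    have m3 : 0 ≤ |β| * |k0 m l| * |S| := by positivity
    nlinarith

/-- The amplitude constant does not depend on t, so the oscillatory estimates hold uniformly
although the amplitude itself moves with t. -/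
lemma exists_isAmp_mul_jost (m : ℝ) (hβ : β ≠ 0) (hp : IsPhasePoint β Qm Qp p)
    (ha : IsAmp c L a) : ∃ L', ∀ (t : ℝ) (i i' j j' : Fin 2),
      IsAmp c L' fun l => a l * (star (jostPlus m β p l t i' i) * jostMinus m β p l t j' j) := by
  obtain ⟨C, hC, h⟩ := exists_lipschitz_jost_const m hβ hp ha.pos
  refine ⟨2 * L * (1 + 2 * C), fun t i i' j j' => ha.mul (fun l hl => ?_) (fun l hl l' hl' => ?_)
    (by positivity)⟩
  all_goals
    have n1 : ∀ l ∈ ann c, ‖star (jostPlus m β p l t i' i)‖ ≤ 1 := fun l hl => by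
      rw [norm_star]
      refine (norm_entry_le _ _ _).trans ?_
      rw [norm_unitary (jostPlus_mem_unitary hβ hp (ne_zero_of_mem_ann ha.pos hl) t)]
    have n2 : ∀ l ∈ ann c, ‖jostMinus m β p l t j' j‖ ≤ 1 := fun l hl => by
      refine (norm_entry_le _ _ _).trans ?_
      rw [norm_unitary (jostMinus_mem_unitary hβ hp (ne_zero_of_mem_ann ha.pos hl) t)]
  · rw [norm_mul]
    have := mul_le_mul (n1 l hl) (n2 l hl) (norm_nonneg _) zero_le_one
    linarith
  · obtain ⟨h1, h2⟩ := h l hl l' hl' t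
    have d1 : ‖star (jostPlus m β p l t i' i) - star (jostPlus m β p l' t i' i)‖ ≤
        C * |l - l'| := by
      rw [← star_sub, norm_star]
      exact (norm_entry_le (jostPlus m β p l t - jostPlus m β p l' t) i' i).trans h2
    have d2 : ‖jostMinus m β p l t j' j - jostMinus m β p l' t j' j‖ ≤ C * |l - l'| :=
      (norm_entry_le (jostMinus m β p l t - jostMinus m β p l' t) j' j).trans h1
    have e : star (jostPlus m β p l t i' i) * jostMinus m β p l t j' j -
        star (jostPlus m β p l' t i' i) * jostMinus m β p l' t j' j =
        (star (jostPlus m β p l t i' i) - star (jostPlus m β p l' t i' i)) *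
          jostMinus m β p l t j' j + star (jostPlus m β p l' t i' i) *
          (jostMinus m β p l t j' j - jostMinus m β p l' t j' j) := by ring
    rw [e]
    refine (norm_add_le _ _).trans ?_
    rw [norm_mul, norm_mul]
    have m1 := mul_le_mul d1 (n2 l hl) (norm_nonneg _) (by positivity)
    have m2 := mul_le_mul (n1 l' hl') d2 (norm_nonneg _) zero_le_one
    nlinarith [abs_nonneg (l - l')]

lemma star_mul_offDiag_mul_apply (P Q : Mat) (x y : ℂ) (i j : Fin 2) :
    (star P * !![0, x; y, 0] * Q) i j = star (P 0 i) * Q 1 j * x + star (P 1 i) * Q 0 j * y := by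
  simp [Matrix.mul_apply, Fin.sum_univ_two]
  ring

/-- In the moving frame σ₃ becomes purely off-diagonal with phases exp(±2i k₀ t), whence the rate
1/3. For ∂V/∂φ the part that does not decay pointwise has the extra factor k₁, whence the rate 1. -/
lemma exists_kernel_decay (hm : 0 < m) (hβ : β ≠ 0) (hp : IsPhasePoint β Qm Qp p)
    (ha : IsAmp c L a) : ∃ C, 0 ≤ C ∧ ∀ (i j : Fin 2) (t : ℝ),
      ‖smearKernel (kerPi m β p) a i j t‖ ≤ C * (1 + |t|) ^ (-(1 / 3 : ℝ)) ∧
      ‖smearKernel (kerPhi m β p) a i j t‖ ≤ C * (1 + |t|) ^ (-1 : ℝ) := by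
  have hc := ha.pos
  have hc' := inv_pos.2 hc
  obtain ⟨L', hL'⟩ := exists_isAmp_mul_jost m hβ hp ha
  obtain ⟨C, hC, hdec⟩ := exists_oscillatory_decay hm hc
  obtain ⟨D, hD, hdat⟩ := hp.exists_bound hβ
  have hL0 : 0 ≤ L' := (hL' 0 0 0 0 0).nonneg
  have hL := ha.nonneg
  have hK := one_le_kBound (m := m) hc
  have hK0 : 0 ≤ kBound m c := by linarith
  set Y := 2 * (C * L') with hY
  set W := L * (|β| * (3 * kBound m c) * D) * (2 * c⁻¹) with hW
  have hY0 : 0 ≤ Y := by positivity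
  have hW0 : 0 ≤ W := by positivity
  refine ⟨|β| * Y + 2 * W, by positivity, fun i j t => ?_⟩
  have ht1 : 0 < 1 + |t| := by positivity
  have q1 : 0 ≤ (1 + |t|) ^ (-(1 / 3 : ℝ)) := by positivity
  have q2 : 0 ≤ (1 + |t|) ^ (-1 : ℝ) := by positivity
  have a1 := hL' t i 0 j 1
  have a2 := hL' t i 1 j 0
  have d1 := hdec _ _ a1 t
  have d2 := hdec _ _ a2 (-t)
  rw [abs_neg] at d2
  have hk0 := measurable_k0 m
  have hk1 := measurable_k1 m
  have iexp : ∀ (f : ℝ → ℂ), IsAmp c L' f → ∀ s : ℝ,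
      Integrable (fun l => f l * Complex.exp (Complex.I * ((2 * s * k0 m l : ℝ) : ℂ))) ∧
      Integrable (fun l => f l * ((k1 m l : ℝ) : ℂ) *
        Complex.exp (Complex.I * ((2 * s * k0 m l : ℝ) : ℂ))) := fun f hf s => by
    have hfm := hf.measurable
    constructor
    · exact hf.integrable.mul_bdd (c := 1) (Measurable.aestronglyMeasurable (by fun_prop))
        (Eventually.of_forall fun l => (norm_expI _).le)
    · refine (hf.integrable.norm.mul_const (kBound m c)).mono'
        (Measurable.aestronglyMeasurable (by fun_prop)) (Eventually.of_forall fun l => ?_)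
      rw [norm_mul, norm_mul, norm_expI, mul_one, Complex.norm_real]
      by_cases hfl : f l = 0
      · simp [hfl]
      · exact mul_le_mul_of_nonneg_left (abs_le_kBound hc (hf.mem hfl)).2 (norm_nonneg _)
  constructor
  · have e : smearKernel (kerPi m β p) a i j t =
        (-((β / 4 : ℝ) : ℂ)) * (∫ l, a l * (star (jostPlus m β p l t 0 i) * jostMinus m β p l t 1 j) *
          Complex.exp (Complex.I * ((2 * t * k0 m l : ℝ) : ℂ))) +
        ((β / 4 : ℝ) : ℂ) * ∫ l, a l * (star (jostPlus m β p l t 1 i) * jostMinus m β p l t 0 j) *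
          Complex.exp (Complex.I * ((2 * -t * k0 m l : ℝ) : ℂ)) := by
      rw [← integral_const_mul, ← integral_const_mul,
        ← integral_add ((iexp _ a1 t).1.const_mul _) ((iexp _ a2 (-t)).1.const_mul _)]
      refine integral_congr_ae (Eventually.of_forall fun l => ?_)
      have h1 : kerPi m β p l t = (Complex.I * ((β / 4 : ℝ) : ℂ)) • (star (jostPlus m β p l t) *
          (star (frame m β p l t) * pauli3 * frame m β p l t) * jostMinus m β p l t) := by
        simp only [kerPi, laxVPi, psiPlus, psiMinus, star_mul, mul_smul_comm, smul_mul_assoc,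
          mul_assoc]
      simp only [h1, star_frame_mul_pauli3_mul_frame, Matrix.smul_apply,
        star_mul_offDiag_mul_apply, smul_eq_mul]
      linear_combination (a l * ((β / 4 : ℝ) : ℂ) * (star (jostPlus m β p l t 0 i) *
        jostMinus m β p l t 1 j * Complex.exp (Complex.I * ((2 * t * k0 m l : ℝ) : ℂ)) -
        star (jostPlus m β p l t 1 i) * jostMinus m β p l t 0 j *
        Complex.exp (Complex.I * ((2 * -t * k0 m l : ℝ) : ℂ)))) * Complex.I_mul_I
    rw [e]
    refine (norm_add_le _ _).trans ?_
    rw [norm_mul, norm_mul, norm_neg, Complex.norm_real, Real.norm_eq_abs, abs_div,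
      abs_of_pos (by norm_num : (0:ℝ) < 4)]
    have m1 := mul_le_mul_of_nonneg_left d1.1 (by positivity : 0 ≤ |β| / 4)
    have m2 := mul_le_mul_of_nonneg_left d2.1 (by positivity : 0 ≤ |β| / 4)
    have m3 : 0 ≤ W * (1 + |t|) ^ (-(1 / 3 : ℝ)) := by positivity
    have m4 : 0 ≤ |β| * (C * L' * (1 + |t|) ^ (-(1 / 3 : ℝ))) := by positivity
    rw [hY]
    nlinarith
  · have hX := fun l => exists_star_frame_mul_laxVPhi_mul_frame m β p l t
    choose X hX1 hX2 using hX
    have e1 : ∀ l, a l * kerPhi m β p l t i j =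
        (-(Complex.I * ((β / 2 : ℝ) : ℂ))) * (a l * (star (jostPlus m β p l t 0 i) *
          jostMinus m β p l t 1 j) * ((k1 m l : ℝ) : ℂ) *
          Complex.exp (Complex.I * ((2 * t * k0 m l : ℝ) : ℂ))) +
        (-(Complex.I * ((β / 2 : ℝ) : ℂ))) * (a l * (star (jostPlus m β p l t 1 i) *
          jostMinus m β p l t 0 j) * ((k1 m l : ℝ) : ℂ) *
          Complex.exp (Complex.I * ((2 * -t * k0 m l : ℝ) : ℂ))) +
        a l * (star (jostPlus m β p l t) * X l * jostMinus m β p l t) i j := fun l => by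
      have h1 : kerPhi m β p l t = star (jostPlus m β p l t) *
          (star (frame m β p l t) * laxVPhi m β p l t * frame m β p l t) * jostMinus m β p l t := by
        simp only [kerPhi, psiPlus, psiMinus, star_mul, mul_assoc]
      rw [h1, hX1, mul_add, add_mul, mul_smul_comm, smul_mul_assoc, Matrix.add_apply,
        Matrix.smul_apply, star_mul_offDiag_mul_apply, smul_eq_mul]
      push_cast
      ring
    have iA : Integrable fun l => a l * kerPhi m β p l t i j := by
      have hcont := continuous_amp_mul_kernel (K := kerPhi m β p) ha
        (fun z hz => continuousAt_kerPhi hβ hp hz) i j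
      refine (ha.integrable.norm.mul_const (2 * |β| * kBound m c)).mono'
        (hcont.comp (continuous_id.prodMk continuous_const)).aestronglyMeasurable
        (Eventually.of_forall fun l => ?_)
      exact norm_amp_mul_kernel_le ha (fun l hl t => norm_kerPhi_le hβ hp hc hl t) i j l t
    have i1 := ((iexp _ a1 t).2.const_mul (-(Complex.I * ((β / 2 : ℝ) : ℂ))))
    have i2 := ((iexp _ a2 (-t)).2.const_mul (-(Complex.I * ((β / 2 : ℝ) : ℂ))))
    -- The matrix `X` was obtained by choice and is not known to be measurable in l; integrability
    -- follows because it is a difference of integrable terms.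
    have iX : Integrable fun l => a l *
        (star (jostPlus m β p l t) * X l * jostMinus m β p l t) i j := by
      refine (iA.sub (i1.add i2)).congr (Eventually.of_forall fun l => ?_)
      simp only [Pi.sub_apply, Pi.add_apply]
      rw [e1]; ring
    have bX : ‖∫ l, a l * (star (jostPlus m β p l t) * X l * jostMinus m β p l t) i j‖ ≤
        W * (1 / (1 + t ^ 2)) := by
      have := norm_integral_le_of_supp (f := fun l => a l *
        (star (jostPlus m β p l t) * X l * jostMinus m β p l t) i j) (T := c⁻¹)
        (B := L * (|β| * (3 * kBound m c) * (D * (1 / (1 + t ^ 2))))) (fun l => ?_) hc'.le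
        (fun l hl => ha.abs_le (left_ne_zero_of_mul hl))
      · refine this.trans (le_of_eq ?_)
        rw [hW]; ring
      · by_cases hal : a l = 0
        · simp [hal]; positivity
        have hl := ha.mem hal
        have hl0 := ne_zero_of_mem_ann hc hl
        rw [norm_mul]
        refine mul_le_mul (ha.bdd l) ((norm_entry_le _ _ _).trans
          ((norm_star_mul_mul_le (jostPlus_mem_unitary hβ hp hl0 t)
            (jostMinus_mem_unitary hβ hp hl0 t)).trans ((hX2 l).trans ?_))) (norm_nonneg _) hL
        obtain ⟨h0, h1⟩ := abs_le_kBound (m := m) hc hl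
        have h3 : |Real.sin (β * p.1 t / 2)| ≤ D * (1 / (1 + t ^ 2)) := by
          refine ((hdat t).1).trans ?_
          rw [mul_one_div]
          refine div_le_div_of_nonneg_left hD (by positivity) ?_
          nlinarith [sq_nonneg t]
        refine mul_le_mul (mul_le_mul_of_nonneg_left (by linarith) (abs_nonneg _)) h3
          (abs_nonneg _) (by positivity)
    have et : (1 : ℝ) / (1 + t ^ 2) ≤ 2 * (1 + |t|) ^ (-1 : ℝ) := by
      rw [Real.rpow_neg_one, ← div_eq_mul_inv, div_le_div_iff₀ (by positivity) ht1, ← sq_abs t]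
      nlinarith [sq_nonneg (|t| - 1), abs_nonneg t]
    have e : smearKernel (kerPhi m β p) a i j t =
        (-(Complex.I * ((β / 2 : ℝ) : ℂ))) * (∫ l, a l * (star (jostPlus m β p l t 0 i) *
          jostMinus m β p l t 1 j) * ((k1 m l : ℝ) : ℂ) *
          Complex.exp (Complex.I * ((2 * t * k0 m l : ℝ) : ℂ))) +
        (-(Complex.I * ((β / 2 : ℝ) : ℂ))) * (∫ l, a l * (star (jostPlus m β p l t 1 i) *
          jostMinus m β p l t 0 j) * ((k1 m l : ℝ) : ℂ) *
          Complex.exp (Complex.I * ((2 * -t * k0 m l : ℝ) : ℂ))) +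
        ∫ l, a l * (star (jostPlus m β p l t) * X l * jostMinus m β p l t) i j := by
      rw [← integral_const_mul, ← integral_const_mul, ← integral_add i1 i2,
        ← integral_add (i1.fun_add i2) iX]
      exact integral_congr_ae (Eventually.of_forall e1)
    rw [e]
    refine (norm_add_le _ _).trans ((add_le_add_left (norm_add_le _ _) _).trans ?_)
    rw [norm_mul, norm_mul, norm_neg, norm_mul, Complex.norm_I, Complex.norm_real,
      Real.norm_eq_abs, abs_div, abs_two, one_mul]
    have m1 := mul_le_mul_of_nonneg_left d1.2 (by positivity : 0 ≤ |β| / 2)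
    have m2 := mul_le_mul_of_nonneg_left d2.2 (by positivity : 0 ≤ |β| / 2)
    have m3 := mul_le_mul_of_nonneg_left et hW0
    have m4 : 0 ≤ |β| * (C * L' * (1 + |t|) ^ (-1 : ℝ)) := by positivity
    rw [hY]
    nlinarith

/-- The density of the bracket of two smeared entries of the monodromy matrix. -/
def bracketDensity (m β : ℝ) (p : Phase) (a b : ℝ → ℂ) (i j k n : Fin 2) (t : ℝ) : ℂ :=
  smearKernel (kerPhi m β p) a i j t * smearKernel (kerPi m β p) b k n t -
    smearKernel (kerPi m β p) a i j t * smearKernel (kerPhi m β p) b k n t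

/-- Each product pairs one φ-kernel with one Π-kernel, so the exponents add up to 4/3 > 1. -/
lemma integrable_bracketDensity (hm : 0 < m) (hβ : β ≠ 0) (hp : IsPhasePoint β Qm Qp p)
    {b : ℝ → ℂ} (ha : IsAmp c L a) (hb : IsAmp c L b) (i j k n : Fin 2) :
    Integrable (bracketDensity m β p a b i j k n) := by
  obtain ⟨C, hC, h1⟩ := exists_kernel_decay hm hβ hp ha
  obtain ⟨D, hD, h2⟩ := exists_kernel_decay hm hβ hp hb
  have f1 := hasFunctionalDeriv_smear m hβ hp ha i j
  have f2 := hasFunctionalDeriv_smear m hβ hp hb k n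
  have hinteg : Integrable fun t : ℝ => 2 * (C * D) * (1 + ‖t‖) ^ (-(4 / 3 : ℝ)) :=
    (integrable_one_add_norm (by norm_num)).const_mul _
  refine hinteg.mono' ((f1.continuous_fst.mul f2.continuous_snd).sub
    (f1.continuous_snd.mul f2.continuous_fst)).aestronglyMeasurable
    (Eventually.of_forall fun t => ?_)
  have ht1 : 0 < 1 + |t| := by positivity
  have e : (1 + ‖t‖) ^ (-(4 / 3 : ℝ)) = (1 + |t|) ^ (-1 : ℝ) * (1 + |t|) ^ (-(1 / 3 : ℝ)) := by
    rw [Real.norm_eq_abs, ← Real.rpow_add ht1]; norm_num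
  have q1 : 0 ≤ (1 + |t|) ^ (-(1 / 3 : ℝ)) := by positivity
  have q2 : 0 ≤ (1 + |t|) ^ (-1 : ℝ) := by positivity
  refine (norm_sub_le _ _).trans ?_
  rw [norm_mul, norm_mul, e]
  have m1 := mul_le_mul (h1 i j t).2 (h2 k n t).1 (norm_nonneg _) (by positivity)
  have m2 := mul_le_mul (h1 i j t).1 (h2 k n t).2 (norm_nonneg _) (by positivity)
  nlinarith

lemma hasBracketT_smear (hm : 0 < m) (hβ : β ≠ 0) (hp : IsPhasePoint β Qm Qp p)
    {b : ℝ → ℂ} (ha : IsAmp c L a) (hb : IsAmp c L b) (i j k n : Fin 2) :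
    HasBracketT (smear (fun q l => timeMonodromy m β q l i j) a)
      (smear (fun q l => timeMonodromy m β q l k n) b) p
      (∫ t, bracketDensity m β p a b i j k n t) :=
  ⟨_, _, _, _, hasFunctionalDeriv_smear m hβ hp ha i j, hasFunctionalDeriv_smear m hβ hp hb k n,
    integrable_bracketDensity hm hβ hp ha hb i j k n, rfl⟩

end

/-! ### Reflection of the spectral parameter -/

lemma pauli2_mul_self : pauli2 * pauli2 = 1 := by
  ext i j; fin_cases i <;> fin_cases j <;> simp [pauli2]

lemma star_pauli2 : star pauli2 = pauli2 := by
  ext i j; fin_cases i <;> fin_cases j <;> simp [pauli2]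

lemma star_pauli3 : star pauli3 = pauli3 := by
  ext i j; fin_cases i <;> fin_cases j <;> simp [pauli3]

lemma k1_neg (m l : ℝ) : k1 m (-l) = -k1 m l := by
  unfold k1; rw [one_div_neg_eq_neg_one_div]; ring

/-- The eigenvalues `1, -1` of `σ₃`. -/
def spin (i : Fin 2) : ℝ := if i = 0 then 1 else -1

lemma spin_mul_self (i : Fin 2) : (spin i : ℂ) * spin i = 1 := by
  fin_cases i <;> simp [spin]

/-- Adding `1` in `Fin 2` exchanges the two indices: σ₂ flips the index and contributes the sign
`spin`. -/
lemma pauli2_mul_apply (X : Mat) (i j : Fin 2) :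
    (pauli2 * X) (i + 1) j = Complex.I * spin i * X i j := by
  fin_cases i <;> simp [pauli2, spin, Matrix.mul_apply]

lemma mul_pauli2_apply (X : Mat) (i j : Fin 2) :
    (X * pauli2) i (j + 1) = -(Complex.I * spin j) * X i j := by
  fin_cases j <;> simp [pauli2, spin, Matrix.mul_apply, mul_comm]

/-- Both k₀ and k₁ are odd, so reflecting l is conjugation by σ₃ for the Lax matrix; the right
factor σ₂ restores the vacuum normalisation. -/
lemma frame_neg (m β : ℝ) (p : Phase) (l t : ℝ) :
    frame m β p (-l) t = -(pauli3 * frame m β p l t * pauli2) := by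
  rw [frame_eq, frame_eq, k0_neg, neg_mul, sub_neg_eq_add, ← sub_eq_add_neg]
  ext i j
  fin_cases i <;> fin_cases j <;> simp [pauli2, pauli3]
  all_goals ring_nf; try simp [Complex.I_sq]

lemma potential_neg (m β : ℝ) (p : Phase) (l t : ℝ) :
    potential m β p (-l) t = pauli2 * potential m β p l t * pauli2 := by
  simp only [potential, k0_neg, div_neg, neg_mul, Complex.ofReal_neg, mul_neg, neg_neg]
  ext i j
  fin_cases i <;> fin_cases j <;>
    simp [pauli2, -Complex.ofReal_mul, -Complex.ofReal_div, -Complex.ofReal_pow]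
  all_goals ring_nf; try simp only [Complex.I_sq, Complex.I_pow_three]; ring_nf

lemma IsJost.unique {w G G' : ℝ → Mat} (h : IsJost w G) (h' : IsJost w G')
    (hs : ∀ t, star (w t) = -w t) : G = G' := by
  funext t
  have hd : ∀ t, HasDerivAt (fun t => star (G t) * G' t) 0 t := fun t => by
    simpa using hasDerivAt_star_mul hs (h.deriv t) (h'.deriv t)
  have hconst : ∀ x y, star (G x) * G' x = star (G y) * G' y :=
    is_const_of_deriv_eq_zero (fun t => (hd t).differentiableAt) (fun t => (hd t).deriv)
  have hl : Tendsto (fun t => star (G t) * G' t) atBot (𝓝 1) := by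
    simpa using (h.lim.star).mul h'.lim
  have h1 : star (G t) * G' t = 1 :=
    tendsto_nhds_unique (tendsto_const_nhds.congr fun s => hconst t s) hl
  have h2 := congrArg (G t * ·) h1
  simp only [← mul_assoc, (Unitary.mem_iff.1 (h.mem_unitary hs t)).2, one_mul, mul_one] at h2
  exact h2.symm

section

variable {m β : ℝ} {Qm Qp : ℤ} {p : Phase} {l : ℝ}

lemma jostMinus_neg (hβ : β ≠ 0) (hp : IsPhasePoint β Qm Qp p) (hl : l ≠ 0) (t : ℝ) :
    jostMinus m β p (-l) t = pauli2 * jostMinus m β p l t * pauli2 := by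
  have h := isJost_jostMinus (m := m) hβ hp hl
  have h' : IsJost (potential m β p (-l)) fun t => pauli2 * jostMinus m β p l t * pauli2 := by
    refine ⟨fun t => (((h.deriv t).const_mul pauli2).mul_const pauli2).congr_deriv ?_, ?_⟩
    · rw [potential_neg]
      calc _ = pauli2 * potential m β p l t * 1 * jostMinus m β p l t * pauli2 := by noncomm_ring
        _ = _ := by rw [← pauli2_mul_self]; noncomm_ring
    · have := (h.lim.const_mul pauli2).mul_const pauli2
      rwa [mul_one, pauli2_mul_self] at this
  exact congrFun ((isJost_jostMinus hβ hp (neg_ne_zero.2 hl)).unique h'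
    (star_potential m β p (-l))) t

lemma timeMonodromy_neg (hβ : β ≠ 0) (hp : IsPhasePoint β Qm Qp p) (hl : l ≠ 0) :
    timeMonodromy m β p (-l) = pauli2 * timeMonodromy m β p l * pauli2 := by
  have h := tendsto_jostMinus_atTop (m := m) hβ hp (neg_ne_zero.2 hl)
  refine tendsto_nhds_unique h (Tendsto.congr (fun t => (jostMinus_neg hβ hp hl t).symm) ?_)
  exact ((tendsto_jostMinus_atTop hβ hp hl).const_mul pauli2).mul_const pauli2

lemma timeMonodromy_neg_apply (hβ : β ≠ 0) (hp : IsPhasePoint β Qm Qp p) (hl : l ≠ 0)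
    (i j : Fin 2) : timeMonodromy m β p (-l) (i + 1) (j + 1) =
      spin i * spin j * timeMonodromy m β p l i j := by
  rw [timeMonodromy_neg hβ hp hl, mul_pauli2_apply, pauli2_mul_apply]
  linear_combination (-(spin i * spin j * timeMonodromy m β p l i j)) * Complex.I_mul_I

lemma jostPlus_neg (hβ : β ≠ 0) (hp : IsPhasePoint β Qm Qp p) (hl : l ≠ 0) (t : ℝ) :
    jostPlus m β p (-l) t = pauli2 * jostPlus m β p l t * pauli2 := by
  rw [jostPlus, jostPlus, jostMinus_neg hβ hp hl, timeMonodromy_neg hβ hp hl, star_mul, star_mul,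
    star_pauli2]
  calc _ = pauli2 * jostMinus m β p l t * (pauli2 * pauli2) *
        star (timeMonodromy m β p l) * pauli2 := by noncomm_ring
    _ = _ := by rw [pauli2_mul_self]; noncomm_ring

lemma psiMinus_neg (hβ : β ≠ 0) (hp : IsPhasePoint β Qm Qp p) (hl : l ≠ 0) (t : ℝ) :
    psiMinus m β p (-l) t = -(pauli3 * psiMinus m β p l t * pauli2) := by
  rw [psiMinus, psiMinus, jostMinus_neg hβ hp hl, frame_neg]
  calc _ = -(pauli3 * frame m β p l t * (pauli2 * pauli2) * jostMinus m β p l t * pauli2) := by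
        noncomm_ring
    _ = _ := by rw [pauli2_mul_self]; noncomm_ring

lemma star_psiPlus_neg (hβ : β ≠ 0) (hp : IsPhasePoint β Qm Qp p) (hl : l ≠ 0) (t : ℝ) :
    star (psiPlus m β p (-l) t) = -(pauli2 * star (psiPlus m β p l t) * pauli3) := by
  have : psiPlus m β p (-l) t = -(pauli3 * psiPlus m β p l t * pauli2) := by
    rw [psiPlus, psiPlus, jostPlus_neg hβ hp hl, frame_neg]
    calc _ = -(pauli3 * frame m β p l t * (pauli2 * pauli2) * jostPlus m β p l t * pauli2) := by
          noncomm_ring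
      _ = _ := by rw [pauli2_mul_self]; noncomm_ring
  rw [this, star_neg, star_mul, star_mul, star_pauli2, star_pauli3, mul_assoc]

end

/-! ### The density of the bracket as a total derivative -/

/-- The matrix `-γ (l + u) / (l - u) (V(u) - V(l))`, which has no singularity at `l = u`. -/
def exchMat (m β : ℝ) (p : Phase) (z : ℝ × ℝ) (t : ℝ) : Mat :=
  (-(Complex.I * ((gam β * ((k0 m z.1 + k0 m z.2) * Real.sin (β * p.1 t / 2)) : ℝ) : ℂ))) • pauli1 +
    (-(Complex.I * ((gam β * ((k1 m z.1 + k1 m z.2) * Real.cos (β * p.1 t / 2)) : ℝ) : ℂ))) • pauli2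

/-- The quotient (l + u)/(l - u) turns differences of k₁ into sums of k₀ and differences of k₀ into
sums of k₁, so the pole disappears. -/
lemma smul_laxV_sub_laxV (m β : ℝ) (p : Phase) {l u : ℝ} (hl : l ≠ 0) (hu : u ≠ 0) (hlu : l ≠ u)
    (t : ℝ) : ((-gam β * ((l + u) / (l - u)) : ℝ) : ℂ) • (laxV m β p u t - laxV m β p l t) =
      exchMat m β p (l, u) t := by
  have hd : l - u ≠ 0 := sub_ne_zero.2 hlu
  have e1 : gam β * (k0 m l + k0 m u) = -gam β * ((l + u) / (l - u)) * (k1 m u - k1 m l) := by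
    unfold k0 k1; field_simp; ring
  have e2 : gam β * (k1 m l + k1 m u) = -gam β * ((l + u) / (l - u)) * (k0 m u - k0 m l) := by
    unfold k0 k1; field_simp; ring
  unfold exchMat laxV
  simp only
  rw [← mul_assoc, ← mul_assoc, e1, e2]
  push_cast
  module

/-- The density whose integral in `t` is the boundary term of the bracket. -/
def exchDensity (m β : ℝ) (p : Phase) (i j k n : Fin 2) (z : ℝ × ℝ) (t : ℝ) : ℂ :=
  (star (psiPlus m β p z.1 t) * exchMat m β p z t * psiMinus m β p z.2 t) i n *
      (star (psiPlus m β p z.2 t) * psiMinus m β p z.1 t) k j -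
    (star (psiPlus m β p z.1 t) * psiMinus m β p z.2 t) i n *
      (star (psiPlus m β p z.2 t) * exchMat m β p z t * psiMinus m β p z.1 t) k j

/-- The product of transition coefficients between two values of the spectral parameter. -/
def exchProd (m β : ℝ) (p : Phase) (i j k n : Fin 2) (z : ℝ × ℝ) (t : ℝ) : ℂ :=
  (star (psiPlus m β p z.1 t) * psiMinus m β p z.2 t) i n *
    (star (psiPlus m β p z.2 t) * psiMinus m β p z.1 t) k j

section

variable {m β : ℝ} {Qm Qp : ℤ} {p : Phase}

/-- Each transition coefficient is differentiated by the Wronskian identity, producing V(u) - V(l)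
in one factor and its negative in the other; the prefactor turns these into `exchMat`. -/
lemma hasDerivAt_exchProd (hβ : β ≠ 0) (hp : IsPhasePoint β Qm Qp p) (i j k n : Fin 2) {z : ℝ × ℝ}
    (h1 : z.1 ≠ 0) (h2 : z.2 ≠ 0) (h12 : z.1 ≠ z.2) (t : ℝ) :
    HasDerivAt (fun t => ((-gam β * ((z.1 + z.2) / (z.1 - z.2)) : ℝ) : ℂ) *
      exchProd m β p i j k n z t) (exchDensity m β p i j k n z t) t := by
  have d1 := hasDerivAt_star_mul (star_laxV m β p z.1) (hasDerivAt_psiPlus hβ hp h1 t)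
    (hasDerivAt_psiMinus (m := m) hβ hp h2 t)
  have d2 := hasDerivAt_star_mul (star_laxV m β p z.2) (hasDerivAt_psiPlus hβ hp h2 t)
    (hasDerivAt_psiMinus (m := m) hβ hp h1 t)
  have c1 := hasDerivAt_pi.1 (hasDerivAt_pi.1 d1 i) n
  have c2 := hasDerivAt_pi.1 (hasDerivAt_pi.1 d2 k) j
  refine ((c1.mul c2).const_mul _).congr_deriv ?_
  have e := smul_laxV_sub_laxV m β p h1 h2 h12 t
  have e' : laxV m β p z.1 t - laxV m β p z.2 t = -(laxV m β p z.2 t - laxV m β p z.1 t) := by abel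
  rw [e', exchDensity, ← e]
  simp only [mul_smul_comm, smul_mul_assoc, Matrix.smul_apply, mul_neg, neg_mul, Matrix.neg_apply,
    smul_eq_mul]
  ring

/-- The classical r-matrix relation for V in entries: the ultralocal bracket of two Lax matrices is
a commutator with the permutation plus a second one with the permutation twisted by σ₃, in which k₀
and k₁ of the first parameter change sign. -/
lemma exchDensity_identity (A B C D : Mat) (i j k n : Fin 2) (g S K a a' b b' : ℂ) :
    (A * ((Complex.I * (a * (g / 2 * S))) • pauli2 - (Complex.I * (b * (g / 2 * K))) • pauli1) * B)
        i j * (C * ((Complex.I * (g / 4)) • pauli3) * D) k n -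
      (A * ((Complex.I * (g / 4)) • pauli3) * B) i j *
        (C * ((Complex.I * (a' * (g / 2 * S))) • pauli2 -
          (Complex.I * (b' * (g / 2 * K))) • pauli1) * D) k n =
    ((A * ((-(Complex.I * (g ^ 2 / 16 * ((a + a') * S)))) • pauli1 +
          (-(Complex.I * (g ^ 2 / 16 * ((b + b') * K)))) • pauli2) * D) i n * (C * B) k j -
      (A * D) i n * (C * ((-(Complex.I * (g ^ 2 / 16 * ((a + a') * S)))) • pauli1 +
          (-(Complex.I * (g ^ 2 / 16 * ((b + b') * K)))) • pauli2) * B) k j) +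
    ((A * pauli3 * ((-(Complex.I * (g ^ 2 / 16 * ((-a + a') * S)))) • pauli1 +
          (-(Complex.I * (g ^ 2 / 16 * ((-b + b') * K)))) • pauli2) * D) i n *
        (C * (pauli3 * B)) k j -
      (A * pauli3 * D) i n * (C * ((-(Complex.I * (g ^ 2 / 16 * ((-a + a') * S)))) • pauli1 +
          (-(Complex.I * (g ^ 2 / 16 * ((-b + b') * K)))) • pauli2) * (pauli3 * B)) k j) := by
  simp only [Matrix.mul_apply, Fin.sum_univ_two, Matrix.smul_apply, Matrix.add_apply,
    Matrix.sub_apply, smul_eq_mul, pauli1, pauli2, pauli3, Matrix.of_apply, Matrix.cons_val',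
    Matrix.cons_val_zero, Matrix.cons_val_one, Matrix.cons_val_fin_one]
  ring_nf
  have h3 : Complex.I ^ 3 = -Complex.I := by rw [pow_succ, Complex.I_sq]; ring
  simp only [Complex.I_sq, h3]
  ring

/-- Recognises the σ₃-twisted half of the r-matrix relation as the exchange density at the reflected
parameter, the matrices σ₂ being absorbed into flipped indices and signs. -/
lemma exchDensity_neg (hβ : β ≠ 0) (hp : IsPhasePoint β Qm Qp p) (i j k n : Fin 2) {l : ℝ}
    (hl : l ≠ 0) (u t : ℝ) :
    spin i * spin j * exchDensity m β p (i + 1) (j + 1) k n (-l, u) t =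
      (star (psiPlus m β p l t) * pauli3 * exchMat m β p (-l, u) t * psiMinus m β p u t) i n *
        (star (psiPlus m β p u t) * (pauli3 * psiMinus m β p l t)) k j -
      (star (psiPlus m β p l t) * pauli3 * psiMinus m β p u t) i n *
        (star (psiPlus m β p u t) * exchMat m β p (-l, u) t *
          (pauli3 * psiMinus m β p l t)) k j := by
  unfold exchDensity
  simp only
  rw [psiMinus_neg hβ hp hl, star_psiPlus_neg hβ hp hl]
  simp only [neg_mul, mul_neg, Matrix.neg_apply]
  have e1 : ∀ X Y : Mat, (pauli2 * star (psiPlus m β p l t) * pauli3 * X * Y) (i + 1) n =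
      Complex.I * spin i * (star (psiPlus m β p l t) * pauli3 * X * Y) i n := fun X Y => by
    rw [← pauli2_mul_apply]; simp only [mul_assoc]
  have e2 : ∀ Y : Mat, (pauli2 * star (psiPlus m β p l t) * pauli3 * Y) (i + 1) n =
      Complex.I * spin i * (star (psiPlus m β p l t) * pauli3 * Y) i n := fun Y => by
    rw [← pauli2_mul_apply]; simp only [mul_assoc]
  have e3 : ∀ X : Mat, (X * (pauli3 * psiMinus m β p l t * pauli2)) k (j + 1) =
      -(Complex.I * spin j) * (X * (pauli3 * psiMinus m β p l t)) k j := fun X => by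
    rw [← mul_pauli2_apply]; simp only [mul_assoc]
  simp only [e1, e2, e3]
  have hi := spin_mul_self i
  have hj := spin_mul_self j
  have : (spin i : ℂ) * spin j * (Complex.I * spin i) * (Complex.I * spin j) = -1 := by
    linear_combination (spin i * spin i * spin j * spin j : ℂ) * Complex.I_mul_I -
      (spin j * spin j : ℂ) * hi - hj
  linear_combination (-((star (psiPlus m β p l t) * pauli3 * exchMat m β p (-l, u) t *
      psiMinus m β p u t) i n * (star (psiPlus m β p u t) * (pauli3 * psiMinus m β p l t)) k j -
      (star (psiPlus m β p l t) * pauli3 * psiMinus m β p u t) i n *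
        (star (psiPlus m β p u t) * exchMat m β p (-l, u) t *
          (pauli3 * psiMinus m β p l t)) k j)) * this

lemma kerPhi_mul_kerPi_sub (hβ : β ≠ 0) (hp : IsPhasePoint β Qm Qp p) (i j k n : Fin 2) {l : ℝ}
    (hl : l ≠ 0) (u t : ℝ) :
    kerPhi m β p l t i j * kerPi m β p u t k n - kerPi m β p l t i j * kerPhi m β p u t k n =
      exchDensity m β p i j k n (l, u) t +
        spin i * spin j * exchDensity m β p (i + 1) (j + 1) k n (-l, u) t := by
  rw [exchDensity_neg hβ hp i j k n hl]
  have := exchDensity_identity (star (psiPlus m β p l t)) (psiMinus m β p l t)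
    (star (psiPlus m β p u t)) (psiMinus m β p u t) i j k n (β : ℂ)
    ((Real.sin (β * p.1 t / 2) : ℝ) : ℂ) ((Real.cos (β * p.1 t / 2) : ℝ) : ℂ)
    ((k0 m l : ℝ) : ℂ) ((k0 m u : ℝ) : ℂ) ((k1 m l : ℝ) : ℂ) ((k1 m u : ℝ) : ℂ)
  unfold kerPhi kerPi laxVPhi laxVPi exchDensity exchMat gam
  simp only [k0_neg, k1_neg]
  push_cast at this ⊢
  exact this

end

/-! ### Asymptotics of the transition coefficients -/

lemma expPauli3_mul_apply (x : ℝ) (X : Mat) (i n : Fin 2) :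
    (expPauli3 (Complex.I * x) * X) i n = Complex.exp (Complex.I * ((spin i * x : ℝ) : ℂ)) * X i n := by
  fin_cases i <;> simp [expPauli3, spin, Matrix.mul_apply, Fin.sum_univ_two]

lemma mul_expPauli3_apply (x : ℝ) (X : Mat) (i n : Fin 2) :
    (X * expPauli3 (Complex.I * x)) i n = X i n * Complex.exp (Complex.I * ((spin n * x : ℝ) : ℂ)) := by
  fin_cases n <;> simp [expPauli3, spin, Matrix.mul_apply, Fin.sum_univ_two]

lemma norm_expPauli3_sub_one_le (x : ℝ) : ‖expPauli3 (Complex.I * x) - 1‖ ≤ 2 * |x| := by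
  have h : ∀ y : ℝ, |y| = |x| → ‖Complex.exp (Complex.I * (y : ℂ)) - 1‖ ≤ |x| := fun y hy => by
    rw [← hy]; exact Real.norm_exp_I_mul_ofReal_sub_one_le
  refine norm_le_of_entries _ fun i j => ?_
  fin_cases i <;> fin_cases j <;> simp [expPauli3]
  · exact h x rfl
  · have := h (-x) (abs_neg x)
    rwa [Complex.ofReal_neg, mul_neg] at this

/-- The terms are grouped so that each is small both when `G` is close to `G'` and when the phase is
small. The error is thus of order `|l - u|` near the diagonal and remains integrable after division
by `l - u`. -/
lemma norm_star_mul_expPauli3_mul_sub_le {G G' : Mat} (hG' : G' ∈ unitary Mat) (x : ℝ) :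
    ‖star G * expPauli3 (Complex.I * x) * G' - expPauli3 (Complex.I * x)‖ ≤
      ‖G - G'‖ + 4 * |x| * ‖G' - 1‖ := by
  set E := expPauli3 (Complex.I * x) with hE
  have hEu : E ∈ unitary Mat := expPauli3_mem_unitary x
  have hE1 : ‖E - 1‖ ≤ 2 * |x| := norm_expPauli3_sub_one_le x
  have e : star G * E * G' - E = (star (G - G') * E * G' + star (G' - 1) * (E - 1) * G') +
      (E - 1) * (G' - 1) := by
    have h := (Unitary.mem_iff.1 hG').1
    have h2 : star G' * G' - 1 = 0 := by rw [h, sub_self]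
    rw [star_sub, star_sub, star_one, ← sub_eq_zero]
    calc _ = star G' * G' - 1 := by noncomm_ring
      _ = 0 := h2
  have n1 : ‖star (G - G') * E * G'‖ ≤ ‖G - G'‖ := by
    refine (norm_mul_le _ _).trans ?_
    rw [norm_unitary hG', mul_one]
    refine (norm_mul_le _ _).trans ?_
    rw [norm_unitary hEu, mul_one, norm_star]
  have n2 : ‖star (G' - 1) * (E - 1) * G'‖ ≤ ‖G' - 1‖ * (2 * |x|) := by
    refine (norm_mul_le _ _).trans ?_
    rw [norm_unitary hG', mul_one]
    refine (norm_mul_le _ _).trans ?_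
    rw [norm_star]
    gcongr
  have n3 : ‖(E - 1) * (G' - 1)‖ ≤ 2 * |x| * ‖G' - 1‖ :=
    (norm_mul_le _ _).trans (mul_le_mul_of_nonneg_right hE1 (norm_nonneg _))
  rw [e]
  refine (norm_add_le _ _).trans ((add_le_add_left (norm_add_le _ _) _).trans ?_)
  linarith

lemma star_frame_mul_frame (m β : ℝ) (p : Phase) (l u t : ℝ) :
    star (frame m β p l t) * frame m β p u t =
      expPauli3 (Complex.I * (((k0 m l - k0 m u) * t : ℝ) : ℂ)) := by
  simp only [frame, vacuumE, star_mul, star_expPauli3_neg]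
  calc _ = expPauli3 (Complex.I * ((k0 m l * t : ℝ) : ℂ)) * (star matN *
        (star (gaugeOmega β p t) * gaugeOmega β p t) * matN) *
        expPauli3 (-Complex.I * ((k0 m u * t : ℝ) : ℂ)) := by noncomm_ring
    _ = _ := by
      rw [(Unitary.mem_iff.1 (gaugeOmega_mem_unitary β p t)).1, mul_one,
        (Unitary.mem_iff.1 matN_mem_unitary).1, mul_one, expPauli3_mul]
      congr 1; push_cast; ring

lemma norm_mul_sub_mul_le_add {x x' y y' : ℂ} (hx' : ‖x'‖ ≤ 1) (hy : ‖y‖ ≤ 1) :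
    ‖x * x' - y * y'‖ ≤ ‖x - y‖ + ‖x' - y'‖ := by
  have e : x * x' - y * y' = (x - y) * x' + y * (x' - y') := by ring
  rw [e]
  refine (norm_add_le _ _).trans (add_le_add ?_ ?_)
  · rw [norm_mul]; exact mul_le_of_le_one_right (norm_nonneg _) hx'
  · rw [norm_mul]; exact mul_le_of_le_one_left (norm_nonneg _) hy

section

variable {m β c : ℝ} {Qm Qp : ℤ} {p : Phase}

lemma norm_transition_apply_le_one (hβ : β ≠ 0) (hp : IsPhasePoint β Qm Qp p) {l u : ℝ}
    (hl : l ≠ 0) (hu : u ≠ 0) (t : ℝ) (i n : Fin 2) :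
    ‖(star (psiPlus m β p l t) * psiMinus m β p u t) i n‖ ≤ 1 := by
  refine (norm_entry_le _ _ _).trans (le_of_eq (norm_unitary ?_))
  exact mul_mem (Unitary.star_mem (psiPlus_mem_unitary hβ hp hl t)) (psiMinus_mem_unitary hβ hp hu t)

lemma norm_exp_mul_timeMonodromy_le (hβ : β ≠ 0) (hp : IsPhasePoint β Qm Qp p) {l : ℝ} (hl : l ≠ 0)
    (x : ℝ) (i n : Fin 2) :
    ‖Complex.exp (Complex.I * (x : ℂ)) * timeMonodromy m β p l i n‖ ≤ 1 := by
  rw [norm_mul, norm_expI, one_mul]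
  exact (norm_entry_le _ _ _).trans (norm_unitary (timeMonodromy_mem_unitary hβ hp hl)).le

/-- Useful as t → +∞: writing Ψ₋ = Ψ₊T, the transition coefficient becomes a free phase times T(u).
The companion on the left uses Ψ₊ = Ψ₋T* and serves at -∞. -/
lemma norm_transition_sub_le_right (hβ : β ≠ 0) (hp : IsPhasePoint β Qm Qp p) {l u : ℝ}
    (hu : u ≠ 0) (t : ℝ) (i n : Fin 2) :
    ‖(star (psiPlus m β p l t) * psiMinus m β p u t) i n -
      Complex.exp (Complex.I * ((spin i * ((k0 m l - k0 m u) * t) : ℝ) : ℂ)) *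
        timeMonodromy m β p u i n‖ ≤ ‖jostPlus m β p l t - jostPlus m β p u t‖ +
      4 * |(k0 m l - k0 m u) * t| * ‖jostPlus m β p u t - 1‖ := by
  have e : star (psiPlus m β p l t) * psiMinus m β p u t = (star (jostPlus m β p l t) *
      expPauli3 (Complex.I * (((k0 m l - k0 m u) * t : ℝ) : ℂ)) * jostPlus m β p u t) *
        timeMonodromy m β p u := by
    rw [psiPlus, psiMinus, star_mul, ← jostPlus_mul_timeMonodromy hβ hp hu,
      ← star_frame_mul_frame m β p l u t]
    noncomm_ring
  rw [← expPauli3_mul_apply, e, ← Matrix.sub_apply, ← sub_mul]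
  refine (norm_entry_le _ _ _).trans ((norm_mul_le _ _).trans ?_)
  rw [norm_unitary (timeMonodromy_mem_unitary hβ hp hu), mul_one]
  exact norm_star_mul_expPauli3_mul_sub_le (jostPlus_mem_unitary hβ hp hu t) _

lemma norm_transition_sub_le_left (hβ : β ≠ 0) (hp : IsPhasePoint β Qm Qp p) {l u : ℝ}
    (hl : l ≠ 0) (hu : u ≠ 0) (t : ℝ) (i n : Fin 2) :
    ‖(star (psiPlus m β p l t) * psiMinus m β p u t) i n -
      Complex.exp (Complex.I * ((spin n * ((k0 m l - k0 m u) * t) : ℝ) : ℂ)) *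
        timeMonodromy m β p l i n‖ ≤ ‖jostMinus m β p l t - jostMinus m β p u t‖ +
      4 * |(k0 m l - k0 m u) * t| * ‖jostMinus m β p u t - 1‖ := by
  have e : star (psiPlus m β p l t) * psiMinus m β p u t = timeMonodromy m β p l *
      (star (jostMinus m β p l t) * expPauli3 (Complex.I * (((k0 m l - k0 m u) * t : ℝ) : ℂ)) *
        jostMinus m β p u t) := by
    rw [psiPlus, psiMinus, jostPlus, star_mul, star_mul, star_star,
      ← star_frame_mul_frame m β p l u t]
    noncomm_ring
  rw [mul_comm (Complex.exp _), ← mul_expPauli3_apply, e, ← Matrix.sub_apply, ← mul_sub]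
  refine (norm_entry_le _ _ _).trans ((norm_mul_le _ _).trans ?_)
  rw [norm_unitary (timeMonodromy_mem_unitary hβ hp hl), one_mul]
  exact norm_star_mul_expPauli3_mul_sub_le (jostMinus_mem_unitary hβ hp hu t) _

/-- Up to an error which is small in the Lipschitz sense at the diagonal, the products of
transition coefficients are oscillating products of entries of the monodromy matrix. -/
lemma exists_exchProd_asymptotics (m : ℝ) (hβ : β ≠ 0) (hp : IsPhasePoint β Qm Qp p) (hc : 0 < c) :
    ∃ η : ℝ → ℝ, Tendsto η atTop (𝓝 0) ∧ ∀ R ≥ 0, 0 ≤ η R ∧ ∀ z : ℝ × ℝ, z.1 ∈ ann c → z.2 ∈ ann c →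
      ∀ i j k n : Fin 2,
      ‖exchProd m β p i j k n z R - timeMonodromy m β p z.1 k j * timeMonodromy m β p z.2 i n *
        Complex.exp (Complex.I *
          ((2 * (R * ((spin i - spin k) / 2)) * (k0 m z.1 - k0 m z.2) : ℝ) : ℂ))‖ ≤
        η R * |z.1 - z.2| ∧
      ‖exchProd m β p i j k n z (-R) - timeMonodromy m β p z.1 i n * timeMonodromy m β p z.2 k j *
        Complex.exp (Complex.I *
          ((2 * (R * ((spin j - spin n) / 2)) * (k0 m z.1 - k0 m z.2) : ℝ) : ℂ))‖ ≤
        η R * |z.1 - z.2| := by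
  obtain ⟨C, hC, h⟩ := exists_lipschitz_jost m hβ hp hc
  set K := |m| / 4 * (1 + c⁻¹ * c⁻¹) with hK
  have hK0 : 0 ≤ K := by positivity
  refine ⟨fun R => 2 * (C + 4 * K * C) * (Real.pi / 2 - Real.arctan R), ?_, fun R hR =>
    ⟨mul_nonneg (by positivity) (by linarith [Real.arctan_lt_pi_div_two R]), fun z h1 h2 i j k n => ?_⟩⟩
  · have := (tendsto_nhds_of_tendsto_nhdsWithin Real.tendsto_arctan_atTop).const_sub (Real.pi / 2)
    simpa using this.const_mul (2 * (C + 4 * K * C))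
  have z1 := ne_zero_of_mem_ann hc h1
  have z2 := ne_zero_of_mem_ann hc h2
  have hk : ∀ l ∈ ann c, ∀ u ∈ ann c, |k0 m l - k0 m u| ≤ K * |l - u| := fun l hl u hu => abs_k0_sub_le m hc hl hu
  have hA : 0 ≤ Real.pi / 2 - Real.arctan R := by linarith [Real.arctan_lt_pi_div_two R]
  -- The growing factor `|t|` in the phase is compensated by the approach of the Jost solution to
  -- `1`, which is controlled after multiplication by `|t|`.
  have bnd : ∀ l ∈ ann c, ∀ u ∈ ann c, ∀ x y t : ℝ, |t| = R →
      x ≤ C * (Real.pi / 2 - Real.arctan R) * |l - u| →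
      R * y ≤ C * (Real.pi / 2 - Real.arctan R) → 0 ≤ y →
      x + 4 * |(k0 m l - k0 m u) * t| * y ≤
        (C + 4 * K * C) * (Real.pi / 2 - Real.arctan R) * |l - u| := by
    intro l hl u hu x y t ht hx hy hy0
    rw [abs_mul, ht]
    have := mul_le_mul (hk l hl u hu) hy (by positivity) (by positivity)
    nlinarith
  constructor
  · have a1 := bnd _ h1 _ h2 _ _ R (abs_of_nonneg hR) ((h _ h1).1 _ h2 R).2
      (by simpa [abs_of_nonneg hR] using (h _ h2).2.2 R hR) (norm_nonneg _)
    have a2 := bnd _ h2 _ h1 _ _ R (abs_of_nonneg hR) ((h _ h2).1 _ h1 R).2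
      (by simpa [abs_of_nonneg hR] using (h _ h1).2.2 R hR) (norm_nonneg _)
    rw [abs_sub_comm] at a2
    have b1 := (norm_transition_sub_le_right (l := z.1) hβ hp z2 R i n).trans a1
    have b2 := (norm_transition_sub_le_right (l := z.2) hβ hp z1 R k j).trans a2
    have b := (norm_mul_sub_mul_le_add (norm_transition_apply_le_one (m := m) hβ hp z2 z1 R k j)
      (norm_exp_mul_timeMonodromy_le (m := m) hβ hp z2 _ i n)).trans (add_le_add b1 b2)
    refine (le_of_eq ?_).trans (b.trans (le_of_eq ?_))
    -- The two phases carry opposite parameter differences, so their product has exponent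
    -- proportional to `spin i - spin k`: no oscillation when the indices agree, frequency ±2R
    -- otherwise.
    · congr 1
      rw [exchProd]
      congr 1
      rw [mul_mul_mul_comm, ← Complex.exp_add, mul_comm (Complex.exp _),
        mul_comm (timeMonodromy m β p z.1 k j)]
      congr 2; push_cast; ring
    · ring
  · have e : Real.arctan (-R) + Real.pi / 2 = Real.pi / 2 - Real.arctan R := by
      rw [Real.arctan_neg]; ring
    have hR' : |-R| = R := by rw [abs_neg, abs_of_nonneg hR]
    have l1 := ((h _ h1).1 _ h2 (-R)).1
    have l2 := ((h _ h2).1 _ h1 (-R)).1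
    have t1 := (h _ h1).2.1 (-R) (by linarith)
    have t2 := (h _ h2).2.1 (-R) (by linarith)
    rw [e] at l1 l2 t1 t2
    rw [hR'] at t1 t2
    have a1 := bnd _ h1 _ h2 _ _ (-R) hR' l1 t2 (norm_nonneg _)
    have a2 := bnd _ h2 _ h1 _ _ (-R) hR' l2 t1 (norm_nonneg _)
    rw [abs_sub_comm] at a2
    have b1 := (norm_transition_sub_le_left hβ hp z1 z2 (-R) i n).trans a1
    have b2 := (norm_transition_sub_le_left hβ hp z2 z1 (-R) k j).trans a2
    have b := (norm_mul_sub_mul_le_add (norm_transition_apply_le_one (m := m) hβ hp z2 z1 (-R) k j)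
      (norm_exp_mul_timeMonodromy_le (m := m) hβ hp z1 _ i n)).trans (add_le_add b1 b2)
    refine (le_of_eq ?_).trans (b.trans (le_of_eq ?_))
    · congr 1
      rw [exchProd]
      congr 1
      rw [mul_mul_mul_comm, ← Complex.exp_add, mul_comm (Complex.exp _)]
      congr 2; push_cast; ring
    · ring

end

/-! ### The value of the bracket -/

lemma gam_pos {β : ℝ} (hβ : β ≠ 0) : 0 < gam β := by unfold gam; positivity

lemma ae_fst_ne_snd : ∀ᵐ z : ℝ × ℝ, z.1 ≠ z.2 := by
  have hs : MeasurableSet {z : ℝ × ℝ | z.1 = z.2} := measurableSet_eq_fun measurable_fst measurable_snd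
  have : (volume : Measure (ℝ × ℝ)) {z : ℝ × ℝ | z.1 = z.2} = 0 := by
    rw [Measure.volume_eq_prod, Measure.measure_prod_null hs]
    refine Eventually.of_forall fun x => ?_
    have : Prod.mk x ⁻¹' {z : ℝ × ℝ | z.1 = z.2} = {x} := by ext y; simp [eq_comm]
    beta_reduce
    rw [this]; simp
  exact measure_eq_zero_iff_ae_notMem.1 this

lemma integral_reflect_fst (F : ℝ × ℝ → ℂ) : ∫ z : ℝ × ℝ, F (-z.1, z.2) = ∫ z, F z := by
  have hmp : MeasurePreserving ((MeasurableEquiv.neg ℝ).prodCongr (MeasurableEquiv.refl ℝ))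
      (volume : Measure (ℝ × ℝ)) volume :=
    (Measure.measurePreserving_neg (volume : Measure ℝ)).prod (MeasurePreserving.id volume)
  exact hmp.integral_comp' F

lemma integrable_reflect_fst {F : ℝ × ℝ → ℂ} (hF : Integrable F) :
    Integrable fun z : ℝ × ℝ => F (-z.1, z.2) := by
  have hmp : MeasurePreserving (fun z : ℝ × ℝ => (-z.1, z.2)) (volume : Measure (ℝ × ℝ)) volume :=
    (Measure.measurePreserving_neg (volume : Measure ℝ)).prod (MeasurePreserving.id volume)
  exact hmp.integrable_comp_of_integrable hF

section

variable {m β c L : ℝ} {Qm Qp : ℤ} {p : Phase} {a b : ℝ → ℂ}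

lemma norm_exchMat_le (β : ℝ) (p : Phase) (hc : 0 < c) {z : ℝ × ℝ} (h1 : z.1 ∈ ann c)
    (h2 : z.2 ∈ ann c) (t : ℝ) : ‖exchMat m β p z t‖ ≤ 8 * (gam β * kBound m c) := by
  have hg : 0 ≤ gam β := by unfold gam; positivity
  obtain ⟨p1, q1⟩ := abs_le_kBound (m := m) hc h1
  obtain ⟨p2, q2⟩ := abs_le_kBound (m := m) hc h2
  have hK := one_le_kBound (m := m) hc
  have key : ∀ x y s : ℝ, |x| ≤ kBound m c → |y| ≤ kBound m c → |s| ≤ 1 →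
      ‖-(Complex.I * ((gam β * ((x + y) * s) : ℝ) : ℂ))‖ ≤ gam β * (2 * kBound m c) := by
    intro x y s hx hy hs
    rw [norm_neg, norm_mul, Complex.norm_I, one_mul, Complex.norm_real, Real.norm_eq_abs, abs_mul,
      abs_of_nonneg hg, abs_mul]
    refine mul_le_mul_of_nonneg_left ?_ hg
    have := mul_le_mul ((abs_add_le x y).trans (add_le_add hx hy)) hs (abs_nonneg _) (by linarith)
    linarith
  have n1 : ‖pauli1‖ ≤ 2 * 1 := norm_le_of_entries _ fun i j => by
    fin_cases i <;> fin_cases j <;> simp [pauli1]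
  have n2 : ‖pauli2‖ ≤ 2 * 1 := norm_le_of_entries _ fun i j => by
    fin_cases i <;> fin_cases j <;> simp [pauli2]
  unfold exchMat
  refine (norm_add_le _ _).trans ?_
  rw [norm_smul, norm_smul]
  have m1 := mul_le_mul (key _ _ _ p1 p2 (Real.abs_sin_le_one (β * p.1 t / 2))) n1 (norm_nonneg _)
    (by positivity)
  have m2 := mul_le_mul (key _ _ _ q1 q2 (Real.abs_cos_le_one (β * p.1 t / 2))) n2 (norm_nonneg _)
    (by positivity)
  linarith

lemma norm_exchDensity_le (hβ : β ≠ 0) (hp : IsPhasePoint β Qm Qp p) (hc : 0 < c) {z : ℝ × ℝ}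
    (h1 : z.1 ∈ ann c) (h2 : z.2 ∈ ann c) (t : ℝ) (i j k n : Fin 2) :
    ‖exchDensity m β p i j k n z t‖ ≤ 16 * (gam β * kBound m c) := by
  have z1 := ne_zero_of_mem_ann hc h1
  have z2 := ne_zero_of_mem_ann hc h2
  have e := norm_exchMat_le (m := m) β p hc h1 h2 t
  have s1 := ((norm_entry_le _ i n).trans (norm_star_mul_mul_le (psiPlus_mem_unitary (m := m) hβ hp z1 t)
    (psiMinus_mem_unitary (m := m) hβ hp z2 t))).trans e
  have s2 := ((norm_entry_le _ k j).trans (norm_star_mul_mul_le (psiPlus_mem_unitary (m := m) hβ hp z2 t)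
    (psiMinus_mem_unitary (m := m) hβ hp z1 t))).trans e
  have t1 := norm_transition_apply_le_one (m := m) hβ hp z1 z2 t i n
  have t2 := norm_transition_apply_le_one (m := m) hβ hp z2 z1 t k j
  unfold exchDensity
  refine (norm_sub_le _ _).trans ?_
  rw [norm_mul, norm_mul]
  have m1 := mul_le_mul s1 t2 (norm_nonneg _) ((norm_nonneg _).trans e)
  have m2 := mul_le_mul t1 s2 (norm_nonneg _) zero_le_one
  linarith

lemma continuousAt_exchDensity (hβ : β ≠ 0) (hp : IsPhasePoint β Qm Qp p) {x : (ℝ × ℝ) × ℝ}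
    (h1 : x.1.1 ≠ 0) (h2 : x.1.2 ≠ 0) (i j k n : Fin 2) :
    ContinuousAt (fun x : (ℝ × ℝ) × ℝ => exchDensity m β p i j k n x.1 x.2) x := by
  have g1 : ContinuousAt (fun x : (ℝ × ℝ) × ℝ => (x.1.1, x.2)) x := by fun_prop
  have g2 : ContinuousAt (fun x : (ℝ × ℝ) × ℝ => (x.1.2, x.2)) x := by fun_prop
  have a1 := (ContinuousAt.comp (f := fun x : (ℝ × ℝ) × ℝ => (x.1.1, x.2))
    (continuousAt_psiPlus (m := m) hβ hp (z := (x.1.1, x.2)) h1) g1).star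
  have a2 := (ContinuousAt.comp (f := fun x : (ℝ × ℝ) × ℝ => (x.1.2, x.2))
    (continuousAt_psiPlus (m := m) hβ hp (z := (x.1.2, x.2)) h2) g2).star
  have b1 := ContinuousAt.comp (f := fun x : (ℝ × ℝ) × ℝ => (x.1.1, x.2))
    (continuousAt_psiMinus (m := m) hβ hp (z := (x.1.1, x.2)) h1) g1
  have b2 := ContinuousAt.comp (f := fun x : (ℝ × ℝ) × ℝ => (x.1.2, x.2))
    (continuousAt_psiMinus (m := m) hβ hp (z := (x.1.2, x.2)) h2) g2
  have s : ContinuousAt (fun x : (ℝ × ℝ) × ℝ => exchMat m β p x.1 x.2) x := by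
    have f1 : ContinuousAt (fun x : (ℝ × ℝ) × ℝ => p.1 x.2) x :=
      (hp.smooth_fst.continuous.comp continuous_snd).continuousAt
    have f2 : ContinuousAt (fun x : (ℝ × ℝ) × ℝ => k0 m x.1.1) x :=
      ContinuousAt.comp (f := fun x : (ℝ × ℝ) × ℝ => x.1.1) (continuousAt_k0 m h1) (by fun_prop)
    have f3 : ContinuousAt (fun x : (ℝ × ℝ) × ℝ => k0 m x.1.2) x :=
      ContinuousAt.comp (f := fun x : (ℝ × ℝ) × ℝ => x.1.2) (continuousAt_k0 m h2) (by fun_prop)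
    have f4 : ContinuousAt (fun x : (ℝ × ℝ) × ℝ => k1 m x.1.1) x :=
      ContinuousAt.comp (f := fun x : (ℝ × ℝ) × ℝ => x.1.1) (continuousAt_k1 m h1) (by fun_prop)
    have f5 : ContinuousAt (fun x : (ℝ × ℝ) × ℝ => k1 m x.1.2) x :=
      ContinuousAt.comp (f := fun x : (ℝ × ℝ) × ℝ => x.1.2) (continuousAt_k1 m h2) (by fun_prop)
    unfold exchMat
    fun_prop
  unfold exchDensity
  exact ((continuousAt_entry ((a1.mul s).mul b2) i n).mul (continuousAt_entry (a2.mul b1) k j)).sub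
    ((continuousAt_entry (a1.mul b2) i n).mul (continuousAt_entry ((a2.mul s).mul b1) k j))

lemma continuous_amp_mul_exchDensity (hβ : β ≠ 0) (hp : IsPhasePoint β Qm Qp p)
    (ha : IsAmp c L a) (hb : IsAmp c L b) (i j k n : Fin 2) :
    Continuous fun x : (ℝ × ℝ) × ℝ => a x.1.1 * b x.1.2 * exchDensity m β p i j k n x.1 x.2 := by
  simp only [mul_assoc]
  refine continuous_iff_continuousAt.2 fun x => ha.continuousAt_mul (by fun_prop) fun h1 =>
    hb.continuousAt_mul (by fun_prop) fun h2 => continuousAt_exchDensity hβ hp h1 h2 i j k n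

lemma norm_amp_mul_exchDensity_le (hβ : β ≠ 0) (hp : IsPhasePoint β Qm Qp p)
    (ha : IsAmp c L a) (hb : IsAmp c L b) (i j k n : Fin 2) (z : ℝ × ℝ) (t : ℝ) :
    ‖a z.1 * b z.2 * exchDensity m β p i j k n z t‖ ≤
      ‖a z.1‖ * ‖b z.2‖ * (16 * (gam β * kBound m c)) := by
  by_cases h1 : a z.1 = 0
  · simp [h1]
  by_cases h2 : b z.2 = 0
  · simp [h2]
  rw [norm_mul, norm_mul]
  exact mul_le_mul_of_nonneg_left
    (norm_exchDensity_le hβ hp ha.pos (ha.mem h1) (hb.mem h2) t i j k n) (by positivity)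

lemma integrable_amp_mul_exchDensity (hβ : β ≠ 0) (hp : IsPhasePoint β Qm Qp p)
    (ha : IsAmp c L a) (hb : IsAmp c L b) (i j k n : Fin 2) (t : ℝ) :
    Integrable fun z : ℝ × ℝ => a z.1 * b z.2 * exchDensity m β p i j k n z t := by
  refine ((ha.integrable.norm.mul_prod hb.integrable.norm).mul_const
    (16 * (gam β * kBound m c))).mono' ?_
    (Eventually.of_forall fun z => norm_amp_mul_exchDensity_le hβ hp ha hb i j k n z t)
  exact ((continuous_amp_mul_exchDensity hβ hp ha hb i j k n).comp
    (continuous_id.prodMk continuous_const)).aestronglyMeasurable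

/-- The exchange density is controlled only by a bound constant in t, so Fubini is used on a bounded
time interval before R is sent to infinity. -/
lemma integral_exchDensity_swap (hβ : β ≠ 0) (hp : IsPhasePoint β Qm Qp p)
    (ha : IsAmp c L a) (hb : IsAmp c L b) (i j k n : Fin 2) {R : ℝ} (hR : 0 ≤ R) :
    (Integrable fun z : ℝ × ℝ => ∫ t in -R..R, a z.1 * b z.2 * exchDensity m β p i j k n z t) ∧
    ∫ t in -R..R, ∫ z : ℝ × ℝ, a z.1 * b z.2 * exchDensity m β p i j k n z t =
      ∫ z : ℝ × ℝ, ∫ t in -R..R, a z.1 * b z.2 * exchDensity m β p i j k n z t := by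
  have hle : -R ≤ R := by linarith
  have hi : Integrable (Function.uncurry fun (z : ℝ × ℝ) (t : ℝ) =>
      a z.1 * b z.2 * exchDensity m β p i j k n z t)
      ((volume : Measure (ℝ × ℝ)).prod (volume.restrict (Ioc (-R) R))) := by
    have hc1 : Integrable (fun _ : ℝ => 16 * (gam β * kBound m c)) (volume.restrict (Ioc (-R) R)) :=
      integrable_const _
    refine ((ha.integrable.norm.mul_prod hb.integrable.norm).mul_prod hc1).mono' ?_
      (Eventually.of_forall fun x => norm_amp_mul_exchDensity_le hβ hp ha hb i j k n x.1 x.2)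
    exact (continuous_amp_mul_exchDensity hβ hp ha hb i j k n).aestronglyMeasurable
  simp only [intervalIntegral.integral_of_le hle]
  exact ⟨hi.integral_prod_left, (integral_integral_swap hi).symm⟩

/-- The boundary term at time `R`, before division by `l - u`. -/
def exchBoundary (m β : ℝ) (p : Phase) (a b : ℝ → ℂ) (i j k n : Fin 2) (R : ℝ) (z : ℝ × ℝ) : ℂ :=
  a z.1 * b z.2 * ((z.1 + z.2 : ℝ) : ℂ) *
    (exchProd m β p i j k n z R - exchProd m β p i j k n z (-R))

lemma integral_exchDensity_eq (hβ : β ≠ 0) (hp : IsPhasePoint β Qm Qp p)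
    (ha : IsAmp c L a) (hb : IsAmp c L b) (i j k n : Fin 2) (R : ℝ) {z : ℝ × ℝ} (hz : z.1 ≠ z.2) :
    ∫ t in -R..R, a z.1 * b z.2 * exchDensity m β p i j k n z t =
      (-gam β : ℂ) * (exchBoundary m β p a b i j k n R z * ((1 / (z.1 - z.2) : ℝ) : ℂ)) := by
  unfold exchBoundary
  by_cases h1 : a z.1 = 0
  · simp [h1]
  by_cases h2 : b z.2 = 0
  · simp [h2]
  have z1 := ne_zero_of_mem_ann ha.pos (ha.mem h1)
  have z2 := ne_zero_of_mem_ann hb.pos (hb.mem h2)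
  have hcont : Continuous fun t => a z.1 * b z.2 * exchDensity m β p i j k n z t :=
    (continuous_amp_mul_exchDensity hβ hp ha hb i j k n).comp (continuous_const.prodMk continuous_id)
  rw [intervalIntegral.integral_eq_sub_of_hasDerivAt (fun t _ =>
    (hasDerivAt_exchProd hβ hp i j k n z1 z2 hz t).const_mul (a z.1 * b z.2))
    (hcont.intervalIntegrable _ _)]
  push_cast
  ring

/-- The boundary difference divided by `l - u` is, off the null diagonal, the time integral of a
bounded density. It is therefore integrable, and its principal value is an ordinary integral. -/
lemma integral_exchDensity_eq_pv (hβ : β ≠ 0) (hp : IsPhasePoint β Qm Qp p)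
    (ha : IsAmp c L a) (hb : IsAmp c L b) (i j k n : Fin 2) {R : ℝ} (hR : 0 ≤ R) :
    (Integrable fun z : ℝ × ℝ =>
      exchBoundary m β p a b i j k n R z * ((1 / (z.1 - z.2) : ℝ) : ℂ)) ∧
    ∫ t in -R..R, ∫ z : ℝ × ℝ, a z.1 * b z.2 * exchDensity m β p i j k n z t =
      (-gam β : ℂ) * pv (exchBoundary m β p a b i j k n R) := by
  obtain ⟨h1, h2⟩ := integral_exchDensity_swap (m := m) hβ hp ha hb i j k n hR
  have hg : (gam β : ℂ) ≠ 0 := by exact_mod_cast (gam_pos hβ).ne'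
  have hae : ∀ᵐ z : ℝ × ℝ, ∫ t in -R..R, a z.1 * b z.2 * exchDensity m β p i j k n z t =
      (-gam β : ℂ) * (exchBoundary m β p a b i j k n R z * ((1 / (z.1 - z.2) : ℝ) : ℂ)) := by
    filter_upwards [ae_fst_ne_snd] with z hz
    exact integral_exchDensity_eq hβ hp ha hb i j k n R hz
  have hi : Integrable fun z : ℝ × ℝ =>
      exchBoundary m β p a b i j k n R z * ((1 / (z.1 - z.2) : ℝ) : ℂ) := by
    refine ((h1.congr hae).const_mul (-gam β : ℂ)⁻¹).congr (Eventually.of_forall fun z => ?_)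
    simp only
    rw [inv_mul_cancel_left₀ (neg_ne_zero.2 hg)]
  refine ⟨hi, ?_⟩
  rw [h2, (pv_eq_integral hi).2, ← integral_const_mul]
  exact integral_congr_ae hae

/-- The limit of the principal value of an oscillating product. -/
def oscLimit (m : ℝ) (i k : Fin 2) (a b : ℝ → ℂ) : ℂ :=
  if i = k then pv (oscProd m a b 0)
  else spin i * (Complex.I *
    (Real.pi * ∫ l, ((2 * l * Real.sign (l ^ 2 - 1) : ℝ) : ℂ) * (a l * b l)))

lemma tendsto_oscLimit (hm : 0 < m) (ha : IsAmp c L a) (hb : IsAmp c L b) (i k : Fin 2) :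
    Tendsto (fun R : ℝ => pv (oscProd m a b (R * ((spin i - spin k) / 2)))) atTop
      (𝓝 (oscLimit m i k a b)) := by
  have h1 := tendsto_pv_oscProd_atTop hm ha hb
  have h2 := (tendsto_pv_oscProd_atBot hm ha hb).comp tendsto_neg_atTop_atBot
  fin_cases i <;> fin_cases k
  · simp [oscLimit, spin]
  · simpa [oscLimit, spin] using h1
  · simp [oscLimit, spin]
    norm_num
    simpa [Function.comp_def] using h2
  · simp [oscLimit, spin]

/-- The contribution to the bracket of the boundary terms at `t = ±∞`. -/
def exchLimit (m β : ℝ) (M : ℝ → Mat) (a b : ℝ → ℂ) (i j k n : Fin 2) : ℂ :=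
  (-gam β : ℂ) * (oscLimit m i k (fun l => a l * M l k j) (fun l => b l * M l i n) -
    oscLimit m j n (fun l => a l * M l i n) (fun l => b l * M l k j))

/-- Though the total boundary term has an integrable quotient, its asymptotic pieces do not
separately; symmetrised principal values allow them to be split and each limit taken on its own. -/
lemma tendsto_pv_exchBoundary (hm : 0 < m) (hβ : β ≠ 0) (hp : IsPhasePoint β Qm Qp p)
    (ha : IsAmp c L a) (hb : IsAmp c L b) (i j k n : Fin 2) :
    Tendsto (fun R => (-gam β : ℂ) * pv (exchBoundary m β p a b i j k n R)) atTop
      (𝓝 (exchLimit m β (timeMonodromy m β p) a b i j k n)) := by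
  refine Tendsto.const_mul _ ?_
  obtain ⟨L₁, hA⟩ := exists_isAmp_mul_timeMonodromy m hβ hp ha
  obtain ⟨L₂, hB⟩ := exists_isAmp_mul_timeMonodromy m hβ hp hb
  have hA' : ∀ i j, IsAmp c (max L₁ L₂) fun l => a l * timeMonodromy m β p l i j := fun i j =>
    (hA i j).mono ha.pos le_rfl (le_max_left _ _)
  have hB' : ∀ i j, IsAmp c (max L₁ L₂) fun l => b l * timeMonodromy m β p l i j := fun i j =>
    (hB i j).mono ha.pos le_rfl (le_max_right _ _)
  obtain ⟨η, hη, hasy⟩ := exists_exchProd_asymptotics m hβ hp ha.pos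
  set O₁ : ℝ → ℝ × ℝ → ℂ := fun R => oscProd m (fun l => a l * timeMonodromy m β p l k j)
    (fun l => b l * timeMonodromy m β p l i n) (R * ((spin i - spin k) / 2)) with hO₁
  set O₂ : ℝ → ℝ × ℝ → ℂ := fun R => oscProd m (fun l => a l * timeMonodromy m β p l i n)
    (fun l => b l * timeMonodromy m β p l k j) (R * ((spin j - spin n) / 2)) with hO₂
  set E : ℝ → ℝ × ℝ → ℂ := fun R z => exchBoundary m β p a b i j k n R z - (O₁ R z - O₂ R z) with hE
  have hab : Integrable fun z : ℝ × ℝ => ‖a z.1‖ * ‖b z.2‖ :=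
    ha.integrable.norm.mul_prod hb.integrable.norm
  have hcp := inv_pos.2 ha.pos
  -- Here the Lipschitz form of the asymptotics is essential: the factor `|z.1 - z.2|` cancels the
  -- denominator.
  have bE : ∀ R ≥ 0, ∀ z : ℝ × ℝ, ‖E R z * ((1 / (z.1 - z.2) : ℝ) : ℂ)‖ ≤
      ‖a z.1‖ * ‖b z.2‖ * (4 * c⁻¹ * η R) := by
    intro R hR z
    obtain ⟨hη0, hz⟩ := hasy R hR
    have e : E R z = a z.1 * b z.2 * ((z.1 + z.2 : ℝ) : ℂ) *
        ((exchProd m β p i j k n z R - timeMonodromy m β p z.1 k j * timeMonodromy m β p z.2 i n *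
          Complex.exp (Complex.I *
            ((2 * (R * ((spin i - spin k) / 2)) * (k0 m z.1 - k0 m z.2) : ℝ) : ℂ))) -
        (exchProd m β p i j k n z (-R) - timeMonodromy m β p z.1 i n * timeMonodromy m β p z.2 k j *
          Complex.exp (Complex.I *
            ((2 * (R * ((spin j - spin n) / 2)) * (k0 m z.1 - k0 m z.2) : ℝ) : ℂ)))) := by
      simp only [hE, hO₁, hO₂, exchBoundary, oscProd]
      ring
    by_cases h1 : a z.1 = 0
    · simp [e, h1]
    by_cases h2 : b z.2 = 0
    · simp [e, h2]
    obtain ⟨e1, e2⟩ := hz z (ha.mem h1) (hb.mem h2) i j k n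
    rcases eq_or_ne z.1 z.2 with h12 | h12
    · simp only [h12, sub_self, div_zero, Complex.ofReal_zero, mul_zero, norm_zero]
      positivity
    have hd : 0 < |z.1 - z.2| := abs_pos.2 (sub_ne_zero.2 h12)
    have hs : |z.1 + z.2| ≤ 2 * c⁻¹ :=
      (abs_add_le _ _).trans (by linarith [ha.abs_le h1, hb.abs_le h2])
    rw [e, norm_mul, norm_mul, norm_mul, norm_mul, Complex.norm_real, Complex.norm_real,
      Real.norm_eq_abs, Real.norm_eq_abs, abs_div, abs_one, mul_one_div, div_le_iff₀ hd]
    have e3 := (norm_sub_le _ _).trans (add_le_add e1 e2)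
    calc _ ≤ ‖a z.1‖ * ‖b z.2‖ * (2 * c⁻¹) * (η R * |z.1 - z.2| + η R * |z.1 - z.2|) := by
          refine mul_le_mul ?_ e3 (norm_nonneg _) (by positivity)
          exact mul_le_mul_of_nonneg_left hs (by positivity)
      _ = _ := by ring
  have iE : ∀ R ≥ 0, Integrable fun z : ℝ × ℝ => E R z * ((1 / (z.1 - z.2) : ℝ) : ℂ) := by
    intro R hR
    refine (hab.mul_const (4 * c⁻¹ * η R)).mono' ?_ (Eventually.of_forall (bE R hR))
    have hmO : Measurable fun z : ℝ × ℝ => (O₁ R z - O₂ R z) * ((1 / (z.1 - z.2) : ℝ) : ℂ) := by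
      have a1 := (hA' k j).measurable
      have a2 := (hA' i n).measurable
      have b1 := (hB' k j).measurable
      have b2 := (hB' i n).measurable
      have hk := measurable_k0 m
      simp only [hO₁, hO₂, oscProd]
      refine Measurable.mul (Measurable.sub (Measurable.mul (Measurable.mul (by fun_prop)
        ((a1.comp measurable_fst).mul (b2.comp measurable_snd))) (by fun_prop))
        (Measurable.mul (Measurable.mul (by fun_prop)
        ((a2.comp measurable_fst).mul (b1.comp measurable_snd))) (by fun_prop))) (by fun_prop)
    refine ((integral_exchDensity_eq_pv (m := m) hβ hp ha hb i j k n hR).1.aestronglyMeasurable.sub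
      hmO.aestronglyMeasurable).congr (Eventually.of_forall fun z => ?_)
    simp only [hE, Pi.sub_apply]
    ring
  have hpv : ∀ R ≥ 0, pv (O₁ R) - pv (O₂ R) + pv (E R) =
      pv (exchBoundary m β p a b i j k n R) := by
    intro R hR
    have i1 := (pv_oscProd m (R * ((spin i - spin k) / 2)) (hA' k j) (hB' i n)).1
    have i2 := (pv_oscProd m (R * ((spin j - spin n) / 2)) (hA' i n) (hB' k j)).1
    have i3 := (pv_eq_integral (integral_exchDensity_eq_pv (m := m) hβ hp ha hb i j k n hR).1).1
    have s1 := pv_sub i1 i2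
    have s2 := pv_sub i3 (pv_eq_integral (iE R hR)).1
    have s3 : (fun z => exchBoundary m β p a b i j k n R z - E R z) = fun z => O₁ R z - O₂ R z := by
      funext z; simp only [hE]; ring
    rw [s3, show (fun z => O₁ R z - O₂ R z) = _ from rfl, s1] at s2
    exact eq_sub_iff_add_eq.1 s2
  have tE : Tendsto (fun R => pv (E R)) atTop (𝓝 0) := by
    have t0 := (hη.const_mul (4 * c⁻¹)).const_mul (∫ z : ℝ × ℝ, ‖a z.1‖ * ‖b z.2‖)
    rw [mul_zero, mul_zero] at t0
    refine squeeze_zero_norm' ?_ t0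
    filter_upwards [eventually_ge_atTop 0] with R hR
    rw [(pv_eq_integral (iE R hR)).2, ← integral_mul_const]
    exact norm_integral_le_of_norm_le (hab.mul_const _) (Eventually.of_forall (bE R hR))
  have t1 := tendsto_oscLimit hm (hA' k j) (hB' i n) i k
  have t2 := tendsto_oscLimit hm (hA' i n) (hB' k j) j n
  have t3 := (t1.sub t2).add tE
  rw [add_zero] at t3
  refine t3.congr' ?_
  filter_upwards [eventually_ge_atTop 0] with R hR
  exact hpv R hR

/-- The double integral of the r-matrix relation. The change of variable l → -l moves the reflection
from the density onto the amplitude, so the second term has the form of the first. -/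
lemma bracketDensity_eq (hβ : β ≠ 0) (hp : IsPhasePoint β Qm Qp p)
    (ha : IsAmp c L a) (hb : IsAmp c L b) (i j k n : Fin 2) (t : ℝ) :
    bracketDensity m β p a b i j k n t =
      (∫ z : ℝ × ℝ, a z.1 * b z.2 * exchDensity m β p i j k n z t) +
      spin i * spin j *
        ∫ z : ℝ × ℝ, a (-z.1) * b z.2 * exchDensity m β p (i + 1) (j + 1) k n z t := by
  have hneg : ∫ z : ℝ × ℝ, a (-z.1) * b z.2 * exchDensity m β p (i + 1) (j + 1) k n z t =
      ∫ z : ℝ × ℝ, a z.1 * b z.2 * exchDensity m β p (i + 1) (j + 1) k n (-z.1, z.2) t := by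
    rw [← integral_reflect_fst]
    simp only [neg_neg]
  have hi2 : Integrable fun z : ℝ × ℝ =>
      a z.1 * b z.2 * exchDensity m β p (i + 1) (j + 1) k n (-z.1, z.2) t := by
    have := integrable_reflect_fst
      (integrable_amp_mul_exchDensity (m := m) hβ hp ha.neg_arg hb (i + 1) (j + 1) k n t)
    simpa only [neg_neg] using this
  have iK : ∀ (a : ℝ → ℂ), IsAmp c L a → ∀ i j, (Integrable fun l => a l * kerPhi m β p l t i j) ∧
      Integrable fun l => a l * kerPi m β p l t i j := fun a ha i j => by
    constructor
    · exact (ha.integrable.norm.mul_const _).mono'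
        (((continuous_amp_mul_kernel (K := kerPhi m β p) ha
          (fun z hz => continuousAt_kerPhi hβ hp hz) i j).comp
          (continuous_id.prodMk continuous_const)).aestronglyMeasurable)
        (Eventually.of_forall fun l => norm_amp_mul_kernel_le ha
          (fun l hl t => norm_kerPhi_le hβ hp ha.pos hl t) i j l t)
    · exact (ha.integrable.norm.mul_const _).mono'
        (((continuous_amp_mul_kernel (K := kerPi m β p) ha
          (fun z hz => continuousAt_kerPi hβ hp hz) i j).comp
          (continuous_id.prodMk continuous_const)).aestronglyMeasurable)
        (Eventually.of_forall fun l => norm_amp_mul_kernel_le ha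
          (fun l hl t => norm_kerPi_le hβ hp ha.pos hl t) i j l t)
  rw [hneg, ← integral_const_mul,
    ← integral_add (integrable_amp_mul_exchDensity hβ hp ha hb i j k n t) (hi2.const_mul _),
    bracketDensity, smearKernel, smearKernel, smearKernel, smearKernel, ← integral_prod_mul,
    ← integral_prod_mul, ← integral_sub ((iK a ha i j).1.mul_prod (iK b hb k n).2)
      ((iK a ha i j).2.mul_prod (iK b hb k n).1)]
  refine integral_congr_ae (Eventually.of_forall fun z => ?_)
  beta_reduce
  by_cases h1 : a z.1 = 0
  · simp [h1]
  have := kerPhi_mul_kerPi_sub (m := m) hβ hp i j k n (ne_zero_of_mem_ann ha.pos (ha.mem h1)) z.2 t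
  linear_combination (a z.1 * b z.2) * this

/-- Integrability over the whole line, known from the kernel decay, identifies the integral with the
limit over [-R, R], and the boundary terms give that limit. -/
lemma integral_bracketDensity (hm : 0 < m) (hβ : β ≠ 0) (hp : IsPhasePoint β Qm Qp p)
    (ha : IsAmp c L a) (hb : IsAmp c L b) (i j k n : Fin 2) :
    ∫ t, bracketDensity m β p a b i j k n t =
      exchLimit m β (timeMonodromy m β p) a b i j k n +
      spin i * spin j *
        exchLimit m β (timeMonodromy m β p) (fun l => a (-l)) b (i + 1) (j + 1) k n := by
  have h0 := intervalIntegral_tendsto_integral (integrable_bracketDensity hm hβ hp ha hb i j k n)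
    tendsto_neg_atTop_atBot tendsto_id
  refine tendsto_nhds_unique h0 ?_
  have t1 := tendsto_pv_exchBoundary hm hβ hp ha hb i j k n
  have t2 := (tendsto_pv_exchBoundary hm hβ hp ha.neg_arg hb (i + 1) (j + 1) k n).const_mul
    ((spin i : ℂ) * spin j)
  refine (t1.add t2).congr' ?_
  filter_upwards [eventually_ge_atTop 0] with R hR
  have ci : ∀ (a : ℝ → ℂ), IsAmp c L a → ∀ i j, IntervalIntegrable (fun t =>
      ∫ z : ℝ × ℝ, a z.1 * b z.2 * exchDensity m β p i j k n z t) volume (-R) R := by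
    intro a ha i j
    refine Continuous.intervalIntegrable ?_ _ _
    have hcont := continuous_amp_mul_exchDensity (m := m) hβ hp ha hb i j k n
    exact continuous_of_dominated (fun t => (hcont.comp
      (continuous_id.prodMk continuous_const)).aestronglyMeasurable)
      (fun t => Eventually.of_forall fun z => norm_amp_mul_exchDensity_le hβ hp ha hb i j k n z t)
      ((ha.integrable.norm.mul_prod hb.integrable.norm).mul_const _)
      (Eventually.of_forall fun z => hcont.comp (continuous_const.prodMk continuous_id))
  rw [← (integral_exchDensity_eq_pv hβ hp ha hb i j k n hR).2,
    ← (integral_exchDensity_eq_pv hβ hp ha.neg_arg hb (i + 1) (j + 1) k n hR).2,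
    ← intervalIntegral.integral_const_mul, ← intervalIntegral.integral_add (ci a ha i j)
      ((ci _ ha.neg_arg (i + 1) (j + 1)).const_mul _)]
  exact intervalIntegral.integral_congr fun t _ => (bracketDensity_eq hβ hp ha hb i j k n t).symm

end

/-! ### Entries of the quadratic algebra -/

lemma expPauli3_eq_diagonal (z : ℂ) :
    expPauli3 z = Matrix.diagonal fun i => Complex.exp (spin i * z) := by
  ext i j; fin_cases i <;> fin_cases j <;> simp [expPauli3, spin]

lemma conjX_apply (m x l u : ℝ) (R : Mat4) (a b : Fin 2 × Fin 2) :
    conjX m x l u R a b = Complex.exp (Complex.I * x * ((spin a.1 - spin b.1) * k1 m l +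
      (spin a.2 - spin b.2) * k1 m u)) * R a b := by
  simp only [conjX, expPauli3_eq_diagonal, Matrix.diagonal_kronecker_diagonal,
    Matrix.mul_diagonal, Matrix.diagonal_mul]
  rw [mul_right_comm, ← Complex.exp_add, ← Complex.exp_add, ← Complex.exp_add]
  congr 2
  push_cast
  ring

lemma conjX_rDiag (m β x ε l u : ℝ) : conjX m x l u (rDiag β ε l u) = rDiag β ε l u := by
  ext a b
  rw [conjX_apply]
  rcases eq_or_ne a b with rfl | h
  · simp
  · simp [rDiag, Matrix.diagonal_apply_ne _ h]

/-- The two non-zero entries acquire phases ±2(k₁(l) - k₁(u))x, which vanish at u = l. With the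
diagonal part this makes the r-matrices independent of x. -/
lemma conjX_rDelta (m β x s l : ℝ) : conjX m x l l (rDelta β s l l) = rDelta β s l l := by
  ext a b
  rw [conjX_apply]
  by_cases h1 : a = (0, 1) ∧ b = (1, 0)
  · rw [h1.1, h1.2]
    convert one_mul _
    rw [← Complex.exp_zero]
    congr 1
    simp [spin]
    right
    ring
  by_cases h2 : a = (1, 0) ∧ b = (0, 1)
  · rw [h2.1, h2.2]
    convert one_mul _
    rw [← Complex.exp_zero]
    congr 1
    simp [spin]
    right
    ring
  simp [rDelta, h1, h2]

/-- The diagonal entries of `-r_± / γ`. -/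
def rCoef (ε : ℝ) (i k : Fin 2) (z : ℝ × ℝ) : ℂ :=
  if i = k then (((z.1 - z.2) / (z.1 + z.2) : ℝ) : ℂ)
  else if ε < |z.1 - z.2| then (((z.1 + z.2) / (z.1 - z.2) : ℝ) : ℂ) else 0

lemma quadratic_rDiag_apply (β ε : ℝ) (M : ℝ → Mat) (l u : ℝ) (i j k n : Fin 2) :
    quadratic M l u (rDiag β ε l u) (rDiag β ε l u) (i, k) (j, n) =
      (-gam β : ℂ) * (-rCoef ε i k (l, u) + rCoef ε j n (l, u)) * (M l i j * M u k n) := by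
  rw [quadratic, ← Matrix.mul_kronecker_mul, one_mul, mul_one, rDiag]
  simp only [Matrix.add_apply, Matrix.neg_apply, Matrix.smul_mul, Matrix.mul_smul,
    Matrix.smul_apply, Matrix.diagonal_mul, Matrix.mul_diagonal, Matrix.kroneckerMap_apply,
    smul_eq_mul, rCoef]
  ring

lemma rDelta_mul_apply (β s l u : ℝ) (K : Mat4) (i k : Fin 2) (b : Fin 2 × Fin 2) :
    (rDelta β s l u * K) (i, k) b = if i = k then 0 else
      gam β * (s * Complex.I * ((Real.pi * Real.sign (l ^ 2 - 1) * (l + u) : ℝ) : ℂ)) * spin i *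
        K (k, i) b := by
  rw [Matrix.mul_apply, Fintype.sum_prod_type]
  fin_cases i <;> fin_cases k <;> simp [rDelta, spin, Fin.sum_univ_two]

lemma mul_rDelta_apply (β s l u : ℝ) (K : Mat4) (a : Fin 2 × Fin 2) (j n : Fin 2) :
    (K * rDelta β s l u) a (j, n) = if j = n then 0 else
      -(gam β * (s * Complex.I * ((Real.pi * Real.sign (l ^ 2 - 1) * (l + u) : ℝ) : ℂ)) * spin j *
        K a (n, j)) := by
  rw [Matrix.mul_apply, Fintype.sum_prod_type]
  fin_cases j <;> fin_cases n <;> simp [rDelta, spin, Fin.sum_univ_two] <;> ring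

/-- The coefficient of the local part of the bracket. -/
def localCoef (i j k n : Fin 2) : ℂ :=
  (if i = k then 0 else (spin i : ℂ)) - if j = n then 0 else (spin j : ℂ)

lemma quadratic_rDelta_apply (β : ℝ) (M : ℝ → Mat) (l : ℝ) (i j k n : Fin 2) :
    quadratic M l l (rDelta β 1 l l) (rDelta β (-1) l l) (i, k) (j, n) =
      (-gam β : ℂ) * (localCoef i j k n * (Complex.I * Real.pi)) *
        (((2 * l * Real.sign (l ^ 2 - 1) : ℝ) : ℂ) * (M l k j * M l i n)) := by
  rw [quadratic, ← Matrix.mul_kronecker_mul, one_mul, mul_one, Matrix.add_apply, Matrix.neg_apply,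
    rDelta_mul_apply, mul_rDelta_apply, localCoef]
  simp only [Matrix.kroneckerMap_apply]
  push_cast
  split_ifs <;> ring

/-! ### Principal values and reflection -/

section

variable {m β c L : ℝ} {Qm Qp : ℤ} {p : Phase} {a b : ℝ → ℂ}

lemma pv_oscProd_const_mul (m r : ℝ) (x : ℂ) (a b : ℝ → ℂ) :
    pv (oscProd m (fun l => x * a l) b r) = x * pv (oscProd m a b r) := by
  rw [pv, pv, ← integral_const_mul]
  congr 1; funext z
  simp only [pvIntegrand, oscProd]
  ring

/-- The limit of the pairing with the diagonal entries of the `r`-matrix. -/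
def coefLimit (m : ℝ) (i k : Fin 2) (a b : ℝ → ℂ) : ℂ :=
  if i = k then pv (oscProd m (fun l => a (-l)) b 0) else pv (oscProd m a b 0)

/-- The regular coefficient (l - u)/(l + u) is the singular one at the reflected parameter -l. The
separation `δ` makes the truncation there inactive once ε ≤ δ. -/
lemma tendsto_integral_rCoef (m : ℝ) (ha : IsAmp c L a) (hb : IsAmp c L b)
    {δ : ℝ} (hδ : 0 < δ) (hsep : ∀ l u, a l ≠ 0 → b u ≠ 0 → δ < |l + u|) (i k : Fin 2) :
    (∀ ε > 0, Integrable fun z : ℝ × ℝ => a z.1 * b z.2 * rCoef ε i k z) ∧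
    Tendsto (fun ε : ℝ => ∫ z : ℝ × ℝ, a z.1 * b z.2 * rCoef ε i k z) (𝓝[>] 0)
      (𝓝 (coefLimit m i k a b)) := by
  unfold rCoef coefLimit
  split_ifs with hik
  · obtain ⟨h1, h2⟩ := tendsto_truncated_pv m ha.neg_arg hb
    have e : ∀ ε, ε ≤ δ → (fun z : ℝ × ℝ => a (- -z.1) * b z.2 * (if ε < |-z.1 - z.2| then
        (((-z.1 + z.2) / (-z.1 - z.2) : ℝ) : ℂ) else 0)) = fun z : ℝ × ℝ => a z.1 * b z.2 *
        (((z.1 - z.2) / (z.1 + z.2) : ℝ) : ℂ) := by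
      intro ε hε
      funext z
      rw [neg_neg]
      by_cases ha0 : a z.1 = 0
      · simp [ha0]
      by_cases hb0 : b z.2 = 0
      · simp [hb0]
      have h3 := hsep _ _ ha0 hb0
      rw [show -z.1 - z.2 = -(z.1 + z.2) by ring, abs_neg, if_pos (hε.trans_lt h3),
        show -z.1 + z.2 = -(z.1 - z.2) by ring, neg_div_neg_eq]
    constructor
    · intro _ _
      rw [← e δ le_rfl]
      exact integrable_reflect_fst (h1 δ hδ)
    · refine Tendsto.congr' ?_ h2
      have : Iic δ ∈ 𝓝[>] (0:ℝ) := mem_nhdsWithin_of_mem_nhds (Iic_mem_nhds hδ)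
      filter_upwards [this] with ε hε
      rw [← integral_reflect_fst, ← e ε hε]
  · exact tendsto_truncated_pv m ha hb

lemma oscLimit_eq_zero {i k : Fin 2} (hik : i ≠ k) (h : ∀ l, a l * b l = 0) :
    oscLimit m i k a b = 0 := by
  simp [oscLimit, hik, h]

lemma pv_reflected (hβ : β ≠ 0) (hp : IsPhasePoint β Qm Qp p) (ha : IsAmp c L a) (i j : Fin 2)
    (b : ℝ → ℂ) :
    spin i * spin j *
        pv (oscProd m (fun l => a (-l) * timeMonodromy m β p l (i + 1) (j + 1)) b 0) =
      pv (oscProd m (fun l => a (-l) * timeMonodromy m β p (-l) i j) b 0) := by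
  rw [← pv_oscProd_const_mul]
  congr 2
  funext l
  by_cases h : a (-l) = 0
  · simp [h]
  have hl : -l ≠ 0 := ne_zero_of_mem_ann ha.pos (ha.mem h)
  have h1 := timeMonodromy_neg_apply (m := m) hβ hp hl i j
  rw [neg_neg] at h1
  rw [h1]
  linear_combination (a (-l) * timeMonodromy m β p (-l) i j * spin j * spin j) * spin_mul_self i +
    (a (-l) * timeMonodromy m β p (-l) i j) * spin_mul_self j

lemma eq_add_one_of_ne {i k : Fin 2} (h : i ≠ k) : k = i + 1 := by
  fin_cases i <;> fin_cases k <;> simp_all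

/-- The sum of the boundary contributions, in terms of the entries of the `r`-matrices. -/
lemma exchLimit_add_reflected (hβ : β ≠ 0) (hp : IsPhasePoint β Qm Qp p) (ha : IsAmp c L a)
    (hab : ∀ l, a (-l) * b l = 0) (i j k n : Fin 2) :
    exchLimit m β (timeMonodromy m β p) a b i j k n +
      spin i * spin j *
        exchLimit m β (timeMonodromy m β p) (fun l => a (-l)) b (i + 1) (j + 1) k n =
    (-gam β : ℂ) * (-coefLimit m i k (fun l => a l * timeMonodromy m β p l i j)
          (fun l => b l * timeMonodromy m β p l k n) +
        coefLimit m j n (fun l => a l * timeMonodromy m β p l i j)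
          (fun l => b l * timeMonodromy m β p l k n)) +
      (-gam β : ℂ) * (localCoef i j k n * (Complex.I * Real.pi)) *
        ∫ l, ((2 * l * Real.sign (l ^ 2 - 1) : ℝ) : ℂ) *
          (a l * timeMonodromy m β p l k j * (b l * timeMonodromy m β p l i n)) := by
  have hne : ∀ i : Fin 2, i + 1 ≠ i := fun i => by fin_cases i <;> simp
  -- The reflected local terms carry a(-l) b(l), zero by separation of the supports. In each case
  -- below, equal indices keep the direct principal value and distinct indices the reflected one.
  have z0 : ∀ (x y : ℝ → ℂ) (i : Fin 2), oscLimit m (i + 1) i (fun l => a (-l) * x l)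
      (fun l => b l * y l) = 0 := fun x y i => oscLimit_eq_zero (hne i) fun l => by
    rw [mul_mul_mul_comm, hab, zero_mul]
  have hc : ∫ l, ((2 * l * Real.sign (l ^ 2 - 1) : ℝ) : ℂ) *
      (a l * timeMonodromy m β p l i n * (b l * timeMonodromy m β p l k j)) =
      ∫ l, ((2 * l * Real.sign (l ^ 2 - 1) : ℝ) : ℂ) *
      (a l * timeMonodromy m β p l k j * (b l * timeMonodromy m β p l i n)) :=
    integral_congr_ae (Eventually.of_forall fun l => by ring)
  unfold exchLimit
  by_cases hik : i = k <;> by_cases hjn : j = n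
  · subst hik hjn
    rw [z0, z0]
    simp [localCoef, oscLimit, coefLimit]
  · obtain rfl := eq_add_one_of_ne hjn
    subst hik
    have := pv_reflected (m := m) hβ hp ha i j (fun l => b l * timeMonodromy m β p l i (j + 1))
    rw [z0]
    simp only [oscLimit, coefLimit, localCoef, if_true, hjn, if_false]
    rw [hc]
    linear_combination (gam β : ℂ) * this
  · obtain rfl := eq_add_one_of_ne hik
    subst hjn
    have := pv_reflected (m := m) hβ hp ha i j (fun l => b l * timeMonodromy m β p l (i + 1) j)
    rw [z0]
    simp only [oscLimit, coefLimit, localCoef, if_true, hik, if_false]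
    linear_combination (-gam β : ℂ) * this
  · obtain rfl := eq_add_one_of_ne hik
    obtain rfl := eq_add_one_of_ne hjn
    simp only [oscLimit, coefLimit, localCoef, if_true, hik, hjn, if_false]
    rw [hc]
    ring

end

/-! ### Test functions -/

/-- Zero lies outside the closed support, so a ball around it does too; compactness bounds the
support from above and provides the size and Lipschitz constants. -/
lemma IsTest.exists_isAmp {χ : ℝ → ℂ} (hχ : IsTest χ) : ∃ c L, IsAmp c L χ := by
  obtain ⟨r, hr, hball⟩ := Metric.isOpen_iff.1 (isClosed_tsupport χ).isOpen_compl 0 hχ.zero_notMem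
  obtain ⟨T, hT⟩ := hχ.compact.isCompact.isBounded.subset_closedBall (0 : ℝ)
  obtain ⟨B, hB⟩ := hχ.compact.exists_bound_of_continuous hχ.smooth.continuous
  obtain ⟨K, hK⟩ := hχ.smooth.lipschitzWith_of_hasCompactSupport hχ.compact (by simp)
  have hT1 : 0 < |T| + 1 := by positivity
  refine ⟨min r (|T| + 1)⁻¹, max B K, lt_min hr (inv_pos.2 hT1), fun l hl => ?_,
    fun l => (hB l).trans (le_max_left _ _), fun l l' => ?_⟩
  · by_contra h
    have hmem : l ∈ tsupport χ := subset_tsupport χ h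
    refine hl ⟨(min_le_left _ _).trans (not_lt.1 fun h1 => ?_), ?_⟩
    · exact hball (by simpa using h1) hmem
    · have h2 : |l| ≤ T := by simpa using hT hmem
      rw [← inv_inv |l|]
      rcases eq_or_lt_of_le (abs_nonneg l) with h0 | h0
      · rw [← h0]; simp only [inv_zero]; positivity
      · refine inv_anti₀ (lt_min hr (inv_pos.2 hT1)) ((min_le_right _ _).trans ?_)
        exact inv_anti₀ h0 (by linarith [le_abs_self T])
  · have := hK.dist_le_mul l l'
    rw [dist_eq_norm, Real.dist_eq] at this
    exact this.trans (mul_le_mul_of_nonneg_right (le_max_right _ _) (abs_nonneg _))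

lemma exists_common_isAmp {χ ψ : ℝ → ℂ} (hχ : IsTest χ) (hψ : IsTest ψ) :
    ∃ c L, IsAmp c L χ ∧ IsAmp c L ψ := by
  obtain ⟨c, L, h⟩ := hχ.exists_isAmp
  obtain ⟨c', L', h'⟩ := hψ.exists_isAmp
  have hc := lt_min h.pos h'.pos
  exact ⟨min c c', max L L', h.mono hc (min_le_left _ _) (le_max_left _ _),
    h'.mono hc (min_le_right _ _) (le_max_right _ _)⟩

lemma IsTest.mul {χ g : ℝ → ℂ} (hχ : IsTest χ) (hg : ContDiff ℝ ∞ g) :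
    IsTest fun l => χ l * g l where
  smooth := hχ.smooth.mul hg
  compact := hχ.compact.mul_right
  zero_notMem h := hχ.zero_notMem (tsupport_mul_subset_left h)

/-- The reflected support is compact and disjoint from a closed set, hence at positive distance from
it. -/
lemma exists_separation {χ ψ : ℝ → ℂ} (hχ : IsTest χ)
    (h : ∀ l ∈ tsupport χ, -l ∉ tsupport ψ) :
    ∃ δ > 0, ∀ l u, χ l ≠ 0 → ψ u ≠ 0 → δ < |l + u| := by
  have hd : Disjoint ((fun l : ℝ => -l) '' tsupport χ) (tsupport ψ) := by
    rw [disjoint_left]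
    rintro _ ⟨l, hl, rfl⟩
    exact h l hl
  obtain ⟨r, hr, hlt⟩ := Metric.exists_pos_forall_lt_edist (hχ.compact.isCompact.image continuous_neg)
    (isClosed_tsupport ψ) hd
  refine ⟨r, hr, fun l u hl hu => ?_⟩
  have := hlt (-l) ⟨l, subset_tsupport χ hl, rfl⟩ u (subset_tsupport ψ hu)
  rw [edist_nndist, ENNReal.coe_lt_coe, ← NNReal.coe_lt_coe, coe_nndist, Real.dist_eq,
    abs_sub_comm, sub_neg_eq_add, add_comm] at this
  exact this

section

variable {m β c L : ℝ} {Qm Qp : ℤ} {p : Phase} {a b : ℝ → ℂ}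

/-- The distributional bracket of two entries of the monodromy matrix. -/
lemma tendsto_bracket (hm : 0 < m) (hβ : β ≠ 0) (hp : IsPhasePoint β Qm Qp p)
    (ha : IsAmp c L a) (hb : IsAmp c L b) {δ : ℝ} (hδ : 0 < δ)
    (hsep : ∀ l u, a l ≠ 0 → b u ≠ 0 → δ < |l + u|) (i j k n : Fin 2) :
    Tendsto (fun ε : ℝ => (∫ l, ∫ u, a l * b u * ((-gam β : ℂ) *
        (-rCoef ε i k (l, u) + rCoef ε j n (l, u)) *
          (timeMonodromy m β p l i j * timeMonodromy m β p u k n))) +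
      ∫ l, a l * b l * ((-gam β : ℂ) * (localCoef i j k n * (Complex.I * Real.pi)) *
        (((2 * l * Real.sign (l ^ 2 - 1) : ℝ) : ℂ) *
          (timeMonodromy m β p l k j * timeMonodromy m β p l i n)))) (𝓝[>] 0)
      (𝓝 (∫ t, bracketDensity m β p a b i j k n t)) := by
  -- On the antidiagonal the sum of the parameters is zero, which the separation forbids.
  have hab : ∀ l, a (-l) * b l = 0 := fun l => by
    by_contra h
    have := hsep (-l) l (left_ne_zero_of_mul h) (right_ne_zero_of_mul h)
    rw [neg_add_cancel, abs_zero] at this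
    exact lt_asymm hδ this
  rw [integral_bracketDensity hm hβ hp ha hb, exchLimit_add_reflected hβ hp ha hab]
  obtain ⟨L₁, hA⟩ := exists_isAmp_mul_timeMonodromy m hβ hp ha
  obtain ⟨L₂, hB⟩ := exists_isAmp_mul_timeMonodromy m hβ hp hb
  have hA' := (hA i j).mono ha.pos le_rfl (le_max_left L₁ L₂)
  have hB' := (hB k n).mono ha.pos le_rfl (le_max_right L₁ L₂)
  have hs' : ∀ l u, a l * timeMonodromy m β p l i j ≠ 0 → b u * timeMonodromy m β p u k n ≠ 0 →
      δ < |l + u| := fun l u h1 h2 => hsep l u (left_ne_zero_of_mul h1) (left_ne_zero_of_mul h2)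
  obtain ⟨i1, t1⟩ := tendsto_integral_rCoef m hA' hB' hδ hs' i k
  obtain ⟨i2, t2⟩ := tendsto_integral_rCoef m hA' hB' hδ hs' j n
  refine Tendsto.add ?_ ?_
  · refine ((t1.neg.add t2).const_mul (-gam β : ℂ)).congr' ?_
    filter_upwards [self_mem_nhdsWithin] with ε hε
    have j1 := i1 ε hε
    have j2 := i2 ε hε
    have hinteg := (j1.fun_neg.fun_add j2).const_mul (-gam β : ℂ)
    rw [← integral_neg, ← integral_add j1.fun_neg j2, ← integral_const_mul]
    refine (integral_prod _ hinteg).trans ?_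
    refine integral_congr_ae (Eventually.of_forall fun l => integral_congr_ae
      (Eventually.of_forall fun u => ?_))
    beta_reduce
    ring
  · refine tendsto_const_nhds.congr fun ε => ?_
    rw [← integral_const_mul]
    exact integral_congr_ae (Eventually.of_forall fun l => by ring)

/-- The quadratic algebra for a matrix functional whose entries are multiples of those of the
time monodromy matrix. -/
theorem satisfiesQuadraticAlgebra_of_scaling (hm : 0 < m) (hβ : β ≠ 0)
    (hp : IsPhasePoint β Qm Qp p) (x : ℝ) {M : Phase → ℝ → Mat} {g : Fin 2 → Fin 2 → ℝ → ℂ}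
    (hg : ∀ i j, ContDiff ℝ ∞ (g i j))
    (hM : ∀ q l, l ≠ 0 → ∀ i j, M q l i j = g i j l * timeMonodromy m β q l i j)
    (hgg : ∀ l i j k n, g i j l * g k n l = g k j l * g i n l) :
    SatisfiesQuadraticAlgebra m β x M p := by
  intro χ ψ hχ hψ hsupp i j k n
  have hχ' := hχ.mul (hg i j)
  have hψ' := hψ.mul (hg k n)
  obtain ⟨c, L, ha, hb⟩ := exists_common_isAmp hχ' hψ'
  obtain ⟨δ, hδ, hsep⟩ := exists_separation hχ hsupp
  have hsep' : ∀ l u, χ l * g i j l ≠ 0 → ψ u * g k n u ≠ 0 → δ < |l + u| := fun l u h1 h2 =>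
    hsep l u (left_ne_zero_of_mul h1) (left_ne_zero_of_mul h2)
  have zero : ∀ {χ : ℝ → ℂ}, IsTest χ → ∀ l, χ l ≠ 0 → l ≠ 0 := fun hχ l h h0 =>
    hχ.zero_notMem (h0 ▸ subset_tsupport _ h)
  have hs : ∀ {χ : ℝ → ℂ}, IsTest χ → ∀ i j, smear (fun q l => M q l i j) χ =
      smear (fun q l => timeMonodromy m β q l i j) fun l => χ l * g i j l := fun {χ} hχ i j => by
    funext q
    refine integral_congr_ae (Eventually.of_forall fun l => ?_)
    beta_reduce
    by_cases h : χ l = 0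
    · simp [h]
    · rw [hM q l (zero hχ l h), mul_assoc]
  -- The scalar factors do not depend on the phase-space point, so they are absorbed in the test
  -- functions.
  refine ⟨_, by rw [hs hχ, hs hψ]; exact hasBracketT_smear hm hβ hp ha hb i j k n, ?_⟩
  refine (tendsto_bracket hm hβ hp ha hb hδ hsep' i j k n).congr fun ε => ?_
  unfold quadraticPairing
  congr 1
  · refine integral_congr_ae (Eventually.of_forall fun l => integral_congr_ae
      (Eventually.of_forall fun u => ?_))
    beta_reduce
    rw [conjX_rDiag, quadratic_rDiag_apply]
    by_cases h : χ l = 0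
    · simp [h]
    by_cases h' : ψ u = 0
    · simp [h']
    rw [hM p l (zero hχ l h), hM p u (zero hψ u h')]
    ring
  · refine integral_congr_ae (Eventually.of_forall fun l => ?_)
    beta_reduce
    rw [conjX_rDelta, conjX_rDelta, quadratic_rDelta_apply]
    by_cases h : χ l = 0
    · simp [h]
    rw [hM p l (zero hχ l h), hM p l (zero hχ l h)]
    -- The local term involves the entries with exchanged row indices, and the multiplicative
    -- condition `hgg` says that the scaling is blind to this exchange.
    linear_combination (χ l * ψ l * ((-gam β : ℂ) * (localCoef i j k n * (Complex.I * Real.pi)) *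
        (((2 * l * Real.sign (l ^ 2 - 1) : ℝ) : ℂ) *
          (timeMonodromy m β p l k j * timeMonodromy m β p l i n)))) * hgg l i j k n

theorem satisfiesQuadraticAlgebra_timeMonodromy (hm : 0 < m) (hβ : β ≠ 0)
    (hp : IsPhasePoint β Qm Qp p) (x : ℝ) :
    SatisfiesQuadraticAlgebra m β x (timeMonodromy m β) p :=
  satisfiesQuadraticAlgebra_of_scaling hm hβ hp x (g := fun _ _ _ => 1)
    (fun _ _ => contDiff_const) (fun _ _ _ _ _ => (one_mul _).symm) fun _ _ _ _ _ => rfl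

/-! ### The branch to the left of the defect, and the involution property -/

lemma sub_I_mul_ne_zero {x : ℝ} (hx : x ≠ 0) (l : ℝ) : (l : ℂ) - Complex.I * x ≠ 0 := fun h => by
  have := congrArg Complex.im h
  simp at this
  exact hx this

/-- The limits of the Bäcklund matrix are diagonal, so each entry is scaled by a row factor over a
column factor. The quotient is smooth in l through zero as well, since σ ≠ 0 keeps the denominator
off the real axis. -/
lemma leftMonodromy_apply {σ : ℝ} (hσ : σ ≠ 0) (Qm' Qp' Qm Qp : ℤ) (q : Phase) {l : ℝ} (hl : l ≠ 0)
    (i j : Fin 2) : leftMonodromy m β σ Qm' Qp' Qm Qp q l i j =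
      ((l : ℂ) - Complex.I * ((σ * (-1) ^ (Qp' + Qp) * spin i : ℝ) : ℂ)) /
        ((l : ℂ) - Complex.I * ((σ * (-1) ^ (Qm' + Qm) * spin j : ℝ) : ℂ)) *
        timeMonodromy m β q l i j := by
  have hl' : (l : ℂ) ≠ 0 := by exact_mod_cast hl
  have hd : ∀ Q' Q : ℤ, defectLimit σ Q' Q l = Matrix.diagonal fun i =>
      ((l : ℂ) - Complex.I * ((σ * (-1) ^ (Q' + Q) * spin i : ℝ) : ℂ)) / l := fun Q' Q => by
    ext i j
    fin_cases i <;> fin_cases j <;> simp [defectLimit, pauli3, spin] <;> field_simp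
  have h0 : (l : ℂ) - Complex.I * ((σ * (-1) ^ (Qm' + Qm) * spin j : ℝ) : ℂ) ≠ 0 := by
    refine sub_I_mul_ne_zero (mul_ne_zero (mul_ne_zero hσ (zpow_ne_zero _ (by norm_num))) ?_) l
    fin_cases j <;> simp [spin]
  have e : leftMonodromy m β σ Qm' Qp' Qm Qp q l * defectLimit σ Qm' Qm l =
      defectLimit σ Qp' Qp l * timeMonodromy m β q l := by
    rw [leftMonodromy_eq _ _ _ _ _ hl, mul_assoc,
      Matrix.nonsing_inv_mul _ (isUnit_iff_ne_zero.2 (det_defectLimit_ne_zero l _ _)), mul_one]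
  have e' := congrFun (congrFun e i) j
  rw [hd, hd, Matrix.mul_diagonal, Matrix.diagonal_mul] at e'
  field_simp at e' ⊢
  linear_combination e'

theorem satisfiesQuadraticAlgebra_leftMonodromy {σ : ℝ} (hm : 0 < m) (hβ : β ≠ 0) (hσ : σ ≠ 0)
    {Qm' Qp' : ℤ} (hp : IsPhasePoint β Qm' Qp' p) (x : ℝ) (Qm Qp : ℤ) :
    SatisfiesQuadraticAlgebra m β x (leftMonodromy m β σ Qm' Qp' Qm Qp) p := by
  refine satisfiesQuadraticAlgebra_of_scaling hm hβ hp x (g := fun i j l =>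
      ((l : ℂ) - Complex.I * ((σ * (-1) ^ (Qp' + Qp) * spin i : ℝ) : ℂ)) /
        ((l : ℂ) - Complex.I * ((σ * (-1) ^ (Qm' + Qm) * spin j : ℝ) : ℂ))) (fun i j => ?_)
    (fun q l hl i j => leftMonodromy_apply hσ _ _ _ _ q hl i j) fun l i j k n => by ring
  have h1 : ContDiff ℝ ∞ fun l : ℝ => (l : ℂ) := Complex.ofRealCLM.contDiff
  simp only [div_eq_mul_inv]
  refine (h1.sub contDiff_const).mul ((h1.sub contDiff_const).inv fun l => ?_)
  refine sub_I_mul_ne_zero (mul_ne_zero (mul_ne_zero hσ (zpow_ne_zero _ (by norm_num))) ?_) l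
  fin_cases j <;> simp [spin]

/-- With all four indices equal the direct boundary contributions at ±∞ coincide and cancel. The
reflected ones are purely local and depend only on the product of the amplitudes at one point, so
they cancel too, without any separation of supports. -/
theorem inInvolution_timeMonodromy (hm : 0 < m) (hβ : β ≠ 0) (hp : IsPhasePoint β Qm Qp p) :
    InInvolution (fun q l => timeMonodromy m β q l 0 0) p := by
  intro χ ψ hχ hψ
  obtain ⟨c, L, ha, hb⟩ := exists_common_isAmp hχ hψ
  have h := hasBracketT_smear hm hβ hp ha hb 0 0 0 0
  have e : ∫ t, bracketDensity m β p χ ψ 0 0 0 0 t = 0 := by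
    rw [integral_bracketDensity hm hβ hp ha hb]
    have h1 : oscLimit m 1 0 (fun l => χ (-l) * timeMonodromy m β p l 0 1)
        (fun l => ψ l * timeMonodromy m β p l 1 0) =
        oscLimit m 1 0 (fun l => χ (-l) * timeMonodromy m β p l 1 0)
        (fun l => ψ l * timeMonodromy m β p l 0 1) := by
      simp only [oscLimit, one_ne_zero, if_false]
      congr 4
      funext l
      ring
    simp only [exchLimit, zero_add, h1, sub_self, mul_zero]
  rwa [e] at h

end

end SineGordonDefect

end

open SineGordonDefect in
theorem mainTheorem4 (m β σ : ℝ) (hm : 0 < m) (hβ : β ≠ 0) (hσ : σ ≠ 0)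
    (Qm' Qp' Qm Qp : ℤ) (φ' P' φ P : ℝ → ℝ → ℝ)
    (h : IsDefectSolution m β σ Qm' Qp' Qm Qp φ' P' φ P) :
    -- the time monodromy matrices exist on both sides
    (∀ x ≤ 0, ∀ l : ℝ, l ≠ 0 →
      IsMonodromy m β (φ' x, P' x) l (timeMonodromy m β (φ' x, P' x) l)) ∧
    (∀ x ≥ 0, ∀ l : ℝ, l ≠ 0 →
      IsMonodromy m β (φ x, P x) l (timeMonodromy m β (φ x, P x) l)) ∧
    -- the two branches agree at the defect
    (∀ l : ℝ, l ≠ 0 →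
      leftMonodromy m β σ Qm' Qp' Qm Qp (φ' 0, P' 0) l = timeMonodromy m β (φ 0, P 0) l) ∧
    -- the quadratic algebra, at every position (and for both descriptions at the defect)
    (∀ x : ℝ, SatisfiesQuadraticAlgebra m β x
      (defectMonodromy m β σ Qm' Qp' Qm Qp x) (dataAt φ' P' φ P x)) ∧
    SatisfiesQuadraticAlgebra m β 0 (leftMonodromy m β σ Qm' Qp' Qm Qp) (φ' 0, P' 0) ∧
    -- involution
    (∀ x ≥ 0, InInvolution (fun p l => timeMonodromy m β p l 0 0) (φ x, P x)) ∧
    (∀ x ≤ 0, InInvolution (fun p l => timeMonodromy m β p l 0 0) (φ' x, P' x)) := by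
  have hL : ∀ x ≤ 0, IsPhasePoint β Qm' Qp' (φ' x, P' x) := fun x hx => h.left.phase x hx
  have hR : ∀ x ≥ 0, IsPhasePoint β Qm Qp (φ x, P x) := fun x hx => h.right.phase x hx
  refine ⟨fun x hx l hl => isMonodromy_timeMonodromy hβ (hL x hx) hl,
    fun x hx l hl => isMonodromy_timeMonodromy hβ (hR x hx) hl,
    fun l hl => IsDefectSolution.leftMonodromy_eq_timeMonodromy hβ hσ h hl, fun x => ?_,
    satisfiesQuadraticAlgebra_leftMonodromy hm hβ hσ (hL 0 le_rfl) 0 Qm Qp,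
    fun x hx => inInvolution_timeMonodromy hm hβ (hR x hx),
    fun x hx => inInvolution_timeMonodromy hm hβ (hL x hx)⟩
  rcases lt_or_ge x 0 with hx | hx
  · have e : defectMonodromy m β σ Qm' Qp' Qm Qp x = leftMonodromy m β σ Qm' Qp' Qm Qp := by
      funext q l; simp [defectMonodromy, hx]
    rw [e, dataAt, if_pos hx]
    exact satisfiesQuadraticAlgebra_leftMonodromy hm hβ hσ (hL x hx.le) x Qm Qp
  · have e : defectMonodromy m β σ Qm' Qp' Qm Qp x = timeMonodromy m β := by
      funext q l; simp [defectMonodromy, not_lt.2 hx]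
    rw [e, dataAt, if_neg (not_lt.2 hx)]
    exact satisfiesQuadraticAlgebra_timeMonodromy hm hβ (hR x hx) x
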